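/- Let $\nu$ be a $\sigma$-finite measure on $\mathbb R_0=\mathbb R\setminus\{0\}$, put $m_p=\int_{\mathbb R_0}|z|^p\,\nu(dz)$ and suppose $m_2<\infty$. Let $Z=\mathbb R_+\times\mathbb R\times\mathbb R_0$ and $\mathfrak m(dt,dx,dz)=dt\,dx\,\nu(dz)$, let $N$ be a Poisson random measure on $Z$ with intensity $\mathfrak m$, $\widehat N=N-\mathfrak m$, and $L(dt,dx)=\int_{\mathbb R_0}z\,\widehat N(dt,dx,dz)$. Let $G_t(x)=\frac12\mathbf 1_{\{|x|<t\}}$ (so $G_t=0$ for $t\le 0$). Let $u$ be the solution of the hyperbolic Anderson model $\partial_t^2u=\partial_x^2u+u\dot L$, $u(0,\cdot)=1$, $\partial_tu(0,\cdot)=0$, that is, the predictable random field with $\sup_{t\le T,\,x\in\mathbb R}\mathbb E[u(t,x)^2]<\infty$ for all $T>0$, $u(0,x)=1$, and almost surely $$u(t,x)=1+\int_0^t\!\int_{\mathbb R}G_{t-s}(x-y)u(s,y)\,L(ds,dy)\qquad(t>0,\ x\in\mathbb R),$$ the integral being an Itô integral. For $(r,y,z)\in Z$ let $v^{(r,y,z)}$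 be the solution of the same equation on $(r,\infty)\times\mathbb R$ with $v(r,\cdot)=0$, $\partial_tv(r,\cdot)=z\delta_y$, that is, the predictable random field with $v(r,x)=0$ and almost surely $v(t,x)=G_{t-r}(x-y)z+\int_r^t\int_{\mathbb R}G_{t-s}(x-y')v(s,y')\,L(ds,dy')$ for $t>r$, $x\in\mathbb R$. Let $I_n$ denote the $n$-th multiple integral with respect to $\widehat N$. For $F=\sum_{n\ge0}I_n(f_n)$ in $L^2(\Omega)$ with symmetric $f_n\in L^2(Z^n,\mathfrak m^{n})$, the Malliavin derivatives are $D_\xi F=\sum_{n\ge1}nI_{n-1}(f_n(\xi,\bullet))$ and $D_\zeta D_\xi F=\sum_{n\ge2}n(n-1)I_{n-2}(f_n(\xi,\zeta,\bullet))$, and $F\in\mathrm{dom}(D^2)$ means $\sum_n n^2\,n!\,\|f_n\|^2_{L^2(Z^n)}<\infty$. Then, for all $t\ge0$ and $x\in\mathbb R$, the kernels of $u(t,x)$ are $f_n=\widetilde F_{t,x,n}$, the symmetrizations of $$F_{t,x,n}\big((t_1,x_1,z_1),\dots,(t_n,x_n,z_n)\big)=G_{t-t_n}(x-x_n)z_n\,G_{t_n-t_{n-1}}(x_n-x_{n-1})z_{n-1}\cdots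 G_{t_2-t_1}(x_2-x_1)z_1 ,\qquad F_{t,x,0}=1,$$ and $u(t,x)\in\mathrm{dom}(D^2)$. Moreover, with the derivatives of $u(t,x)$ computed from these kernels at every single point of $Z$, the following holds; and the identities in (i) and (ii) hold for every other version of the derivatives at $\mathfrak m$-almost every point, respectively $\mathfrak m\otimes\mathfrak m$-almost every pair of points. (i) For all $(r,y,z)\in(0,t]\times\mathbb R\times\mathbb R_0$, almost surely $D_{r,y,z}u(t,x)=u(r,y)\,v^{(r,y,z)}(t,x)$. (ii) For all $(r_1,y_1,z_1),(r_2,y_2,z_2)\in Z$ with $r_1<r_2\le t$, almost surely $$D_{r_1,y_1,z_1}D_{r_2,y_2,z_2}u(t,x)=u(r_1,y_1)\,v^{(r_1,y_1,z_1)}(r_2,y_2)\,v^{(r_2,y_2,z_2)}(t,x),$$ and the three factors on the right are independent. (iii) Let $m_p<\infty$ for some $p\in[2,\infty)$ and let $T>0$. There are constants $C',C''$ that depend only on $p$, $T$, $m_2$ and $m_p$ such that, if $t\le T$, then for all $0<r<t$, $y\in\mathbb R$, $z\in\mathbb R_0$ $$\|D_{r,y,z}u(t,x)\|_p\le C'\,G_{t-r}(x-y)\,|z|,$$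 and for all $(r_1,y_1,z_1),(r_2,y_2,z_2)\in Z$ with $r_1\ne r_2$ $$\|D_{r_1,y_1,z_1}D_{r_2,y_2,z_2}u(t,x)\|_p\le C''\,|z_1z_2|\times\begin{cases}G_{t-r_2}(x-y_2)\,G_{r_2-r_1}(y_2-y_1)&\text{if }r_1<r_2,\\ G_{t-r_1}(x-y_1)\,G_{r_1-r_2}(y_1-y_2)&\text{if }r_2<r_1.\end{cases}$$ -/

import Mathlib

open MeasureTheory ProbabilityTheory Filter Topology Set
open scoped NNReal ENNReal Nat

noncomputable section

/-! ### Poisson random measures, multiple integrals, Malliavin derivatives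

`E` is a measurable space, `m` a (σ-finite) measure on `E`, `P` a probability measure. -/

/-- `N` is a Poisson random measure on `E` with intensity measure `m`. The Giry σ-algebra on
`Measure E` is the smallest one that makes all evaluations `χ ↦ χ B` (`B` measurable)
measurable. -/
structure IsPoissonRandomMeasure {Ω E : Type*} [MeasurableSpace Ω] [MeasurableSpace E]
    (P : Measure Ω) (m : Measure E) (N : Ω → Measure E) : Prop where
  measurable : Measurable N
  sigmaFinite : ∀ ω, SigmaFinite (N ω)
  integer_valued : ∀ ω B, MeasurableSet B → ∃ n : ℕ∞, N ω B = (n : ℝ≥0∞)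
  poisson : ∀ A, MeasurableSet A → m A ≠ ∞ →
    P.map (fun ω => N ω A) = (poissonMeasure (m A).toNNReal).map (fun n : ℕ => (n : ℝ≥0∞))
  infinite : ∀ A, MeasurableSet A → m A = ∞ → ∀ᵐ ω ∂P, N ω A = ∞
  indep : ∀ (k : ℕ) (A : Fin k → Set E), (∀ i, MeasurableSet (A i)) →
    Pairwise (fun i j => Disjoint (A i) (A j)) → iIndepFun (fun i ω => N ω (A i)) P

/-- The compensated random measure `N(A) - m(A)`, meant for sets with `m A < ∞`. -/
def compensated {Ω E : Type*} [MeasurableSpace E] (m : Measure E) (N : Ω → Measure E)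
    (A : Set E) (ω : Ω) : ℝ :=
  (N ω A).toReal - (m A).toReal

/-- Simple kernels of order `k`: linear combinations of indicators of products
`F (i 1) × ⋯ × F (i k)` of pairwise disjoint sets of finite measure, whose coefficients vanish
as soon as two of the indices coincide. -/
structure SimpleKernel {E : Type*} [MeasurableSpace E] (m : Measure E) (k : ℕ) where
  size : ℕ
  F : Fin size → Set E
  coeff : (Fin k → Fin size) → ℝ
  measurable : ∀ i, MeasurableSet (F i)
  finite : ∀ i, m (F i) ≠ ∞
  disjoint : Pairwise (fun i j => Disjoint (F i) (F j))
  diagonal : ∀ i : Fin k → Fin size, ¬ Function.Injective i → coeff i = 0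

/-- The function on `E ^ k` that a simple kernel stands for. -/
def SimpleKernel.toFun {E : Type*} [MeasurableSpace E] {m : Measure E} {k : ℕ}
    (h : SimpleKernel m k) (ξ : Fin k → E) : ℝ :=
  ∑ i : Fin k → Fin h.size, h.coeff i * ∏ j, (h.F (i j)).indicator (fun _ => (1 : ℝ)) (ξ j)

/-- The multiple integral of a simple kernel. -/
def SimpleKernel.integral {Ω E : Type*} [MeasurableSpace E] {m : Measure E} {k : ℕ}
    (N : Ω → Measure E) (h : SimpleKernel m k) (ω : Ω) : ℝ :=
  ∑ i : Fin k → Fin h.size, h.coeff i * ∏ j, compensated m N (h.F (i j)) ω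

/-- `X = I_k(h)`: the random variable `X` is the `k`-th multiple integral of `h ∈ L²(m^k)` with
respect to the compensated random measure, i.e. the `L²`-limit of the multiple integrals of
simple kernels that converge to `h` in `L²(m^k)`. For `k = 0` this is the constant `h`. -/
def IsMultipleIntegral {Ω E : Type*} [MeasurableSpace Ω] [MeasurableSpace E]
    (P : Measure Ω) (m : Measure E) (N : Ω → Measure E) (k : ℕ) (h : (Fin k → E) → ℝ)
    (X : Ω → ℝ) : Prop :=
  MemLp h 2 (Measure.pi fun _ : Fin k => m) ∧ MemLp X 2 P ∧
    ∃ s : ℕ → SimpleKernel m k,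
      Tendsto (fun l => eLpNorm ((s l).toFun - h) 2 (Measure.pi fun _ : Fin k => m)) atTop (𝓝 0) ∧
      Tendsto (fun l => eLpNorm ((s l).integral N - X) 2 P) atTop (𝓝 0)

/-- `F = ∑ₙ Iₙ(fₙ)` in `L²(P)`, with symmetric kernels `fₙ ∈ L²(m^n)`; the term `n = 0` is the
constant `f₀`. -/
def IsChaosExpansion {Ω E : Type*} [MeasurableSpace Ω] [MeasurableSpace E]
    (P : Measure Ω) (m : Measure E) (N : Ω → Measure E) (f : ∀ n : ℕ, (Fin n → E) → ℝ)
    (F : Ω → ℝ) : Prop :=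
  MemLp F 2 P ∧
    (∀ n, ∀ σ : Equiv.Perm (Fin n),
      (fun ξ => f n (ξ ∘ σ)) =ᵐ[Measure.pi fun _ : Fin n => m] f n) ∧
    ∃ X : ℕ → Ω → ℝ, (∀ n, IsMultipleIntegral P m N n (f n) (X n)) ∧
      Tendsto (fun M => eLpNorm ((∑ n ∈ Finset.range M, X n) - F) 2 P) atTop (𝓝 0)

/-- The kernels `(n + 1) fₙ₊₁(ξ, •)`, `n ≥ 0`, of the chaos expansion
`D_ξ F = ∑_{n ≥ 1} n Iₙ₋₁(fₙ(ξ, •))` of the Malliavin derivative of `F = ∑ₙ Iₙ(fₙ)`. -/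
def derivKernel {E : Type*} (f : ∀ n : ℕ, (Fin n → E) → ℝ) (ξ : E) :
    ∀ n : ℕ, (Fin n → E) → ℝ :=
  fun n η => ((n : ℝ) + 1) * f (n + 1) (Fin.cons ξ η)

/-- `F` belongs to the domain of the second Malliavin derivative. -/
def InDomD2 {Ω E : Type*} [MeasurableSpace Ω] [MeasurableSpace E]
    (P : Measure Ω) (m : Measure E) (N : Ω → Measure E) (F : Ω → ℝ) : Prop :=
  ∃ f, IsChaosExpansion P m N f F ∧
    ∑' n : ℕ, ((n ^ 2 * n ! : ℕ) : ℝ≥0∞) *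
      eLpNorm (f n) 2 (Measure.pi fun _ : Fin n => m) ^ 2 < ∞

/-- `F` belongs to the domain of the Malliavin derivative and the random field `D` on `E` is a
version of its Malliavin derivative (kernels, and hence the derivative, are determined only up
to null sets of points `ξ`). -/
def IsMalliavinDeriv {Ω E : Type*} [MeasurableSpace Ω] [MeasurableSpace E]
    (P : Measure Ω) (m : Measure E) (N : Ω → Measure E) (F : Ω → ℝ) (D : E → Ω → ℝ) : Prop :=
  ∃ f, IsChaosExpansion P m N f F ∧
    ∑' n : ℕ, ((n * n ! : ℕ) : ℝ≥0∞) *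
      eLpNorm (f n) 2 (Measure.pi fun _ : Fin n => m) ^ 2 < ∞ ∧
    ∀ᵐ ξ ∂m, IsChaosExpansion P m N (derivKernel f ξ) (D ξ)

/-- `F` belongs to the domain of the second Malliavin derivative, and `(ζ, ξ) ↦ D2 ζ ξ` is a
version of the second derivative `D_ζ D_ξ F`. -/
def IsMalliavinDeriv2 {Ω E : Type*} [MeasurableSpace Ω] [MeasurableSpace E]
    (P : Measure Ω) (m : Measure E) (N : Ω → Measure E) (F : Ω → ℝ) (D2 : E → E → Ω → ℝ) :
    Prop :=
  ∃ f, IsChaosExpansion P m N f F ∧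
    ∑' n : ℕ, ((n ^ 2 * n ! : ℕ) : ℝ≥0∞) *
      eLpNorm (f n) 2 (Measure.pi fun _ : Fin n => m) ^ 2 < ∞ ∧
    ∀ᵐ p ∂(m.prod m), IsChaosExpansion P m N (derivKernel (derivKernel f p.2) p.1) (D2 p.1 p.2)

/-- Canonical symmetrization of a function of `n` arguments. -/
def symmetrize {E : Type*} {n : ℕ} (h : (Fin n → E) → ℝ) (ξ : Fin n → E) : ℝ :=
  (n ! : ℝ)⁻¹ * ∑ σ : Equiv.Perm (Fin n), h (ξ ∘ σ)

/-! ### The space-time Lévy noise -/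

/-- The set of jump sizes `ℝ \ {0}`. -/
abbrev JumpSize : Type := {z : ℝ // z ≠ 0}

/-- The space `Z = ℝ₊ × ℝ × (ℝ \ {0})` of points (time, position, jump size). -/
abbrev JumpSpace : Type := ℝ≥0 × ℝ × JumpSize

/-- Lebesgue measure on the half-line `ℝ₊ = [0, ∞)`. -/
def lebTime : Measure ℝ≥0 := Measure.comap (fun t : ℝ≥0 => (t : ℝ)) volume

instance : SigmaFinite lebTime := by
  have h : MeasurableEmbedding (fun t : ℝ≥0 => (t : ℝ)) :=
    MeasurableEmbedding.subtype_coe measurableSet_Ici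
  have h' : SigmaFinite (Measure.map (fun t : ℝ≥0 => (t : ℝ)) lebTime) := by
    rw [lebTime, h.map_comap]
    infer_instance
  exact SigmaFinite.of_map lebTime h.measurable.aemeasurable h'

/-- The intensity `dt dx ν(dz)` on `Z`. -/
def intensity (ν : Measure JumpSize) : Measure JumpSpace :=
  lebTime.prod ((volume : Measure ℝ).prod ν)

/-- The absolute moment `∫ |z|^p ν(dz)` of the jump measure. -/
def jumpMoment (ν : Measure JumpSize) (p : ℝ) : ℝ≥0∞ :=
  ∫⁻ z, ENNReal.ofReal (|(z : ℝ)| ^ p) ∂ν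

/-- The σ-algebra `𝓕_t`, generated by `N([0,s] × A × B)`, `s ≤ t`, `Leb(A) + ν(B) < ∞`, and by
the null events. -/
abbrev noiseSigma {Ω : Type*} [MeasurableSpace Ω] (P : Measure Ω) (ν : Measure JumpSize)
    (N : Ω → Measure JumpSpace) (t : ℝ≥0) : MeasurableSpace Ω :=
  (⨆ (s : ℝ≥0) (A : Set ℝ) (B : Set JumpSize) (_ : s ≤ t) (_ : MeasurableSet A)
      (_ : MeasurableSet B) (_ : volume A + ν B < ∞),
    MeasurableSpace.comap (fun ω => N ω (Iic s ×ˢ A ×ˢ B)) (borel ℝ≥0∞)) ⊔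
  MeasurableSpace.generateFrom {S : Set Ω | MeasurableSet S ∧ P S = 0}

/-- The predictable σ-algebra on `ℝ₊ × ℝ × Ω`, generated by the processes
`Y 1_{(a,b]}(t) 1_A(x)` with `0 < a < b` and `Y` bounded `𝓕_a`-measurable. -/
abbrev predictableSigma {Ω : Type*} [MeasurableSpace Ω] (P : Measure Ω) (ν : Measure JumpSize)
    (N : Ω → Measure JumpSpace) : MeasurableSpace (ℝ≥0 × ℝ × Ω) :=
  MeasurableSpace.generateFrom
    {S | ∃ (a b : ℝ≥0) (A : Set ℝ) (H : Set Ω), 0 < a ∧ a < b ∧ MeasurableSet A ∧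
      volume A < ∞ ∧ MeasurableSet[noiseSigma P ν N a] H ∧ S = Ioc a b ×ˢ A ×ˢ H}

/-- The random field `u` is predictable. -/
def IsPredictableField {Ω : Type*} [MeasurableSpace Ω] (P : Measure Ω) (ν : Measure JumpSize)
    (N : Ω → Measure JumpSpace) (u : ℝ≥0 → ℝ → Ω → ℝ) : Prop :=
  Measurable[predictableSigma P ν N, borel ℝ] fun p : ℝ≥0 × ℝ × Ω => u p.1 p.2.1 p.2.2

/-- Elementary processes `∑_j Y_j 1_{(a_j,b_j]}(t) 1_{A_j}(x) 1_{Γ_j}(z)`, with `Y_j` bounded and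
`𝓕_{a_j}`-measurable. -/
structure ElementaryProcess {Ω : Type*} [MeasurableSpace Ω] (P : Measure Ω)
    (ν : Measure JumpSize) (N : Ω → Measure JumpSpace) where
  size : ℕ
  Y : Fin size → Ω → ℝ
  a : Fin size → ℝ≥0
  b : Fin size → ℝ≥0
  A : Fin size → Set ℝ
  Γ : Fin size → Set JumpSize
  a_pos : ∀ j, 0 < a j
  a_lt_b : ∀ j, a j < b j
  measurable_A : ∀ j, MeasurableSet (A j)
  measurable_Γ : ∀ j, MeasurableSet (Γ j)
  finite : ∀ j, volume (A j) + ν (Γ j) < ∞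
  measurable_Y : ∀ j, Measurable[noiseSigma P ν N (a j), borel ℝ] (Y j)
  bounded_Y : ∀ j, ∃ K : ℝ, ∀ ω, |Y j ω| ≤ K

/-- The process given by the data of an elementary process. -/
def ElementaryProcess.toFun {Ω : Type*} [MeasurableSpace Ω] {P : Measure Ω}
    {ν : Measure JumpSize} {N : Ω → Measure JumpSpace} (V : ElementaryProcess P ν N)
    (p : JumpSpace × Ω) : ℝ :=
  ∑ j, V.Y j p.2 * (Ioc (V.a j) (V.b j) ×ˢ V.A j ×ˢ V.Γ j).indicator (fun _ => (1 : ℝ)) p.1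

/-- The stochastic integral of an elementary process. -/
def ElementaryProcess.integral {Ω : Type*} [MeasurableSpace Ω] {P : Measure Ω}
    {ν : Measure JumpSize} {N : Ω → Measure JumpSpace} (V : ElementaryProcess P ν N)
    (ω : Ω) : ℝ :=
  ∑ j, V.Y j ω * compensated (intensity ν) N (Ioc (V.a j) (V.b j) ×ˢ V.A j ×ˢ V.Γ j) ω

/-- `X` is the Itô integral of `V ∈ L²(Z × Ω)` against the compensated random measure: the
`L²`-limit of the integrals of elementary processes that converge to `V` in `L²(Z × Ω)`. -/
def IsItoIntegral {Ω : Type*} [MeasurableSpace Ω] (P : Measure Ω) (ν : Measure JumpSize)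
    (N : Ω → Measure JumpSpace) (V : JumpSpace × Ω → ℝ) (X : Ω → ℝ) : Prop :=
  MemLp V 2 ((intensity ν).prod P) ∧ MemLp X 2 P ∧
    ∃ s : ℕ → ElementaryProcess P ν N,
      Tendsto (fun l => eLpNorm ((s l).toFun - V) 2 ((intensity ν).prod P)) atTop (𝓝 0) ∧
      Tendsto (fun l => eLpNorm ((s l).integral - X) 2 P) atTop (𝓝 0)

/-! ### The hyperbolic Anderson model -/

/-- The fundamental solution `G_t(x) = 1/2` if `|x| < t`, and `0` otherwise, of the wave equation;
it vanishes for `t ≤ 0`. -/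
def waveG (t x : ℝ) : ℝ := if |x| < t then 1 / 2 else 0

/-- `u` is the solution of `∂ₜ²u = ∂ₓ²u + u L̇`, `u(0,·) = 1`, `∂ₜu(0,·) = 0`: a predictable random
field, with second moments bounded on each `[0,T] × ℝ`, such that
`u(t,x) = 1 + ∫∫∫ G_{t-s}(x-y) u(s,y) z N̂(ds,dy,dz)`. -/
structure IsWaveSolution {Ω : Type*} [MeasurableSpace Ω] (P : Measure Ω) (ν : Measure JumpSize)
    (N : Ω → Measure JumpSpace) (u : ℝ≥0 → ℝ → Ω → ℝ) : Prop where
  predictable : IsPredictableField P ν N u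
  initial : ∀ x, u 0 x =ᵐ[P] fun _ => 1
  bounded : ∀ T : ℝ≥0, ∃ K : ℝ≥0, ∀ t ≤ T, ∀ x, eLpNorm (u t x) 2 P ≤ K
  mild : ∀ t : ℝ≥0, 0 < t → ∀ x, ∃ I : Ω → ℝ,
    IsItoIntegral P ν N
      (fun p => waveG ((t : ℝ) - p.1.1) (x - p.1.2.1) * u p.1.1 p.1.2.1 p.2 * p.1.2.2) I ∧
    u t x =ᵐ[P] fun ω => 1 + I ω

/-- For `ξ = (r,y,z)`, `v` is a solution, for times `t ≥ r`, of `∂ₜ²v = ∂ₓ²v + v L̇` with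
`v(r,·) = 0`, `∂ₜv(r,·) = z δ_y`: a predictable random field with
`v(t,x) = G_{t-r}(x-y) z + ∫_{(r,t)}∫∫ G_{t-s}(x-y') v(s,y') z' N̂(ds,dy',dz')`. -/
structure IsDeltaWaveSolution {Ω : Type*} [MeasurableSpace Ω] (P : Measure Ω)
    (ν : Measure JumpSize) (N : Ω → Measure JumpSpace) (ξ : JumpSpace)
    (v : ℝ≥0 → ℝ → Ω → ℝ) : Prop where
  predictable : IsPredictableField P ν N v
  initial : ∀ x, v ξ.1 x =ᵐ[P] fun _ => 0
  mild : ∀ t : ℝ≥0, ξ.1 < t → ∀ x, ∃ I : Ω → ℝ,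
    IsItoIntegral P ν N
      (fun p => (Ioi ξ.1).indicator (fun _ => (1 : ℝ)) p.1.1 *
        (waveG ((t : ℝ) - p.1.1) (x - p.1.2.1) * v p.1.1 p.1.2.1 p.2 * p.1.2.2)) I ∧
    v t x =ᵐ[P] fun ω => waveG ((t : ℝ) - ξ.1) (x - ξ.2.1) * ξ.2.2 + I ω

/-- The kernel
`F_{t,x,n} = G_{t-tₙ}(x-xₙ) zₙ G_{tₙ-tₙ₋₁}(xₙ-xₙ₋₁) zₙ₋₁ ⋯ G_{t₂-t₁}(x₂-x₁) z₁`; it vanishes unless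
`t > tₙ > ⋯ > t₁`. -/
def waveKernel : ∀ n : ℕ, ℝ≥0 → ℝ → (Fin n → JumpSpace) → ℝ
  | 0, _, _, _ => 1
  | n + 1, t, x, ξ =>
    waveG ((t : ℝ) - (ξ (Fin.last n)).1) (x - (ξ (Fin.last n)).2.1) * (ξ (Fin.last n)).2.2 *
      waveKernel n (ξ (Fin.last n)).1 (ξ (Fin.last n)).2.1 (Fin.init ξ)

/-- The symmetrized kernels of the chaos expansion of `u(t,x)`. They are defined at every point,
and so fix the version `D_ξ u(t,x) = ∑_{n ≥ 1} n Iₙ₋₁(F̃_{t,x,n}(ξ, •))` of the Malliavin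
derivative at every single point `ξ`. -/
def waveChaos (t : ℝ≥0) (x : ℝ) (n : ℕ) : (Fin n → JumpSpace) → ℝ :=
  symmetrize (waveKernel n t x)

/-- `X = D_ξ u(t,x)`, at the single point `ξ`. -/
def IsWaveD {Ω : Type*} [MeasurableSpace Ω] (P : Measure Ω) (ν : Measure JumpSize)
    (N : Ω → Measure JumpSpace) (t : ℝ≥0) (x : ℝ) (ξ : JumpSpace) (X : Ω → ℝ) : Prop :=
  IsChaosExpansion P (intensity ν) N (derivKernel (waveChaos t x) ξ) X

/-- `X = D_ζ D_ξ u(t,x)`, at the single pair `(ζ, ξ)`. -/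
def IsWaveD2 {Ω : Type*} [MeasurableSpace Ω] (P : Measure Ω) (ν : Measure JumpSize)
    (N : Ω → Measure JumpSpace) (t : ℝ≥0) (x : ℝ) (ζ ξ : JumpSpace) (X : Ω → ℝ) : Prop :=
  IsChaosExpansion P (intensity ν) N (derivKernel (derivKernel (waveChaos t x) ξ) ζ) X

end

set_option linter.unusedSectionVars false

/-! ### Poisson variables, Poisson random measures and independence over disjoint sets. -/

noncomputable section

/-! ### The Poisson law -/

/-! Everything about chaos expansions is read off from pairings with exponential functionals. For a
test function h (finitely many values, support of finite measure) put ε_h = exp(-∫h dN) / E exp(-∫h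
dN), which is `normExp`. Three facts carry parts (i) and (ii).

Duality: under the density ε_h the intensity m becomes e^{-h} m. Hence E[I_n(f) ε_h] = ∫ f
(e^{-h}-1)^{⊗n} dm^n (`IsMultipleIntegral.integral_mul_normExp`), and an Itô integral X of V
satisfies E[X ε_h] = ∫ (e^{-h}-1)(ξ) E[V(ξ) ε_h] m(dξ) (`IsItoIntegral.integral_mul_normExp`).
Factorization: if X depends on the noise in B and Y on the noise outside B, then E[X Y ε_h] = E[X
ε_h] E[Y ε_h] (`integral_mul_mul_normExp`). Totality: an integrable functional of N whose pairings
with all ε_h vanish is zero (`ae_eq_zero_of_forall_integral_mul_normExp_eq_zero`). So a square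
integrable functional of the noise has prescribed summable kernels as soon as the pairings agree
(`IsChaosExpansion.of_tendsto_pairing`).

Duality turns the mild equations into deterministic Volterra equations. T(t,x) = E[u(t,x) ε_h]
solves T = 1 + ∫ G z (e^{-h}-1) T dm, whose Neumann series is the sum of the pairings of the kernels
F_n; this identifies the kernels of u. The derivative at ξ = (r,y,z) of a symmetrized kernel is the
symmetrization of the sum over all insertions of ξ, and these sums obey the recursion of the F_n
with forcing G_{t-r}(x-y) z F_n(r,y;·) (`IsForced.insFam`). On the other side u(r,y) depends on the
noise up to time r and v on the noise in (r,t], so E[u v ε_h] = E[u ε_h] E[v ε_h], and the equation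
of v multiplied by the number E[u(r,y) ε_h] has the same forcing. This is (i); for (ii) the product
u v₁ takes the place of u. The three factors live on the noise of disjoint time intervals and are
therefore independent. All series converge because the squared norm of F_n is at most of order
(Ct)^{2n}/(2n)! (`volterra_iterate_le`), which beats n! and also gives the domain of D².

For (iii), independence makes the p-norm of a product the product of the p-norms, so it suffices to
bound u by M and v by M G |z|. Since only second moments are known beforehand, |x|^p is replaced by
a power that is quadratic beyond K. A Rosenthal type inequality with constants free of K holds for
Itô integrals: a second order Taylor bound treats a Poisson increment of small parameter,
independence allows iteration over the cells of an elementary process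
(`ElementaryProcess.hasMomentBound`), and Fatou's lemma gives the limit
(`IsItoIntegral.lintegral_truncPow_le`). Truncated moments are finite, so a Gronwall argument on
backward light cones applies (`gronwall_pastClosed`), and then K tends to infinity. -/

lemma integrable_natCast_mul_poissonMeasure {r : ℝ≥0} {f : ℕ → ℝ}
    (hf : Integrable (fun n => f (n + 1)) (poissonMeasure r)) :
    Integrable (fun n : ℕ => (n : ℝ) * f n) (poissonMeasure r) := by
  rw [integrable_poissonMeasure_iff] at hf ⊢
  rw [← summable_nat_add_iff 1]
  refine (hf.mul_left (r : ℝ)).congr fun n => ?_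
  rw [norm_mul, Nat.factorial_succ]
  push_cast
  rw [Real.norm_of_nonneg (by positivity : (0 : ℝ) ≤ (n : ℝ) + 1)]
  field_simp
  ring

/-- The Chen–Stein identity `E[X f(X)] = r E[f(X + 1)]`. -/
lemma integral_natCast_mul_poissonMeasure (r : ℝ≥0) (f : ℕ → ℝ)
    (hf : Integrable (fun n => f (n + 1)) (poissonMeasure r)) :
    ∫ n : ℕ, (n : ℝ) * f n ∂(poissonMeasure r) = r * ∫ n, f (n + 1) ∂(poissonMeasure r) := by
  have h := (hasSum_integral_poissonMeasure
    (integrable_natCast_mul_poissonMeasure hf)).summable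
  rw [integral_poissonMeasure, integral_poissonMeasure, h.tsum_eq_zero_add, ← tsum_mul_left]
  simp only [Nat.cast_zero, zero_mul, smul_zero, zero_add]
  refine tsum_congr fun n => ?_
  rw [Nat.factorial_succ, smul_eq_mul, smul_eq_mul]
  push_cast
  field_simp
  ring

lemma integrable_natCast_poissonMeasure (r : ℝ≥0) :
    Integrable (fun n : ℕ => (n : ℝ)) (poissonMeasure r) := by
  simpa using integrable_natCast_mul_poissonMeasure (r := r) (f := fun _ => 1)
    (integrable_const _)

lemma integral_natCast_poissonMeasure (r : ℝ≥0) :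
    ∫ n : ℕ, (n : ℝ) ∂(poissonMeasure r) = r := by
  simpa using integral_natCast_mul_poissonMeasure r (fun _ => 1) (integrable_const _)

lemma integrable_natCast_sq_poissonMeasure (r : ℝ≥0) :
    Integrable (fun n : ℕ => (n : ℝ) * (n : ℝ)) (poissonMeasure r) := by
  refine integrable_natCast_mul_poissonMeasure (f := fun n => (n : ℝ)) ?_
  simpa using (integrable_natCast_poissonMeasure r).add (integrable_const (1 : ℝ))

lemma integral_natCast_sq_poissonMeasure (r : ℝ≥0) :
    ∫ n : ℕ, (n : ℝ) * (n : ℝ) ∂(poissonMeasure r) = r * (r + 1) := by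
  have h : Integrable (fun n : ℕ => ((n + 1 : ℕ) : ℝ)) (poissonMeasure r) := by
    simpa using (integrable_natCast_poissonMeasure r).add (integrable_const (1 : ℝ))
  rw [integral_natCast_mul_poissonMeasure r (fun n => (n : ℝ)) h]
  congr 1
  have := integral_add (integrable_natCast_poissonMeasure r)
    (integrable_const (1 : ℝ) (μ := poissonMeasure r))
  simpa [integral_natCast_poissonMeasure] using this

/-- Tilting a Poisson law of parameter r by e^{-yn} multiplies its mean by e^{-y}. This is the
one-cell case of the change of intensity from m to e^{-h} m. -/
lemma integral_natCast_mul_exp_poissonMeasure (r : ℝ≥0) {y : ℝ} (hy : 0 ≤ y) :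
    ∫ n : ℕ, (n : ℝ) * Real.exp (-(y * n)) ∂(poissonMeasure r) =
      r * Real.exp (-y) * ∫ n : ℕ, Real.exp (-(y * n)) ∂(poissonMeasure r) := by
  have hinteg : Integrable (fun n : ℕ => Real.exp (-(y * ((n + 1 : ℕ) : ℝ)))) (poissonMeasure r) := by
    refine Integrable.of_bound (C := 1) (by fun_prop) (ae_of_all _ fun n => ?_)
    rw [Real.norm_of_nonneg (Real.exp_nonneg _), Real.exp_le_one_iff]
    have : 0 ≤ y * ((n + 1 : ℕ) : ℝ) := by positivity
    linarith
  rw [integral_natCast_mul_poissonMeasure r (fun n => Real.exp (-(y * n))) hinteg, mul_assoc]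
  congr 1
  rw [← integral_const_mul]
  refine integral_congr_ae (ae_of_all _ fun n => ?_)
  simp only
  rw [← Real.exp_add]
  congr 1
  push_cast
  ring

/-! ### Poisson random measures -/

section

variable {Ω E : Type*} [MeasurableSpace Ω] [MeasurableSpace E] {P : Measure Ω}
  {m : Measure E} {N : Ω → Measure E}

/-- The σ-algebra generated by the restriction of `N` to `B`. -/
@[reducible] def restrictSigma (N : Ω → Measure E) (B : Set E) : MeasurableSpace Ω :=
  MeasurableSpace.comap (fun ω => (N ω).restrict B) inferInstance

namespace IsPoissonRandomMeasure

lemma measurable_apply (hN : IsPoissonRandomMeasure P m N) {A : Set E} (hA : MeasurableSet A) :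
    Measurable fun ω => N ω A :=
  (Measure.measurable_coe hA).comp hN.measurable

lemma ae_lt_top (hN : IsPoissonRandomMeasure P m N) {A : Set E} (hA : MeasurableSet A)
    (hm : m A ≠ ∞) : ∀ᵐ ω ∂P, N ω A < ∞ := by
  have h : ∀ᵐ x ∂(P.map fun ω => N ω A), x < ∞ := by
    rw [hN.poisson A hA hm, ae_map_iff (by fun_prop) measurableSet_Iio]
    exact ae_of_all _ fun n => ENNReal.natCast_lt_top n
  exact ae_of_ae_map (hN.measurable_apply hA).aemeasurable h

lemma lintegral_comp (hN : IsPoissonRandomMeasure P m N) {A : Set E} (hA : MeasurableSet A)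
    (hm : m A ≠ ∞) {f : ℝ → ℝ≥0∞} (hf : Measurable f) :
    ∫⁻ ω, f (N ω A).toReal ∂P = ∫⁻ n : ℕ, f n ∂(poissonMeasure (m A).toNNReal) := by
  have h1 := lintegral_map (μ := P) (f := fun x : ℝ≥0∞ => f x.toReal)
    (hf.comp ENNReal.measurable_toReal) (hN.measurable_apply hA)
  rw [← h1, hN.poisson A hA hm,
    lintegral_map (f := fun x : ℝ≥0∞ => f x.toReal) (hf.comp ENNReal.measurable_toReal)
      (by fun_prop)]
  simp

lemma integral_comp (hN : IsPoissonRandomMeasure P m N) {A : Set E} (hA : MeasurableSet A)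
    (hm : m A ≠ ∞) {f : ℝ → ℝ} (hf : Measurable f) :
    ∫ ω, f (N ω A).toReal ∂P = ∫ n : ℕ, f n ∂(poissonMeasure (m A).toNNReal) := by
  have h1 := integral_map (μ := P) (f := fun x : ℝ≥0∞ => f x.toReal)
    (hN.measurable_apply hA).aemeasurable
    (hf.comp ENNReal.measurable_toReal).aestronglyMeasurable
  rw [← h1, hN.poisson A hA hm, integral_map (f := fun x : ℝ≥0∞ => f x.toReal) (by fun_prop)
    (hf.comp ENNReal.measurable_toReal).aestronglyMeasurable]
  simp

lemma integrable_comp_iff (hN : IsPoissonRandomMeasure P m N) {A : Set E} (hA : MeasurableSet A)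
    (hm : m A ≠ ∞) {f : ℝ → ℝ} (hf : Measurable f) :
    Integrable (fun ω => f (N ω A).toReal) P ↔
      Integrable (fun n : ℕ => f n) (poissonMeasure (m A).toNNReal) := by
  have h1 := integrable_map_measure (μ := P) (g := fun x : ℝ≥0∞ => f x.toReal)
    (hf.comp ENNReal.measurable_toReal).aestronglyMeasurable (hN.measurable_apply hA).aemeasurable
  have h2 := integrable_map_measure (μ := poissonMeasure (m A).toNNReal)
    (f := fun n : ℕ => (n : ℝ≥0∞)) (g := fun x : ℝ≥0∞ => f x.toReal)
    (hf.comp ENNReal.measurable_toReal).aestronglyMeasurable (by fun_prop)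
  rw [← hN.poisson A hA hm] at h2
  have h3 := h1.symm.trans h2
  simpa [Function.comp_def] using h3

lemma measurable_compensated (hN : IsPoissonRandomMeasure P m N) {A : Set E}
    (hA : MeasurableSet A) : Measurable (compensated m N A) :=
  (hN.measurable_apply hA).ennreal_toReal.sub_const _

lemma integrable_toReal (hN : IsPoissonRandomMeasure P m N) {A : Set E} (hA : MeasurableSet A)
    (hm : m A ≠ ∞) : Integrable (fun ω => (N ω A).toReal) P :=
  (hN.integrable_comp_iff hA hm measurable_id).2 (integrable_natCast_poissonMeasure _)

lemma integral_toReal (hN : IsPoissonRandomMeasure P m N) {A : Set E} (hA : MeasurableSet A)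
    (hm : m A ≠ ∞) : ∫ ω, (N ω A).toReal ∂P = (m A).toReal :=
  (hN.integral_comp hA hm measurable_id).trans (integral_natCast_poissonMeasure _)

lemma integrable_toReal_sq (hN : IsPoissonRandomMeasure P m N) {A : Set E} (hA : MeasurableSet A)
    (hm : m A ≠ ∞) : Integrable (fun ω => (N ω A).toReal * (N ω A).toReal) P :=
  (hN.integrable_comp_iff hA hm (f := fun x => x * x) (by fun_prop)).2
    (integrable_natCast_sq_poissonMeasure _)

lemma integral_toReal_sq (hN : IsPoissonRandomMeasure P m N) {A : Set E} (hA : MeasurableSet A)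
    (hm : m A ≠ ∞) :
    ∫ ω, (N ω A).toReal * (N ω A).toReal ∂P = (m A).toReal * ((m A).toReal + 1) :=
  (hN.integral_comp hA hm (f := fun x => x * x) (by fun_prop)).trans
    (integral_natCast_sq_poissonMeasure _)

lemma restrictSigma_le (hN : IsPoissonRandomMeasure P m N) {B : Set E} (hB : MeasurableSet B) :
    restrictSigma N B ≤ ‹MeasurableSpace Ω› := by
  rintro _ ⟨s, hs, rfl⟩
  have : Measurable fun ω => (N ω).restrict B := by
    refine Measure.measurable_of_measurable_coe _ fun A hA => ?_
    simp only [Measure.restrict_apply hA]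
    exact hN.measurable_apply (hA.inter hB)
  exact this hs

/-- Independence over an arbitrary finite index type. -/
lemma iIndepFun_fintype (hN : IsPoissonRandomMeasure P m N) {κ : Type*} [Fintype κ]
    {A : κ → Set E} (hA : ∀ i, MeasurableSet (A i))
    (hd : Pairwise fun i j => Disjoint (A i) (A j)) : iIndepFun (fun i ω => N ω (A i)) P := by
  have h := hN.indep (Fintype.card κ) (fun i => A ((Fintype.equivFin κ).symm i))
    (fun i => hA _) (fun i j hij => hd (by simpa using hij))
  have := h.precomp (Fintype.equivFin κ).injective
  simpa using this

/-- The atom of `B` selected by `b`, in the partition generated by the sets `A i`. -/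
def atomOf {E κ : Type*} (B : Set E) (A : κ → Set E) (b : κ → Bool) : Set E :=
  {x ∈ B | ∀ i, x ∈ A i ↔ b i = true}

lemma atomOf_disjoint {E κ : Type*} (B : Set E) (A : κ → Set E) {b b' : κ → Bool} (h : b ≠ b') :
    Disjoint (atomOf B A b) (atomOf B A b') := by
  rw [Set.disjoint_left]
  rintro x ⟨-, hx⟩ ⟨-, hx'⟩
  apply h
  ext i
  rw [Bool.eq_iff_iff, ← hx i, ← hx' i]

lemma measurableSet_atomOf {κ : Type*} [Finite κ] {B : Set E} {A : κ → Set E}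
    (hB : MeasurableSet B) (hA : ∀ i, MeasurableSet (A i)) (b : κ → Bool) :
    MeasurableSet (atomOf B A b) := by
  have : atomOf B A b = B ∩ ⋂ i, {x | x ∈ A i ↔ b i = true} := by
    ext x; simp [atomOf]
  rw [this]
  refine hB.inter (MeasurableSet.iInter fun i => ?_)
  cases hb : b i
  · have h : {x | x ∈ A i ↔ false = true} = (A i)ᶜ := by ext x; simp
    rw [h]
    exact (hA i).compl
  · have h : {x | x ∈ A i ↔ true = true} = A i := by ext x; simp
    rw [h]
    exact hA i

/-- Reduces counts of overlapping sets to counts of disjoint atoms, the only ones for which the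
definition of a Poisson random measure provides independence. -/
lemma measure_inter_eq_sum_atomOf {κ : Type*} [Fintype κ] [DecidableEq κ] (χ : Measure E)
    {B : Set E} {A : κ → Set E} (hB : MeasurableSet B) (hA : ∀ i, MeasurableSet (A i)) (i : κ) :
    χ (A i ∩ B) = ∑ b : κ → Bool with b i = true, χ (atomOf B A b) := by
  classical
  rw [← measure_biUnion_finset (fun b _ b' _ hbb' => atomOf_disjoint B A hbb')
    (fun b _ => measurableSet_atomOf hB hA b)]
  congr 1
  ext x
  simp only [Set.mem_inter_iff, Set.mem_iUnion, Finset.mem_filter, Finset.mem_univ, true_and,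
    atomOf, Set.mem_ofPred_eq, exists_prop]
  constructor
  · rintro ⟨h1, h2⟩
    exact ⟨fun j => decide (x ∈ A j), by simpa using h1, h2, by simp⟩
  · rintro ⟨b, hb, h2, h3⟩
    exact ⟨(h3 i).2 hb, h2⟩

variable [IsProbabilityMeasure P]

lemma integral_compensated (hN : IsPoissonRandomMeasure P m N) {A : Set E} (hA : MeasurableSet A)
    (hm : m A ≠ ∞) : ∫ ω, compensated m N A ω ∂P = 0 := by
  simp only [compensated]
  rw [integral_sub (hN.integrable_toReal hA hm) (integrable_const _), hN.integral_toReal hA hm]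
  simp

lemma memLp_compensated (hN : IsPoissonRandomMeasure P m N) {A : Set E} (hA : MeasurableSet A)
    (hm : m A ≠ ∞) : MemLp (compensated m N A) 2 P := by
  have : MemLp (fun ω => (N ω A).toReal) 2 P := by
    rw [memLp_two_iff_integrable_sq
      (hN.measurable_apply hA).ennreal_toReal.aestronglyMeasurable]
    simpa [sq] using hN.integrable_toReal_sq hA hm
  exact this.sub (memLp_const _)

lemma integral_compensated_sq (hN : IsPoissonRandomMeasure P m N) {A : Set E}
    (hA : MeasurableSet A) (hm : m A ≠ ∞) :
    ∫ ω, compensated m N A ω * compensated m N A ω ∂P = (m A).toReal := by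
  have h1 : (fun ω => compensated m N A ω * compensated m N A ω) = fun ω =>
      (N ω A).toReal * (N ω A).toReal - 2 * (m A).toReal * (N ω A).toReal
        + (m A).toReal * (m A).toReal := by
    ext ω; simp only [compensated]; ring
  have h2 : Integrable (fun ω => (N ω A).toReal * (N ω A).toReal
      - 2 * (m A).toReal * (N ω A).toReal) P :=
    (hN.integrable_toReal_sq hA hm).sub ((hN.integrable_toReal hA hm).const_mul _)
  rw [h1, integral_add h2 (integrable_const _),
    integral_sub (hN.integrable_toReal_sq hA hm) ((hN.integrable_toReal hA hm).const_mul _),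
    integral_const_mul, hN.integral_toReal hA hm, hN.integral_toReal_sq hA hm]
  simp only [integral_const, probReal_univ, one_smul]
  ring

/-- It suffices to treat finitely many counts on each side. The atoms they generate in B together
with those in C form one disjoint family; splitting its index set into the two blocks gives
independent vectors, and the counts are sums of their entries. -/
lemma indepFun_restrict (hN : IsPoissonRandomMeasure P m N) {B C : Set E} (hB : MeasurableSet B)
    (hC : MeasurableSet C) (hBC : Disjoint B C) :
    IndepFun (fun ω => (N ω).restrict B) (fun ω => (N ω).restrict C) P := by
  classical
  let S := {A : Set E // MeasurableSet A}
  have key : IndepFun (fun ω (A : S) => N ω (A.1 ∩ B)) (fun ω (A : S) => N ω (A.1 ∩ C)) P := by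
    refine IndepFun.process_indepFun_process
      (fun A => hN.measurable_apply (A.2.inter hB)) (fun A => hN.measurable_apply (A.2.inter hC))
      fun I J => ?_
    let κ := (I → Bool) ⊕ (J → Bool)
    let D : κ → Set E := Sum.elim (atomOf B fun i : I => i.1.1) (atomOf C fun j : J => j.1.1)
    have hD : ∀ k, MeasurableSet (D k) := by
      rintro (b | b)
      · exact measurableSet_atomOf hB (fun i => i.1.2) b
      · exact measurableSet_atomOf hC (fun i => i.1.2) b
    have hdisj : Pairwise fun k l => Disjoint (D k) (D l) := by
      rintro (b | b) (b' | b') h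
      · exact atomOf_disjoint B _ fun e => h (by rw [e])
      · exact hBC.mono (fun x hx => hx.1) (fun x hx => hx.1)
      · exact hBC.symm.mono (fun x hx => hx.1) (fun x hx => hx.1)
      · exact atomOf_disjoint C _ fun e => h (by rw [e])
    have hi := hN.iIndepFun_fintype hD hdisj
    let SL : Finset κ := Finset.univ.map ⟨Sum.inl, Sum.inl_injective⟩
    let SR : Finset κ := Finset.univ.map ⟨Sum.inr, Sum.inr_injective⟩
    have hSLR : Disjoint SL SR := by
      rw [Finset.disjoint_left]
      simp [SL, SR]
    have h2 := hi.indepFun_finset SL SR hSLR (fun k => hN.measurable_apply (hD k))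
    let f : (SL → ℝ≥0∞) → (I → ℝ≥0∞) := fun x i =>
      ∑ b : I → Bool with b i = true, x ⟨Sum.inl b, by simp [SL]⟩
    let g : (SR → ℝ≥0∞) → (J → ℝ≥0∞) := fun x i =>
      ∑ b : J → Bool with b i = true, x ⟨Sum.inr b, by simp [SR]⟩
    have hf : Measurable f := by
      refine measurable_pi_lambda _ fun i => Finset.measurable_sum _ fun b _ => ?_
      exact measurable_pi_apply _
    have hg : Measurable g := by
      refine measurable_pi_lambda _ fun i => Finset.measurable_sum _ fun b _ => ?_
      exact measurable_pi_apply _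
    have h3 := h2.comp hf hg
    convert h3 using 1
    · ext ω i
      exact measure_inter_eq_sum_atomOf (N ω) hB (fun i : I => i.1.2) i
    · ext ω i
      exact measure_inter_eq_sum_atomOf (N ω) hC (fun i : J => i.1.2) i
  -- Measures carry the σ-algebra of evaluations, so independence of the families of counts is
  -- independence of the restricted measures.
  have hle : ∀ {D : Set E}, MeasurableSet D → restrictSigma N D ≤
      MeasurableSpace.comap (fun ω (A : S) => N ω (A.1 ∩ D)) inferInstance := by
    intro D hD
    rw [restrictSigma, ← measurable_iff_comap_le]
    refine @Measure.measurable_of_measurable_coe _ _ _ (MeasurableSpace.comap _ _) _ fun A hA => ?_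
    simp only [Measure.restrict_apply hA]
    exact (measurable_pi_apply (⟨A, hA⟩ : S)).comp
      (comap_measurable (fun ω (A : S) => N ω (A.1 ∩ D)))
  exact indep_of_indep_of_le_right (indep_of_indep_of_le_left key (hle hB)) (hle hC)

end IsPoissonRandomMeasure

end

end

noncomputable section

section

variable {Ω E : Type*} [MeasurableSpace Ω] [MeasurableSpace E] {P : Measure Ω}
  {m : Measure E} {N : Ω → Measure E}

/-! ### σ-algebras generated by restrictions -/

lemma measurable_restrictSigma_apply (N : Ω → Measure E) {B A : Set E} (hA : MeasurableSet A)
    (hAB : A ⊆ B) : Measurable[restrictSigma N B] fun ω => N ω A := by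
  have h : Measurable[restrictSigma N B] fun ω => (N ω).restrict B A :=
    (Measure.measurable_coe hA).comp (comap_measurable fun ω => (N ω).restrict B)
  simpa [Measure.restrict_apply hA, inter_eq_self_of_subset_left hAB] using h

lemma measurable_restrictSigma_compensated (N : Ω → Measure E) {B A : Set E}
    (hA : MeasurableSet A) (hAB : A ⊆ B) :
    Measurable[restrictSigma N B] (compensated m N A) :=
  (@Measurable.ennreal_toReal _ (restrictSigma N B) _
    (measurable_restrictSigma_apply N hA hAB)).sub_const _

lemma restrictSigma_mono (N : Ω → Measure E) {B C : Set E} (hB : MeasurableSet B) (h : B ⊆ C) :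
    restrictSigma N B ≤ restrictSigma N C := by
  conv_lhs => rw [restrictSigma]
  rw [← measurable_iff_comap_le]
  refine @Measure.measurable_of_measurable_coe _ _ _ (restrictSigma N C) _ fun A hA => ?_
  simp only [Measure.restrict_apply hA]
  exact measurable_restrictSigma_apply N (hA.inter hB) (inter_subset_right.trans h)

lemma IsPoissonRandomMeasure.indep_restrictSigma [IsProbabilityMeasure P]
    (hN : IsPoissonRandomMeasure P m N) {B C : Set E} (hB : MeasurableSet B)
    (hC : MeasurableSet C) (hBC : Disjoint B C) :
    Indep (restrictSigma N B) (restrictSigma N C) P :=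
  hN.indepFun_restrict hB hC hBC

/-- The filtration contains null events and L² limits are defined only almost surely, so
measurability is available only up to modification; independence does not see the difference. -/
lemma indepFun_of_indep_of_aestronglyMeasurable {m₁ m₂ : MeasurableSpace Ω} {X Y : Ω → ℝ}
    (h : Indep m₁ m₂ P) (hX : AEStronglyMeasurable[m₁] X P) (hY : AEStronglyMeasurable[m₂] Y P) :
    IndepFun X Y P := by
  have h1 : IndepFun (hX.mk X) (hY.mk Y) P :=
    indep_of_indep_of_le_right (indep_of_indep_of_le_left h
      hX.stronglyMeasurable_mk.measurable.comap_le) hY.stronglyMeasurable_mk.measurable.comap_le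
  exact h1.congr hX.ae_eq_mk.symm hY.ae_eq_mk.symm

/-! ### Exponential functionals -/

/-- Test functions: measurable with finitely many values and support of finite measure. -/
structure IsTestFun (m : Measure E) (h : E → ℝ≥0) : Prop where
  measurable : Measurable h
  finite_range : (range h).Finite
  support_ne_top : m (Function.support h) ≠ ∞

lemma IsTestFun.indicator {h : E → ℝ≥0} (hh : IsTestFun m h) {B : Set E} (hB : MeasurableSet B) :
    IsTestFun m (B.indicator h) where
  measurable := hh.measurable.indicator hB
  finite_range := by
    refine (hh.finite_range.insert 0).subset ?_
    rintro _ ⟨x, rfl⟩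
    by_cases hx : x ∈ B <;> simp [hx]
  support_ne_top := by
    refine ne_top_of_le_ne_top hh.support_ne_top (measure_mono ?_)
    intro x hx
    by_contra h0
    simp_all

/-- The functional `exp(-∫ h dN)`. -/
def expFun (N : Ω → Measure E) (h : E → ℝ≥0) (ω : Ω) : ℝ :=
  Real.exp (-(∫⁻ x, h x ∂(N ω)).toReal)

/-- The normalized functional `exp(-∫ h dN) / E exp(-∫ h dN)`. -/
def normExp (P : Measure Ω) (N : Ω → Measure E) (h : E → ℝ≥0) (ω : Ω) : ℝ :=
  expFun N h ω / ∫ ω', expFun N h ω' ∂P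

/-- The function `e^{-h} - 1`. -/
def expGap (h : E → ℝ≥0) (x : E) : ℝ := Real.exp (-(h x : ℝ)) - 1

lemma expFun_pos (N : Ω → Measure E) (h : E → ℝ≥0) (ω : Ω) : 0 < expFun N h ω := Real.exp_pos _

lemma expFun_le_one (N : Ω → Measure E) (h : E → ℝ≥0) (ω : Ω) : expFun N h ω ≤ 1 := by
  rw [expFun, Real.exp_le_one_iff]
  simp

lemma norm_expFun_le (N : Ω → Measure E) (h : E → ℝ≥0) (ω : Ω) : ‖expFun N h ω‖ ≤ 1 := by
  rw [Real.norm_of_nonneg (expFun_pos N h ω).le]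
  exact expFun_le_one N h ω

lemma measurable_expGap {h : E → ℝ≥0} (hh : Measurable h) : Measurable (expGap h) := by
  unfold expGap; fun_prop

lemma abs_expGap_le (h : E → ℝ≥0) (x : E) :
    |expGap h x| ≤ (Function.support h).indicator (fun _ => 1) x := by
  unfold expGap
  by_cases hx : h x = 0
  · simp [hx]
  · rw [indicator_of_mem (by simpa using hx), abs_le]
    constructor
    · have := Real.exp_pos (-(h x : ℝ)); linarith
    · have : Real.exp (-(h x : ℝ)) ≤ 1 := by simp
      linarith

lemma abs_expGap_le_one (h : E → ℝ≥0) (x : E) : |expGap h x| ≤ 1 :=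
  (abs_expGap_le h x).trans (indicator_le_self' (fun _ _ => zero_le_one) x)

lemma measurable_expFun_restrictSigma (N : Ω → Measure E) {h : E → ℝ≥0} (hh : Measurable h)
    {B : Set E} (hB : MeasurableSet B) (hs : Function.support h ⊆ B) :
    Measurable[restrictSigma N B] (expFun N h) := by
  have h1 : ∀ ω, ∫⁻ x, h x ∂(N ω) = ∫⁻ x, h x ∂((N ω).restrict B) := by
    intro ω
    rw [← lintegral_indicator hB]
    refine lintegral_congr fun x => ?_
    by_cases hx : x ∈ B
    · simp [hx]
    · have : h x = 0 := by
        by_contra h0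
        exact hx (hs h0)
      simp [hx, this]
  have h2 : Measurable[restrictSigma N B] fun ω => ∫⁻ x, h x ∂(N ω) := by
    simp_rw [h1]
    exact (Measure.measurable_lintegral (by fun_prop)).comp
      (comap_measurable fun ω => (N ω).restrict B)
  exact Real.measurable_exp.comp (@Measurable.neg _ _ _ _ _ (restrictSigma N B) _
    (@Measurable.ennreal_toReal _ (restrictSigma N B) _ h2))

namespace IsPoissonRandomMeasure

lemma measurable_expFun (hN : IsPoissonRandomMeasure P m N) {h : E → ℝ≥0} (hh : Measurable h) :
    Measurable (expFun N h) :=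
  (measurable_expFun_restrictSigma N hh MeasurableSet.univ (subset_univ _)).mono
    (hN.restrictSigma_le MeasurableSet.univ) le_rfl

lemma ae_lintegral_lt_top (hN : IsPoissonRandomMeasure P m N) {h : E → ℝ≥0}
    (hh : IsTestFun m h) : ∀ᵐ ω ∂P, ∫⁻ x, h x ∂(N ω) < ∞ := by
  obtain ⟨C, hC⟩ := hh.finite_range.bddAbove
  have hms : MeasurableSet (Function.support h) :=
    hh.measurable (measurableSet_singleton 0).compl
  filter_upwards [hN.ae_lt_top hms hh.support_ne_top] with ω hω
  calc ∫⁻ x, h x ∂(N ω) ≤ ∫⁻ x, (Function.support h).indicator (fun _ => (C : ℝ≥0∞)) x ∂(N ω) := by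
        refine lintegral_mono fun x => ?_
        by_cases hx : h x = 0
        · simp [hx]
        · rw [indicator_of_mem (by simpa using hx)]
          exact ENNReal.coe_le_coe.2 (hC ⟨x, rfl⟩)
    _ = C * N ω (Function.support h) := by rw [lintegral_indicator_const hms]
    _ < ∞ := ENNReal.mul_lt_top (by simp) hω

/-- Only almost sure: `toReal` sends an infinite integral to 0, which would break additivity of the
exponent. A test function is bounded with support of finite measure, so its integral is almost
surely finite. -/
lemma ae_expFun_indicator_mul (hN : IsPoissonRandomMeasure P m N) {h : E → ℝ≥0}
    (hh : IsTestFun m h) {B : Set E} (hB : MeasurableSet B) :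
    ∀ᵐ ω ∂P, expFun N h ω = expFun N (B.indicator h) ω * expFun N (Bᶜ.indicator h) ω := by
  filter_upwards [hN.ae_lintegral_lt_top (hh.indicator hB),
    hN.ae_lintegral_lt_top (hh.indicator hB.compl)] with ω h1 h2
  unfold expFun
  rw [← Real.exp_add, ← neg_add, ← ENNReal.toReal_add h1.ne h2.ne, ← lintegral_add_left
    (by have := (hh.indicator hB).measurable; fun_prop)]
  congr 4 with x
  by_cases hx : x ∈ B <;> simp [hx]

variable [IsProbabilityMeasure P]

lemma integrable_expFun (hN : IsPoissonRandomMeasure P m N) {h : E → ℝ≥0} (hh : Measurable h) :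
    Integrable (expFun N h) P :=
  Integrable.of_bound (hN.measurable_expFun hh).aestronglyMeasurable 1
    (ae_of_all _ (norm_expFun_le N h))

lemma integral_expFun_pos (hN : IsPoissonRandomMeasure P m N) {h : E → ℝ≥0} (hh : Measurable h) :
    0 < ∫ ω, expFun N h ω ∂P := by
  rw [integral_pos_iff_support_of_nonneg (fun ω => (expFun_pos N h ω).le) (hN.integrable_expFun hh)]
  have : Function.support (expFun N h) = univ := by
    ext ω; simp [(expFun_pos N h ω).ne']
  simp [this]

lemma measurable_normExp (hN : IsPoissonRandomMeasure P m N) {h : E → ℝ≥0} (hh : Measurable h) :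
    Measurable (normExp P N h) := (hN.measurable_expFun hh).div_const _

lemma norm_normExp_le (hN : IsPoissonRandomMeasure P m N) {h : E → ℝ≥0} (hh : Measurable h)
    (ω : Ω) : ‖normExp P N h ω‖ ≤ (∫ ω', expFun N h ω' ∂P)⁻¹ := by
  rw [normExp, norm_div, div_eq_mul_inv, Real.norm_of_nonneg (hN.integral_expFun_pos hh).le]
  exact mul_le_of_le_one_left (inv_nonneg.2 (hN.integral_expFun_pos hh).le) (norm_expFun_le N h ω)

lemma memLp_normExp (hN : IsPoissonRandomMeasure P m N) {h : E → ℝ≥0} (hh : Measurable h)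
    (p : ℝ≥0∞) : MemLp (normExp P N h) p P :=
  MemLp.of_bound (hN.measurable_normExp hh).aestronglyMeasurable _
    (ae_of_all _ (hN.norm_normExp_le hh))

lemma integral_normExp (hN : IsPoissonRandomMeasure P m N) {h : E → ℝ≥0} (hh : Measurable h) :
    ∫ ω, normExp P N h ω ∂P = 1 := by
  simp only [normExp]
  rw [integral_div, div_self (hN.integral_expFun_pos hh).ne']

lemma integral_mul_expFun (hN : IsPoissonRandomMeasure P m N) {h : E → ℝ≥0}
    (hh : IsTestFun m h) {B : Set E} (hB : MeasurableSet B) {X Y : Ω → ℝ}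
    (hX : AEStronglyMeasurable[restrictSigma N B] X P)
    (hY : AEStronglyMeasurable[restrictSigma N Bᶜ] Y P) :
    ∫ ω, X ω * Y ω * expFun N h ω ∂P = (∫ ω, X ω * expFun N (B.indicator h) ω ∂P) *
      ∫ ω, Y ω * expFun N (Bᶜ.indicator h) ω ∂P := by
  have hX' : AEStronglyMeasurable[restrictSigma N B]
      (fun ω => X ω * expFun N (B.indicator h) ω) P :=
    hX.mul (measurable_expFun_restrictSigma N (hh.indicator hB).measurable hB
      (by simp)).aestronglyMeasurable
  have hY' : AEStronglyMeasurable[restrictSigma N Bᶜ]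
      (fun ω => Y ω * expFun N (Bᶜ.indicator h) ω) P :=
    hY.mul (measurable_expFun_restrictSigma N (hh.indicator hB.compl).measurable hB.compl
      (by simp)).aestronglyMeasurable
  have hind := indepFun_of_indep_of_aestronglyMeasurable
    (hN.indep_restrictSigma hB hB.compl disjoint_compl_right) hX' hY'
  rw [← hind.integral_mul_eq_mul_integral (hX'.mono (hN.restrictSigma_le hB))
    (hY'.mono (hN.restrictSigma_le hB.compl))]
  refine integral_congr_ae ?_
  filter_upwards [hN.ae_expFun_indicator_mul hh hB] with ω hω
  simp only [Pi.mul_apply, hω]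
  ring

lemma integral_expFun_eq_mul (hN : IsPoissonRandomMeasure P m N) {h : E → ℝ≥0}
    (hh : IsTestFun m h) {B : Set E} (hB : MeasurableSet B) :
    ∫ ω, expFun N h ω ∂P = (∫ ω, expFun N (B.indicator h) ω ∂P) *
      ∫ ω, expFun N (Bᶜ.indicator h) ω ∂P := by
  simpa using hN.integral_mul_expFun hh hB (X := fun _ => 1) (Y := fun _ => 1)
    aestronglyMeasurable_const aestronglyMeasurable_const

/-- The normalized functional splits into independent factors for B and its complement, and the
latter has mean one. -/
lemma integral_mul_normExp_indicator (hN : IsPoissonRandomMeasure P m N) {h : E → ℝ≥0}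
    (hh : IsTestFun m h) {B : Set E} (hB : MeasurableSet B) {X : Ω → ℝ}
    (hX : AEStronglyMeasurable[restrictSigma N B] X P) :
    ∫ ω, X ω * normExp P N h ω ∂P = ∫ ω, X ω * normExp P N (B.indicator h) ω ∂P := by
  have h1 := hN.integral_mul_expFun hh hB hX (Y := fun _ => 1) aestronglyMeasurable_const
  simp only [mul_one, one_mul] at h1
  simp only [normExp, ← mul_div_assoc]
  rw [integral_div, integral_div, h1, hN.integral_expFun_eq_mul hh hB]
  exact mul_div_mul_right _ _ (hN.integral_expFun_pos (hh.indicator hB.compl).measurable).ne'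

/-- Factorization of expectations against an exponential functional. -/
lemma integral_mul_mul_normExp (hN : IsPoissonRandomMeasure P m N) {h : E → ℝ≥0}
    (hh : IsTestFun m h) {B : Set E} (hB : MeasurableSet B) {X Y : Ω → ℝ}
    (hX : AEStronglyMeasurable[restrictSigma N B] X P)
    (hY : AEStronglyMeasurable[restrictSigma N Bᶜ] Y P) :
    ∫ ω, X ω * Y ω * normExp P N h ω ∂P = (∫ ω, X ω * normExp P N h ω ∂P) *
      ∫ ω, Y ω * normExp P N h ω ∂P := by
  rw [hN.integral_mul_normExp_indicator hh hB hX,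
    hN.integral_mul_normExp_indicator hh hB.compl hY]
  simp only [normExp, ← mul_div_assoc]
  rw [integral_div, integral_div, integral_div, hN.integral_mul_expFun hh hB hX hY,
    hN.integral_expFun_eq_mul hh hB]
  exact mul_div_mul_comm _ _ _ _

/-- Only the factor of ε_h that belongs to F matters; it is exp(-y N(F)) up to normalization, so
this is the tilted mean of a single Poisson variable. -/
lemma integral_toReal_mul_normExp_of_const (hN : IsPoissonRandomMeasure P m N) {h : E → ℝ≥0}
    (hh : IsTestFun m h) {F : Set E} (hF : MeasurableSet F) (hm : m F ≠ ∞) {y : ℝ≥0}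
    (hy : ∀ x ∈ F, h x = y) :
    ∫ ω, (N ω F).toReal * normExp P N h ω ∂P = (m F).toReal * Real.exp (-(y : ℝ)) := by
  have hmeas : AEStronglyMeasurable[restrictSigma N F] (fun ω => (N ω F).toReal) P := by
    have := @Measurable.ennreal_toReal _ (restrictSigma N F) _
      (measurable_restrictSigma_apply N hF subset_rfl)
    exact this.aestronglyMeasurable
  rw [hN.integral_mul_normExp_indicator hh hF hmeas]
  have h1 : F.indicator h = F.indicator fun _ => y := by
    ext x
    by_cases hx : x ∈ F <;> simp [hx, hy]
  have h2 : ∀ ω, expFun N (F.indicator h) ω = Real.exp (-(y * (N ω F).toReal)) := by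
    intro ω
    have : ∀ x, ((F.indicator (fun _ => y) x : ℝ≥0) : ℝ≥0∞) = F.indicator (fun _ => (y : ℝ≥0∞)) x := by
      intro x
      by_cases hx : x ∈ F <;> simp [hx]
    rw [expFun, h1]
    simp_rw [this]
    rw [lintegral_indicator_const hF, ENNReal.toReal_mul]
    simp
  simp only [normExp, ← mul_div_assoc, h2]
  rw [integral_div, hN.integral_comp hF hm (f := fun x => x * Real.exp (-(y * x))) (by fun_prop),
    hN.integral_comp hF hm (f := fun x => Real.exp (-(y * x))) (by fun_prop),
    integral_natCast_mul_exp_poissonMeasure _ (NNReal.coe_nonneg y)]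
  have hpos : (∫ n : ℕ, Real.exp (-((y : ℝ) * n)) ∂(poissonMeasure (m F).toNNReal)) ≠ 0 := by
    have h3 := (hN.integral_expFun_pos (hh.indicator hF).measurable)
    simp only [h2] at h3
    rw [hN.integral_comp hF hm (f := fun x => Real.exp (-(y * x))) (by fun_prop)] at h3
    exact h3.ne'
  exact mul_div_cancel_right₀ _ hpos

/-- Under the density ε_h the mean of N(F) is the integral of e^{-h} over F; subtracting m(F) leaves
e^{-h}-1. The test function has finitely many values, so F splits into finitely many level sets on
which it is constant. -/
lemma integral_compensated_mul_normExp (hN : IsPoissonRandomMeasure P m N) {h : E → ℝ≥0}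
    (hh : IsTestFun m h) {F : Set E} (hF : MeasurableSet F) (hm : m F ≠ ∞) :
    ∫ ω, compensated m N F ω * normExp P N h ω ∂P = ∫ x in F, expGap h x ∂m := by
  classical
  let R := hh.finite_range.toFinset
  let G : ℝ≥0 → Set E := fun y => F ∩ h ⁻¹' {y}
  have hGm : ∀ y, MeasurableSet (G y) := fun y => hF.inter (hh.measurable (measurableSet_singleton y))
  have hGd : ∀ y y', y ≠ y' → Disjoint (G y) (G y') := by
    intro y y' hyy
    rw [Set.disjoint_left]
    rintro x ⟨-, hx⟩ ⟨-, hx'⟩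
    exact hyy (hx.symm.trans hx')
  have hFU : F = ⋃ y ∈ R, G y := by
    ext x
    simp [R, G]
  have hGfin : ∀ y, m (G y) ≠ ∞ := fun y => ne_top_of_le_ne_top hm (measure_mono inter_subset_left)
  have hNsum : ∀ᵐ ω ∂P, (N ω F).toReal = ∑ y ∈ R, (N ω (G y)).toReal := by
    filter_upwards [hN.ae_lt_top hF hm] with ω hω
    rw [← ENNReal.toReal_sum (fun y _ => ((measure_mono inter_subset_left).trans_lt hω).ne)]
    congr 1
    conv_lhs => rw [hFU]
    exact measure_biUnion_finset (fun y _ y' _ hyy => hGd y y' hyy) fun y _ => hGm y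
  have hgi : IntegrableOn (fun x => Real.exp (-(h x : ℝ))) F m := by
    have := hh.measurable
    have hfm : IsFiniteMeasure (m.restrict F) := ⟨by simpa using hm.lt_top⟩
    refine Integrable.of_bound (C := 1) (by fun_prop) ?_
    refine ae_of_all _ fun x => ?_
    rw [Real.norm_of_nonneg (Real.exp_nonneg _)]
    simp
  have hinteg : Integrable (fun ω => (N ω F).toReal * normExp P N h ω) P :=
    (hN.integrable_toReal hF hm).mul_bdd (hN.measurable_normExp hh.measurable).aestronglyMeasurable
      (ae_of_all _ (hN.norm_normExp_le hh.measurable))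
  have hA : ∫ ω, (N ω F).toReal * normExp P N h ω ∂P = ∫ x in F, Real.exp (-(h x : ℝ)) ∂m := by
    have e1 : ∫ ω, (N ω F).toReal * normExp P N h ω ∂P
        = ∫ ω, ∑ y ∈ R, (N ω (G y)).toReal * normExp P N h ω ∂P := by
      refine integral_congr_ae ?_
      filter_upwards [hNsum] with ω hω
      rw [hω, Finset.sum_mul]
    rw [e1, integral_finsetSum _ fun y _ => (hN.integrable_toReal (hGm y) (hGfin y)).mul_bdd
      (hN.measurable_normExp hh.measurable).aestronglyMeasurable
      (ae_of_all _ (hN.norm_normExp_le hh.measurable))]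
    have e2 : ∫ x in F, Real.exp (-(h x : ℝ)) ∂m = ∑ y ∈ R, ∫ x in G y, Real.exp (-(h x : ℝ)) ∂m := by
      conv_lhs => rw [hFU]
      refine integral_biUnion_finset _ (fun y _ => hGm y) (fun y _ y' _ hyy => hGd y y' hyy) fun y _ => ?_
      exact hgi.mono_set inter_subset_left
    rw [e2]
    refine Finset.sum_congr rfl fun y _ => ?_
    rw [hN.integral_toReal_mul_normExp_of_const hh (hGm y) (hGfin y) (fun x hx => hx.2)]
    rw [setIntegral_congr_fun (g := fun _ => Real.exp (-(y : ℝ))) (hGm y)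
      (fun x hx => by have : h x = y := hx.2
                      simp [this])]
    simp [Measure.real]
  have e3 : ∀ ω, compensated m N F ω * normExp P N h ω =
      (N ω F).toReal * normExp P N h ω - (m F).toReal * normExp P N h ω := by
    intro ω; simp only [compensated]; ring
  simp only [e3, expGap]
  rw [integral_sub hinteg (((hN.memLp_normExp hh.measurable 1).integrable le_rfl).const_mul _),
    integral_const_mul, hN.integral_normExp hh.measurable, hA, integral_sub hgi (by
      refine integrableOn_const hm)]
  simp [Measure.real]

end IsPoissonRandomMeasure

end

end

open scoped NNReal ENNReal Nat BoundedContinuousFunction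

noncomputable section

/-! ### Totality of the exponential functionals -/

/-- The bounded continuous function `x ↦ e^{-x i}`. -/
def expCoord {ι : Type*} (i : ι) : (ι → ℝ≥0) →ᵇ ℝ :=
  BoundedContinuousFunction.ofNormedAddCommGroup (fun x => Real.exp (-(x i : ℝ)))
    (by fun_prop) 1 (fun x => by
      rw [Real.norm_of_nonneg (Real.exp_nonneg _)]
      simp)

/-- The algebra of polynomials in the functions `expCoord i`. -/
def expAlgebra (ι : Type*) : StarSubalgebra ℝ ((ι → ℝ≥0) →ᵇ ℝ) where
  toSubalgebra := (MvPolynomial.aeval (R := ℝ) (expCoord (ι := ι))).range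
  star_mem' := by
    intro a ha
    have : star a = a := by ext x; simp
    rw [this]
    exact ha

lemma expAlgebra_separatesPoints (ι : Type*) :
    ((expAlgebra ι).map (BoundedContinuousFunction.toContinuousMapStarₐ ℝ)).SeparatesPoints := by
  intro x y hxy
  obtain ⟨i, hi⟩ := Function.ne_iff.1 hxy
  refine ⟨fun z => Real.exp (-(z i : ℝ)), ⟨(expCoord i : (ι → ℝ≥0) →ᵇ ℝ).toContinuousMap,
    ⟨expCoord i, ?_, rfl⟩, rfl⟩, ?_⟩
  · exact ⟨MvPolynomial.X i, by simp⟩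
  · simpa using hi

/-- Integer points of the Laplace transform suffice: the monomials in e^{-x_i} span an algebra of
bounded continuous functions that separates points, and such an algebra determines finite measures.
-/
lemma measure_eq_of_forall_integral_prod_exp {ι : Type*} [Fintype ι] {μ ν : Measure (ι → ℝ≥0)}
    [IsFiniteMeasure μ] [IsFiniteMeasure ν]
    (h : ∀ n : ι → ℕ, ∫ x, ∏ i, Real.exp (-(x i : ℝ)) ^ n i ∂μ =
      ∫ x, ∏ i, Real.exp (-(x i : ℝ)) ^ n i ∂ν) : μ = ν := by
  refine ext_of_forall_mem_subalgebra_integral_eq_of_pseudoEMetric_complete_countable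
    (expAlgebra_separatesPoints ι) ?_
  rintro _ ⟨p, rfl⟩
  induction p using MvPolynomial.induction_on' with
  | monomial u a =>
    have e : ∀ x : ι → ℝ≥0, (MvPolynomial.aeval (R := ℝ) (expCoord (ι := ι))
        (MvPolynomial.monomial u a)) x = a * ∏ i, Real.exp (-(x i : ℝ)) ^ u i := by
      intro x
      rw [MvPolynomial.aeval_monomial, Finsupp.prod_fintype _ _ (by simp)]
      have : ∀ s : Finset ι, (∏ i ∈ s, expCoord i ^ u i : (ι → ℝ≥0) →ᵇ ℝ) x =
          ∏ i ∈ s, Real.exp (-(x i : ℝ)) ^ u i := by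
        classical
        intro s
        induction s using Finset.induction_on with
        | empty => simp
        | insert i s hi ih =>
          rw [Finset.prod_insert hi, Finset.prod_insert hi, BoundedContinuousFunction.mul_apply, ih]
          rfl
      rw [BoundedContinuousFunction.mul_apply, this]
      rfl
    simp only [AlgHom.toRingHom_eq_coe, RingHom.coe_coe] 
    simp only [e, integral_const_mul, h]
  | add p q hp hq =>
    simp only [AlgHom.toRingHom_eq_coe, RingHom.coe_coe] at hp hq ⊢
    simp only [map_add, BoundedContinuousFunction.add_apply]
    rw [integral_add (BoundedContinuousFunction.integrable _ _)
      (BoundedContinuousFunction.integrable _ _),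
      integral_add (BoundedContinuousFunction.integrable _ _)
      (BoundedContinuousFunction.integrable _ _), hp, hq]

section

variable {Ω E : Type*} [MeasurableSpace Ω] [MeasurableSpace E] {P : Measure Ω}
  {m : Measure E} {N : Ω → Measure E} [IsProbabilityMeasure P]

lemma isTestFun_sum_indicator {ι : Type*} [Fintype ι] {A : ι → Set E}
    (hA : ∀ i, MeasurableSet (A i)) (hm : ∀ i, m (A i) ≠ ∞) (n : ι → ℕ) :
    IsTestFun m (fun x => ∑ i, (A i).indicator (fun _ => (n i : ℝ≥0)) x) where
  measurable := Finset.measurable_sum _ fun i _ => measurable_const.indicator (hA i)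
  finite_range := by
    classical
    refine (Set.finite_range fun b : ι → Bool => ∑ i, if b i then (n i : ℝ≥0) else 0).subset ?_
    rintro _ ⟨x, rfl⟩
    exact ⟨fun i => decide (x ∈ A i), by simp [indicator_apply]⟩
  support_ne_top := by
    refine ne_top_of_le_ne_top (b := m (⋃ i, A i)) ?_ (measure_mono ?_)
    · exact ((measure_iUnion_fintype_le m A).trans_lt
        (ENNReal.sum_lt_top.2 fun i _ => (hm i).lt_top)).ne
    · intro x hx
      by_contra h
      simp only [mem_iUnion, not_exists] at h
      exact hx (Finset.sum_eq_zero fun i _ => by simp [h i])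

/-- The σ-algebra generated by the counts `N(A)`, `A ⊆ S k` for some `k`. -/
@[reducible] def countSigma (N : Ω → Measure E) (S : ℕ → Set E) : MeasurableSpace Ω :=
  ⨆ A ∈ (univ : Set {A : Set E // MeasurableSet A ∧ ∃ k, A ⊆ S k}),
    MeasurableSpace.comap (fun ω => N ω A.1) inferInstance

namespace IsPoissonRandomMeasure

/-- An integrable functional of `N` is determined by its expectations against the exponential
functionals of test functions supported in the sets of an exhausting sequence. -/
theorem ae_eq_zero_of_forall_integral_mul_normExp_eq_zero (hN : IsPoissonRandomMeasure P m N)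
    {S : ℕ → Set E} (hSm : ∀ k, MeasurableSet (S k)) (hS : Monotone S)
    (hSU : ⋃ k, S k = univ) (hSfin : ∀ k, m (S k) ≠ ∞) {X : Ω → ℝ} (hXi : Integrable X P)
    (hX : AEStronglyMeasurable[restrictSigma N univ] X P)
    (h0 : ∀ h, IsTestFun m h → (∃ k, Function.support h ⊆ S k) →
      ∫ ω, X ω * normExp P N h ω ∂P = 0) : X =ᵐ[P] 0 := by
  classical
  let 𝒜 := {A : Set E // MeasurableSet A ∧ ∃ k, A ⊆ S k}
  let mA : 𝒜 → MeasurableSpace Ω := fun A => MeasurableSpace.comap (fun ω => N ω A.1) inferInstance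
  have hle' : (countSigma N S) ≤ ‹MeasurableSpace Ω› := by
    refine iSup₂_le fun A _ => ?_
    exact (hN.measurable_apply A.2.1).comap_le
  -- Any count is the increasing limit of counts in the sets of the exhaustion, which have finite
  -- intensity and are almost surely finite.
  have hσ : restrictSigma N univ ≤ (countSigma N S) := by
    rw [restrictSigma, ← measurable_iff_comap_le]
    refine @Measure.measurable_of_measurable_coe _ _ _ (countSigma N S) _ fun A hA => ?_
    have e : (fun ω => (N ω).restrict univ A) = fun ω => ⨆ k, N ω (A ∩ S k) := by
      ext ω
      rw [Measure.restrict_univ, ← Monotone.measure_iUnion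
        (fun i j hij => inter_subset_inter_right A (hS hij)), ← inter_iUnion, hSU, inter_univ]
    rw [e]
    refine Measurable.iSup fun k => ?_
    have hle : mA ⟨A ∩ S k, hA.inter (hSm k), k, inter_subset_right⟩ ≤ (countSigma N S) :=
      le_iSup₂_of_le _ (mem_univ _) le_rfl
    exact (comap_measurable fun ω => N ω (A ∩ S k)).mono hle le_rfl
  have hX' : AEStronglyMeasurable[countSigma N S] X P := hX.mono hσ
  let X' := hX'.mk X
  have hX'sm : StronglyMeasurable[countSigma N S] X' := hX'.stronglyMeasurable_mk
  have hXX' : X =ᵐ[P] X' := hX'.ae_eq_mk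
  have hX'i : Integrable X' P := hXi.congr hXX'
  have hX'm : Measurable X' := hX'sm.measurable.mono hle' le_rfl
  -- The positive and the negative part of X' become two finite measures; the claim is that they
  -- agree on the σ-algebra of the counts.
  let μ₁ := P.withDensity fun ω => ENNReal.ofReal (X' ω)
  let μ₂ := P.withDensity fun ω => ENNReal.ofReal (-X' ω)
  have hf1 : IsFiniteMeasure μ₁ := isFiniteMeasure_withDensity_ofReal hX'i.2
  have hf2 : IsFiniteMeasure μ₂ := isFiniteMeasure_withDensity_ofReal hX'i.neg.2
  have hac1 : μ₁ ≪ P := withDensity_absolutelyContinuous _ _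
  have hac2 : μ₂ ≪ P := withDensity_absolutelyContinuous _ _
  -- the image measures under finitely many counts agree
  have hfd : ∀ t : Finset 𝒜, μ₁.map (fun ω (A : t) => (N ω A.1.1).toNNReal) =
      μ₂.map (fun ω (A : t) => (N ω A.1.1).toNNReal) := by
    intro t
    have hTm : Measurable fun ω (A : t) => (N ω A.1.1).toNNReal :=
      measurable_pi_lambda _ fun A => (hN.measurable_apply A.1.2.1).ennreal_toNNReal
    refine measure_eq_of_forall_integral_prod_exp fun n => ?_
    have hmf : Measurable fun x : t → ℝ≥0 => ∏ i, Real.exp (-(x i : ℝ)) ^ n i := by fun_prop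
    rw [integral_map hTm.aemeasurable hmf.aestronglyMeasurable,
      integral_map hTm.aemeasurable hmf.aestronglyMeasurable,
      integral_withDensity_eq_integral_toReal_smul (by fun_prop) (by simp),
      integral_withDensity_eq_integral_toReal_smul (by fun_prop) (by simp), ← sub_eq_zero]
    have hAfin : ∀ A : t, m A.1.1 ≠ ∞ := fun A => by
      obtain ⟨k, hk⟩ := A.1.2.2
      exact ne_top_of_le_ne_top (hSfin k) (measure_mono hk)
    -- Chosen so that exp(-∫h dN) is the monomial with exponents n i in the variables exp(-N(A_i)).
    let h : E → ℝ≥0 := fun x => ∑ i : t, (i.1.1).indicator (fun _ => (n i : ℝ≥0)) x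
    have hh : IsTestFun m h := isTestFun_sum_indicator (fun i => i.1.2.1) hAfin n
    have hhS : ∃ k, Function.support h ⊆ S k := by
      have : ∃ k, ∀ A : t, A.1.1 ⊆ S k := by
        choose k hk using fun A : t => A.1.2.2
        refine ⟨Finset.univ.sup k, fun A => (hk A).trans (hS (Finset.le_sup (Finset.mem_univ A)))⟩
      obtain ⟨k, hk⟩ := this
      refine ⟨k, fun x hx => ?_⟩
      by_contra hxk
      exact hx (Finset.sum_eq_zero fun i _ => by
        have : x ∉ i.1.1 := fun h => hxk (hk i h)
        simp [this])
    have hexp : ∀ᵐ ω ∂P, ∏ i : t, Real.exp (-((N ω i.1.1).toNNReal : ℝ)) ^ n i = expFun N h ω := by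
      have hall : ∀ᵐ ω ∂P, ∀ i : t, N ω i.1.1 < ∞ := by
        rw [ae_all_iff]
        exact fun i => hN.ae_lt_top i.1.2.1 (hAfin i)
      filter_upwards [hall] with ω hω
      have e1 : ∫⁻ x, h x ∂(N ω) = ∑ i : t, (n i : ℝ≥0∞) * N ω i.1.1 := by
        have : ∀ x, (h x : ℝ≥0∞) = ∑ i : t, (i.1.1).indicator (fun _ => (n i : ℝ≥0∞)) x := by
          intro x
          simp only [h, ENNReal.ofNNReal_finsetSum]
          refine Finset.sum_congr rfl fun i _ => ?_
          by_cases hx : x ∈ i.1.1 <;> simp [hx]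
        simp_rw [this]
        rw [lintegral_finsetSum _ fun i _ => measurable_const.indicator i.1.2.1]
        exact Finset.sum_congr rfl fun i _ => lintegral_indicator_const i.1.2.1 _
      rw [expFun, e1, ENNReal.toReal_sum
        (fun i _ => ENNReal.mul_ne_top (by simp) (hω i).ne), ← Finset.sum_neg_distrib,
        Real.exp_sum]
      refine Finset.prod_congr rfl fun i _ => ?_
      rw [← Real.exp_nat_mul, ENNReal.toReal_mul]
      simp [ENNReal.toReal]
    have hb : ∀ f : Ω → ℝ, Integrable f P → Integrable (fun ω => (ENNReal.ofReal (f ω)).toReal •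
        ∏ i : t, Real.exp (-((N ω i.1.1).toNNReal : ℝ)) ^ n i) P := by
      intro f hf
      have h1 : Integrable (fun ω => (ENNReal.ofReal (f ω)).toReal) P := by
        simpa [ENNReal.toReal_ofReal'] using hf.pos_part
      refine h1.mul_bdd (c := 1) (hmf.comp hTm).aestronglyMeasurable ?_
      filter_upwards [hexp] with ω hω
      rw [hω]
      exact norm_expFun_le N h ω
    refine (integral_sub (hb _ hX'i) (hb _ hX'i.neg)).symm.trans ?_
    have hz := h0 h hh hhS
    simp only [normExp, ← mul_div_assoc] at hz
    rw [integral_div, div_eq_zero_iff, or_iff_left (hN.integral_expFun_pos hh.measurable).ne'] at hz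
    rw [← hz]
    refine integral_congr_ae ?_
    filter_upwards [hexp, hXX'] with ω hω hω'
    rw [hω, hω', smul_eq_mul, smul_eq_mul, ← sub_mul, ENNReal.toReal_ofReal', ENNReal.toReal_ofReal',
      Pi.neg_apply]
    congr 1
    exact max_zero_sub_max_neg_zero_eq_self (X' ω)
  -- Events in finitely many counts form a generating π-system. The counts involved are almost
  -- surely finite, so nothing is lost by viewing them in the nonnegative reals.
  have htrim : μ₁.trim hle' = μ₂.trim hle' := by
    refine ext_of_generate_finite _ (generateFrom_piiUnionInter_measurableSet mA univ).symm
      (isPiSystem_piiUnionInter _ (fun A => @MeasurableSpace.isPiSystem_measurableSet _ (mA A)) univ)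
      ?_ ?_
    · rintro _ ⟨t, -, f, hf, rfl⟩
      choose! s hs hsf using hf
      have hfm : ∀ A ∈ t, MeasurableSet (f A) := fun A hA => by
        rw [← hsf A hA]; exact hN.measurable_apply A.2.1 (hs A hA)
      have hm1 : MeasurableSet[countSigma N S] (⋂ A ∈ t, f A) := by
        refine @Finset.measurableSet_biInter _ _ (countSigma N S) _ t fun A hA => ?_
        have hle : mA A ≤ (countSigma N S) := le_iSup₂_of_le _ (mem_univ _) le_rfl
        exact hle _ ⟨s A, hs A hA, hsf A hA⟩
      rw [trim_measurableSet_eq _ hm1, trim_measurableSet_eq _ hm1]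
      let T : Ω → (t → ℝ≥0) := fun ω A => (N ω A.1.1).toNNReal
      have hTm : Measurable T :=
        measurable_pi_lambda _ fun A => (hN.measurable_apply A.1.2.1).ennreal_toNNReal
      let Q : Set (t → ℝ≥0) := Set.pi univ fun A => ((↑) : ℝ≥0 → ℝ≥0∞) ⁻¹' s A.1
      have hQ : MeasurableSet Q :=
        MeasurableSet.univ_pi fun A => measurable_coe_nnreal_ennreal (hs A.1 A.2)
      have hae : (⋂ A ∈ t, f A) =ᵐ[P] T ⁻¹' Q := by
        have hall : ∀ᵐ ω ∂P, ∀ i : t, N ω i.1.1 < ∞ := by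
          rw [ae_all_iff]
          intro i
          obtain ⟨k, hk⟩ := i.1.2.2
          exact hN.ae_lt_top i.1.2.1 (ne_top_of_le_ne_top (hSfin k) (measure_mono hk))
        filter_upwards [hall] with ω hω
        apply propext
        change ω ∈ (⋂ A ∈ t, f A) ↔ T ω ∈ Q
        simp only [mem_iInter, Q, Set.mem_pi, mem_univ, true_implies, mem_preimage, T, Subtype.forall]
        refine forall_congr' fun A => forall_congr' fun hA => ?_
        rw [← hsf A hA, mem_preimage, ENNReal.coe_toNNReal (hω ⟨A, hA⟩).ne]
      rw [measure_congr (hac1.ae_le hae), measure_congr (hac2.ae_le hae),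
        ← Measure.map_apply hTm hQ, ← Measure.map_apply hTm hQ, hfd t]
    · rw [trim_measurableSet_eq _ MeasurableSet.univ, trim_measurableSet_eq _ MeasurableSet.univ]
      have := congrArg (fun μ => μ univ) (hfd ∅)
      have hTm : Measurable fun ω (A : (∅ : Finset 𝒜)) => (N ω A.1.1).toNNReal :=
        measurable_pi_lambda _ fun A => (hN.measurable_apply A.1.2.1).ennreal_toNNReal
      rwa [Measure.map_apply hTm MeasurableSet.univ,
        Measure.map_apply hTm MeasurableSet.univ, preimage_univ] at this
  have hset : ∀ s, MeasurableSet[countSigma N S] s → μ₁ s = μ₂ s := fun s hs => by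
    rw [← trim_measurableSet_eq hle' hs, htrim, trim_measurableSet_eq hle' hs]
  have hpos : MeasurableSet[countSigma N S] {ω | 0 < X' ω} := 
    hX'sm.measurable measurableSet_Ioi
  have hneg : MeasurableSet[countSigma N S] {ω | X' ω < 0} := 
    hX'sm.measurable measurableSet_Iio
  -- On {X' > 0} the second measure vanishes, hence so does the first, whose density is positive
  -- there.
  have hp : ∀ᵐ ω ∂P, ¬ 0 < X' ω := by
    have h1 := hset _ hpos
    have h2 : μ₂ {ω | 0 < X' ω} = 0 := by
      rw [withDensity_apply _ (hle' _ hpos), setLIntegral_eq_zero_iff (hle' _ hpos) (by fun_prop)]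
      refine ae_of_all _ fun ω hω => ?_
      have : 0 < X' ω := hω
      simp [this.le]
    rw [h2, withDensity_apply _ (hle' _ hpos),
      setLIntegral_eq_zero_iff (hle' _ hpos) (by fun_prop)] at h1
    filter_upwards [h1] with ω hω h
    have := hω h
    rw [ENNReal.ofReal_eq_zero] at this
    exact absurd h (not_lt.2 this)
  have hn : ∀ᵐ ω ∂P, ¬ X' ω < 0 := by
    have h1 := hset _ hneg
    have h2 : μ₁ {ω | X' ω < 0} = 0 := by
      rw [withDensity_apply _ (hle' _ hneg), setLIntegral_eq_zero_iff (hle' _ hneg) (by fun_prop)]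
      refine ae_of_all _ fun ω hω => ?_
      have : X' ω < 0 := hω
      simp [this.le]
    rw [h2, withDensity_apply _ (hle' _ hneg), eq_comm,
      setLIntegral_eq_zero_iff (hle' _ hneg) (by fun_prop)] at h1
    filter_upwards [h1] with ω hω h
    have := hω h
    rw [ENNReal.ofReal_eq_zero] at this
    linarith
  filter_upwards [hXX', hp, hn] with ω h1 h2 h3
  rw [h1]
  exact le_antisymm (not_lt.1 h2) (not_lt.1 h3)

/-- A functional of `N` whose expectations against exponential functionals only depend on the
test function on `B` is a functional of the restriction of `N` to `B`. -/
theorem aestronglyMeasurable_restrictSigma_of_forall (hN : IsPoissonRandomMeasure P m N)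
    {S : ℕ → Set E} (hSm : ∀ k, MeasurableSet (S k)) (hS : Monotone S)
    (hSU : ⋃ k, S k = univ) (hSfin : ∀ k, m (S k) ≠ ∞) {X : Ω → ℝ} (hXi : Integrable X P)
    (hX : AEStronglyMeasurable[restrictSigma N univ] X P) {B : Set E} (hB : MeasurableSet B)
    (h0 : ∀ h, IsTestFun m h → (∃ k, Function.support h ⊆ S k) →
      ∫ ω, X ω * normExp P N h ω ∂P = ∫ ω, X ω * normExp P N (B.indicator h) ω ∂P) :
    AEStronglyMeasurable[restrictSigma N B] X P := by
  have hle := hN.restrictSigma_le hB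
  have hYm : StronglyMeasurable[restrictSigma N B] (P[X | restrictSigma N B]) :=
    stronglyMeasurable_condExp
  have hYi : Integrable (P[X | restrictSigma N B]) P := integrable_condExp
  -- By totality it is enough to compare pairings. Both variables see only the part of the test
  -- function on B, and the corresponding ε is measurable for the restriction to B, so it can be
  -- moved inside the conditional expectation.
  have hXY : X - P[X | restrictSigma N B] =ᵐ[P] 0 := by
    refine hN.ae_eq_zero_of_forall_integral_mul_normExp_eq_zero hSm hS hSU hSfin (hXi.sub hYi)
      (hX.sub (hYm.aestronglyMeasurable.mono (restrictSigma_mono N hB (subset_univ _))))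
      fun h hh hhS => ?_
    have hb : ∀ Z : Ω → ℝ, Integrable Z P → ∀ h', Measurable h' →
        Integrable (fun ω => Z ω * normExp P N h' ω) P := fun Z hZ h' hh' =>
      hZ.mul_bdd (hN.measurable_normExp hh').aestronglyMeasurable
        (ae_of_all _ (hN.norm_normExp_le hh'))
    simp only [Pi.sub_apply, sub_mul]
    rw [integral_sub (hb _ hXi _ hh.measurable) (hb _ hYi _ hh.measurable), h0 h hh hhS,
      hN.integral_mul_normExp_indicator hh hB hYm.aestronglyMeasurable, sub_eq_zero]
    have hεm : StronglyMeasurable[restrictSigma N B] (normExp P N (B.indicator h)) := by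
      have := measurable_expFun_restrictSigma N (hh.indicator hB).measurable hB
        (by simp)
      exact (this.div_const _).stronglyMeasurable
    have h1 := condExp_mul_of_stronglyMeasurable_right (μ := P) hεm
      (hb X hXi _ (hh.indicator hB).measurable) hXi
    have h2 := integral_condExp hle (μ := P) (f := X * normExp P N (B.indicator h))
    rw [integral_congr_ae h1] at h2
    exact h2.symm
  refine hYm.aestronglyMeasurable.congr ?_
  filter_upwards [hXY] with ω hω
  simp only [Pi.sub_apply, Pi.zero_apply] at hω
  linarith

end IsPoissonRandomMeasure

end

end

/-! ### Multiple integrals of simple kernels: common refinements, orthogonality and isometry. -/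

noncomputable section

/-! ### Auxiliary facts on `L²` convergence and product measures -/

lemma tendsto_integral_mul_of_tendsto_eLpNorm_two {α ι : Type*} [MeasurableSpace α]
    {μ : Measure α} {l : Filter ι} {f : ι → α → ℝ} {g h : α → ℝ} (hf : ∀ i, MemLp (f i) 2 μ)
    (hg : MemLp g 2 μ) (hh : MemLp h 2 μ)
    (hlim : Tendsto (fun i => eLpNorm (f i - g) 2 μ) l (𝓝 0)) :
    Tendsto (fun i => ∫ x, f i x * h x ∂μ) l (𝓝 (∫ x, g x * h x ∂μ)) := by
  refine tendsto_integral_of_L1' (fun x => g x * h x) (hg.integrable_mul hh).1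
    (Eventually.of_forall fun i => (hf i).integrable_mul hh) ?_
  have hb : ∀ i, eLpNorm ((fun x => f i x * h x) - fun x => g x * h x) 1 μ ≤
      eLpNorm (f i - g) 2 μ * eLpNorm h 2 μ := by
    intro i
    have e : ((fun x => f i x * h x) - fun x => g x * h x) = (f i - g) • h := by
      ext x; simp [sub_mul]
    rw [e]
    exact eLpNorm_smul_le_mul_eLpNorm hh.1 ((hf i).sub hg).1
  refine tendsto_of_tendsto_of_tendsto_of_le_of_le tendsto_const_nhds ?_ (fun i => zero_le) hb
  simpa using ENNReal.Tendsto.mul_const hlim (Or.inr hh.2.ne)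

lemma sq_eLpNorm_two_eq_ofReal_integral {α : Type*} [MeasurableSpace α] {μ : Measure α}
    {f : α → ℝ} (hf : MemLp f 2 μ) :
    eLpNorm f 2 μ ^ 2 = ENNReal.ofReal (∫ x, f x * f x ∂μ) := by
  have h2 : eLpNorm f 2 μ = ENNReal.ofReal ((∫ x, ‖f x‖ ^ (2 : ℝ) ∂μ) ^ (2 : ℝ)⁻¹) := by
    simpa using hf.eLpNorm_eq_integral_rpow_norm (by norm_num) (by norm_num)
  rw [h2, ← ENNReal.ofReal_pow (by positivity)]
  congr 1
  rw [← Real.rpow_natCast, ← Real.rpow_mul (integral_nonneg fun x => by positivity)]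
  norm_num
  simp [sq]

lemma abs_integral_mul_le_of_memLp_two {α : Type*} [MeasurableSpace α] {μ : Measure α}
    {f g : α → ℝ} (hf : MemLp f 2 μ) (hg : MemLp g 2 μ) :
    |∫ x, f x * g x ∂μ| ≤ (eLpNorm f 2 μ).toReal * (eLpNorm g 2 μ).toReal := by
  have h1 : eLpNorm (f • g) 1 μ ≤ eLpNorm f 2 μ * eLpNorm g 2 μ :=
    eLpNorm_smul_le_mul_eLpNorm hg.1 hf.1
  have h2 := ENNReal.toReal_mono (ENNReal.mul_ne_top hf.2.ne hg.2.ne) h1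
  rw [ENNReal.toReal_mul] at h2
  refine le_trans ?_ h2
  have h3 : AEStronglyMeasurable (f • g) μ := (hf.integrable_mul hg).1
  rw [eLpNorm_one_eq_lintegral_enorm, ← integral_norm_eq_lintegral_enorm h3]
  exact norm_integral_le_integral_norm (fun x => f x * g x)

lemma measurePreserving_comp_perm {α : Type*} [MeasurableSpace α] (μ : Measure α) [SigmaFinite μ]
    {n : ℕ} (σ : Equiv.Perm (Fin n)) :
    MeasurePreserving (fun ξ : Fin n → α => ξ ∘ σ) (Measure.pi fun _ => μ)
      (Measure.pi fun _ => μ) := by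
  have h := measurePreserving_piCongrLeft (fun _ : Fin n => μ) σ⁻¹
  convert h using 1
  ext ξ j
  have := MeasurableEquiv.piCongrLeft_apply_apply (β := fun _ : Fin n => α) σ⁻¹ ξ (σ j)
  simpa using this.symm

section

variable {Ω E : Type*} [MeasurableSpace Ω] [MeasurableSpace E] {P : Measure Ω}
  {m : Measure E} {N : Ω → Measure E}

/-! ### Refinements of simple kernels -/

/-- Evaluation of a polynomial with coefficients `c` at one family of values per slot. -/
def multiSum {k L : ℕ} (c : (Fin k → Fin L) → ℝ) (b : Fin k → Fin L → ℝ) : ℝ :=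
  ∑ i : Fin k → Fin L, c i * ∏ j, b j (i j)

/-- Transport of coefficients to a finer partition. -/
def refineCoeff {k L L' : ℕ} (c : (Fin k → Fin L) → ℝ) (q : Fin L' → Option (Fin L))
    (κ : Fin k → Fin L') : ℝ :=
  ∑ i : Fin k → Fin L, c i * ∏ j, if q (κ j) = some (i j) then 1 else 0

/-- A simple kernel and its integral are the same polynomial, evaluated at indicators and at
compensated counts. With arbitrary values b a single identity refines both. -/
lemma multiSum_refineCoeff {k L L' : ℕ} (c : (Fin k → Fin L) → ℝ) (q : Fin L' → Option (Fin L))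
    (b : Fin k → Fin L' → ℝ) :
    multiSum (refineCoeff c q) b =
      multiSum c fun j i => ∑ κ, (if q κ = some i then 1 else 0) * b j κ := by
  classical
  unfold multiSum refineCoeff
  simp_rw [Finset.prod_univ_sum, Fintype.piFinset_univ, Finset.sum_mul, Finset.mul_sum]
  rw [Finset.sum_comm]
  refine Finset.sum_congr rfl fun i _ => Finset.sum_congr rfl fun κ _ => ?_
  rw [Finset.prod_mul_distrib, mul_assoc]

/-- A term can survive only if each fine cell lies in the prescribed coarse cell; a repeated fine
cell then forces a repeated coarse one, where the coefficient vanishes. -/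
lemma refineCoeff_eq_zero {k L L' : ℕ} {c : (Fin k → Fin L) → ℝ}
    (hc : ∀ i : Fin k → Fin L, ¬ Function.Injective i → c i = 0) (q : Fin L' → Option (Fin L))
    (κ : Fin k → Fin L') (hκ : ¬ Function.Injective κ) : refineCoeff c q κ = 0 := by
  refine Finset.sum_eq_zero fun i _ => ?_
  by_cases hi : Function.Injective i
  · have : ∃ j, q (κ j) ≠ some (i j) := by
      by_contra! h
      refine hκ fun j j' hjj => hi ?_
      have h1 := h j
      rw [hjj, h j'] at h1
      exact (Option.some_injective _ h1).symm
    obtain ⟨j, hj⟩ := this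
    rw [Finset.prod_eq_zero (Finset.mem_univ j) (by simp [hj]), mul_zero]
  · rw [hc i hi, zero_mul]

/-- Two simple kernels have a common refinement. -/
lemma SimpleKernel.exists_common_refinement {k k' : ℕ} (s : SimpleKernel m k)
    (s' : SimpleKernel m k') :
    ∃ (L : ℕ) (A : Fin L → Set E) (q : Fin L → Option (Fin s.size))
      (q' : Fin L → Option (Fin s'.size)), (∀ κ, MeasurableSet (A κ)) ∧ (∀ κ, m (A κ) ≠ ∞) ∧
      Pairwise (fun i j => Disjoint (A i) (A j)) ∧
      (∀ i, s.F i = ⋃ κ ∈ Finset.univ.filter (fun κ => q κ = some i), A κ) ∧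
      (∀ i, s'.F i = ⋃ κ ∈ Finset.univ.filter (fun κ => q' κ = some i), A κ) := by
  classical
  let κ₀ := Option (Fin s.size) × Option (Fin s'.size)
  let U : Option (Fin s.size) → Set E := fun o => o.elim (⋃ i, s.F i)ᶜ s.F
  let U' : Option (Fin s'.size) → Set E := fun o => o.elim (⋃ i, s'.F i)ᶜ s'.F
  -- The cell outside both supports may have infinite measure; it belongs to neither kernel and is
  -- replaced by the empty set.
  let A₀ : κ₀ → Set E := fun κ => if κ = (none, none) then ∅ else U κ.1 ∩ U' κ.2
  have hU : ∀ o, MeasurableSet (U o) := by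
    rintro (_ | i)
    · exact (MeasurableSet.iUnion s.measurable).compl
    · exact s.measurable i
  have hU' : ∀ o, MeasurableSet (U' o) := by
    rintro (_ | i)
    · exact (MeasurableSet.iUnion s'.measurable).compl
    · exact s'.measurable i
  have hUd : ∀ o o', o ≠ o' → Disjoint (U o) (U o') := by
    rintro (_ | i) (_ | i') h
    · exact absurd rfl h
    · exact (disjoint_compl_left).mono_right (subset_iUnion s.F i')
    · exact (disjoint_compl_right).mono_left (subset_iUnion s.F i)
    · exact s.disjoint (fun e => h (by rw [e]))
  have hUd' : ∀ o o', o ≠ o' → Disjoint (U' o) (U' o') := by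
    rintro (_ | i) (_ | i') h
    · exact absurd rfl h
    · exact (disjoint_compl_left).mono_right (subset_iUnion s'.F i')
    · exact (disjoint_compl_right).mono_left (subset_iUnion s'.F i)
    · exact s'.disjoint (fun e => h (by rw [e]))
  have hUU : ∀ x, ∃ o, x ∈ U o := by
    intro x
    by_cases h : x ∈ ⋃ i, s.F i
    · obtain ⟨i, hi⟩ := mem_iUnion.1 h
      exact ⟨some i, hi⟩
    · exact ⟨none, h⟩
  have hUU' : ∀ x, ∃ o, x ∈ U' o := by
    intro x
    by_cases h : x ∈ ⋃ i, s'.F i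
    · obtain ⟨i, hi⟩ := mem_iUnion.1 h
      exact ⟨some i, hi⟩
    · exact ⟨none, h⟩
  have hA₀ : ∀ κ, MeasurableSet (A₀ κ) := by
    intro κ
    by_cases h : κ = (none, none)
    · simp [A₀, h]
    · simp only [A₀, h, if_false]; exact (hU _).inter (hU' _)
  have hA₀f : ∀ κ, m (A₀ κ) ≠ ∞ := by
    rintro ⟨_ | i, _ | i'⟩
    · simp [A₀]
    · refine ne_top_of_le_ne_top (s'.finite i') (measure_mono ?_)
      simp only [A₀]
      exact inter_subset_right
    · refine ne_top_of_le_ne_top (s.finite i) (measure_mono ?_)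
      simp only [A₀]
      exact inter_subset_left
    · refine ne_top_of_le_ne_top (s.finite i) (measure_mono ?_)
      simp only [A₀]
      exact inter_subset_left
  have hA₀d : ∀ κ κ', κ ≠ κ' → Disjoint (A₀ κ) (A₀ κ') := by
    intro κ κ' hκ
    by_cases h : κ = (none, none)
    · simp [A₀, h]
    by_cases h' : κ' = (none, none)
    · simp [A₀, h']
    simp only [A₀, h, h', if_false]
    by_cases h1 : κ.1 = κ'.1
    · have h2 : κ.2 ≠ κ'.2 := fun h2 => hκ (Prod.ext h1 h2)
      exact (hUd' _ _ h2).mono inter_subset_right inter_subset_right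
    · exact (hUd _ _ h1).mono inter_subset_left inter_subset_left
  let e := Fintype.equivFin κ₀
  refine ⟨Fintype.card κ₀, fun κ => A₀ (e.symm κ), fun κ => (e.symm κ).1, fun κ => (e.symm κ).2,
    fun κ => hA₀ _, fun κ => hA₀f _, fun κ κ' h => hA₀d _ _ (fun h' => h (e.symm.injective h')),
    fun i => ?_, fun i => ?_⟩
  · ext x
    simp only [Finset.mem_filter, Finset.mem_univ, true_and, mem_iUnion, exists_prop]
    constructor
    · intro hx
      obtain ⟨o, ho⟩ := hUU' x
      refine ⟨e (some i, o), by simp, ?_⟩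
      simp only [Equiv.symm_apply_apply, A₀]
      exact ⟨hx, ho⟩
    · rintro ⟨κ, hκ, hx⟩
      simp only [A₀] at hx
      split_ifs at hx with h
      · exact absurd hx (notMem_empty x)
      · have := hx.1
        rwa [hκ] at this
  · ext x
    simp only [Finset.mem_filter, Finset.mem_univ, true_and, mem_iUnion, exists_prop]
    constructor
    · intro hx
      obtain ⟨o, ho⟩ := hUU x
      refine ⟨e (o, some i), by simp, ?_⟩
      have h1 : A₀ (o, some i) = U o ∩ U' (some i) :=
        if_neg fun h => by cases congrArg Prod.snd h
      rw [Equiv.symm_apply_apply, h1]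
      exact ⟨ho, hx⟩
    · rintro ⟨κ, hκ, hx⟩
      simp only [A₀] at hx
      split_ifs at hx with h
      · exact absurd hx (notMem_empty x)
      · have := hx.2
        rwa [hκ] at this

lemma indicator_eq_sum_of_refinement {L L' : ℕ} {F : Set E} {A : Fin L' → Set E}
    (hd : Pairwise fun i j => Disjoint (A i) (A j)) {q : Fin L' → Option (Fin L)} {i : Fin L}
    (hF : F = ⋃ κ ∈ Finset.univ.filter (fun κ => q κ = some i), A κ) (x : E) :
    F.indicator (fun _ => (1 : ℝ)) x =
      ∑ κ, (if q κ = some i then 1 else 0) * (A κ).indicator (fun _ => (1 : ℝ)) x := by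
  classical
  by_cases hx : x ∈ F
  · have hx' := hx
    rw [hF] at hx'
    simp only [Finset.mem_filter, Finset.mem_univ, true_and, mem_iUnion, exists_prop] at hx'
    obtain ⟨κ, hκ, hxκ⟩ := hx'
    rw [indicator_of_mem hx, Finset.sum_eq_single κ]
    · simp [hκ, hxκ]
    · intro κ' _ h
      have : x ∉ A κ' := fun h' => Set.disjoint_left.1 (hd h) h' hxκ
      simp [this]
    · simp
  · rw [indicator_of_notMem hx]
    refine (Finset.sum_eq_zero fun κ _ => ?_).symm
    by_cases hκ : q κ = some i
    · have : x ∉ A κ := fun h => hx (by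
        rw [hF]
        simp only [Finset.mem_filter, Finset.mem_univ, true_and, mem_iUnion, exists_prop]
        exact ⟨κ, hκ, h⟩)
      simp [this]
    · simp [hκ]

lemma compensated_eq_sum_of_refinement {L L' : ℕ} {F : Set E} {A : Fin L' → Set E}
    (hA : ∀ κ, MeasurableSet (A κ)) (hAm : ∀ κ, m (A κ) ≠ ∞)
    (hd : Pairwise fun i j => Disjoint (A i) (A j)) {q : Fin L' → Option (Fin L)} {i : Fin L}
    (hF : F = ⋃ κ ∈ Finset.univ.filter (fun κ => q κ = some i), A κ) {ω : Ω}
    (hω : ∀ κ, N ω (A κ) < ∞) :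
    compensated m N F ω = ∑ κ, (if q κ = some i then 1 else 0) * compensated m N (A κ) ω := by
  classical
  have key : ∀ χ : Measure E, (∀ κ, χ (A κ) ≠ ∞) → (χ F).toReal =
      ∑ κ, (if q κ = some i then 1 else 0) * (χ (A κ)).toReal := by
    intro χ hχ
    rw [hF, measure_biUnion_finset (fun κ _ κ' _ h => hd h) (fun κ _ => hA κ),
      ENNReal.toReal_sum (fun κ _ => hχ κ), Finset.sum_filter]
    exact Finset.sum_congr rfl fun κ _ => by split_ifs <;> simp
  simp only [compensated, mul_sub, Finset.sum_sub_distrib]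
  rw [← key m hAm, ← key (N ω) fun κ => (hω κ).ne]

/-! ### Products of compensated counts -/

/-- The product of compensated counts over a tuple of cells. -/
def cellProd (m : Measure E) (N : Ω → Measure E) {L k : ℕ} (A : Fin L → Set E) (i : Fin k → Fin L)
    (ω : Ω) : ℝ := ∏ j, compensated m N (A (i j)) ω

/-- Writing a product over a tuple as a product over all cells lets two tuples be merged cell by
cell, so that independence applies once. -/
lemma prod_comp_injective_eq {L k : ℕ} {i : Fin k → Fin L} (hi : Function.Injective i)
    (b : Fin L → ℝ) [DecidablePred (· ∈ range i)] :
    ∏ j, b (i j) = ∏ l, if l ∈ range i then b l else 1 := by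
  classical
  rw [Finset.prod_ite, Finset.prod_const_one, mul_one]
  refine Finset.prod_bij (fun j _ => i j) (by simp) (fun a _ b _ h => hi h) ?_ (by simp)
  intro l hl
  simp only [Finset.mem_filter, mem_range, Finset.mem_univ, true_and] at hl
  obtain ⟨j, rfl⟩ := hl
  exact ⟨j, Finset.mem_univ _, rfl⟩

namespace IsPoissonRandomMeasure

variable [IsProbabilityMeasure P]

lemma measurable_cellProd (hN : IsPoissonRandomMeasure P m N) {L k : ℕ} {A : Fin L → Set E}
    (hA : ∀ l, MeasurableSet (A l)) (i : Fin k → Fin L) : Measurable (cellProd m N A i) :=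
  Finset.measurable_prod _ fun _ _ => hN.measurable_compensated (hA _)

lemma integrable_sq_prod_compensated (hN : IsPoissonRandomMeasure P m N) {L : ℕ}
    {A : Fin L → Set E} (hA : ∀ l, MeasurableSet (A l)) (hm : ∀ l, m (A l) ≠ ∞)
    (hd : Pairwise fun i j => Disjoint (A i) (A j)) (S : Finset (Fin L)) :
    Integrable (fun ω => (∏ l ∈ S, compensated m N (A l) ω) ^ 2) P := by
  classical
  induction S using Finset.induction_on with
  | empty => simp
  | insert l S hl ih =>
    have hfm : Measurable (fun ω => (∏ l ∈ S, compensated m N (A l) ω) ^ 2) :=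
      (Finset.measurable_prod _ fun j _ => hN.measurable_compensated (hA j)).pow_const 2
    have h1 : Integrable (fun ω => compensated m N (A l) ω ^ 2) P :=
      (hN.memLp_compensated (hA l) (hm l)).integrable_sq
    have hX : AEStronglyMeasurable[restrictSigma N (A l)]
        (fun ω => compensated m N (A l) ω ^ 2) P :=
      ((measurable_restrictSigma_compensated N (hA l) subset_rfl).pow_const 2).aestronglyMeasurable
    have hY : AEStronglyMeasurable[restrictSigma N (A l)ᶜ]
        (fun ω => (∏ l ∈ S, compensated m N (A l) ω) ^ 2) P := by
      refine Measurable.aestronglyMeasurable (Measurable.pow_const ?_ 2)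
      refine Finset.measurable_prod _ fun j hj => ?_
      refine measurable_restrictSigma_compensated N (hA j) ?_
      rw [subset_compl_iff_disjoint_right]
      exact hd (fun e => hl (e ▸ hj))
    have hind := indepFun_of_indep_of_aestronglyMeasurable
      (hN.indep_restrictSigma (hA l) (hA l).compl disjoint_compl_right) hX hY
    have := hind.integrable_mul h1 ih
    refine this.congr (ae_of_all _ fun ω => ?_)
    simp only [Pi.mul_apply]
    rw [Finset.prod_insert hl, mul_pow]

lemma memLp_cellProd (hN : IsPoissonRandomMeasure P m N) {L k : ℕ}
    {A : Fin L → Set E} (hA : ∀ l, MeasurableSet (A l)) (hm : ∀ l, m (A l) ≠ ∞)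
    (hd : Pairwise fun i j => Disjoint (A i) (A j)) {i : Fin k → Fin L}
    (hi : Function.Injective i) : MemLp (cellProd m N A i) 2 P := by
  classical
  rw [memLp_two_iff_integrable_sq (hN.measurable_cellProd hA i).aestronglyMeasurable]
  have := hN.integrable_sq_prod_compensated hA hm hd (Finset.univ.image i)
  refine this.congr (ae_of_all _ fun ω => ?_)
  simp only [cellProd]
  rw [Finset.prod_image fun a _ b _ h => hi h]

/-- By independence the expectation is a product over cells: a cell in both tuples contributes its
variance m(A), a cell in exactly one contributes mean zero, the others contribute one. -/
lemma integral_cellProd_mul_cellProd (hN : IsPoissonRandomMeasure P m N) {L k k' : ℕ}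
    {A : Fin L → Set E} (hA : ∀ l, MeasurableSet (A l)) (hm : ∀ l, m (A l) ≠ ∞)
    (hd : Pairwise fun i j => Disjoint (A i) (A j)) {i : Fin k → Fin L}
    (hi : Function.Injective i) {i' : Fin k' → Fin L} (hi' : Function.Injective i')
    [Decidable (range i = range i')] :
    ∫ ω, cellProd m N A i ω * cellProd m N A i' ω ∂P =
      if range i = range i' then ∏ j, (m (A (i j))).toReal else 0 := by
  classical
  let f : Fin L → ℝ≥0∞ → ℝ := fun l x =>
    (if l ∈ range i then x.toReal - (m (A l)).toReal else 1) *
      (if l ∈ range i' then x.toReal - (m (A l)).toReal else 1)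
  have hf : ∀ l, Measurable (f l) := by
    intro l
    refine Measurable.mul ?_ ?_ <;> split_ifs <;> fun_prop
  have hprod : ∀ ω, cellProd m N A i ω * cellProd m N A i' ω = ∏ l, f l (N ω (A l)) := by
    intro ω
    simp only [cellProd, f]
    rw [prod_comp_injective_eq hi (fun l => compensated m N (A l) ω),
      prod_comp_injective_eq hi' (fun l => compensated m N (A l) ω), ← Finset.prod_mul_distrib]
    rfl
  simp only [hprod]
  have hind : iIndepFun (fun l ω => f l (N ω (A l))) P := (hN.indep L A hA hd).comp f hf
  rw [hind.integral_fun_prod_eq_prod_integral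
    fun l => ((hf l).comp (hN.measurable_apply (hA l))).aestronglyMeasurable]
  have hval : ∀ l, ∫ ω, f l (N ω (A l)) ∂P = if l ∈ range i then
      (if l ∈ range i' then (m (A l)).toReal else 0) else (if l ∈ range i' then 0 else 1) := by
    intro l
    by_cases h1 : l ∈ range i <;> by_cases h2 : l ∈ range i' <;> simp only [f, h1, h2, if_true,
      if_false, mul_one, one_mul]
    · exact hN.integral_compensated_sq (hA l) (hm l)
    · exact hN.integral_compensated (hA l) (hm l)
    · exact hN.integral_compensated (hA l) (hm l)
    · simp
  simp only [hval]
  split_ifs with h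
  · rw [prod_comp_injective_eq hi (fun l => (m (A l)).toReal)]
    refine Finset.prod_congr rfl fun l _ => ?_
    have h' : l ∈ range i ↔ l ∈ range i' := by rw [h]
    by_cases hl : l ∈ range i
    · rw [if_pos hl, if_pos hl, if_pos (h'.1 hl)]
    · rw [if_neg hl, if_neg hl, if_neg fun h2 => hl (h'.2 h2)]
  · have : ∃ l, ¬ (l ∈ range i ↔ l ∈ range i') := by
      by_contra! h'
      exact h (Set.ext h')
    obtain ⟨l, hl⟩ := this
    refine Finset.prod_eq_zero (Finset.mem_univ l) ?_
    by_cases h1 : l ∈ range i <;> by_cases h2 : l ∈ range i'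
    · exact absurd (by simp [h1, h2]) hl
    · simp only [h1, h2, if_true, if_false]
    · simp only [h1, h2, if_true, if_false]
    · exact absurd (by simp [h1, h2]) hl

end IsPoissonRandomMeasure

end

end

noncomputable section

section

variable {Ω E : Type*} [MeasurableSpace Ω] [MeasurableSpace E] {P : Measure Ω}
  {m : Measure E} {N : Ω → Measure E}

/-! ### Second moments of multiple integrals of simple kernels -/

/-- The product of indicators over a tuple of cells. -/
def cellInd {L k : ℕ} (A : Fin L → Set E) (i : Fin k → Fin L) (ξ : Fin k → E) : ℝ :=
  ∏ j, (A (i j)).indicator (fun _ => (1 : ℝ)) (ξ j)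

lemma memLp_cellInd [SigmaFinite m] {L k : ℕ} {A : Fin L → Set E}
    (hA : ∀ l, MeasurableSet (A l)) (hm : ∀ l, m (A l) ≠ ∞) (i : Fin k → Fin L) :
    MemLp (cellInd A i) 2 (Measure.pi fun _ : Fin k => m) := by
  have hmeas : Measurable (cellInd A i) :=
    Finset.measurable_prod _ fun j _ => (measurable_const.indicator (hA _)).comp
      (measurable_pi_apply j)
  rw [memLp_two_iff_integrable_sq hmeas.aestronglyMeasurable]
  have : Integrable (fun ξ : Fin k → E => ∏ j, (A (i j)).indicator (fun _ => (1 : ℝ)) (ξ j))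
      (Measure.pi fun _ : Fin k => m) :=
    Integrable.fintype_prod fun j => (integrable_indicator_iff (hA _)).2 (integrableOn_const (hm _))
  refine this.congr (ae_of_all _ fun ξ => ?_)
  simp only [cellInd]
  rw [← Finset.prod_pow]
  refine Finset.prod_congr rfl fun j _ => ?_
  by_cases h : ξ j ∈ A (i j) <;> simp [h]

lemma integral_cellInd_mul_cellInd_perm [SigmaFinite m] {L k : ℕ} {A : Fin L → Set E}
    (hA : ∀ l, MeasurableSet (A l)) (hd : Pairwise fun i j => Disjoint (A i) (A j))
    (i i' : Fin k → Fin L) (σ : Equiv.Perm (Fin k)) [Decidable (i = i' ∘ ⇑σ⁻¹)] :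
    ∫ ξ, cellInd A i ξ * cellInd A i' (ξ ∘ σ) ∂(Measure.pi fun _ : Fin k => m) =
      if i = i' ∘ ⇑σ⁻¹ then ∏ j, (m (A (i j))).toReal else 0 := by
  classical
  have h1 : ∀ ξ : Fin k → E, cellInd A i ξ * cellInd A i' (ξ ∘ σ) =
      ∏ j, ((A (i j)).indicator (fun _ => (1 : ℝ)) (ξ j) *
        (A (i' (σ⁻¹ j))).indicator (fun _ => (1 : ℝ)) (ξ j)) := by
    intro ξ
    rw [Finset.prod_mul_distrib]
    simp only [cellInd, Function.comp]
    congr 1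
    rw [← Equiv.prod_comp σ fun j => (A (i' (σ⁻¹ j))).indicator (fun _ => (1 : ℝ)) (ξ j)]
    simp
  simp only [h1]
  rw [integral_fintype_prod_eq_prod (fun j x => (A (i j)).indicator (fun _ => (1 : ℝ)) x *
    (A (i' (σ⁻¹ j))).indicator (fun _ => (1 : ℝ)) x)]
  have h2 : ∀ j, ∫ x, (A (i j)).indicator (fun _ => (1 : ℝ)) x *
      (A (i' (σ⁻¹ j))).indicator (fun _ => (1 : ℝ)) x ∂m =
      if i j = i' (σ⁻¹ j) then (m (A (i j))).toReal else 0 := by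
    intro j
    split_ifs with h
    · rw [← h]
      have : ∀ x, (A (i j)).indicator (fun _ => (1 : ℝ)) x *
          (A (i j)).indicator (fun _ => (1 : ℝ)) x = (A (i j)).indicator (fun _ => (1 : ℝ)) x := by
        intro x
        by_cases hx : x ∈ A (i j) <;> simp [hx]
      simp only [this]
      rw [integral_indicator (hA _)]
      simp [Measure.real]
    · have : ∀ x, (A (i j)).indicator (fun _ => (1 : ℝ)) x *
          (A (i' (σ⁻¹ j))).indicator (fun _ => (1 : ℝ)) x = 0 := by
        intro x
        by_cases hx : x ∈ A (i j)
        · have : x ∉ A (i' (σ⁻¹ j)) := Set.disjoint_left.1 (hd h) hx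
          rw [indicator_of_notMem this, mul_zero]
        · rw [indicator_of_notMem hx, zero_mul]
      simp only [this, integral_zero]
  simp only [h2]
  split_ifs with h
  · refine Finset.prod_congr rfl fun j _ => ?_
    exact if_pos (congrFun h j)
  · obtain ⟨j, hj⟩ := Function.ne_iff.1 h
    exact Finset.prod_eq_zero (Finset.mem_univ j) (if_neg hj)

/-- Two injective tuples with the same range differ by exactly one permutation. This is the origin
of the sum over permutations in the isometry. -/
lemma sum_perm_ite_eq {L k : ℕ} {i i' : Fin k → Fin L} (hi : Function.Injective i)
    (hi' : Function.Injective i') (M : ℝ) [Decidable (range i = range i')]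
    [∀ σ : Equiv.Perm (Fin k), Decidable (i = i' ∘ ⇑σ⁻¹)] :
    ∑ σ : Equiv.Perm (Fin k), (if i = i' ∘ ⇑σ⁻¹ then M else 0) =
      if range i = range i' then M else 0 := by
  split_ifs with h
  · let e : Equiv.Perm (Fin k) := (Equiv.ofInjective i hi).trans
      ((Equiv.setCongr h).trans (Equiv.ofInjective i' hi').symm)
    have he : i = i' ∘ e := by
      ext j
      have : i' (e j) = i j := by
        have h1 : Equiv.ofInjective i' hi' (e j) = Equiv.setCongr h (Equiv.ofInjective i hi j) := by
          simp [e]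
        exact congrArg Subtype.val h1
      simp [this]
    rw [Finset.sum_eq_single e⁻¹]
    · rw [if_pos (by simpa using he)]
    · intro σ _ hσ
      refine if_neg fun h' => hσ ?_
      rw [he] at h'
      have : ⇑e = ⇑σ⁻¹ := by
        ext j
        exact congrArg Fin.val (hi' (congrFun h' j))
      rw [DFunLike.coe_injective this, inv_inv]
    · simp
  · refine Finset.sum_eq_zero fun σ _ => if_neg fun h' => h ?_
    rw [h', range_comp, (Equiv.surjective _).range_eq, image_univ]

namespace IsPoissonRandomMeasure

variable [IsProbabilityMeasure P]

lemma memLp_multiSum (hN : IsPoissonRandomMeasure P m N) {L k : ℕ}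
    {A : Fin L → Set E} (hA : ∀ l, MeasurableSet (A l)) (hm : ∀ l, m (A l) ≠ ∞)
    (hd : Pairwise fun i j => Disjoint (A i) (A j)) {c : (Fin k → Fin L) → ℝ}
    (hc : ∀ i, ¬ Function.Injective i → c i = 0) :
    MemLp (fun ω => multiSum c fun _ l => compensated m N (A l) ω) 2 P := by
  unfold multiSum
  refine memLp_finsetSum _ fun i _ => ?_
  by_cases hi : Function.Injective i
  · exact (hN.memLp_cellProd hA hm hd hi).const_mul _
  · simp [hc i hi]

lemma integral_multiSum_mul (hN : IsPoissonRandomMeasure P m N) {L k k' : ℕ}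
    {A : Fin L → Set E} (hA : ∀ l, MeasurableSet (A l)) (hm : ∀ l, m (A l) ≠ ∞)
    (hd : Pairwise fun i j => Disjoint (A i) (A j)) {c : (Fin k → Fin L) → ℝ}
    (hc : ∀ i, ¬ Function.Injective i → c i = 0) {c' : (Fin k' → Fin L) → ℝ}
    (hc' : ∀ i, ¬ Function.Injective i → c' i = 0) :
    ∫ ω, (multiSum c fun _ l => compensated m N (A l) ω) *
      (multiSum c' fun _ l => compensated m N (A l) ω) ∂P =
      ∑ i, ∑ i', c i * c' i' * ∫ ω, cellProd m N A i ω * cellProd m N A i' ω ∂P := by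
  have hinteg : ∀ i i', Integrable (fun ω => c i * c' i' *
      (cellProd m N A i ω * cellProd m N A i' ω)) P := by
    intro i i'
    by_cases hi : Function.Injective i
    · by_cases hi' : Function.Injective i'
      · exact ((hN.memLp_cellProd hA hm hd hi).integrable_mul
          (hN.memLp_cellProd hA hm hd hi')).const_mul _
      · simp [hc' i' hi']
    · simp [hc i hi]
  have e : ∀ ω, (multiSum c fun _ l => compensated m N (A l) ω) *
      (multiSum c' fun _ l => compensated m N (A l) ω) =
      ∑ i, ∑ i', c i * c' i' * (cellProd m N A i ω * cellProd m N A i' ω) := by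
    intro ω
    simp only [multiSum, Finset.sum_mul_sum, cellProd]
    exact Finset.sum_congr rfl fun i _ => Finset.sum_congr rfl fun i' _ => by ring
  simp only [e]
  rw [integral_finsetSum _ fun i _ => integrable_finsetSum _ fun i' _ => hinteg i i']
  refine Finset.sum_congr rfl fun i _ => ?_
  rw [integral_finsetSum _ fun i' _ => hinteg i i']
  exact Finset.sum_congr rfl fun i' _ => integral_const_mul _ _

lemma integral_multiSum_mul_eq_zero (hN : IsPoissonRandomMeasure P m N) {L k k' : ℕ}
    (hkk : k ≠ k') {A : Fin L → Set E} (hA : ∀ l, MeasurableSet (A l)) (hm : ∀ l, m (A l) ≠ ∞)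
    (hd : Pairwise fun i j => Disjoint (A i) (A j)) {c : (Fin k → Fin L) → ℝ}
    (hc : ∀ i, ¬ Function.Injective i → c i = 0) {c' : (Fin k' → Fin L) → ℝ}
    (hc' : ∀ i, ¬ Function.Injective i → c' i = 0) :
    ∫ ω, (multiSum c fun _ l => compensated m N (A l) ω) *
      (multiSum c' fun _ l => compensated m N (A l) ω) ∂P = 0 := by
  classical
  rw [hN.integral_multiSum_mul hA hm hd hc hc']
  refine Finset.sum_eq_zero fun i _ => Finset.sum_eq_zero fun i' _ => ?_
  by_cases hi : Function.Injective i
  · by_cases hi' : Function.Injective i'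
    · rw [hN.integral_cellProd_mul_cellProd hA hm hd hi hi', if_neg, mul_zero]
      intro h
      have h1 := Set.ncard_range_of_injective hi
      have h2 := Set.ncard_range_of_injective hi'
      rw [h] at h1
      simp at h1 h2
      omega
    · simp [hc' i' hi']
  · simp [hc i hi]

/-- The isometry for kernels that need not be symmetric; for symmetric ones all permutations
contribute equally and the factor k! appears. -/
lemma integral_multiSum_mul_eq_sum_perm [SigmaFinite m] (hN : IsPoissonRandomMeasure P m N)
    {L k : ℕ} {A : Fin L → Set E} (hA : ∀ l, MeasurableSet (A l)) (hm : ∀ l, m (A l) ≠ ∞)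
    (hd : Pairwise fun i j => Disjoint (A i) (A j)) {c : (Fin k → Fin L) → ℝ}
    (hc : ∀ i, ¬ Function.Injective i → c i = 0) {c' : (Fin k → Fin L) → ℝ}
    (hc' : ∀ i, ¬ Function.Injective i → c' i = 0) :
    ∫ ω, (multiSum c fun _ l => compensated m N (A l) ω) *
      (multiSum c' fun _ l => compensated m N (A l) ω) ∂P =
    ∑ σ : Equiv.Perm (Fin k), ∫ ξ, (multiSum c fun j l => (A l).indicator (fun _ => (1 : ℝ)) (ξ j)) *
      (multiSum c' fun j l => (A l).indicator (fun _ => (1 : ℝ)) ((ξ ∘ σ) j))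
        ∂(Measure.pi fun _ : Fin k => m) := by
  classical
  have e : ∀ (σ : Equiv.Perm (Fin k)) (ξ : Fin k → E),
      (multiSum c fun j l => (A l).indicator (fun _ => (1 : ℝ)) (ξ j)) *
      (multiSum c' fun j l => (A l).indicator (fun _ => (1 : ℝ)) ((ξ ∘ σ) j)) =
      ∑ i, ∑ i', c i * c' i' * (cellInd A i ξ * cellInd A i' (ξ ∘ σ)) := by
    intro σ ξ
    simp only [multiSum, Finset.sum_mul_sum, cellInd]
    exact Finset.sum_congr rfl fun i _ => Finset.sum_congr rfl fun i' _ => by ring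
  have hinteg : ∀ (σ : Equiv.Perm (Fin k)) i i', Integrable (fun ξ => c i * c' i' *
      (cellInd A i ξ * cellInd A i' (ξ ∘ σ))) (Measure.pi fun _ : Fin k => m) := by
    intro σ i i'
    exact ((memLp_cellInd hA hm i).integrable_mul
      ((memLp_cellInd hA hm i').comp_measurePreserving (measurePreserving_comp_perm m σ))).const_mul _
  have h2 : ∀ σ : Equiv.Perm (Fin k), ∫ ξ,
      (multiSum c fun j l => (A l).indicator (fun _ => (1 : ℝ)) (ξ j)) *
      (multiSum c' fun j l => (A l).indicator (fun _ => (1 : ℝ)) ((ξ ∘ σ) j))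
        ∂(Measure.pi fun _ : Fin k => m) =
      ∑ i, ∑ i', c i * c' i' * if i = i' ∘ ⇑σ⁻¹ then ∏ j, (m (A (i j))).toReal else 0 := by
    intro σ
    simp only [e]
    rw [integral_finsetSum _ fun i _ => integrable_finsetSum _ fun i' _ => hinteg σ i i']
    refine Finset.sum_congr rfl fun i _ => ?_
    rw [integral_finsetSum _ fun i' _ => hinteg σ i i']
    refine Finset.sum_congr rfl fun i' _ => ?_
    rw [integral_const_mul, integral_cellInd_mul_cellInd_perm hA hd]
  simp only [h2]
  rw [hN.integral_multiSum_mul hA hm hd hc hc', Finset.sum_comm]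
  conv_rhs => rw [Finset.sum_comm]
  rw [Finset.sum_comm]
  refine Finset.sum_congr rfl fun i _ => ?_
  rw [Finset.sum_comm]
  refine Finset.sum_congr rfl fun i' _ => ?_
  rw [← Finset.mul_sum]
  by_cases hi : Function.Injective i
  · by_cases hi' : Function.Injective i'
    · rw [hN.integral_cellProd_mul_cellProd hA hm hd hi hi', sum_perm_ite_eq hi hi']
    · simp [hc' i' hi']
  · simp [hc i hi]

/-- Two simple kernels and their multiple integrals, on a common partition. -/
lemma exists_common_partition (hN : IsPoissonRandomMeasure P m N) {k k' : ℕ}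
    (s : SimpleKernel m k) (s' : SimpleKernel m k') :
    ∃ (L : ℕ) (A : Fin L → Set E) (c : (Fin k → Fin L) → ℝ) (c' : (Fin k' → Fin L) → ℝ),
      (∀ l, MeasurableSet (A l)) ∧ (∀ l, m (A l) ≠ ∞) ∧
      Pairwise (fun i j => Disjoint (A i) (A j)) ∧
      (∀ i, ¬ Function.Injective i → c i = 0) ∧ (∀ i, ¬ Function.Injective i → c' i = 0) ∧
      (∀ ξ, s.toFun ξ = multiSum c fun j l => (A l).indicator (fun _ => (1 : ℝ)) (ξ j)) ∧
      (∀ ξ, s'.toFun ξ = multiSum c' fun j l => (A l).indicator (fun _ => (1 : ℝ)) (ξ j)) ∧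
      (∀ᵐ ω ∂P, s.integral N ω = multiSum c fun _ l => compensated m N (A l) ω) ∧
      (∀ᵐ ω ∂P, s'.integral N ω = multiSum c' fun _ l => compensated m N (A l) ω) := by
  obtain ⟨L, A, q, q', hA, hm, hd, hF, hF'⟩ := s.exists_common_refinement s'
  have hall : ∀ᵐ ω ∂P, ∀ l, N ω (A l) < ∞ := by
    rw [ae_all_iff]
    exact fun l => hN.ae_lt_top (hA l) (hm l)
  refine ⟨L, A, refineCoeff s.coeff q, refineCoeff s'.coeff q', hA, hm, hd,
    refineCoeff_eq_zero s.diagonal q, refineCoeff_eq_zero s'.diagonal q', fun ξ => ?_, fun ξ => ?_,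
    ?_, ?_⟩
  · rw [multiSum_refineCoeff]
    simp only [← indicator_eq_sum_of_refinement hd (hF _)]
    rfl
  · rw [multiSum_refineCoeff]
    simp only [← indicator_eq_sum_of_refinement hd (hF' _)]
    rfl
  · filter_upwards [hall] with ω hω
    rw [multiSum_refineCoeff]
    simp only [← compensated_eq_sum_of_refinement hA hm hd (hF _) hω]
    rfl
  · filter_upwards [hall] with ω hω
    rw [multiSum_refineCoeff]
    simp only [← compensated_eq_sum_of_refinement hA hm hd (hF' _) hω]
    rfl

lemma memLp_simpleIntegral (hN : IsPoissonRandomMeasure P m N) {k : ℕ} (s : SimpleKernel m k) :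
    MemLp (s.integral N) 2 P :=
  hN.memLp_multiSum s.measurable s.finite s.disjoint s.diagonal

lemma _root_.SimpleKernel.memLp_toFun [SigmaFinite m] {k : ℕ} (s : SimpleKernel m k) :
    MemLp s.toFun 2 (Measure.pi fun _ : Fin k => m) :=
  memLp_finsetSum (f := fun i ξ => s.coeff i * cellInd s.F i ξ) _ fun i _ =>
    (memLp_cellInd s.measurable s.finite i).const_mul _

lemma exists_linearCombination (hN : IsPoissonRandomMeasure P m N) {k : ℕ} (a b : ℝ)
    (s s' : SimpleKernel m k) : ∃ t : SimpleKernel m k,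
      (∀ ξ, t.toFun ξ = a * s.toFun ξ + b * s'.toFun ξ) ∧
      t.integral N =ᵐ[P] fun ω => a * s.integral N ω + b * s'.integral N ω := by
  obtain ⟨L, A, c, c', hA, hm, hd, hc, hc', hs, hs', hI, hI'⟩ := hN.exists_common_partition s s'
  have hadd : ∀ d : Fin k → Fin L → ℝ, multiSum (fun i => a * c i + b * c' i) d =
      a * multiSum c d + b * multiSum c' d := by
    intro d
    simp only [multiSum, Finset.mul_sum, ← Finset.sum_add_distrib]
    exact Finset.sum_congr rfl fun i _ => by ring
  refine ⟨⟨L, A, fun i => a * c i + b * c' i, hA, hm, hd, fun i hi => by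
    simp [hc i hi, hc' i hi]⟩, fun ξ => ?_, ?_⟩
  · rw [hs, hs', ← hadd]; rfl
  · filter_upwards [hI, hI'] with ω h1 h2
    rw [h1, h2, ← hadd]; rfl

lemma integral_simpleIntegral_mul [SigmaFinite m] (hN : IsPoissonRandomMeasure P m N) {k : ℕ}
    (s s' : SimpleKernel m k) :
    ∫ ω, s.integral N ω * s'.integral N ω ∂P = ∑ σ : Equiv.Perm (Fin k),
      ∫ ξ, s.toFun ξ * s'.toFun (ξ ∘ σ) ∂(Measure.pi fun _ : Fin k => m) := by
  obtain ⟨L, A, c, c', hA, hm, hd, hc, hc', hs, hs', hI, hI'⟩ := hN.exists_common_partition s s'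
  simp only [hs, hs']
  rw [← hN.integral_multiSum_mul_eq_sum_perm hA hm hd hc hc']
  refine integral_congr_ae ?_
  filter_upwards [hI, hI'] with ω h1 h2
  rw [h1, h2]

lemma integral_simpleIntegral_mul_eq_zero (hN : IsPoissonRandomMeasure P m N) {k k' : ℕ}
    (hkk : k ≠ k') (s : SimpleKernel m k) (s' : SimpleKernel m k') :
    ∫ ω, s.integral N ω * s'.integral N ω ∂P = 0 := by
  obtain ⟨L, A, c, c', hA, hm, hd, hc, hc', hs, hs', hI, hI'⟩ := hN.exists_common_partition s s'
  rw [← hN.integral_multiSum_mul_eq_zero hkk hA hm hd hc hc']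
  refine integral_congr_ae ?_
  filter_upwards [hI, hI'] with ω h1 h2
  rw [h1, h2]

/-- Each of the k! terms of the isometry is at most the squared norm, by Cauchy–Schwarz and since
permuting coordinates preserves the product measure. -/
lemma eLpNorm_simpleIntegral_le [SigmaFinite m] (hN : IsPoissonRandomMeasure P m N) {k : ℕ}
    (s : SimpleKernel m k) : eLpNorm (s.integral N) 2 P ≤
      ENNReal.ofReal √(k ! : ℝ) * eLpNorm s.toFun 2 (Measure.pi fun _ : Fin k => m) := by
  set a := (eLpNorm s.toFun 2 (Measure.pi fun _ : Fin k => m)).toReal with ha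
  have h1 : ∫ ω, s.integral N ω * s.integral N ω ∂P ≤ k ! * (a * a) := by
    rw [hN.integral_simpleIntegral_mul s s]
    have : ∀ σ : Equiv.Perm (Fin k), ∫ ξ, s.toFun ξ * s.toFun (ξ ∘ σ)
        ∂(Measure.pi fun _ : Fin k => m) ≤ a * a := by
      intro σ
      have hp := measurePreserving_comp_perm m σ
      refine (le_abs_self _).trans ((abs_integral_mul_le_of_memLp_two s.memLp_toFun
        (s.memLp_toFun.comp_measurePreserving hp)).trans ?_)
      rw [eLpNorm_comp_measurePreserving s.memLp_toFun.1 hp]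
    refine (Finset.sum_le_sum fun σ _ => this σ).trans ?_
    simp [Fintype.card_perm]
  rw [← ENNReal.pow_le_pow_left_iff (n := 2) (by norm_num), mul_pow,
    sq_eLpNorm_two_eq_ofReal_integral (hN.memLp_simpleIntegral s),
    ← ENNReal.ofReal_toReal s.memLp_toFun.2.ne, ← ha, ← ENNReal.ofReal_pow (by positivity),
    ← ENNReal.ofReal_pow (by positivity), ← ENNReal.ofReal_mul (by positivity)]
  refine ENNReal.ofReal_le_ofReal (h1.trans ?_)
  rw [Real.sq_sqrt (by positivity), sq]

end IsPoissonRandomMeasure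

end

end

/-! ### Density of simple kernels off the diagonals and existence of multiple integrals. -/

noncomputable section

section

variable {Ω E : Type*} [MeasurableSpace Ω] [MeasurableSpace E] {P : Measure Ω}
  {m : Measure E} {N : Ω → Measure E}

/-! ### Density of simple kernels -/

/-- Nonatomicity of m enters through a real function τ with null level sets; for the noise it will
be the time coordinate. It makes the diagonals null, so kernels vanishing there lose nothing. -/
lemma ae_injective_comp [SigmaFinite m] {τ : E → ℝ} (hτm : Measurable τ)
    (hτ : ∀ c, m {x | τ x = c} = 0) (n : ℕ) :
    ∀ᵐ ξ ∂(Measure.pi fun _ : Fin n => m), Function.Injective (τ ∘ ξ) := by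
  have key : ∀ i j : Fin n, i ≠ j →
      ∀ᵐ ξ ∂(Measure.pi fun _ : Fin n => m), τ (ξ i) ≠ τ (ξ j) := by
    intro i j hij
    cases n with
    | zero => exact i.elim0
    | succ n =>
      obtain ⟨j', rfl⟩ := Fin.exists_succAbove_eq hij.symm
      have hmp := measurePreserving_piFinSuccAbove (fun _ : Fin (n + 1) => m) i
      let s : Set (E × (Fin n → E)) := {p | τ p.1 = τ (p.2 j')}
      have hs : MeasurableSet s := measurableSet_eq_fun (by fun_prop) (by fun_prop)
      have h0 : (m.prod (Measure.pi fun _ : Fin n => m)) s = 0 := by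
        rw [Measure.measure_prod_null hs]
        refine ae_of_all _ fun x => ?_
        have : Prod.mk x ⁻¹' s = Function.eval j' ⁻¹' {y | τ y = τ x} := by
          ext η; simp [s, eq_comm]
        change (Measure.pi fun _ : Fin n => m) (Prod.mk x ⁻¹' s) = 0
        rw [this]
        exact Measure.pi_eval_preimage_null _ (hτ _)
      have h1 := hmp.measure_preimage hs.nullMeasurableSet
      rw [h0] at h1
      rw [ae_iff]
      convert h1 using 2
      ext ξ
      simp [s, MeasurableEquiv.piFinSuccAbove, Fin.insertNthEquiv, Fin.removeNth]
  have h2 : ∀ᵐ ξ ∂(Measure.pi fun _ : Fin n => m), ∀ i j : Fin n, i ≠ j → τ (ξ i) ≠ τ (ξ j) := by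
    simp only [ae_all_iff]
    exact key
  filter_upwards [h2] with ξ hξ i j hij
  by_contra h
  exact hξ i j h hij

/-- A grid finer than the smallest gap separates finitely many distinct numbers. -/
lemma exists_floor_injective {n : ℕ} {a : Fin n → ℝ} (ha : Function.Injective a) :
    ∃ M : ℕ, Function.Injective fun i => ⌊((M : ℝ) + 1) * a i⌋ := by
  have h1 : ∀ p : Fin n × Fin n, ∀ᶠ M : ℕ in atTop, p.1 ≠ p.2 →
      1 ≤ ((M : ℝ) + 1) * |a p.1 - a p.2| := by
    intro p
    by_cases hp : p.1 = p.2
    · exact Eventually.of_forall fun M h => absurd hp h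
    · have hpos : 0 < |a p.1 - a p.2| := abs_pos.2 (sub_ne_zero.2 fun h => hp (ha h))
      obtain ⟨M₀, hM₀⟩ := exists_nat_ge (1 / |a p.1 - a p.2|)
      filter_upwards [eventually_ge_atTop M₀] with M hM _
      rw [div_le_iff₀ hpos] at hM₀
      have : (M₀ : ℝ) ≤ M := by exact_mod_cast hM
      nlinarith
  obtain ⟨M, hM⟩ := (eventually_all.2 h1).exists
  refine ⟨M, fun i j hij => ?_⟩
  by_contra h
  have h2 := Int.abs_sub_lt_one_of_floor_eq_floor hij
  have h3 := hM (i, j) h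
  rw [← mul_sub, abs_mul, abs_of_pos (by positivity)] at h2
  linarith

/-- A square integrable kernel that integrates to zero over all products of pairwise disjoint
sets vanishes almost everywhere. -/
lemma ae_eq_zero_of_forall_setIntegral_offDiagonal [SigmaFinite m] {τ : E → ℝ}
    (hτm : Measurable τ) (hτ : ∀ c, m {x | τ x = c} = 0) {n : ℕ} {f : (Fin n → E) → ℝ}
    (hf : MemLp f 2 (Measure.pi fun _ : Fin n => m))
    (h0 : ∀ A : Fin n → Set E, (∀ i, MeasurableSet (A i)) → (∀ i, m (A i) ≠ ∞) →
      Pairwise (fun i j => Disjoint (A i) (A j)) →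
      ∫ ξ in univ.pi A, f ξ ∂(Measure.pi fun _ : Fin n => m) = 0) :
    f =ᵐ[Measure.pi fun _ : Fin n => m] 0 := by
  let μ := Measure.pi fun _ : Fin n => m
  -- An index consists of a mesh, distinct grid slots of τ for the n coordinates, and a set of
  -- finite measure. The countably many boxes cover all points whose coordinates have distinct
  -- values of τ.
  let I := ℕ × {q : Fin n → ℤ // Function.Injective q} × ℕ
  let C : I → Fin n → Set E := fun a i =>
    spanningSets m a.2.2 ∩ {x | ⌊((a.1 : ℝ) + 1) * τ x⌋ = a.2.1.1 i}
  have hC : ∀ a i, MeasurableSet (C a i) := fun a i =>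
    (measurableSet_spanningSets m _).inter
      ((Int.measurable_floor.comp (hτm.const_mul _)) (measurableSet_singleton _))
  have hCf : ∀ a i, m (C a i) ≠ ∞ := fun a i =>
    ((measure_mono inter_subset_left).trans_lt (measure_spanningSets_lt_top m _)).ne
  have hCd : ∀ a, Pairwise fun i j => Disjoint (C a i) (C a j) := by
    intro a i j hij
    rw [Set.disjoint_left]
    rintro x ⟨-, h1⟩ ⟨-, h2⟩
    exact hij (a.2.1.2 (h1.symm.trans h2))
  have hD : ∀ a, f =ᵐ[μ.restrict (univ.pi (C a))] 0 := by
    intro a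
    have hfin : μ (univ.pi (C a)) ≠ ∞ := by
      rw [Measure.pi_pi]
      exact (ENNReal.prod_lt_top fun i _ => (hCf a i).lt_top).ne
    have hfm : IsFiniteMeasure (μ.restrict (univ.pi (C a))) := ⟨by simpa using hfin.lt_top⟩
    have hinteg : Integrable f (μ.restrict (univ.pi (C a))) :=
      (hf.restrict _).integrable (by norm_num)
    have hDm : MeasurableSet (univ.pi (C a)) := MeasurableSet.univ_pi (hC a)
    have hrect : ∀ B : Fin n → Set E, (∀ i, MeasurableSet (B i)) →
        ∫ ξ in univ.pi B, f ξ ∂(μ.restrict (univ.pi (C a))) = 0 := by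
      intro B hB
      rw [Measure.restrict_restrict (MeasurableSet.univ_pi hB), ← pi_inter_distrib]
      refine h0 _ (fun i => (hB i).inter (hC a i)) (fun i => ?_) fun i j hij => ?_
      · exact ne_top_of_le_ne_top (hCf a i) (measure_mono inter_subset_right)
      · exact (hCd a hij).mono inter_subset_right inter_subset_right
    have htot : ∫ ξ, f ξ ∂(μ.restrict (univ.pi (C a))) = 0 := by
      have := hrect (fun _ => univ) fun _ => MeasurableSet.univ
      rwa [pi_univ, Measure.restrict_univ] at this
    -- Inside one box the sides are disjoint, so all subrectangles are admissible for the
    -- hypothesis, and rectangles form a generating π-system.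
    refine hinteg.ae_eq_zero_of_forall_setIntegral_eq_zero fun s hs _ => ?_
    refine MeasurableSpace.induction_on_inter
      (C := fun s _ => ∫ ξ in s, f ξ ∂(μ.restrict (univ.pi (C a))) = 0)
      generateFrom_pi.symm isPiSystem_pi (by simp) ?_ ?_ ?_ s hs
    · rintro t ⟨B, hB, rfl⟩
      exact hrect B fun i => hB i (mem_univ i)
    · intro t htm ih
      have := integral_add_compl htm hinteg
      rwa [ih, htot, zero_add] at this
    · intro g hgd hgm ih
      rw [integral_iUnion hgm hgd hinteg.integrableOn]
      simp [ih]
  have hcov : ∀ᵐ ξ ∂μ, ξ ∈ ⋃ a, univ.pi (C a) := by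
    filter_upwards [ae_injective_comp hτm hτ n] with ξ hξ
    obtain ⟨M, hM⟩ := exists_floor_injective hξ
    have hk : ∃ k, ∀ i, ξ i ∈ spanningSets m k := by
      have : ∀ i, ∃ k, ξ i ∈ spanningSets m k := fun i => by
        have : ξ i ∈ ⋃ k, spanningSets m k := by rw [iUnion_spanningSets]; trivial
        exact mem_iUnion.1 this
      choose k hk using this
      exact ⟨Finset.univ.sup k, fun i =>
        monotone_spanningSets m (Finset.le_sup (Finset.mem_univ i)) (hk i)⟩
    obtain ⟨k, hk⟩ := hk
    exact mem_iUnion.2 ⟨(M, ⟨_, hM⟩, k), fun i _ => ⟨hk i, rfl⟩⟩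
  have h3 := (ae_restrict_iUnion_iff (μ := μ) (fun a => univ.pi (C a)) (fun ξ => f ξ = 0)).2 hD
  rw [ae_restrict_iff' (MeasurableSet.iUnion fun a => MeasurableSet.univ_pi (hC a))] at h3
  filter_upwards [hcov, h3] with ξ h1 h2
  exact h2 h1

/-- The simple kernel `1_{A 1 × ⋯ × A n}`. -/
def SimpleKernel.rect {n : ℕ} (A : Fin n → Set E) (hA : ∀ i, MeasurableSet (A i))
    (hm : ∀ i, m (A i) ≠ ∞) (hd : Pairwise fun i j => Disjoint (A i) (A j)) :
    SimpleKernel m n where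
  size := n
  F := A
  coeff := fun i => if i = id then 1 else 0
  measurable := hA
  finite := hm
  disjoint := hd
  diagonal := fun i hi => if_neg (by rintro rfl; exact hi Function.injective_id)

lemma SimpleKernel.rect_toFun {n : ℕ} {A : Fin n → Set E} (hA : ∀ i, MeasurableSet (A i))
    (hm : ∀ i, m (A i) ≠ ∞) (hd : Pairwise fun i j => Disjoint (A i) (A j)) (ξ : Fin n → E) :
    (SimpleKernel.rect A hA hm hd).toFun ξ = (univ.pi A).indicator (fun _ => (1 : ℝ)) ξ := by
  classical
  change ∑ i : Fin n → Fin n, (if i = id then (1 : ℝ) else 0) *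
    ∏ j, (A (i j)).indicator (fun _ => (1 : ℝ)) (ξ j) = _
  rw [Finset.sum_eq_single (id : Fin n → Fin n)]
  · simp only [if_true, one_mul, id]
    by_cases h : ξ ∈ univ.pi A
    · rw [indicator_of_mem h]
      exact Finset.prod_eq_one fun j _ => by simp [h j (mem_univ j)]
    · rw [indicator_of_notMem h]
      simp only [Set.mem_pi, mem_univ, true_implies, not_forall] at h
      obtain ⟨j, hj⟩ := h
      exact Finset.prod_eq_zero (Finset.mem_univ j) (by simp [hj])
  · intro i _ hi
    rw [if_neg hi, zero_mul]
  · simp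

namespace IsPoissonRandomMeasure

variable [IsProbabilityMeasure P]

/-- Simple kernels form a subspace of L²; an element orthogonal to it integrates to zero over all
products of disjoint sets and hence vanishes, so the subspace is dense. -/
lemma exists_simpleKernel_eLpNorm_sub_le [SigmaFinite m] (hN : IsPoissonRandomMeasure P m N)
    {τ : E → ℝ} (hτm : Measurable τ) (hτ : ∀ c, m {x | τ x = c} = 0) {n : ℕ}
    {f : (Fin n → E) → ℝ} (hf : MemLp f 2 (Measure.pi fun _ : Fin n => m)) {ε : ℝ} (hε : 0 < ε) :
    ∃ s : SimpleKernel m n,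
      eLpNorm (s.toFun - f) 2 (Measure.pi fun _ : Fin n => m) ≤ ENNReal.ofReal ε := by
  let μ := Measure.pi fun _ : Fin n => m
  let K : Submodule ℝ (Lp ℝ 2 μ) :=
    { carrier := {g | ∃ s : SimpleKernel m n, g = s.memLp_toFun.toLp s.toFun}
      add_mem' := by
        rintro _ _ ⟨s, rfl⟩ ⟨s', rfl⟩
        obtain ⟨t, ht, -⟩ := hN.exists_linearCombination 1 1 s s'
        refine ⟨t, ?_⟩
        rw [← MemLp.toLp_add]
        congr 1
        ext ξ
        simp [ht]
      zero_mem' := by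
        refine ⟨⟨0, fun i => i.elim0, fun _ => 0, fun i => i.elim0, fun i => i.elim0,
          fun i => i.elim0, fun _ _ => rfl⟩, ?_⟩
        refine ((Lp.eq_zero_iff_ae_eq_zero).2 ((MemLp.coeFn_toLp _).trans
          (ae_of_all _ fun ξ => ?_))).symm
        simp [SimpleKernel.toFun]
      smul_mem' := by
        rintro a _ ⟨s, rfl⟩
        obtain ⟨t, ht, -⟩ := hN.exists_linearCombination a 0 s s
        refine ⟨t, ?_⟩
        rw [← MemLp.toLp_const_smul]
        congr 1
        ext ξ
        simp [ht] }
  have hK : K.topologicalClosure = ⊤ := by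
    rw [Submodule.topologicalClosure_eq_top_iff, Submodule.eq_bot_iff]
    intro h hh
    rw [Submodule.mem_orthogonal] at hh
    have hmem : MemLp (h : (Fin n → E) → ℝ) 2 μ := Lp.memLp h
    have h0 : (h : (Fin n → E) → ℝ) =ᵐ[μ] 0 := by
      refine ae_eq_zero_of_forall_setIntegral_offDiagonal hτm hτ hmem fun A hA hAm hd => ?_
      have := hh _ ⟨SimpleKernel.rect A hA hAm hd, rfl⟩
      rw [L2.inner_def] at this
      rw [← integral_indicator (MeasurableSet.univ_pi hA), ← this]
      refine integral_congr_ae ?_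
      filter_upwards [(SimpleKernel.rect A hA hAm hd).memLp_toFun.coeFn_toLp] with ξ hξ
      rw [hξ, SimpleKernel.rect_toFun]
      by_cases hx : ξ ∈ univ.pi A
      · rw [indicator_of_mem hx, indicator_of_mem hx]; simp
      · rw [indicator_of_notMem hx, indicator_of_notMem hx]; simp
    exact (Lp.eq_zero_iff_ae_eq_zero).2 h0
  have hcl : hf.toLp f ∈ closure (K : Set (Lp ℝ 2 μ)) := by
    rw [← Submodule.topologicalClosure_coe, hK]; trivial
  obtain ⟨_, ⟨s, rfl⟩, hs⟩ := Metric.mem_closure_iff.1 hcl ε hε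
  refine ⟨s, ?_⟩
  rw [dist_comm, dist_eq_norm, ← MemLp.toLp_sub, Lp.norm_toLp] at hs
  rw [← ENNReal.ofReal_toReal (s.memLp_toFun.sub hf).2.ne]
  exact ENNReal.ofReal_le_ofReal hs.le

/-- Existence of the multiple integral of a square integrable kernel. -/
theorem exists_isMultipleIntegral [SigmaFinite m] (hN : IsPoissonRandomMeasure P m N)
    {τ : E → ℝ} (hτm : Measurable τ) (hτ : ∀ c, m {x | τ x = c} = 0) {n : ℕ}
    {f : (Fin n → E) → ℝ} (hf : MemLp f 2 (Measure.pi fun _ : Fin n => m)) :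
    ∃ X, IsMultipleIntegral P m N n f X ∧ eLpNorm X 2 P ≤
      ENNReal.ofReal √(n ! : ℝ) * eLpNorm f 2 (Measure.pi fun _ : Fin n => m) := by
  let μ := Measure.pi fun _ : Fin n => m
  -- Geometric accuracy makes the Cauchy bounds of the integrals summable, as the completeness of L²
  -- is used in that form.
  have hpos : ∀ l : ℕ, (0 : ℝ) < (1 / 2) ^ l := fun l => by positivity
  choose s hs using fun l : ℕ => hN.exists_simpleKernel_eLpNorm_sub_le hτm hτ hf (hpos l)
  have hs0 : Tendsto (fun l => eLpNorm ((s l).toFun - f) 2 μ) atTop (𝓝 0) := by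
    refine tendsto_of_tendsto_of_tendsto_of_le_of_le tendsto_const_nhds ?_ (fun _ => zero_le) hs
    have : Tendsto (fun l : ℕ => ENNReal.ofReal ((1 / 2 : ℝ) ^ l)) atTop (𝓝 (ENNReal.ofReal 0)) :=
      ENNReal.tendsto_ofReal (tendsto_pow_atTop_nhds_zero_of_lt_one (by norm_num) (by norm_num))
    simpa using this
  let c : ℝ := √(n ! : ℝ)
  have hc : 0 < c := Real.sqrt_pos.2 (by positivity)
  have hdiff : ∀ l l', eLpNorm ((s l).integral N - (s l').integral N) 2 P ≤
      ENNReal.ofReal c * (eLpNorm ((s l).toFun - f) 2 μ + eLpNorm ((s l').toFun - f) 2 μ) := by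
    intro l l'
    obtain ⟨t, ht, htI⟩ := hN.exists_linearCombination 1 (-1) (s l) (s l')
    have e1 : (s l).integral N - (s l').integral N =ᵐ[P] t.integral N := by
      filter_upwards [htI] with ω hω
      rw [hω, Pi.sub_apply]; ring
    rw [eLpNorm_congr_ae e1]
    refine (hN.eLpNorm_simpleIntegral_le t).trans (mul_le_mul_right ?_ _)
    have e2 : t.toFun = ((s l).toFun - f) - ((s l').toFun - f) := by
      ext ξ; simp [ht]; ring
    rw [e2]
    exact eLpNorm_sub_le ((s l).memLp_toFun.sub hf).1 ((s l').memLp_toFun.sub hf).1 (by norm_num)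
  let B : ℕ → ℝ≥0∞ := fun l => ENNReal.ofReal (3 * c * (1 / 2) ^ l)
  have hB : ∑' l, B l ≠ ∞ := by
    have hsum : Summable fun l : ℕ => 3 * c * (1 / 2 : ℝ) ^ l :=
      (summable_geometric_of_lt_one (by norm_num) (by norm_num)).mul_left _
    rw [← ENNReal.ofReal_tsum_of_nonneg (fun l => by positivity) hsum]
    exact ENNReal.ofReal_ne_top
  have hcau : ∀ L l l', L ≤ l → L ≤ l' →
      eLpNorm ((s l).integral N - (s l').integral N) 2 P < B L := by
    intro L l l' hl hl'
    have hle : ∀ j, L ≤ j → eLpNorm ((s j).toFun - f) 2 μ ≤ ENNReal.ofReal ((1 / 2) ^ L) :=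
      fun j hj => (hs j).trans (ENNReal.ofReal_le_ofReal
        (pow_le_pow_of_le_one (by norm_num) (by norm_num) hj))
    calc eLpNorm ((s l).integral N - (s l').integral N) 2 P
        ≤ ENNReal.ofReal c * (ENNReal.ofReal ((1 / 2) ^ L) + ENNReal.ofReal ((1 / 2) ^ L)) :=
          (hdiff l l').trans (mul_le_mul_right (add_le_add (hle l hl) (hle l' hl')) _)
      _ = ENNReal.ofReal (2 * c * (1 / 2) ^ L) := by
          rw [← ENNReal.ofReal_add (by positivity) (by positivity),
            ← ENNReal.ofReal_mul hc.le]
          congr 1; ring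
      _ < B L := by
          rw [ENNReal.ofReal_lt_ofReal_iff (by positivity)]
          have : 0 < c * (1 / 2) ^ L := by positivity
          linarith
  obtain ⟨X, hX, hXlim⟩ := Lp.cauchy_complete_eLpNorm (by norm_num)
    (fun l => hN.memLp_simpleIntegral (s l)) hB hcau
  refine ⟨X, ⟨hf, hX, s, hs0, hXlim⟩, ?_⟩
  have hb : ∀ l, eLpNorm X 2 P ≤ eLpNorm ((s l).integral N - X) 2 P +
      ENNReal.ofReal c * (eLpNorm ((s l).toFun - f) 2 μ + eLpNorm f 2 μ) := by
    intro l
    have e1 : X = (s l).integral N - ((s l).integral N - X) := by simp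
    have h1 : eLpNorm X 2 P ≤ eLpNorm ((s l).integral N) 2 P +
        eLpNorm ((s l).integral N - X) 2 P := by
      conv_lhs => rw [e1]
      exact eLpNorm_sub_le (hN.memLp_simpleIntegral _).1 ((hN.memLp_simpleIntegral _).sub hX).1
        (by norm_num)
    have e2 : (s l).toFun = ((s l).toFun - f) + f := by simp
    have h2 : eLpNorm (s l).toFun 2 μ ≤ eLpNorm ((s l).toFun - f) 2 μ + eLpNorm f 2 μ := by
      conv_lhs => rw [e2]
      exact eLpNorm_add_le ((s l).memLp_toFun.sub hf).1 hf.1 (by norm_num)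
    rw [add_comm]
    exact h1.trans (add_le_add_left
      ((hN.eLpNorm_simpleIntegral_le _).trans (mul_le_mul_right h2 _)) _)
  have hlim : Tendsto (fun l => eLpNorm ((s l).integral N - X) 2 P +
      ENNReal.ofReal c * (eLpNorm ((s l).toFun - f) 2 μ + eLpNorm f 2 μ)) atTop
      (𝓝 (0 + ENNReal.ofReal c * (0 + eLpNorm f 2 μ))) :=
    hXlim.add (ENNReal.Tendsto.const_mul (hs0.add_const _) (Or.inr ENNReal.ofReal_ne_top))
  rw [zero_add, zero_add] at hlim
  exact ge_of_tendsto' hlim hb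

end IsPoissonRandomMeasure

end

end

/-! ### Chaos expansions tested against exponential functionals. -/

noncomputable section

/-! ### Almost sure measurability with respect to a sub-σ-algebra -/

lemma aestronglyMeasurable_of_tendsto_eLpNorm_two {α : Type*} {m₀ mα : MeasurableSpace α}
    {μ : Measure α} (hm : m₀ ≤ mα) {f : ℕ → α → ℝ} {g : α → ℝ} (hf : ∀ i, MemLp (f i) 2 μ)
    (hg : MemLp g 2 μ) (hfm : ∀ i, AEStronglyMeasurable[m₀] (f i) μ)
    (hlim : Tendsto (fun i => eLpNorm (f i - g) 2 μ) atTop (𝓝 0)) :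
    AEStronglyMeasurable[m₀] g μ := by
  have h1 := (Lp.tendsto_Lp_iff_tendsto_eLpNorm'' f hf g hg).2 hlim
  have h2 := (isClosed_aestronglyMeasurable (F := ℝ) (p := 2) (μ := μ) hm).mem_of_tendsto h1
    (Eventually.of_forall fun i => (hfm i).congr (hf i).coeFn_toLp.symm)
  exact AEStronglyMeasurable.congr h2 hg.coeFn_toLp

lemma aestronglyMeasurable_of_tendsto_ae_of_le {α : Type*} {m₀ mα : MeasurableSpace α}
    {μ : Measure α} {f : ℕ → α → ℝ} {g : α → ℝ}
    (hfm : ∀ i, AEStronglyMeasurable[m₀] (f i) μ)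
    (hlim : ∀ᵐ x ∂μ, Tendsto (fun i => f i x) atTop (𝓝 (g x))) :
    AEStronglyMeasurable[m₀] g μ := by
  choose k hk hfk using hfm
  refine ⟨fun x => limUnder atTop fun i => k i x,
    @StronglyMeasurable.limUnder _ _ _ m₀ _ _ _ _ _ ⟨0⟩ _ hk, ?_⟩
  filter_upwards [hlim, ae_all_iff.2 hfk] with x hx hx'
  simp only [← hx']
  exact hx.limUnder_eq.symm

/-- A function that is measurable for the completion of `m₀` by null sets has an
`m₀`-measurable version. -/
lemma aestronglyMeasurable_of_measurable_eventually {α : Type*} {m₀ mα : MeasurableSpace α}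
    {μ : Measure α} {f : α → ℝ} (hf : Measurable[eventuallyMeasurableSpace m₀ (ae μ)] f) :
    AEStronglyMeasurable[m₀] f μ := by
  have hs : StronglyMeasurable[eventuallyMeasurableSpace m₀ (ae μ)] f :=
    Measurable.stronglyMeasurable hf
  obtain ⟨F, hF⟩ := hs
  refine aestronglyMeasurable_of_tendsto_ae_of_le (f := fun i => F i) (fun i => ?_)
    (Eventually.of_forall hF)
  refine @SimpleFunc.induction α ℝ (eventuallyMeasurableSpace m₀ (ae μ)) _
    (fun F => AEStronglyMeasurable[m₀] F μ) ?_ ?_ (F i)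
  · rintro c s ⟨t, ht, hst⟩
    refine ⟨t.indicator fun _ => c, StronglyMeasurable.indicator stronglyMeasurable_const ht, ?_⟩
    have h2 := indicator_ae_eq_of_ae_eq_set (f := fun _ : α => c) hst
    refine EventuallyEq.trans (Eventually.of_forall fun x => ?_) h2
    change @ite _ (x ∈ s) (Classical.propDecidable _) c 0 = _
    by_cases hx : x ∈ s <;> simp [hx]
  · intro f g _ hf hg
    exact AEStronglyMeasurable.add hf hg

/-! ### Duality with exponential functionals -/

lemma integrable_mul_of_memLp_two {α : Type*} [MeasurableSpace α] {μ : Measure α} {f g : α → ℝ}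
    (hf : MemLp f 2 μ) (hg : MemLp g 2 μ) : Integrable (fun x => f x * g x) μ :=
  hf.integrable_mul hg

section

variable {Ω E : Type*} [MeasurableSpace Ω] [MeasurableSpace E] {P : Measure Ω}
  {m : Measure E} {N : Ω → Measure E}

/-- A sequence of sets of finite measure that exhausts the space. -/
structure IsExhaustion (m : Measure E) (S : ℕ → Set E) : Prop where
  measurableSet : ∀ k, MeasurableSet (S k)
  monotone : Monotone S
  iUnion : ⋃ k, S k = univ
  ne_top : ∀ k, m (S k) ≠ ∞

/-- The tensor power of `expGap h`. -/
def tensorGap (h : E → ℝ≥0) (n : ℕ) (ξ : Fin n → E) : ℝ := ∏ j, expGap h (ξ j)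

lemma integrable_expGap {h : E → ℝ≥0} (hh : IsTestFun m h) : Integrable (expGap h) m := by
  have hs : MeasurableSet (Function.support h) := measurableSet_support hh.measurable
  refine Integrable.mono' (g := (Function.support h).indicator fun _ => (1 : ℝ)) ?_
    (measurable_expGap hh.measurable).aestronglyMeasurable
    (Eventually.of_forall fun x => abs_expGap_le h x)
  rw [integrable_indicator_iff hs]
  exact integrableOn_const hh.support_ne_top

lemma memLp_expGap {h : E → ℝ≥0} (hh : IsTestFun m h) : MemLp (expGap h) 2 m := by
  rw [memLp_two_iff_integrable_sq (measurable_expGap hh.measurable).aestronglyMeasurable]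
  refine (integrable_expGap hh).mono ((measurable_expGap hh.measurable).pow_const 2).aestronglyMeasurable
    (Eventually.of_forall fun x => ?_)
  rw [norm_pow, sq]
  exact mul_le_of_le_one_left (norm_nonneg _) (abs_expGap_le_one h x)

lemma memLp_tensorGap [SigmaFinite m] {h : E → ℝ≥0} (hh : IsTestFun m h) (n : ℕ) :
    MemLp (tensorGap h n) 2 (Measure.pi fun _ : Fin n => m) := by
  have hm : Measurable (tensorGap h n) := by
    unfold tensorGap
    exact Finset.measurable_prod _ fun j _ =>
      (measurable_expGap hh.measurable).comp (measurable_pi_apply j)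
  rw [memLp_two_iff_integrable_sq hm.aestronglyMeasurable]
  have h1 := Integrable.fintype_prod (μ := fun _ : Fin n => m) (f := fun _ x => expGap h x ^ 2)
    fun _ => (memLp_two_iff_integrable_sq
      (measurable_expGap hh.measurable).aestronglyMeasurable).1 (memLp_expGap hh)
  refine h1.congr (Eventually.of_forall fun ξ => ?_)
  simp [tensorGap, Finset.prod_pow]

lemma tensorGap_comp_perm (h : E → ℝ≥0) {n : ℕ} (ξ : Fin n → E) (σ : Equiv.Perm (Fin n)) :
    tensorGap h n (ξ ∘ σ) = tensorGap h n ξ := by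
  unfold tensorGap
  exact Equiv.prod_comp σ fun j => expGap h (ξ j)

namespace IsPoissonRandomMeasure

variable [IsProbabilityMeasure P]

lemma integral_prod_compensated_mul_normExp (hN : IsPoissonRandomMeasure P m N) {h : E → ℝ≥0}
    (hh : IsTestFun m h) {L : ℕ} {A : Fin L → Set E} (hA : ∀ l, MeasurableSet (A l))
    (hm : ∀ l, m (A l) ≠ ∞) (hd : Pairwise fun i j => Disjoint (A i) (A j))
    (S : Finset (Fin L)) :
    ∫ ω, (∏ l ∈ S, compensated m N (A l) ω) * normExp P N h ω ∂P =
      ∏ l ∈ S, ∫ x in A l, expGap h x ∂m := by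
  classical
  induction S using Finset.induction_on with
  | empty => simp [hN.integral_normExp hh.measurable]
  | insert a S ha ih =>
    simp only [Finset.prod_insert ha]
    rw [hN.integral_mul_mul_normExp hh (hA a) (X := compensated m N (A a))
      (Y := fun ω => ∏ l ∈ S, compensated m N (A l) ω), ih,
      hN.integral_compensated_mul_normExp hh (hA a) (hm a)]
    · exact (measurable_restrictSigma_compensated N (hA a)
        subset_rfl).stronglyMeasurable.aestronglyMeasurable
    · have : Measurable[restrictSigma N (A a)ᶜ] fun ω => ∏ l ∈ S, compensated m N (A l) ω := by
        refine Finset.measurable_prod _ fun l hl => ?_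
        refine measurable_restrictSigma_compensated N (hA l) ?_
        exact (hd (fun h => ha (h ▸ hl) : l ≠ a)).subset_compl_right
      exact this.stronglyMeasurable.aestronglyMeasurable

lemma integral_simpleIntegral_mul_normExp [SigmaFinite m] (hN : IsPoissonRandomMeasure P m N)
    {h : E → ℝ≥0} (hh : IsTestFun m h) {k : ℕ} (s : SimpleKernel m k) :
    ∫ ω, s.integral N ω * normExp P N h ω ∂P =
      ∫ ξ, s.toFun ξ * tensorGap h k ξ ∂(Measure.pi fun _ : Fin k => m) := by
  have hL : ∫ ω, s.integral N ω * normExp P N h ω ∂P =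
      ∑ i, s.coeff i * ∏ j, ∫ x in s.F (i j), expGap h x ∂m := by
    have e : ∀ ω, s.integral N ω * normExp P N h ω =
        ∑ i, s.coeff i * (cellProd m N s.F i ω * normExp P N h ω) := by
      intro ω
      simp only [SimpleKernel.integral, cellProd, Finset.sum_mul, mul_assoc]
    simp only [e]
    rw [integral_finsetSum]
    · refine Finset.sum_congr rfl fun i _ => ?_
      rw [integral_const_mul]
      by_cases hi : Function.Injective i
      · have e2 := hN.integral_prod_compensated_mul_normExp hh s.measurable s.finite s.disjoint
          (Finset.univ.map ⟨i, hi⟩)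
        simp only [Finset.prod_map, Function.Embedding.coeFn_mk] at e2
        rw [← e2]; rfl
      · rw [s.diagonal i hi, zero_mul, zero_mul]
    · intro i _
      by_cases hi : Function.Injective i
      · exact ((hN.memLp_cellProd s.measurable s.finite s.disjoint hi).integrable_mul
          (hN.memLp_normExp hh.measurable 2)).const_mul _
      · simp [s.diagonal i hi]
  have hR : ∫ ξ, s.toFun ξ * tensorGap h k ξ ∂(Measure.pi fun _ : Fin k => m) =
      ∑ i, s.coeff i * ∏ j, ∫ x in s.F (i j), expGap h x ∂m := by
    have e : ∀ ξ, s.toFun ξ * tensorGap h k ξ =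
        ∑ i, s.coeff i * (cellInd s.F i ξ * tensorGap h k ξ) := by
      intro ξ
      simp only [SimpleKernel.toFun, cellInd, Finset.sum_mul, mul_assoc]
    simp only [e]
    rw [integral_finsetSum]
    · refine Finset.sum_congr rfl fun i _ => ?_
      rw [integral_const_mul]
      congr 1
      simp only [← integral_indicator (s.measurable _)]
      rw [← integral_fintype_prod_eq_prod (μ := fun _ : Fin k => m)
        (f := fun j x => (s.F (i j)).indicator (expGap h) x)]
      congr 1; ext ξ
      simp only [cellInd, tensorGap, ← Finset.prod_mul_distrib]
      refine Finset.prod_congr rfl fun j _ => ?_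
      by_cases hj : ξ j ∈ s.F (i j) <;> simp [hj]
    · intro i _
      exact ((memLp_cellInd s.measurable s.finite i).integrable_mul
        (memLp_tensorGap hh k)).const_mul _
  rw [hL, hR]

lemma measurable_simpleIntegral_restrictSigma {k : ℕ} (s : SimpleKernel m k) :
    Measurable[restrictSigma N univ] (s.integral N) := by
  unfold SimpleKernel.integral
  refine Finset.measurable_sum _ fun i _ => ?_
  refine Measurable.const_mul ?_ _
  exact Finset.measurable_prod _ fun j _ =>
    measurable_restrictSigma_compensated N (s.measurable _) (subset_univ _)

end IsPoissonRandomMeasure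

namespace IsMultipleIntegral

variable [IsProbabilityMeasure P] {n : ℕ} {f : (Fin n → E) → ℝ} {X : Ω → ℝ}

/-- For simple kernels the pairing factorizes over disjoint cells into integrals of e^{-h}-1; both
sides are continuous in L². -/
lemma integral_mul_normExp [SigmaFinite m] (hX : IsMultipleIntegral P m N n f X)
    (hN : IsPoissonRandomMeasure P m N) {h : E → ℝ≥0} (hh : IsTestFun m h) :
    ∫ ω, X ω * normExp P N h ω ∂P =
      ∫ ξ, f ξ * tensorGap h n ξ ∂(Measure.pi fun _ : Fin n => m) := by
  obtain ⟨hf, hX2, s, hs, hsX⟩ := hX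
  have h1 := tendsto_integral_mul_of_tendsto_eLpNorm_two (fun l => (s l).memLp_toFun) hf
    (memLp_tensorGap hh n) hs
  have h2 := tendsto_integral_mul_of_tendsto_eLpNorm_two
    (fun l => hN.memLp_simpleIntegral (s l)) hX2 (hN.memLp_normExp hh.measurable 2) hsX
  simp only [hN.integral_simpleIntegral_mul_normExp hh] at h2
  exact tendsto_nhds_unique h2 h1

lemma aestronglyMeasurable_restrictSigma (hX : IsMultipleIntegral P m N n f X)
    (hN : IsPoissonRandomMeasure P m N) : AEStronglyMeasurable[restrictSigma N univ] X P := by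
  obtain ⟨hf, hX2, s, hs, hsX⟩ := hX
  exact aestronglyMeasurable_of_tendsto_eLpNorm_two (hN.restrictSigma_le MeasurableSet.univ)
    (fun l => hN.memLp_simpleIntegral (s l)) hX2 (fun l =>
      (IsPoissonRandomMeasure.measurable_simpleIntegral_restrictSigma
        (s l)).stronglyMeasurable.aestronglyMeasurable) hsX

/-- Duality of a multiple integral with the multiple integral of a simple kernel of the same
order. -/
lemma integral_mul_simpleIntegral [SigmaFinite m] (hX : IsMultipleIntegral P m N n f X)
    (hN : IsPoissonRandomMeasure P m N) (s' : SimpleKernel m n) :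
    ∫ ω, X ω * s'.integral N ω ∂P = ∑ σ : Equiv.Perm (Fin n),
      ∫ ξ, f ξ * s'.toFun (ξ ∘ σ) ∂(Measure.pi fun _ : Fin n => m) := by
  obtain ⟨hf, hX2, s, hs, hsX⟩ := hX
  have h2 := tendsto_integral_mul_of_tendsto_eLpNorm_two
    (fun l => hN.memLp_simpleIntegral (s l)) hX2 (hN.memLp_simpleIntegral s') hsX
  simp only [hN.integral_simpleIntegral_mul] at h2
  refine tendsto_nhds_unique h2 (tendsto_finsetSum _ fun σ _ => ?_)
  exact tendsto_integral_mul_of_tendsto_eLpNorm_two (fun l => (s l).memLp_toFun) hf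
    (s'.memLp_toFun.comp_measurePreserving (measurePreserving_comp_perm m σ)) hs

lemma integral_mul_simpleIntegral_eq_zero (hX : IsMultipleIntegral P m N n f X)
    (hN : IsPoissonRandomMeasure P m N) {k : ℕ} (hk : n ≠ k) (s' : SimpleKernel m k) :
    ∫ ω, X ω * s'.integral N ω ∂P = 0 := by
  obtain ⟨hf, hX2, s, hs, hsX⟩ := hX
  have h2 := tendsto_integral_mul_of_tendsto_eLpNorm_two
    (fun l => hN.memLp_simpleIntegral (s l)) hX2 (hN.memLp_simpleIntegral s') hsX
  simp only [hN.integral_simpleIntegral_mul_eq_zero hk] at h2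
  exact tendsto_nhds_unique h2 tendsto_const_nhds

end IsMultipleIntegral

namespace IsChaosExpansion

variable [IsProbabilityMeasure P] {f f' : ∀ n : ℕ, (Fin n → E) → ℝ} {F F' : Ω → ℝ}

lemma congr (hF : IsChaosExpansion P m N f F) (h : F =ᵐ[P] F') : IsChaosExpansion P m N f F' := by
  obtain ⟨h1, h2, X, hX, hlim⟩ := hF
  refine ⟨(memLp_congr_ae h).1 h1, h2, X, hX, ?_⟩
  convert hlim using 2 with M
  refine eLpNorm_congr_ae ?_
  filter_upwards [h] with ω hω
  simp [hω]

lemma tendsto_integral_mul (hF : IsChaosExpansion P m N f F) {X : ℕ → Ω → ℝ}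
    (hX : ∀ n, MemLp (X n) 2 P)
    (hlim : Tendsto (fun M => eLpNorm ((∑ n ∈ Finset.range M, X n) - F) 2 P) atTop (𝓝 0))
    {Y : Ω → ℝ} (hY : MemLp Y 2 P) :
    Tendsto (fun M => ∑ n ∈ Finset.range M, ∫ ω, X n ω * Y ω ∂P) atTop
      (𝓝 (∫ ω, F ω * Y ω ∂P)) := by
  have h1 := tendsto_integral_mul_of_tendsto_eLpNorm_two
    (f := fun M => ∑ n ∈ Finset.range M, X n)
    (fun M => by
      have := memLp_finsetSum (Finset.range M) (f := X) (μ := P) (p := 2) fun n _ => hX n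
      convert this using 1
      ext ω; simp) hF.1 hY hlim
  refine h1.congr fun M => ?_
  rw [← integral_finsetSum _ fun n _ => integrable_mul_of_memLp_two (hX n) hY]
  simp [Finset.sum_mul]

lemma tendsto_pairing [SigmaFinite m] (hF : IsChaosExpansion P m N f F)
    (hN : IsPoissonRandomMeasure P m N) {h : E → ℝ≥0} (hh : IsTestFun m h) :
    Tendsto (fun M => ∑ n ∈ Finset.range M,
      ∫ ξ, f n ξ * tensorGap h n ξ ∂(Measure.pi fun _ : Fin n => m)) atTop
      (𝓝 (∫ ω, F ω * normExp P N h ω ∂P)) := by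
  obtain ⟨X, hX, hlim⟩ := hF.2.2
  refine (hF.tendsto_integral_mul (fun n => (hX n).2.1) hlim
    (hN.memLp_normExp hh.measurable 2)).congr fun M => ?_
  exact Finset.sum_congr rfl fun n _ => (hX n).integral_mul_normExp hN hh

lemma aestronglyMeasurable_restrictSigma (hF : IsChaosExpansion P m N f F)
    (hN : IsPoissonRandomMeasure P m N) : AEStronglyMeasurable[restrictSigma N univ] F P := by
  obtain ⟨hF2, -, X, hX, hlim⟩ := hF
  refine aestronglyMeasurable_of_tendsto_eLpNorm_two (hN.restrictSigma_le MeasurableSet.univ)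
    (f := fun M => ∑ n ∈ Finset.range M, X n)
    (fun M => ?_) hF2 (fun M => ?_) hlim
  · have := memLp_finsetSum (Finset.range M) (f := X) (μ := P) (p := 2) fun n _ => (hX n).2.1
    convert this using 1
    ext ω; simp
  · induction M with
    | zero => exact aestronglyMeasurable_const (b := (0 : ℝ))
    | succ M ih =>
      simp only [Finset.sum_range_succ]
      exact AEStronglyMeasurable.add ih ((hX M).aestronglyMeasurable_restrictSigma hN)

/-- The kernels determine the random variable. -/
lemma ae_eq [SigmaFinite m] (hN : IsPoissonRandomMeasure P m N) {S : ℕ → Set E}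
    (hS : IsExhaustion m S) (hF : IsChaosExpansion P m N f F)
    (hF' : IsChaosExpansion P m N f F') : F =ᵐ[P] F' := by
  have hi := (hF.1.sub hF'.1).integrable (by norm_num)
  have h0 := hN.ae_eq_zero_of_forall_integral_mul_normExp_eq_zero hS.measurableSet hS.monotone
    hS.iUnion hS.ne_top hi ((hF.aestronglyMeasurable_restrictSigma hN).sub
      (hF'.aestronglyMeasurable_restrictSigma hN)) fun h hh _ => ?_
  · filter_upwards [h0] with ω hω
    simpa [sub_eq_zero] using hω
  · have e : ∀ ω, (F - F') ω * normExp P N h ω = F ω * normExp P N h ω - F' ω * normExp P N h ω :=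
      fun ω => by simp [sub_mul]
    simp only [e]
    rw [integral_sub (integrable_mul_of_memLp_two hF.1 (hN.memLp_normExp hh.measurable 2))
      (integrable_mul_of_memLp_two hF'.1 (hN.memLp_normExp hh.measurable 2)), sub_eq_zero]
    exact tendsto_nhds_unique (hF.tendsto_pairing hN hh) (hF'.tendsto_pairing hN hh)

/-- The random variable determines the symmetric kernels. -/
lemma kernel_ae_eq [SigmaFinite m] (hN : IsPoissonRandomMeasure P m N) {τ : E → ℝ}
    (hτm : Measurable τ) (hτ : ∀ c, m {x | τ x = c} = 0) (hF : IsChaosExpansion P m N f F)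
    (hF' : IsChaosExpansion P m N f' F) (n : ℕ) :
    f n =ᵐ[Measure.pi fun _ : Fin n => m] f' n := by
  have key : ∀ {g : ∀ n : ℕ, (Fin n → E) → ℝ}, IsChaosExpansion P m N g F →
      ∀ s' : SimpleKernel m n, ∫ ω, F ω * s'.integral N ω ∂P =
        (n ! : ℝ) * ∫ ξ, g n ξ * s'.toFun ξ ∂(Measure.pi fun _ : Fin n => m) := by
    intro g hg s'
    obtain ⟨hF2, hsymm, X, hX, hlim⟩ := id hg
    have h1 := hg.tendsto_integral_mul (fun n => (hX n).2.1) hlim (hN.memLp_simpleIntegral s')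
    -- By orthogonality of different orders only the n-th term pairs with an n-th order integral, so
    -- the partial sums are eventually constant.
    refine tendsto_nhds_unique h1 (tendsto_const_nhds.congr' ?_)
    filter_upwards [eventually_gt_atTop n] with M hM
    rw [Finset.sum_eq_single_of_mem n (Finset.mem_range.2 hM)
      fun k _ hk => (hX k).integral_mul_simpleIntegral_eq_zero hN hk s',
      (hX n).integral_mul_simpleIntegral hN s']
    -- Symmetry of the kernel makes the n! terms of the isometry equal.
    have e : ∀ σ : Equiv.Perm (Fin n),
        ∫ ξ, g n ξ * s'.toFun (ξ ∘ σ) ∂(Measure.pi fun _ : Fin n => m) =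
        ∫ ξ, g n ξ * s'.toFun ξ ∂(Measure.pi fun _ : Fin n => m) := by
      intro σ
      have hmp := measurePreserving_comp_perm m σ
      have h2 : AEStronglyMeasurable (fun ξ => g n ξ * s'.toFun ξ)
          (Measure.pi fun _ : Fin n => m) := (hX n).1.1.mul s'.memLp_toFun.1
      rw [← hmp.map_eq] at h2
      have h3 := integral_map hmp.measurable.aemeasurable h2
      rw [hmp.map_eq] at h3
      rw [h3]
      refine integral_congr_ae ?_
      filter_upwards [hsymm n σ] with ξ hξ
      rw [hξ]
    simp [e, Fintype.card_perm]
  obtain ⟨X, hX, -⟩ := hF.2.2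
  obtain ⟨X', hX', -⟩ := hF'.2.2
  have h0 := ae_eq_zero_of_forall_setIntegral_offDiagonal hτm hτ ((hX n).1.sub (hX' n).1)
    fun A hA hm hd => ?_
  · filter_upwards [h0] with ξ hξ
    simpa [sub_eq_zero] using hξ
  · let s' := SimpleKernel.rect A hA hm hd
    have e1 := (key hF s').symm.trans (key hF' s')
    have e2 := mul_left_cancel₀ (by positivity) e1
    rw [← integral_indicator (MeasurableSet.univ_pi hA)]
    have e3 : ∀ ξ, (univ.pi A).indicator (f n - f' n) ξ =
        f n ξ * s'.toFun ξ - f' n ξ * s'.toFun ξ := by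
      intro ξ
      rw [SimpleKernel.rect_toFun]
      by_cases hξ : ξ ∈ univ.pi A <;> simp only [hξ, indicator_of_mem, indicator_of_notMem,
        not_false_eq_true] <;> simp
    simp only [e3]
    rw [integral_sub (integrable_mul_of_memLp_two (hX n).1 s'.memLp_toFun)
      (integrable_mul_of_memLp_two (hX' n).1 s'.memLp_toFun), e2, sub_self]

/-- A square integrable functional of the noise has the chaos expansion with kernels `f` as soon
as its pairings with exponential functionals are those of the expansion. -/
theorem of_tendsto_pairing [SigmaFinite m] (hN : IsPoissonRandomMeasure P m N) {S : ℕ → Set E}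
    (hS : IsExhaustion m S) {τ : E → ℝ} (hτm : Measurable τ) (hτ : ∀ c, m {x | τ x = c} = 0)
    (hf : ∀ n, MemLp (f n) 2 (Measure.pi fun _ : Fin n => m))
    (hsymm : ∀ n, ∀ σ : Equiv.Perm (Fin n),
      (fun ξ => f n (ξ ∘ σ)) =ᵐ[Measure.pi fun _ : Fin n => m] f n)
    (hsum : Summable fun n => √(n ! : ℝ) *
      (eLpNorm (f n) 2 (Measure.pi fun _ : Fin n => m)).toReal)
    (hF : MemLp F 2 P) (hFm : AEStronglyMeasurable[restrictSigma N univ] F P)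
    (hpair : ∀ h, IsTestFun m h → (∃ k, Function.support h ⊆ S k) →
      Tendsto (fun M => ∑ n ∈ Finset.range M,
        ∫ ξ, f n ξ * tensorGap h n ξ ∂(Measure.pi fun _ : Fin n => m)) atTop
        (𝓝 (∫ ω, F ω * normExp P N h ω ∂P))) :
    IsChaosExpansion P m N f F := by
  choose X hX hXle using fun n => hN.exists_isMultipleIntegral hτm hτ (hf n)
  -- The series of multiple integrals converges absolutely in L². Its sum G has the required
  -- expansion by construction, and totality then identifies G with F.
  have hs : Summable fun n => (hX n).2.1.toLp (X n) := by
    refine Summable.of_norm (hsum.of_nonneg_of_le (fun _ => norm_nonneg _) fun n => ?_)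
    rw [Lp.norm_toLp]
    refine (ENNReal.toReal_mono (ENNReal.mul_ne_top ENNReal.ofReal_ne_top (hf n).2.ne)
      (hXle n)).trans_eq ?_
    rw [ENNReal.toReal_mul, ENNReal.toReal_ofReal (Real.sqrt_nonneg _)]
  obtain ⟨G', hG⟩ := hs
  obtain ⟨G, hGdef⟩ : ∃ G : Ω → ℝ, G = G' := ⟨_, rfl⟩
  have hGL : MemLp G 2 P := hGdef ▸ Lp.memLp G'
  have hlim : Tendsto (fun M => eLpNorm ((∑ n ∈ Finset.range M, X n) - G) 2 P) atTop (𝓝 0) := by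
    have hXM : ∀ M, MemLp (∑ n ∈ Finset.range M, X n) 2 P := fun M => by
      have := memLp_finsetSum (Finset.range M) (f := X) (μ := P) (p := 2) fun n _ => (hX n).2.1
      convert this using 1
      ext ω; simp
    rw [← Lp.tendsto_Lp_iff_tendsto_eLpNorm'' _ hXM _ hGL]
    subst hGdef
    rw [Lp.toLp_coeFn]
    refine hG.tendsto_sum_nat.congr fun M => ?_
    induction M with
    | zero => simp
    | succ M ih =>
      rw [Finset.sum_range_succ, ih, ← MemLp.toLp_add]
      congr 1
      rw [Finset.sum_range_succ]
  have hGc : IsChaosExpansion P m N f G := ⟨hGL, hsymm, X, hX, hlim⟩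
  refine hGc.congr ?_
  have h0 := hN.ae_eq_zero_of_forall_integral_mul_normExp_eq_zero hS.measurableSet hS.monotone
    hS.iUnion hS.ne_top ((hGL.sub hF).integrable (by norm_num))
    ((hGc.aestronglyMeasurable_restrictSigma hN).sub hFm) fun h hh hk => ?_
  · filter_upwards [h0] with ω hω
    simpa [sub_eq_zero] using hω
  · have e : ∀ ω, (G - F) ω * normExp P N h ω = G ω * normExp P N h ω - F ω * normExp P N h ω :=
      fun ω => by simp [sub_mul]
    simp only [e]
    rw [integral_sub (integrable_mul_of_memLp_two hGL (hN.memLp_normExp hh.measurable 2))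
      (integrable_mul_of_memLp_two hF (hN.memLp_normExp hh.measurable 2)), sub_eq_zero]
    exact tendsto_nhds_unique (hGc.tendsto_pairing hN hh) (hpair h hh hk)

end IsChaosExpansion

end

end

/-! ### The space-time noise, its filtration and duality for the Itô integral. -/

noncomputable section

/-! ### The intensity measure -/

instance sigmaFinite_intensity (ν : Measure JumpSize) [SigmaFinite ν] :
    SigmaFinite (intensity ν) := by
  unfold intensity
  infer_instance

lemma measurableEmbedding_coe_nnreal : MeasurableEmbedding (fun t : ℝ≥0 => (t : ℝ)) :=
  MeasurableEmbedding.subtype_coe measurableSet_Ici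

lemma lebTime_apply {s : Set ℝ≥0} : lebTime s = volume ((fun t : ℝ≥0 => (t : ℝ)) '' s) :=
  measurableEmbedding_coe_nnreal.comap_apply _ _

lemma lebTime_singleton (c : ℝ≥0) : lebTime {c} = 0 := by
  rw [lebTime_apply, image_singleton]
  exact measure_singleton _

lemma lebTime_Iic_ne_top (a : ℝ≥0) : lebTime (Iic a) ≠ ∞ := by
  rw [lebTime_apply]
  refine ((measure_mono (t := Icc (0 : ℝ) a) ?_).trans_lt measure_Icc_lt_top).ne
  rintro _ ⟨t, ht, rfl⟩
  exact ⟨t.2, NNReal.coe_le_coe.2 ht⟩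

lemma lintegral_lebTime (f : ℝ → ℝ≥0∞) :
    ∫⁻ s, f (s : ℝ) ∂lebTime = ∫⁻ s in Ici (0 : ℝ), f s := by
  have h : Measure.map (fun t : ℝ≥0 => (t : ℝ)) lebTime = volume.restrict (Ici 0) := by
    rw [lebTime, measurableEmbedding_coe_nnreal.map_comap]
    congr 1
    ext x
    exact ⟨fun ⟨t, ht⟩ => ht ▸ t.2, fun hx => ⟨⟨x, hx⟩, rfl⟩⟩
  rw [← h, measurableEmbedding_coe_nnreal.lintegral_map]

/-- The time coordinate. -/
def timeOf (ξ : JumpSpace) : ℝ := ξ.1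

lemma measurable_timeOf : Measurable timeOf := measurable_fst.coe_nnreal_real

lemma intensity_timeOf_eq (ν : Measure JumpSize) [SigmaFinite ν] (c : ℝ) :
    intensity ν {ξ | timeOf ξ = c} = 0 := by
  by_cases hc : 0 ≤ c
  · lift c to ℝ≥0 using hc
    have e : {ξ : JumpSpace | timeOf ξ = c} = {c} ×ˢ univ := by
      ext ξ
      simp [timeOf]
    rw [e, intensity, Measure.prod_prod, lebTime_singleton, zero_mul]
  · have e : {ξ : JumpSpace | timeOf ξ = c} = ∅ := by
      ext ξ
      simp only [mem_ofPred_eq, mem_empty_iff_false, iff_false, timeOf]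
      exact fun h => hc (h ▸ ξ.1.2)
    rw [e, measure_empty]

/-- Bounded boxes of finite intensity. -/
def jumpBox (ν : Measure JumpSize) [SigmaFinite ν] (k : ℕ) : Set JumpSpace :=
  Iic (k : ℝ≥0) ×ˢ Icc (-(k : ℝ)) k ×ˢ spanningSets ν k

lemma isExhaustion_jumpBox (ν : Measure JumpSize) [SigmaFinite ν] :
    IsExhaustion (intensity ν) (jumpBox ν) where
  measurableSet k := measurableSet_Iic.prod (measurableSet_Icc.prod (measurableSet_spanningSets ν k))
  monotone := by
    intro k l hkl
    have h : (k : ℝ) ≤ l := by exact_mod_cast hkl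
    refine prod_mono (Iic_subset_Iic.2 (by exact_mod_cast hkl)) (prod_mono
      (Icc_subset_Icc (by linarith) h) (monotone_spanningSets ν hkl))
  iUnion := by
    refine eq_univ_of_forall fun ξ => mem_iUnion.2 ?_
    obtain ⟨k₁, hk₁⟩ := exists_nat_ge ξ.1
    obtain ⟨k₂, hk₂⟩ := exists_nat_ge |ξ.2.1|
    have h3 : ξ.2.2 ∈ ⋃ i, spanningSets ν i := by simp [iUnion_spanningSets]
    obtain ⟨k₃, hk₃⟩ := mem_iUnion.1 h3
    refine ⟨max k₁ (max k₂ k₃), ?_, ?_, ?_⟩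
    · exact hk₁.trans (by exact_mod_cast le_max_left _ _)
    · have : |ξ.2.1| ≤ ((max k₁ (max k₂ k₃) : ℕ) : ℝ) :=
        hk₂.trans (by exact_mod_cast (le_max_left k₂ k₃).trans (le_max_right _ _))
      exact abs_le.1 this
    · exact monotone_spanningSets ν ((le_max_right k₂ k₃).trans (le_max_right _ _)) hk₃
  ne_top k := by
    rw [jumpBox, intensity, Measure.prod_prod, Measure.prod_prod]
    exact ENNReal.mul_ne_top (lebTime_Iic_ne_top _) (ENNReal.mul_ne_top
      measure_Icc_lt_top.ne (measure_spanningSets_lt_top ν k).ne)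

/-- Points with time coordinate at most `a`. -/
def timeLE (a : ℝ≥0) : Set JumpSpace := {ξ | ξ.1 ≤ a}

lemma measurableSet_timeLE (a : ℝ≥0) : MeasurableSet (timeLE a) :=
  measurableSet_le measurable_fst measurable_const

lemma timeLE_mono {a b : ℝ≥0} (h : a ≤ b) : timeLE a ⊆ timeLE b := fun _ hξ => le_trans hξ h

/-! ### The filtration of the noise -/

section

variable {Ω : Type*} [mΩ : MeasurableSpace Ω] {P : Measure Ω} {ν : Measure JumpSize}
  {N : Ω → Measure JumpSpace}

lemma noiseSigma_mono {s t : ℝ≥0} (h : s ≤ t) : noiseSigma P ν N s ≤ noiseSigma P ν N t := by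
  refine sup_le_sup_right ?_ _
  refine iSup_le fun q => iSup_le fun A => iSup_le fun B => iSup_le fun hq => iSup_le fun hA =>
    iSup_le fun hB => iSup_le fun hf => ?_
  exact le_iSup_of_le q (le_iSup_of_le A (le_iSup_of_le B (le_iSup_of_le (hq.trans h)
    (le_iSup_of_le hA (le_iSup_of_le hB (le_iSup_of_le hf le_rfl))))))

/-- Up to null events, the filtration at time a is generated by the restriction of N to times at
most a. Adapted variables thus have versions to which the independence of restrictions applies. -/
lemma noiseSigma_le_eventuallyMeasurableSpace (a : ℝ≥0) :
    noiseSigma P ν N a ≤ eventuallyMeasurableSpace (restrictSigma N (timeLE a)) (ae P) := by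
  refine sup_le ?_ ?_
  · refine le_trans ?_ le_eventuallyMeasurableSpace
    refine iSup_le fun q => iSup_le fun A => iSup_le fun B => iSup_le fun hq => iSup_le fun hA =>
      iSup_le fun hB => iSup_le fun hf => ?_
    have h1 := measurable_restrictSigma_apply N (B := timeLE a)
      (A := Iic q ×ˢ A ×ˢ B) (measurableSet_Iic.prod (hA.prod hB)) (fun ξ hξ => le_trans hξ.1 hq)
    have h2 := h1.comap_le
    rwa [BorelSpace.measurable_eq (α := ℝ≥0∞)] at h2
  · refine MeasurableSpace.generateFrom_le fun S hS => ?_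
    refine ⟨∅, @MeasurableSet.empty _ (restrictSigma N (timeLE a)), ?_⟩
    exact ae_eq_empty.2 hS.2

lemma noiseSigma_le (hN : IsPoissonRandomMeasure P (intensity ν) N) (a : ℝ≥0) :
    noiseSigma P ν N a ≤ mΩ := by
  refine sup_le ?_ ?_
  · refine iSup_le fun q => iSup_le fun A => iSup_le fun B => iSup_le fun hq => iSup_le fun hA =>
      iSup_le fun hB => iSup_le fun hf => ?_
    have h1 := (hN.measurable_apply (A := Iic q ×ˢ A ×ˢ B)
      (measurableSet_Iic.prod (hA.prod hB))).comap_le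
    rwa [BorelSpace.measurable_eq (α := ℝ≥0∞)] at h1
  · exact MeasurableSpace.generateFrom_le fun S hS => hS.1

lemma aestronglyMeasurable_of_measurable_noiseSigma {a : ℝ≥0} {X : Ω → ℝ}
    (hX : Measurable[noiseSigma P ν N a, borel ℝ] X) :
    AEStronglyMeasurable[restrictSigma N (timeLE a)] X P := by
  rw [← BorelSpace.measurable_eq (α := ℝ)] at hX
  exact aestronglyMeasurable_of_measurable_eventually
    (hX.mono (noiseSigma_le_eventuallyMeasurableSpace a) le_rfl)

namespace IsPredictableField

variable {u : ℝ≥0 → ℝ → Ω → ℝ}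

/-- The section of a generating set at (t,x) is empty unless a < t, and then it is an event known at
time a. -/
lemma measurable_section (hu : IsPredictableField P ν N u) (t : ℝ≥0) (x : ℝ) :
    Measurable[noiseSigma P ν N t, borel ℝ] (u t x) := by
  have h1 : Measurable[noiseSigma P ν N t, predictableSigma P ν N] (fun ω => (t, x, ω)) := by
    refine @measurable_generateFrom _ _ (noiseSigma P ν N t) _ _ ?_
    rintro S ⟨a, b, A, H, ha, hab, hA, hAf, hH, rfl⟩
    by_cases h : t ∈ Ioc a b ∧ x ∈ A
    · have e : (fun ω => (t, x, ω)) ⁻¹' (Ioc a b ×ˢ A ×ˢ H) = H := by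
        ext ω
        simp only [mem_preimage, mem_prod]
        exact ⟨fun h => h.2.2, fun hω => ⟨h.1, h.2, hω⟩⟩
      rw [e]
      exact noiseSigma_mono h.1.1.le _ hH
    · have e : (fun ω => (t, x, ω)) ⁻¹' (Ioc a b ×ˢ A ×ˢ H) = ∅ := by
        ext ω
        simp only [mem_preimage, mem_prod, mem_empty_iff_false, iff_false]
        exact fun h' => h ⟨h'.1, h'.2.1⟩
      rw [e]
      exact @MeasurableSet.empty _ (noiseSigma P ν N t)
  exact hu.comp h1

lemma measurable (hN : IsPoissonRandomMeasure P (intensity ν) N)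
    (hu : IsPredictableField P ν N u) :
    Measurable fun p : ℝ≥0 × ℝ × Ω => u p.1 p.2.1 p.2.2 := by
  unfold IsPredictableField at hu
  rw [← BorelSpace.measurable_eq (α := ℝ)] at hu
  refine hu.mono ?_ le_rfl
  refine MeasurableSpace.generateFrom_le ?_
  rintro S ⟨a, b, A, H, ha, hab, hA, hAf, hH, rfl⟩
  exact measurableSet_Ioc.prod (hA.prod (noiseSigma_le hN a _ hH))

lemma aestronglyMeasurable_restrictSigma (hu : IsPredictableField P ν N u) (t : ℝ≥0) (x : ℝ) :
    AEStronglyMeasurable[restrictSigma N (timeLE t)] (u t x) P :=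
  aestronglyMeasurable_of_measurable_noiseSigma (hu.measurable_section t x)

end IsPredictableField

/-! ### Duality for the Itô integral -/

namespace ElementaryProcess

variable (V : ElementaryProcess P ν N)

/-- The space-time-jump cell of the `j`-th summand. -/
def cell (j : Fin V.size) : Set JumpSpace := Ioc (V.a j) (V.b j) ×ˢ V.A j ×ˢ V.Γ j

lemma measurableSet_cell (j : Fin V.size) : MeasurableSet (V.cell j) :=
  measurableSet_Ioc.prod ((V.measurable_A j).prod (V.measurable_Γ j))

lemma intensity_cell_ne_top [SigmaFinite ν] (j : Fin V.size) : intensity ν (V.cell j) ≠ ∞ := by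
  rw [cell, intensity, Measure.prod_prod, Measure.prod_prod]
  have h := V.finite j
  rw [ENNReal.add_lt_top] at h
  refine ENNReal.mul_ne_top ?_ (ENNReal.mul_ne_top h.1.ne h.2.ne)
  exact ((measure_mono Ioc_subset_Iic_self).trans_lt (lebTime_Iic_ne_top _).lt_top).ne

lemma cell_subset_compl (j : Fin V.size) : V.cell j ⊆ (timeLE (V.a j))ᶜ :=
  fun _ hξ => not_le.2 hξ.1.1

lemma measurable_coeff (hN : IsPoissonRandomMeasure P (intensity ν) N) (j : Fin V.size) :
    Measurable (V.Y j) := by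
  have h := V.measurable_Y j
  rw [← BorelSpace.measurable_eq (α := ℝ)] at h
  exact h.mono (noiseSigma_le hN _) le_rfl

variable [IsProbabilityMeasure P]

lemma memLp_coeff (hN : IsPoissonRandomMeasure P (intensity ν) N) (j : Fin V.size) (p : ℝ≥0∞) :
    MemLp (V.Y j) p P := by
  obtain ⟨K, hK⟩ := V.bounded_Y j
  exact MemLp.of_bound (V.measurable_coeff hN j).aestronglyMeasurable K
    (Eventually.of_forall hK)

lemma memLp_toFun [SigmaFinite ν] (hN : IsPoissonRandomMeasure P (intensity ν) N) :
    MemLp V.toFun 2 ((intensity ν).prod P) := by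
  unfold toFun
  refine memLp_finsetSum _ fun j _ => ?_
  have hm : Measurable fun p : JumpSpace × Ω =>
      V.Y j p.2 * (V.cell j).indicator (fun _ => (1 : ℝ)) p.1 :=
    ((V.measurable_coeff hN j).comp measurable_snd).mul
      ((measurable_const.indicator (V.measurableSet_cell j)).comp measurable_fst)
  change MemLp (fun p : JumpSpace × Ω =>
      V.Y j p.2 * (V.cell j).indicator (fun _ => (1 : ℝ)) p.1) 2 _
  rw [memLp_two_iff_integrable_sq hm.aestronglyMeasurable]
  have h1 : Integrable ((V.cell j).indicator fun _ => (1 : ℝ)) (intensity ν) := by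
    rw [integrable_indicator_iff (V.measurableSet_cell j)]
    exact integrableOn_const (V.intensity_cell_ne_top j)
  have h2 := h1.mul_prod ((memLp_two_iff_integrable_sq
    (V.measurable_coeff hN j).aestronglyMeasurable).1 (V.memLp_coeff hN j 2))
  refine h2.congr (Eventually.of_forall fun p => ?_)
  by_cases hp : p.1 ∈ V.cell j <;> simp [hp]

lemma memLp_summand [SigmaFinite ν] (hN : IsPoissonRandomMeasure P (intensity ν) N)
    (j : Fin V.size) :
    MemLp (fun ω => V.Y j ω * compensated (intensity ν) N (V.cell j) ω) 2 P := by
  obtain ⟨K, hK⟩ := V.bounded_Y j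
  have hc := hN.memLp_compensated (V.measurableSet_cell j) (V.intensity_cell_ne_top j)
  refine MemLp.of_le_mul (c := K) hc ((V.measurable_coeff hN j).aestronglyMeasurable.mul hc.1)
    (Eventually.of_forall fun ω => ?_)
  rw [norm_mul]
  exact mul_le_mul_of_nonneg_right (hK ω) (norm_nonneg _)

lemma memLp_integral [SigmaFinite ν] (hN : IsPoissonRandomMeasure P (intensity ν) N) :
    MemLp V.integral 2 P := by
  unfold integral
  exact memLp_finsetSum _ fun j _ => V.memLp_summand hN j

/-- The coefficient of a summand depends on the noise up to time a and its cell lies after a, so the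
pairing factorizes and the cell contributes the integral of e^{-h}-1. -/
lemma integral_mul_normExp [SigmaFinite ν] (hN : IsPoissonRandomMeasure P (intensity ν) N)
    {h : JumpSpace → ℝ≥0} (hh : IsTestFun (intensity ν) h) :
    ∫ ω, V.integral ω * normExp P N h ω ∂P =
      ∫ p, V.toFun p * (expGap h p.1 * normExp P N h p.2) ∂((intensity ν).prod P) := by
  have hε := hN.memLp_normExp hh.measurable 2
  have e1 : ∀ ω, V.integral ω * normExp P N h ω = ∑ j, V.Y j ω *
      compensated (intensity ν) N (V.cell j) ω * normExp P N h ω := fun ω => by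
    rw [integral, Finset.sum_mul]; rfl
  have e2 : ∀ p : JumpSpace × Ω, V.toFun p * (expGap h p.1 * normExp P N h p.2) =
      ∑ j, (V.cell j).indicator (expGap h) p.1 * (V.Y j p.2 * normExp P N h p.2) := fun p => by
    rw [toFun, Finset.sum_mul]
    refine Finset.sum_congr rfl fun j _ => ?_
    change V.Y j p.2 * (V.cell j).indicator (fun _ => (1 : ℝ)) p.1 * _ = _
    by_cases hp : p.1 ∈ V.cell j <;> simp [hp]
    ring
  simp only [e1, e2]
  rw [integral_finsetSum, integral_finsetSum]
  · refine Finset.sum_congr rfl fun j _ => ?_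
    rw [integral_prod_mul ((V.cell j).indicator (expGap h))
      (fun ω => V.Y j ω * normExp P N h ω), integral_indicator (V.measurableSet_cell j),
      ← hN.integral_compensated_mul_normExp hh (V.measurableSet_cell j)
        (V.intensity_cell_ne_top j), mul_comm]
    exact hN.integral_mul_mul_normExp hh (measurableSet_timeLE (V.a j))
      (aestronglyMeasurable_of_measurable_noiseSigma (V.measurable_Y j))
      (measurable_restrictSigma_compensated N (V.measurableSet_cell j)
        (V.cell_subset_compl j)).stronglyMeasurable.aestronglyMeasurable
  · intro j _
    exact ((integrable_expGap hh).indicator (V.measurableSet_cell j)).mul_prod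
      ((V.memLp_coeff hN j 2).integrable_mul hε)
  · intro j _
    exact (V.memLp_summand hN j).integrable_mul hε

end ElementaryProcess

/-- This turns stochastic mild equations into deterministic Volterra equations for pairings. It
passes from elementary processes to the limit because (e^{-h}-1) ⊗ ε_h is square integrable. -/
lemma IsItoIntegral.integral_mul_normExp [IsProbabilityMeasure P] [SigmaFinite ν]
    (hN : IsPoissonRandomMeasure P (intensity ν) N) {V : JumpSpace × Ω → ℝ} {X : Ω → ℝ}
    (hX : IsItoIntegral P ν N V X) {h : JumpSpace → ℝ≥0} (hh : IsTestFun (intensity ν) h) :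
    ∫ ω, X ω * normExp P N h ω ∂P =
      ∫ ξ, expGap h ξ * ∫ ω, V (ξ, ω) * normExp P N h ω ∂P ∂(intensity ν) := by
  obtain ⟨hV, hX2, s, hs, hsX⟩ := hX
  have hg : MemLp (fun p : JumpSpace × Ω => expGap h p.1 * normExp P N h p.2) 2
      ((intensity ν).prod P) := by
    have hm : Measurable fun p : JumpSpace × Ω => expGap h p.1 * normExp P N h p.2 :=
      ((measurable_expGap hh.measurable).comp measurable_fst).mul
        ((hN.measurable_normExp hh.measurable).comp measurable_snd)
    rw [memLp_two_iff_integrable_sq hm.aestronglyMeasurable]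
    refine (((memLp_two_iff_integrable_sq (memLp_expGap hh).1).1 (memLp_expGap hh)).mul_prod
      ((memLp_two_iff_integrable_sq (hN.memLp_normExp hh.measurable 2).1).1
        (hN.memLp_normExp hh.measurable 2))).congr (Eventually.of_forall fun p => ?_)
    simp only
    ring
  have h1 := tendsto_integral_mul_of_tendsto_eLpNorm_two (fun l => (s l).memLp_toFun hN) hV hg hs
  have h2 := tendsto_integral_mul_of_tendsto_eLpNorm_two
    (fun l => (s l).memLp_integral hN) hX2 (hN.memLp_normExp hh.measurable 2) hsX
  simp only [(s _).integral_mul_normExp hN hh] at h2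
  rw [tendsto_nhds_unique h2 h1, integral_prod _ (integrable_mul_of_memLp_two hV hg)]
  congr 1; ext ξ
  rw [← integral_const_mul]
  congr 1; ext ω
  ring

end

end

/-! ### Deterministic Volterra equations and recursions for kernels. -/

noncomputable section

/-! ### The wave kernel and iterated Volterra inequalities -/

lemma waveG_nonneg (t x : ℝ) : 0 ≤ waveG t x := by
  unfold waveG; split_ifs <;> norm_num

lemma waveG_le (t x : ℝ) : waveG t x ≤ 1 / 2 := by
  unfold waveG; split_ifs <;> norm_num

lemma waveG_mul_self (t x : ℝ) : waveG t x * waveG t x = waveG t x / 2 := by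
  unfold waveG; split_ifs <;> norm_num

lemma waveG_eq_zero_of_le {t : ℝ} (ht : t ≤ 0) (x : ℝ) : waveG t x = 0 :=
  if_neg fun h => absurd (abs_nonneg x) (not_le.2 (h.trans_le ht))

lemma waveG_ne_zero_iff {t x : ℝ} : waveG t x ≠ 0 ↔ |x| < t := by
  unfold waveG; split_ifs with h <;> simp [h]

lemma measurable_waveG : Measurable fun p : ℝ × ℝ => waveG p.1 p.2 :=
  Measurable.ite (measurableSet_lt (measurable_norm.comp measurable_snd) measurable_fst)
    measurable_const measurable_const

/-- `G_{t-s}(x-y)` for a point `ξ = (s, y, z)`. -/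
def pathG (t : ℝ≥0) (x : ℝ) (ξ : JumpSpace) : ℝ := waveG ((t : ℝ) - ξ.1) (x - ξ.2.1)

lemma pathG_nonneg (t : ℝ≥0) (x : ℝ) (ξ : JumpSpace) : 0 ≤ pathG t x ξ := waveG_nonneg _ _

lemma pathG_le (t : ℝ≥0) (x : ℝ) (ξ : JumpSpace) : pathG t x ξ ≤ 1 / 2 := waveG_le _ _

lemma pathG_eq_zero_of_le {t : ℝ≥0} {x : ℝ} {ξ : JumpSpace} (h : t ≤ ξ.1) : pathG t x ξ = 0 :=
  waveG_eq_zero_of_le (sub_nonpos.2 (NNReal.coe_le_coe.2 h)) _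

lemma measurable_pathG : Measurable fun p : (ℝ≥0 × ℝ) × JumpSpace => pathG p.1.1 p.1.2 p.2 := by
  unfold pathG
  exact measurable_waveG.comp (by fun_prop :
    Measurable fun p : (ℝ≥0 × ℝ) × JumpSpace => ((p.1.1 : ℝ) - p.2.1, p.1.2 - p.2.2.1))

lemma measurable_pathG_right (t : ℝ≥0) (x : ℝ) : Measurable (pathG t x) :=
  measurable_pathG.comp (measurable_const.prodMk measurable_id : Measurable fun ξ => ((t, x), ξ))

lemma lintegral_waveG (t x : ℝ) : ∫⁻ y, ENNReal.ofReal (waveG t (x - y)) = ENNReal.ofReal t := by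
  have e : ∀ y, ENNReal.ofReal (waveG t (x - y)) =
      (Ioo (x - t) (x + t)).indicator (fun _ => ENNReal.ofReal (1 / 2)) y := by
    intro y
    by_cases h : |x - y| < t
    · have : y ∈ Ioo (x - t) (x + t) := by
        rw [abs_lt] at h; constructor <;> linarith
      simp [waveG, h, this]
    · have : y ∉ Ioo (x - t) (x + t) := fun hy => h (by
        rw [abs_lt]; constructor <;> linarith [hy.1, hy.2])
      simp [waveG, h, this]
  simp only [e]
  rw [lintegral_indicator measurableSet_Ioo, setLIntegral_const, Real.volume_Ioo,
    ← ENNReal.ofReal_mul (by norm_num)]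
  congr 1; ring

section

variable {ν : Measure JumpSize} [SigmaFinite ν]

lemma lintegral_pathG_mul {κ : JumpSize → ℝ≥0∞} (hκ : Measurable κ) {q : ℝ≥0 → ℝ≥0∞}
    (hq : Measurable q) (t : ℝ≥0) (x : ℝ) :
    ∫⁻ ξ, ENNReal.ofReal (pathG t x ξ) * (κ ξ.2.2 * q ξ.1) ∂(intensity ν) =
      (∫⁻ z, κ z ∂ν) * ∫⁻ s, ENNReal.ofReal ((t : ℝ) - s) * q s ∂lebTime := by
  have hG := measurable_pathG_right t x
  rw [intensity, lintegral_prod _ (by fun_prop)]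
  rw [← lintegral_const_mul _ (by fun_prop)]
  refine lintegral_congr fun s => ?_
  rw [lintegral_prod _ (by fun_prop)]
  simp only [pathG]
  have hG' : Measurable fun y => ENNReal.ofReal (waveG ((t : ℝ) - s) (x - y)) :=
    (measurable_waveG.comp (by fun_prop : Measurable fun y : ℝ => ((t : ℝ) - s, x - y))).ennreal_ofReal
  have e : ∀ y, ∫⁻ z, ENNReal.ofReal (waveG ((t : ℝ) - s) (x - y)) * (κ z * q s) ∂ν =
      ENNReal.ofReal (waveG ((t : ℝ) - s) (x - y)) * ((∫⁻ z, κ z ∂ν) * q s) := fun y => by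
    rw [lintegral_const_mul _ (by fun_prop), lintegral_mul_const _ hκ]
  simp only [e]
  rw [lintegral_mul_const _ hG', lintegral_waveG]
  ring

end

lemma integral_sub_mul_pow (t R : ℝ) (n : ℕ) :
    ∫ s in (0 : ℝ)..t, (t - s) * (R + s) ^ (2 * n) =
      ((R + t) ^ (2 * n + 2) - R ^ (2 * n + 2)) / ((2 * n + 1) * (2 * n + 2)) -
        t * R ^ (2 * n + 1) / (2 * n + 1) := by
  have hd : ∀ s ∈ uIcc (0 : ℝ) t, HasDerivAt (fun s => (t - s) * (R + s) ^ (2 * n + 1) / (2 * n + 1)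
      + (R + s) ^ (2 * n + 2) / ((2 * n + 1) * (2 * n + 2))) ((t - s) * (R + s) ^ (2 * n)) s := by
    intro s _
    have h1 : HasDerivAt (fun s : ℝ => R + s) 1 s := (hasDerivAt_id s).const_add R
    have h2 := (((hasDerivAt_id s).const_sub t).mul (h1.pow (2 * n + 1))).div_const
      ((2 * n + 1 : ℕ) : ℝ)
    have h3 := (h1.pow (2 * n + 2)).div_const (((2 * n + 1 : ℕ) : ℝ) * ((2 * n + 2 : ℕ) : ℝ))
    have h4 := h2.add h3
    have a1 : ((2 * n + 1 : ℕ) : ℝ) ≠ 0 := by positivity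
    have a2 : ((2 * n + 2 : ℕ) : ℝ) ≠ 0 := by positivity
    refine HasDerivAt.congr_of_eventuallyEq (h4.congr_deriv ?_) (Eventually.of_forall fun s => ?_)
    · rw [Nat.add_sub_cancel, show 2 * n + 2 - 1 = 2 * n + 1 from rfl, Pi.pow_apply, id]
      field_simp
      ring
    · simp only [Pi.add_apply, Pi.mul_apply, Pi.pow_apply, id]
      push_cast
      ring
  rw [intervalIntegral.integral_eq_sub_of_hasDerivAt hd (by
    apply Continuous.intervalIntegrable; fun_prop)]
  have a1 : (2 * (n : ℝ) + 1) ≠ 0 := by positivity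
  have a2 : (2 * (n : ℝ) + 2) ≠ 0 := by positivity
  field_simp
  ring

/-- The term linear in t is dropped, but R^{2n+2} is kept with its minus sign: it cancels the
forcing in `volterra_iterate_le`. -/
lemma lintegral_lebTime_sub_mul_pow_le (t : ℝ≥0) {R : ℝ} (hR : 0 ≤ R) (n : ℕ) :
    ∫⁻ s, ENNReal.ofReal ((t : ℝ) - s) * ENNReal.ofReal ((R + s) ^ (2 * n)) ∂lebTime ≤
      ENNReal.ofReal (((R + t) ^ (2 * n + 2) - R ^ (2 * n + 2)) / ((2 * n + 1) * (2 * n + 2))) := by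
  rw [lintegral_lebTime fun s => ENNReal.ofReal ((t : ℝ) - s) * ENNReal.ofReal ((R + s) ^ (2 * n))]
  have h1 : ∫⁻ s in Ici (0 : ℝ), ENNReal.ofReal ((t : ℝ) - s) *
      ENNReal.ofReal ((R + s) ^ (2 * n)) =
      ∫⁻ s in Ioc (0 : ℝ) t, ENNReal.ofReal (((t : ℝ) - s) * (R + s) ^ (2 * n)) := by
    rw [setLIntegral_congr Ioi_ae_eq_Ici.symm, ← lintegral_indicator measurableSet_Ioi,
      ← lintegral_indicator measurableSet_Ioc]
    refine lintegral_congr fun s => ?_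
    by_cases hs : 0 < s
    · by_cases hst : s ≤ t
      · have a : s ∈ Ioc (0 : ℝ) t := ⟨hs, hst⟩
        have b : s ∈ Ioi (0 : ℝ) := hs
        rw [indicator_of_mem a, indicator_of_mem b, ENNReal.ofReal_mul (by linarith)]
      · have a : s ∉ Ioc (0 : ℝ) t := fun h => hst h.2
        have b : s ∈ Ioi (0 : ℝ) := hs
        rw [indicator_of_notMem a, indicator_of_mem b, ENNReal.ofReal_of_nonpos (by linarith),
          zero_mul]
    · have a : s ∉ Ioc (0 : ℝ) t := fun h => hs h.1
      have b : s ∉ Ioi (0 : ℝ) := hs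
      rw [indicator_of_notMem a, indicator_of_notMem b]
  rw [h1, ← ofReal_integral_eq_lintegral_ofReal, ← intervalIntegral.integral_of_le t.coe_nonneg,
    integral_sub_mul_pow]
  · refine ENNReal.ofReal_le_ofReal (sub_le_self _ ?_)
    positivity
  · exact (by fun_prop : Continuous fun s : ℝ => ((t : ℝ) - s) * (R + s) ^ (2 * n)).integrableOn_Ioc
  · refine (ae_restrict_iff' measurableSet_Ioc).2 (Eventually.of_forall fun s hs => ?_)
    exact mul_nonneg (by linarith [hs.2]) (pow_nonneg (by linarith [hs.1]) _)

/-- A set of space-time points that contains the backward light cones of its points. -/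
def IsPastClosed (D : Set (ℝ≥0 × ℝ)) : Prop :=
  ∀ t x (s : ℝ≥0) y, (t, x) ∈ D → |x - y| < (t : ℝ) - s → (s, y) ∈ D

/-- The closed backward light cone. -/
def pastCone (t : ℝ≥0) (x : ℝ) : Set (ℝ≥0 × ℝ) := {q | |x - q.2| ≤ (t : ℝ) - q.1}

lemma mem_pastCone_self (t : ℝ≥0) (x : ℝ) : (t, x) ∈ pastCone t x := by
  simp [pastCone]

lemma isPastClosed_pastCone (t : ℝ≥0) (x : ℝ) : IsPastClosed (pastCone t x) := by
  intro s y s' y' h1 h2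
  have h1' : |x - y| ≤ (t : ℝ) - s := h1
  change |x - y'| ≤ (t : ℝ) - s'
  calc |x - y'| = |(x - y) + (y - y')| := by ring_nf
    _ ≤ |x - y| + |y - y'| := abs_add_le _ _
    _ ≤ (t : ℝ) - s' := by linarith

/-- The forcing is the claimed bound at time zero and the integral of the previous bound is at most
its increment from 0 to t, so the two add up exactly. Spatial integration of G gives t-s, and two
time integrations per step produce (2n)!. Past-closedness of D means that the induction hypothesis
is needed only where G does not vanish. -/
theorem volterra_iterate_le {ν : Measure JumpSize} [SigmaFinite ν] {C R c : ℝ} (hC : 0 ≤ C)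
    (hR : 0 ≤ R) (hc : 0 ≤ c) {κ : JumpSize → ℝ≥0∞} (hκm : Measurable κ)
    (hκ : ∫⁻ z, κ z ∂ν ≤ ENNReal.ofReal (C ^ 2)) {D : Set (ℝ≥0 × ℝ)} (hD : IsPastClosed D)
    {Q : ℕ → ℝ≥0 → ℝ → ℝ≥0∞} (h0 : ∀ t x, (t, x) ∈ D → Q 0 t x ≤ ENNReal.ofReal c)
    (hs : ∀ n t x, (t, x) ∈ D → Q (n + 1) t x ≤
      ENNReal.ofReal (c * ((C * R) ^ (2 * (n + 1)) / (2 * (n + 1))!)) +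
      ∫⁻ ξ, ENNReal.ofReal (pathG t x ξ) * (κ ξ.2.2 * Q n ξ.1 ξ.2.1) ∂(intensity ν)) (n : ℕ) :
    ∀ t x, (t, x) ∈ D → Q n t x ≤ ENNReal.ofReal (c * ((C * (R + t)) ^ (2 * n) / (2 * n)!)) := by
  induction n with
  | zero =>
    intro t x h
    simpa using h0 t x h
  | succ n ih =>
    intro t x h
    refine (hs n t x h).trans ?_
    let a : ℝ := c * C ^ (2 * n) / (2 * n)!
    have ha : 0 ≤ a := by positivity
    have h1 : ∫⁻ ξ, ENNReal.ofReal (pathG t x ξ) * (κ ξ.2.2 * Q n ξ.1 ξ.2.1) ∂(intensity ν) ≤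
        ∫⁻ ξ, ENNReal.ofReal (pathG t x ξ) * (κ ξ.2.2 *
          (ENNReal.ofReal a * ENNReal.ofReal ((R + ξ.1) ^ (2 * n)))) ∂(intensity ν) := by
      refine lintegral_mono fun ξ => ?_
      by_cases hG : pathG t x ξ = 0
      · simp [hG]
      · refine mul_le_mul_right (mul_le_mul_right ?_ _) _
        refine (ih ξ.1 ξ.2.1 (hD t x _ _ h (waveG_ne_zero_iff.1 hG))).trans ?_
        rw [← ENNReal.ofReal_mul ha]
        refine ENNReal.ofReal_le_ofReal (le_of_eq ?_)
        simp only [a, mul_pow]; ring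
    have hq : Measurable fun s : ℝ≥0 => ENNReal.ofReal a * ENNReal.ofReal ((R + s) ^ (2 * n)) := by
      fun_prop
    rw [lintegral_pathG_mul hκm hq] at h1
    have h2 : ∫⁻ s, ENNReal.ofReal ((t : ℝ) - s) *
        (ENNReal.ofReal a * ENNReal.ofReal ((R + s) ^ (2 * n))) ∂lebTime ≤ ENNReal.ofReal a *
        ENNReal.ofReal (((R + t) ^ (2 * n + 2) - R ^ (2 * n + 2)) / ((2 * n + 1) * (2 * n + 2))) := by
      refine le_trans (le_of_eq ?_)
        (mul_le_mul_right (lintegral_lebTime_sub_mul_pow_le t hR n) (ENNReal.ofReal a))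
      rw [← lintegral_const_mul _ (by fun_prop)]
      refine lintegral_congr fun s => ?_
      ring
    have hd : 0 ≤ (R + t) ^ (2 * n + 2) - R ^ (2 * n + 2) := by
      have := pow_le_pow_left₀ hR (by linarith [t.2] : R ≤ R + t) (2 * n + 2)
      linarith
    refine (add_le_add le_rfl (h1.trans (mul_le_mul' hκ h2))).trans ?_
    rw [← ENNReal.ofReal_mul ha, ← ENNReal.ofReal_mul (by positivity),
      ← ENNReal.ofReal_add (by positivity) (by positivity)]
    refine ENNReal.ofReal_le_ofReal (le_of_eq ?_)
    have hf : ((2 * (n + 1))! : ℝ) = (2 * n + 2) * ((2 * n + 1) * (2 * n)!) := by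
      rw [show 2 * (n + 1) = 2 * n + 1 + 1 by ring, Nat.factorial_succ, Nat.factorial_succ]
      push_cast; ring
    have hf0 : ((2 * n)! : ℝ) ≠ 0 := by positivity
    rw [hf]
    simp only [a, mul_pow, show 2 * (n + 1) = 2 * n + 2 by ring]
    field_simp
    ring

lemma tendsto_volterra_bound (c y : ℝ) :
    Tendsto (fun n : ℕ => c * (y ^ (2 * n) / (2 * n)!)) atTop (𝓝 0) := by
  have h := (FloorSemiring.tendsto_pow_div_factorial_atTop y).comp
    (tendsto_id.const_mul_atTop' (by norm_num : 0 < 2) : Tendsto (fun n : ℕ => 2 * n) atTop atTop)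
  simpa using h.const_mul c

end

noncomputable section

/-! ### Families of kernels that solve the wave recursion -/

section

variable {E : Type*} [MeasurableSpace E] {m : Measure E} [SigmaFinite m]

lemma measurePreserving_last_init (n : ℕ) :
    MeasurePreserving (fun η : Fin (n + 1) → E => (η (Fin.last n), Fin.init η))
      (Measure.pi fun _ => m) (m.prod (Measure.pi fun _ => m)) := by
  have h := measurePreserving_piFinSuccAbove (fun _ : Fin (n + 1) => m) (Fin.last n)
  convert h using 1
  ext η
  · rfl
  · simp [MeasurableEquiv.piFinSuccAbove, Fin.init]

lemma measurableEmbedding_last_init (n : ℕ) :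
    MeasurableEmbedding (fun η : Fin (n + 1) → E => (η (Fin.last n), Fin.init η)) := by
  have h := (MeasurableEquiv.piFinSuccAbove (fun _ : Fin (n + 1) => E)
    (Fin.last n)).measurableEmbedding
  convert h using 1
  ext η
  · rfl
  · simp [MeasurableEquiv.piFinSuccAbove, Fin.init]

lemma lintegral_pi_last {n : ℕ} {f : E × (Fin n → E) → ℝ≥0∞} (hf : Measurable f) :
    ∫⁻ η : Fin (n + 1) → E, f (η (Fin.last n), Fin.init η) ∂(Measure.pi fun _ => m) =
      ∫⁻ ξ, ∫⁻ η, f (ξ, η) ∂(Measure.pi fun _ => m) ∂m := by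
  rw [(measurePreserving_last_init n).lintegral_comp hf, lintegral_prod _ hf.aemeasurable]

end

/-- `f` solves the wave recursion with forcing terms `a`. -/
structure IsForced (a f : ∀ n : ℕ, ℝ≥0 → ℝ → (Fin n → JumpSpace) → ℝ) : Prop where
  zero : ∀ t x η, f 0 t x η = a 0 t x η
  succ : ∀ n t x η, f (n + 1) t x η = a (n + 1) t x η +
    pathG t x (η (Fin.last n)) * (η (Fin.last n)).2.2 *
      f n (η (Fin.last n)).1 (η (Fin.last n)).2.1 (Fin.init η)

/-- Joint measurability of a family of kernels. -/
def IsMeasurableFamily (f : ∀ n : ℕ, ℝ≥0 → ℝ → (Fin n → JumpSpace) → ℝ) : Prop :=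
  ∀ n, Measurable fun p : (ℝ≥0 × ℝ) × (Fin n → JumpSpace) => f n p.1.1 p.1.2 p.2

lemma measurable_fin_init {E : Type*} [MeasurableSpace E] (n : ℕ) :
    Measurable fun η : Fin (n + 1) → E => (Fin.init η : Fin n → E) :=
  measurable_pi_lambda _ fun _ => measurable_pi_apply _

namespace IsForced

variable {a f : ∀ n : ℕ, ℝ≥0 → ℝ → (Fin n → JumpSpace) → ℝ}

lemma isMeasurableFamily (hf : IsForced a f) (ha : IsMeasurableFamily a) :
    IsMeasurableFamily f := by
  intro n
  induction n with
  | zero =>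
    simp only [hf.zero]
    exact ha 0
  | succ n ih =>
    have hl : Measurable fun p : (ℝ≥0 × ℝ) × (Fin (n + 1) → JumpSpace) => p.2 (Fin.last n) :=
      (measurable_pi_apply _).comp measurable_snd
    have h1 := (measurable_pathG.comp (measurable_fst.prodMk hl)).mul
      (measurable_subtype_coe.comp hl.snd.snd)
    have h2 := ih.comp ((hl.fst.prodMk hl.snd.fst).prodMk
      ((measurable_fin_init n).comp measurable_snd))
    simp only [hf.succ]
    exact (ha (n + 1)).add (h1.mul h2)

end IsForced

lemma IsMeasurableFamily.measurable_right
    {f : ∀ n : ℕ, ℝ≥0 → ℝ → (Fin n → JumpSpace) → ℝ} (hf : IsMeasurableFamily f) (n : ℕ)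
    (t : ℝ≥0) (x : ℝ) : Measurable (f n t x) :=
  (hf n).comp (measurable_const.prodMk measurable_id : Measurable fun η => ((t, x), η))

/-- The recursion kernel `(ξ, η) ↦ f n ξ.1 ξ.2.1 η` is measurable. -/
lemma IsMeasurableFamily.measurable_point
    {f : ∀ n : ℕ, ℝ≥0 → ℝ → (Fin n → JumpSpace) → ℝ} (hf : IsMeasurableFamily f) (n : ℕ) :
    Measurable fun p : JumpSpace × (Fin n → JumpSpace) => f n p.1.1 p.1.2.1 p.2 :=
  (hf n).comp ((measurable_fst.fst.prodMk measurable_fst.snd.fst).prodMk measurable_snd)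

lemma jumpMoment_two_eq (ν : Measure JumpSize) :
    jumpMoment ν 2 = ∫⁻ z, ENNReal.ofReal ((z : ℝ) ^ 2) ∂ν := by
  unfold jumpMoment
  refine lintegral_congr fun z => ?_
  norm_num

lemma measurable_coe_jumpSize : Measurable fun z : JumpSize => (z : ℝ) := measurable_subtype_coe

section

variable {ν : Measure JumpSize} [SigmaFinite ν]
  {a f : ∀ n : ℕ, ℝ≥0 → ℝ → (Fin n → JumpSpace) → ℝ}

/-- Square of the `L²` norm of the `n`-th kernel at the point `(t, x)`. -/
def kernelEnergy (ν : Measure JumpSize) (f : ∀ n : ℕ, ℝ≥0 → ℝ → (Fin n → JumpSpace) → ℝ) (n : ℕ)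
    (t : ℝ≥0) (x : ℝ) : ℝ≥0∞ :=
  ∫⁻ η, ENNReal.ofReal (f n t x η ^ 2) ∂(Measure.pi fun _ : Fin n => intensity ν)

/-- From (a+b)² ≤ 2a² + 2b². Since G² = G/2, the factor 2 disappears in the second term and the
recursion keeps the kernel G with coefficient one. -/
lemma IsForced.kernelEnergy_succ_le (hf : IsForced a f) (ha : IsMeasurableFamily a) (n : ℕ)
    (t : ℝ≥0) (x : ℝ) : kernelEnergy ν f (n + 1) t x ≤ 2 * kernelEnergy ν a (n + 1) t x +
      ∫⁻ ξ, ENNReal.ofReal (pathG t x ξ) *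
        (ENNReal.ofReal ((ξ.2.2 : ℝ) ^ 2) * kernelEnergy ν f n ξ.1 ξ.2.1) ∂(intensity ν) := by
  have hfm := hf.isMeasurableFamily ha
  let b : JumpSpace × (Fin n → JumpSpace) → ℝ≥0∞ := fun p => ENNReal.ofReal (pathG t x p.1) *
    (ENNReal.ofReal ((p.1.2.2 : ℝ) ^ 2) * ENNReal.ofReal (f n p.1.1 p.1.2.1 p.2 ^ 2))
  have hz : Measurable fun ξ : JumpSpace => ENNReal.ofReal ((ξ.2.2 : ℝ) ^ 2) := by fun_prop
  have hfn := ((hfm.measurable_point n).pow_const 2).ennreal_ofReal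
  have hb : Measurable b :=
    ((measurable_pathG_right t x).comp measurable_fst).ennreal_ofReal.mul
      ((hz.comp measurable_fst).mul hfn)
  have h1 : kernelEnergy ν f (n + 1) t x ≤ ∫⁻ η : Fin (n + 1) → JumpSpace,
      (2 * ENNReal.ofReal (a (n + 1) t x η ^ 2) + b (η (Fin.last n), Fin.init η))
        ∂(Measure.pi fun _ => intensity ν) := by
    refine lintegral_mono fun η => ?_
    set ξ := η (Fin.last n) with hξ
    have e : b (ξ, Fin.init η) = ENNReal.ofReal (2 * (pathG t x ξ * ξ.2.2 *
        f n ξ.1 ξ.2.1 (Fin.init η)) ^ 2) := by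
      simp only [b]
      rw [← ENNReal.ofReal_mul (by positivity), ← ENNReal.ofReal_mul (pathG_nonneg _ _ _)]
      congr 1
      have := waveG_mul_self ((t : ℝ) - ξ.1) (x - ξ.2.1)
      change pathG t x ξ * pathG t x ξ = pathG t x ξ / 2 at this
      linear_combination (-2 * (ξ.2.2 : ℝ) ^ 2 * f n ξ.1 ξ.2.1 (Fin.init η) ^ 2) * this
    rw [e, show (2 : ℝ≥0∞) = ENNReal.ofReal 2 by norm_num, ← ENNReal.ofReal_mul (by norm_num),
      ← ENNReal.ofReal_add (by positivity) (by positivity)]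
    refine ENNReal.ofReal_le_ofReal ?_
    rw [hf.succ n t x η, ← hξ]
    nlinarith [sq_nonneg (a (n + 1) t x η - pathG t x ξ * ξ.2.2 * f n ξ.1 ξ.2.1 (Fin.init η))]
  refine h1.trans (le_of_eq ?_)
  rw [lintegral_add_left (((ha.measurable_right _ t x).pow_const 2).ennreal_ofReal.const_mul _),
    lintegral_const_mul _ ((ha.measurable_right _ t x).pow_const 2).ennreal_ofReal,
    lintegral_pi_last hb]
  congr 1
  refine lintegral_congr fun ξ => ?_
  have hfξ : Measurable fun η => ENNReal.ofReal (f n ξ.1 ξ.2.1 η ^ 2) :=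
    ((hfm.measurable_right n ξ.1 ξ.2.1).pow_const 2).ennreal_ofReal
  simp only [b]
  rw [lintegral_const_mul _ (hfξ.const_mul _), lintegral_const_mul _ hfξ]
  rfl

theorem IsForced.kernelEnergy_le (hf : IsForced a f) (ha : IsMeasurableFamily a) {C R c : ℝ}
    (hC : 0 ≤ C) (hR : 0 ≤ R) (hc : 0 ≤ c) (hν : jumpMoment ν 2 ≤ ENNReal.ofReal (C ^ 2))
    (hac : ∀ n t x, kernelEnergy ν a n t x ≤
      ENNReal.ofReal (c * ((C * R) ^ (2 * n) / (2 * n)!))) (n : ℕ) (t : ℝ≥0) (x : ℝ) :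
    kernelEnergy ν f n t x ≤ ENNReal.ofReal (2 * c * ((C * (R + t)) ^ (2 * n) / (2 * n)!)) := by
  refine volterra_iterate_le (ν := ν) (Q := kernelEnergy ν f) (D := univ) hC hR (by positivity : 0 ≤ 2 * c)
    (κ := fun z => ENNReal.ofReal ((z : ℝ) ^ 2)) (by fun_prop) ?_ (fun _ _ _ _ _ _ => mem_univ _)
    (fun t x _ => ?_) (fun n t x _ => ?_) n t x (mem_univ _)
  · rwa [← jumpMoment_two_eq]
  · have h := hac 0 t x
    have e : kernelEnergy ν f 0 t x = kernelEnergy ν a 0 t x := by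
      unfold kernelEnergy; simp only [hf.zero]
    rw [e]
    refine h.trans (ENNReal.ofReal_le_ofReal ?_)
    simp; linarith
  · refine (hf.kernelEnergy_succ_le ha n t x).trans (add_le_add ?_ le_rfl)
    refine (mul_le_mul_right (hac (n + 1) t x) 2).trans (le_of_eq ?_)
    rw [show (2 : ℝ≥0∞) = ENNReal.ofReal 2 by norm_num, ← ENNReal.ofReal_mul (by norm_num), mul_assoc]

lemma memLp_two_of_kernelEnergy (hf : IsMeasurableFamily f) {n : ℕ} {t : ℝ≥0} {x : ℝ}
    (h : kernelEnergy ν f n t x < ∞) :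
    MemLp (f n t x) 2 (Measure.pi fun _ : Fin n => intensity ν) := by
  rw [memLp_two_iff_integrable_sq (hf.measurable_right n t x).aestronglyMeasurable]
  refine ⟨((hf.measurable_right n t x).pow_const 2).aestronglyMeasurable, ?_⟩
  rw [hasFiniteIntegral_iff_ofReal (Eventually.of_forall fun _ => sq_nonneg _)]
  exact h

lemma eLpNorm_sq_eq_kernelEnergy (f : ∀ n : ℕ, ℝ≥0 → ℝ → (Fin n → JumpSpace) → ℝ) (n : ℕ)
    (t : ℝ≥0) (x : ℝ) :
    eLpNorm (f n t x) 2 (Measure.pi fun _ : Fin n => intensity ν) ^ 2 =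
      kernelEnergy ν f n t x := by
  rw [eLpNorm_eq_lintegral_rpow_enorm_toReal (by norm_num) (by norm_num), ← ENNReal.rpow_natCast,
    ← ENNReal.rpow_mul]
  norm_num
  refine lintegral_congr fun η => ?_
  rw [← ofReal_norm, ← ENNReal.ofReal_pow (norm_nonneg _)]
  simp

/-! ### Pairings with tensor powers -/

/-- Pairing of the `n`-th kernel with the tensor power of `expGap h`. -/
def kernelPairing (ν : Measure JumpSize) (h : JumpSpace → ℝ≥0)
    (f : ∀ n : ℕ, ℝ≥0 → ℝ → (Fin n → JumpSpace) → ℝ) (n : ℕ) (t : ℝ≥0) (x : ℝ) : ℝ :=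
  ∫ η, f n t x η * tensorGap h n η ∂(Measure.pi fun _ : Fin n => intensity ν)

lemma tensorGap_succ {E : Type*} (h : E → ℝ≥0) (n : ℕ) (η : Fin (n + 1) → E) :
    tensorGap h (n + 1) η = expGap h (η (Fin.last n)) * tensorGap h n (Fin.init η) := by
  unfold tensorGap
  rw [Fin.prod_univ_castSucc, mul_comm]
  rfl

/-- Fubini in the last variable: the tensor power splits there just as the recursion does. The
pairings therefore satisfy the Volterra recursion of the solutions, with one order of delay. -/
lemma IsForced.kernelPairing_succ (hf : IsForced a f) (ha : IsMeasurableFamily a)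
    {h : JumpSpace → ℝ≥0} (hh : IsTestFun (intensity ν) h) {n : ℕ} {t : ℝ≥0} {x : ℝ}
    (hfL : kernelEnergy ν f (n + 1) t x < ∞) (haL : kernelEnergy ν a (n + 1) t x < ∞) :
    Integrable (fun ξ => pathG t x ξ * (ξ.2.2 * expGap h ξ * kernelPairing ν h f n ξ.1 ξ.2.1))
      (intensity ν) ∧
    kernelPairing ν h f (n + 1) t x = kernelPairing ν h a (n + 1) t x +
      ∫ ξ, pathG t x ξ * (ξ.2.2 * expGap h ξ * kernelPairing ν h f n ξ.1 ξ.2.1)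
        ∂(intensity ν) := by
  have hfm := hf.isMeasurableFamily ha
  have i1 := integrable_mul_of_memLp_two (memLp_two_of_kernelEnergy hfm hfL)
    (memLp_tensorGap hh (n + 1))
  have i2 := integrable_mul_of_memLp_two (memLp_two_of_kernelEnergy ha haL)
    (memLp_tensorGap hh (n + 1))
  let b : JumpSpace × (Fin n → JumpSpace) → ℝ := fun p =>
    pathG t x p.1 * (p.1.2.2 * expGap h p.1) * (f n p.1.1 p.1.2.1 p.2 * tensorGap h n p.2)
  have e : ∀ η : Fin (n + 1) → JumpSpace, b (η (Fin.last n), Fin.init η) =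
      f (n + 1) t x η * tensorGap h (n + 1) η - a (n + 1) t x η * tensorGap h (n + 1) η := by
    intro η
    simp only [b]
    rw [hf.succ n t x η, tensorGap_succ]
    ring
  have hemb := measurableEmbedding_last_init (E := JumpSpace) n
  have hmp := measurePreserving_last_init (m := intensity ν) n
  have ib : Integrable b ((intensity ν).prod (Measure.pi fun _ => intensity ν)) := by
    rw [← hmp.integrable_comp_emb hemb]
    exact (i1.sub i2).congr (Eventually.of_forall fun η => (e η).symm)
  have e2 : ∀ ξ : JumpSpace, ∫ η, b (ξ, η) ∂(Measure.pi fun _ => intensity ν) =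
      pathG t x ξ * (ξ.2.2 * expGap h ξ * kernelPairing ν h f n ξ.1 ξ.2.1) := by
    intro ξ
    simp only [b]
    rw [integral_const_mul, mul_assoc]
    rfl
  refine ⟨?_, ?_⟩
  · have := ib.integral_prod_left
    simpa only [e2] using this
  · have h1 : kernelPairing ν h f (n + 1) t x - kernelPairing ν h a (n + 1) t x =
        ∫ η : Fin (n + 1) → JumpSpace, b (η (Fin.last n), Fin.init η)
          ∂(Measure.pi fun _ => intensity ν) := by
      simp only [e]
      rw [integral_sub i1 i2]
      rfl
    rw [hmp.integral_comp hemb, integral_prod _ ib] at h1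
    simp only [e2] at h1
    linarith

/-- Bound for the weight `z (e^{-h} - 1)`, for `h` supported in the `k`-th box. -/
def boxWeight (ν : Measure JumpSize) [SigmaFinite ν] (k : ℕ) (z : JumpSize) : ℝ≥0∞ :=
  (spanningSets ν k).indicator (fun z => ENNReal.ofReal |(z : ℝ)|) z

lemma measurable_boxWeight (k : ℕ) : Measurable (boxWeight ν k) := by
  unfold boxWeight
  exact (by fun_prop : Measurable fun z : JumpSize => ENNReal.ofReal |(z : ℝ)|).indicator
    (measurableSet_spanningSets ν k)

/-- No first moment of ν is assumed; on a set of finite ν-measure |z| ≤ 1 + z² is integrable. The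
value is written as a square to fit `volterra_iterate_le`. -/
lemma exists_lintegral_boxWeight_le (hν : jumpMoment ν 2 < ∞) (k : ℕ) :
    ∃ C : ℝ, 0 ≤ C ∧ ∫⁻ z, boxWeight ν k z ∂ν ≤ ENNReal.ofReal (C ^ 2) := by
  have h : ∫⁻ z, boxWeight ν k z ∂ν ≠ ∞ := by
    have h1 : ∀ z, boxWeight ν k z ≤
        (spanningSets ν k).indicator (fun _ => 1) z + ENNReal.ofReal ((z : ℝ) ^ 2) := by
      intro z
      unfold boxWeight
      by_cases hz : z ∈ spanningSets ν k
      · simp only [hz, indicator_of_mem]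
        rw [← ENNReal.ofReal_one, ← ENNReal.ofReal_add (by norm_num) (by positivity)]
        refine ENNReal.ofReal_le_ofReal ?_
        nlinarith [sq_abs (z : ℝ), sq_nonneg (|(z : ℝ)| - 1)]
      · simp [hz]
    refine ((lintegral_mono h1).trans_lt ?_).ne
    rw [lintegral_add_right _ (by fun_prop), ← jumpMoment_two_eq,
      lintegral_indicator_const (measurableSet_spanningSets ν k), one_mul]
    exact ENNReal.add_lt_top.2 ⟨measure_spanningSets_lt_top ν k, hν⟩
  refine ⟨√(∫⁻ z, boxWeight ν k z ∂ν).toReal, Real.sqrt_nonneg _, ?_⟩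
  rw [Real.sq_sqrt ENNReal.toReal_nonneg, ENNReal.ofReal_toReal h]

lemma ofReal_abs_mul_expGap_le {h : JumpSpace → ℝ≥0} {k : ℕ}
    (hk : Function.support h ⊆ jumpBox ν k) (ξ : JumpSpace) :
    ENNReal.ofReal |(ξ.2.2 : ℝ) * expGap h ξ| ≤ boxWeight ν k ξ.2.2 := by
  by_cases hξ : ξ ∈ Function.support h
  · have hz : ξ.2.2 ∈ spanningSets ν k := (hk hξ).2.2
    rw [boxWeight, indicator_of_mem hz, abs_mul]
    exact ENNReal.ofReal_le_ofReal (mul_le_of_le_one_right (abs_nonneg _) (abs_expGap_le_one h ξ))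
  · have : expGap h ξ = 0 := by
      have := abs_expGap_le h ξ
      rw [indicator_of_notMem hξ] at this
      exact abs_nonpos_iff.1 this
    simp [this]

/-- A bounded solution `T` of a linear Volterra equation is the sum of the pairings of the kernels
that solve the corresponding recursion. -/
theorem IsForced.abs_sub_sum_kernelPairing_le (hf : IsForced a f) (ha : IsMeasurableFamily a)
    {h : JumpSpace → ℝ≥0} (hh : IsTestFun (intensity ν) h) {k : ℕ}
    (hk : Function.support h ⊆ jumpBox ν k) (hfL : ∀ n t x, kernelEnergy ν f n t x < ∞)
    (haL : ∀ n t x, kernelEnergy ν a n t x < ∞) {C R c : ℝ} (hC : 0 ≤ C) (hR : 0 ≤ R)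
    (hc : 0 ≤ c) (hν : ∫⁻ z, boxWeight ν k z ∂ν ≤ ENNReal.ofReal (C ^ 2)) {D : Set (ℝ≥0 × ℝ)}
    (hD : IsPastClosed D) {T A : ℝ≥0 → ℝ → ℝ} (hTc : ∀ t x, (t, x) ∈ D → |T t x| ≤ c)
    (hTi : ∀ t x, (t, x) ∈ D →
      Integrable (fun ξ => pathG t x ξ * (ξ.2.2 * expGap h ξ * T ξ.1 ξ.2.1)) (intensity ν))
    (hT : ∀ t x, (t, x) ∈ D → T t x = A t x +
      ∫ ξ, pathG t x ξ * (ξ.2.2 * expGap h ξ * T ξ.1 ξ.2.1) ∂(intensity ν))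
    (hA : ∀ M t x, (t, x) ∈ D → |A t x - ∑ n ∈ Finset.range M, kernelPairing ν h a n t x| ≤
      c * ((C * R) ^ (2 * M) / (2 * M)!)) (M : ℕ) (t : ℝ≥0) (x : ℝ) (htx : (t, x) ∈ D) :
    |T t x - ∑ n ∈ Finset.range M, kernelPairing ν h f n t x| ≤
      c * ((C * (R + t)) ^ (2 * M) / (2 * M)!) := by
  have main := volterra_iterate_le (ν := ν) hC hR hc (measurable_boxWeight k) hν hD
    (Q := fun M t x => ENNReal.ofReal |T t x - ∑ n ∈ Finset.range M, kernelPairing ν h f n t x|)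
    (fun t x h => by simpa using ENNReal.ofReal_le_ofReal (hTc t x h)) (fun M t x htx => ?_) M t x htx
  · exact (ENNReal.ofReal_le_ofReal_iff (by
      have := t.coe_nonneg
      positivity)).1 main
  · have hi := fun n => (hf.kernelPairing_succ ha hh (hfL (n + 1) t x) (haL (n + 1) t x)).1
    have he := fun n => (hf.kernelPairing_succ ha hh (hfL (n + 1) t x) (haL (n + 1) t x)).2
    have e0 : kernelPairing ν h f 0 t x = kernelPairing ν h a 0 t x := by
      unfold kernelPairing; simp only [hf.zero]
    -- The remainder of order M+1 is the remainder of the forcing plus the Volterra operator applied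
    -- to the remainder of order M, which is the setting of `volterra_iterate_le`.
    have e1 : T t x - ∑ n ∈ Finset.range (M + 1), kernelPairing ν h f n t x =
        (A t x - ∑ n ∈ Finset.range (M + 1), kernelPairing ν h a n t x) +
        ∫ ξ, pathG t x ξ * (ξ.2.2 * expGap h ξ * (T ξ.1 ξ.2.1 -
          ∑ n ∈ Finset.range M, kernelPairing ν h f n ξ.1 ξ.2.1)) ∂(intensity ν) := by
      have e2 : ∀ ξ : JumpSpace, pathG t x ξ * (ξ.2.2 * expGap h ξ * (T ξ.1 ξ.2.1 -
          ∑ n ∈ Finset.range M, kernelPairing ν h f n ξ.1 ξ.2.1)) =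
          pathG t x ξ * (ξ.2.2 * expGap h ξ * T ξ.1 ξ.2.1) - ∑ n ∈ Finset.range M,
            pathG t x ξ * (ξ.2.2 * expGap h ξ * kernelPairing ν h f n ξ.1 ξ.2.1) := by
        intro ξ
        rw [mul_sub, mul_sub, Finset.mul_sum, Finset.mul_sum]
      simp only [e2]
      rw [integral_sub (hTi t x htx) (integrable_finsetSum _ fun n _ => hi n),
        integral_finsetSum _ fun n _ => hi n, hT t x htx, Finset.sum_range_succ',
        Finset.sum_range_succ', e0]
      simp only [he, Finset.sum_add_distrib]
      ring
    rw [e1]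
    refine (ENNReal.ofReal_le_ofReal (abs_add_le _ _)).trans ?_
    refine ENNReal.ofReal_add_le.trans (add_le_add
      (ENNReal.ofReal_le_ofReal (hA (M + 1) t x htx)) ?_)
    rw [← Real.norm_eq_abs]
    refine (ofReal_norm _).trans_le ((enorm_integral_le_lintegral_enorm _).trans ?_)
    refine lintegral_mono fun ξ => ?_
    rw [← ofReal_norm, Real.norm_eq_abs, abs_mul, abs_mul, abs_of_nonneg (pathG_nonneg _ _ _),
      ENNReal.ofReal_mul (pathG_nonneg _ _ _), ENNReal.ofReal_mul (abs_nonneg _)]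
    exact mul_le_mul_right (mul_le_mul_left (ofReal_abs_mul_expGap_le hk ξ) _) _

end

end

/-! ### Insertion of points in kernels: the kernels of the Malliavin derivatives. -/

noncomputable section

/-! ### Symmetrization and derivatives of kernels -/

section

variable {E : Type*}

/-- Sum of the kernels obtained by inserting `ξ` at all possible places. -/
def insKernel (ξ : E) (f : ∀ n : ℕ, (Fin n → E) → ℝ) (n : ℕ) (η : Fin n → E) : ℝ :=
  ∑ k : Fin (n + 1), f (n + 1) (k.insertNth ξ η)

/-- The permutation that moves `k` to `0` and acts on the other indices as `ρ`. -/
def insPerm {n : ℕ} (q : Fin (n + 1) × Equiv.Perm (Fin n)) : Equiv.Perm (Fin (n + 1)) :=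
  (finSuccEquiv' q.1).trans ((Equiv.optionCongr q.2).trans (finSuccEquiv' 0).symm)

lemma insPerm_apply_self {n : ℕ} (q : Fin (n + 1) × Equiv.Perm (Fin n)) : insPerm q q.1 = 0 := by
  simp [insPerm]

lemma insPerm_apply_succAbove {n : ℕ} (q : Fin (n + 1) × Equiv.Perm (Fin n)) (j : Fin n) :
    insPerm q (q.1.succAbove j) = (q.2 j).succ := by
  simp [insPerm]

lemma insPerm_bijective (n : ℕ) : Function.Bijective (insPerm (n := n)) := by
  rw [Fintype.bijective_iff_injective_and_card]
  refine ⟨?_, ?_⟩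
  · rintro ⟨k, ρ⟩ ⟨k', ρ'⟩ h
    have h1 := insPerm_apply_self (k, ρ)
    have h2 := insPerm_apply_self (k', ρ')
    have hk : k = k' := (insPerm (k', ρ')).injective ((h ▸ h1).trans h2.symm)
    subst hk
    congr 1
    ext j
    have h3 := insPerm_apply_succAbove (k, ρ) j
    have h4 := insPerm_apply_succAbove (k, ρ') j
    rw [h] at h3
    exact congrArg Fin.val (Fin.succ_injective _ (h3.symm.trans h4))
  · simp [Fintype.card_perm, Nat.factorial_succ]

lemma cons_comp_insPerm {n : ℕ} (ξ : E) (η : Fin n → E) (q : Fin (n + 1) × Equiv.Perm (Fin n)) :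
    (Fin.cons ξ η : Fin (n + 1) → E) ∘ insPerm q = q.1.insertNth ξ (η ∘ q.2) := by
  funext i
  rcases Fin.eq_self_or_eq_succAbove q.1 i with rfl | ⟨j, rfl⟩
  · rw [Function.comp_apply, insPerm_apply_self]
    simp
  · rw [Function.comp_apply, insPerm_apply_succAbove]
    simp

/-- A permutation of n+1 slots amounts to a place for ξ and a permutation of the other points. The
factor n+1 of the derivative turns 1/(n+1)! into 1/n!. -/
lemma derivKernel_symmetrize (f : ∀ n : ℕ, (Fin n → E) → ℝ) (ξ : E) :
    derivKernel (fun n => symmetrize (f n)) ξ = fun n => symmetrize (insKernel ξ f n) := by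
  funext n η
  have h1 : ∑ σ : Equiv.Perm (Fin (n + 1)), f (n + 1) ((Fin.cons ξ η : Fin (n + 1) → E) ∘ σ) =
      ∑ ρ : Equiv.Perm (Fin n), insKernel ξ f n (η ∘ ρ) := by
    rw [← (insPerm_bijective n).sum_comp, Fintype.sum_prod_type_right]
    refine Finset.sum_congr rfl fun ρ _ => Finset.sum_congr rfl fun k _ => ?_
    rw [cons_comp_insPerm]
  simp only [derivKernel, symmetrize]
  rw [h1, Nat.factorial_succ]
  have : (n ! : ℝ) ≠ 0 := by positivity
  push_cast
  field_simp

lemma symmetrize_comp_perm {n : ℕ} (f : (Fin n → E) → ℝ) (ξ : Fin n → E)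
    (σ : Equiv.Perm (Fin n)) : symmetrize f (ξ ∘ σ) = symmetrize f ξ := by
  unfold symmetrize
  congr 1
  refine Fintype.sum_equiv (Equiv.mulLeft σ) _ _ fun ρ => ?_
  rfl

variable [MeasurableSpace E] {m : Measure E} [SigmaFinite m]

lemma memLp_symmetrize {n : ℕ} {f : (Fin n → E) → ℝ}
    (hf : MemLp f 2 (Measure.pi fun _ : Fin n => m)) :
    MemLp (symmetrize f) 2 (Measure.pi fun _ : Fin n => m) :=
  (memLp_finsetSum _ fun σ _ =>
    hf.comp_measurePreserving (measurePreserving_comp_perm m σ)).const_mul _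

lemma eLpNorm_symmetrize_le {n : ℕ} {f : (Fin n → E) → ℝ}
    (hf : MemLp f 2 (Measure.pi fun _ : Fin n => m)) :
    eLpNorm (symmetrize f) 2 (Measure.pi fun _ : Fin n => m) ≤
      eLpNorm f 2 (Measure.pi fun _ : Fin n => m) := by
  have h1 : ∀ σ : Equiv.Perm (Fin n), eLpNorm (fun ξ => f (ξ ∘ σ)) 2
      (Measure.pi fun _ : Fin n => m) = eLpNorm f 2 (Measure.pi fun _ : Fin n => m) := fun σ =>
    eLpNorm_comp_measurePreserving hf.1 (measurePreserving_comp_perm m σ)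
  have e : symmetrize f = (n ! : ℝ)⁻¹ • ∑ σ : Equiv.Perm (Fin n), fun ξ => f (ξ ∘ σ) := by
    ext ξ; simp [symmetrize]
  rw [e, eLpNorm_const_smul]
  have h2 : eLpNorm (∑ σ : Equiv.Perm (Fin n), fun ξ => f (ξ ∘ σ)) 2
      (Measure.pi fun _ : Fin n => m) ≤ ∑ σ : Equiv.Perm (Fin n),
        eLpNorm f 2 (Measure.pi fun _ : Fin n => m) :=
    (eLpNorm_sum_le (fun σ _ =>
      (hf.comp_measurePreserving (measurePreserving_comp_perm m σ)).1) (by norm_num)).trans_eq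
        (Finset.sum_congr rfl fun σ _ => h1 σ)
  refine (mul_le_mul_right h2 _).trans (le_of_eq ?_)
  simp only [Finset.sum_const, Finset.card_univ, Fintype.card_perm, Fintype.card_fin,
    nsmul_eq_mul]
  rw [← mul_assoc, Real.enorm_eq_ofReal (by positivity), ENNReal.ofReal_inv_of_pos (by positivity),
    ENNReal.ofReal_natCast, ENNReal.inv_mul_cancel (by positivity) (ENNReal.natCast_ne_top _), one_mul]

lemma integral_symmetrize_mul_tensorGap {n : ℕ} {f : (Fin n → E) → ℝ}
    (hf : MemLp f 2 (Measure.pi fun _ : Fin n => m)) {h : E → ℝ≥0} (hh : IsTestFun m h) :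
    ∫ ξ, symmetrize f ξ * tensorGap h n ξ ∂(Measure.pi fun _ : Fin n => m) =
      ∫ ξ, f ξ * tensorGap h n ξ ∂(Measure.pi fun _ : Fin n => m) := by
  have h1 : ∀ σ : Equiv.Perm (Fin n),
      ∫ ξ, f (ξ ∘ σ) * tensorGap h n ξ ∂(Measure.pi fun _ : Fin n => m) =
      ∫ ξ, f ξ * tensorGap h n ξ ∂(Measure.pi fun _ : Fin n => m) := by
    intro σ
    have hmp := measurePreserving_comp_perm m σ
    have h2 : AEStronglyMeasurable (fun ξ => f ξ * tensorGap h n ξ)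
        (Measure.pi fun _ : Fin n => m) := hf.1.mul (memLp_tensorGap hh n).1
    rw [← hmp.map_eq] at h2
    have h3 := integral_map hmp.measurable.aemeasurable h2
    rw [hmp.map_eq] at h3
    rw [h3]
    simp only [tensorGap_comp_perm]
  have e : ∀ ξ, symmetrize f ξ * tensorGap h n ξ =
      (n ! : ℝ)⁻¹ * ∑ σ : Equiv.Perm (Fin n), f (ξ ∘ σ) * tensorGap h n ξ := by
    intro ξ; rw [symmetrize, mul_assoc, Finset.sum_mul]
  simp only [e]
  rw [integral_const_mul, integral_finsetSum]
  · simp only [h1, Finset.sum_const, Finset.card_univ, Fintype.card_perm, Fintype.card_fin,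
      nsmul_eq_mul]
    rw [← mul_assoc, inv_mul_cancel₀ (by positivity), one_mul]
  · intro σ _
    exact integrable_mul_of_memLp_two
      (hf.comp_measurePreserving (measurePreserving_comp_perm m σ)) (memLp_tensorGap hh n)

end

/-! ### The derivatives of the wave kernels -/

/-- Insertion of `ξ` in all kernels of a family. -/
def insFam (ξ : JumpSpace) (f : ∀ n : ℕ, ℝ≥0 → ℝ → (Fin n → JumpSpace) → ℝ) (n : ℕ) (t : ℝ≥0)
    (x : ℝ) (η : Fin n → JumpSpace) : ℝ :=
  insKernel ξ (fun n => f n t x) n η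

/-- The forcing `G_{t-r}(x-y) z f_n(r, y; ·)`, `ξ = (r, y, z)`. -/
def pointForcing (ξ : JumpSpace) (f : ∀ n : ℕ, ℝ≥0 → ℝ → (Fin n → JumpSpace) → ℝ) (n : ℕ) (t : ℝ≥0)
    (x : ℝ) (η : Fin n → JumpSpace) : ℝ :=
  pathG t x ξ * ξ.2.2 * f n ξ.1 ξ.2.1 η

/-- The forcing of the wave kernels. -/
def unitForcing (n : ℕ) (_ : ℝ≥0) (_ : ℝ) (_ : Fin n → JumpSpace) : ℝ := if n = 0 then 1 else 0

lemma isForced_waveKernel : IsForced unitForcing (fun n => waveKernel n) where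
  zero t x η := by simp [unitForcing, waveKernel]
  succ n t x η := by simp [unitForcing, waveKernel, pathG]

lemma isMeasurableFamily_unitForcing : IsMeasurableFamily unitForcing := fun _ => measurable_const

lemma IsMeasurableFamily.pointForcing {f : ∀ n : ℕ, ℝ≥0 → ℝ → (Fin n → JumpSpace) → ℝ}
    (hf : IsMeasurableFamily f) (ξ : JumpSpace) : IsMeasurableFamily (pointForcing ξ f) := fun n =>
  ((measurable_pathG.comp (measurable_fst.prodMk measurable_const)).mul_const _).mul
    ((hf.measurable_right n ξ.1 ξ.2.1).comp measurable_snd)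

lemma IsForced.eq_zero_of_le {a f : ∀ n : ℕ, ℝ≥0 → ℝ → (Fin n → JumpSpace) → ℝ}
    (hf : IsForced a f) {r : ℝ≥0} (ha : ∀ n t x η, t ≤ r → a n t x η = 0) (n : ℕ) :
    ∀ t x η, t ≤ r → f n t x η = 0 := by
  induction n with
  | zero => intro t x η h; rw [hf.zero, ha 0 t x η h]
  | succ n ih =>
    intro t x η h
    rw [hf.succ, ha _ t x η h]
    rcases le_total t (η (Fin.last n)).1 with h1 | h1
    · rw [pathG_eq_zero_of_le h1]; simp
    · rw [ih _ _ _ (h1.trans h)]; simp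

lemma init_insertNth_castSucc {E : Type*} {n : ℕ} (k : Fin (n + 1)) (ξ : E) (η : Fin (n + 1) → E) :
    (Fin.init (k.castSucc.insertNth ξ η : Fin (n + 2) → E) : Fin (n + 1) → E) =
      k.insertNth ξ (Fin.init η) := by
  funext i
  rcases Fin.eq_self_or_eq_succAbove k i with rfl | ⟨j, rfl⟩
  · simp [Fin.init]
  · have : (k.succAbove j).castSucc = k.castSucc.succAbove j.castSucc := by simp
    rw [Fin.init, this]
    exact (Fin.insertNth_apply_succAbove (α := fun _ => E) _ _ _ _).trans
      (Fin.insertNth_apply_succAbove (α := fun _ => E) k ξ (Fin.init η) j).symm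

lemma insertNth_castSucc_last {E : Type*} {n : ℕ} (k : Fin (n + 1)) (ξ : E)
    (η : Fin (n + 1) → E) :
    (k.castSucc.insertNth ξ η : Fin (n + 2) → E) (Fin.last (n + 1)) = η (Fin.last n) := by
  have : Fin.last (n + 1) = k.castSucc.succAbove (Fin.last n) := by
    rw [Fin.succAbove_castSucc_of_le _ _ (Fin.le_last k)]; rfl
  rw [this]
  exact Fin.insertNth_apply_succAbove (α := fun _ => E) _ _ _ _

/-- Inserting ξ in the last slot exposes the factor G z of ξ itself and leaves f at its position:
the new forcing. In any other slot the insertion commutes with splitting off the last variable, so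
the recursion is inherited. -/
lemma IsForced.insFam {a f : ∀ n : ℕ, ℝ≥0 → ℝ → (Fin n → JumpSpace) → ℝ} (hf : IsForced a f)
    (ξ : JumpSpace) :
    IsForced (fun n t x η => _root_.insFam ξ a n t x η + pointForcing ξ f n t x η)
      (_root_.insFam ξ f) where
  zero t x η := by
    simp only [_root_.insFam, insKernel, pointForcing, Fin.sum_univ_succ, Fin.sum_univ_zero,
      add_zero]
    rw [hf.succ]
    congr 2
    exact congrArg _ (Subsingleton.elim _ _)
  succ n t x η := by
    simp only [_root_.insFam, insKernel, pointForcing]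
    rw [Fin.sum_univ_castSucc]
    have h1 : ∀ k : Fin (n + 1), f (n + 2) t x (k.castSucc.insertNth ξ η) =
        a (n + 2) t x (k.castSucc.insertNth ξ η) + pathG t x (η (Fin.last n)) *
        (η (Fin.last n)).2.2 * f (n + 1) (η (Fin.last n)).1 (η (Fin.last n)).2.1
          (k.insertNth ξ (Fin.init η)) := by
      intro k
      rw [hf.succ, insertNth_castSucc_last, init_insertNth_castSucc]
    have h2 : f (n + 2) t x ((Fin.last (n + 1)).insertNth ξ η) =
        a (n + 2) t x ((Fin.last (n + 1)).insertNth ξ η) + pathG t x ξ * ξ.2.2 *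
          f (n + 1) ξ.1 ξ.2.1 η := by
      rw [hf.succ]
      simp [Fin.insertNth_last']
    simp only [h1, h2]
    rw [Finset.sum_add_distrib, Fin.sum_univ_castSucc (n := n + 1)
      (f := fun k => a (n + 2) t x (k.insertNth ξ η)), Finset.mul_sum]
    ring

/-- The family of kernels of `D_ξ u`. -/
def waveD (ξ : JumpSpace) : ∀ n : ℕ, ℝ≥0 → ℝ → (Fin n → JumpSpace) → ℝ :=
  insFam ξ fun n => waveKernel n

/-- The family of kernels of `D_ζ D_ξ u`. -/
def waveD2 (ζ ξ : JumpSpace) : ∀ n : ℕ, ℝ≥0 → ℝ → (Fin n → JumpSpace) → ℝ :=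
  insFam ζ (waveD ξ)

/-- Insertion evaluates the unit forcing only at orders n+1 ≥ 1, where it vanishes; only the forcing
at ξ remains. -/
lemma isForced_waveD (ξ : JumpSpace) :
    IsForced (pointForcing ξ fun n => waveKernel n) (waveD ξ) := by
  have h := isForced_waveKernel.insFam ξ
  convert h using 5
  · simp [insFam, insKernel, unitForcing]
  · rfl

lemma waveD_eq_zero_of_le {ξ : JumpSpace} (n : ℕ) {t : ℝ≥0} (x : ℝ) (η : Fin n → JumpSpace)
    (h : t ≤ ξ.1) : waveD ξ n t x η = 0 :=
  (isForced_waveD ξ).eq_zero_of_le (fun n t x η h => by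
    rw [pointForcing, pathG_eq_zero_of_le h]; simp) n t x η h

/-- Of the two forcings, the one at ζ contains `waveD ξ` at a time not later than that of ξ and
vanishes by causality; the other one is the insertion of ζ in the forcing at ξ. -/
lemma isForced_waveD2 {ζ ξ : JumpSpace} (h : ζ.1 ≤ ξ.1) :
    IsForced (pointForcing ξ (waveD ζ)) (waveD2 ζ ξ) := by
  have h1 := (isForced_waveD ξ).insFam ζ
  convert h1 using 5 with n t x η
  · simp only [pointForcing, waveD_eq_zero_of_le n _ _ h, mul_zero, add_zero]
    simp only [waveD, insFam, insKernel, pointForcing, Finset.mul_sum]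
  · rfl

lemma derivKernel_waveChaos (t : ℝ≥0) (x : ℝ) (ξ : JumpSpace) :
    derivKernel (waveChaos t x) ξ = fun n => symmetrize (waveD ξ n t x) :=
  derivKernel_symmetrize (fun n => waveKernel n t x) ξ

lemma derivKernel_derivKernel_waveChaos (t : ℝ≥0) (x : ℝ) (ζ ξ : JumpSpace) :
    derivKernel (derivKernel (waveChaos t x) ξ) ζ = fun n => symmetrize (waveD2 ζ ξ n t x) := by
  rw [derivKernel_waveChaos]
  exact derivKernel_symmetrize (fun n => waveD ξ n t x) ζ

lemma isMeasurableFamily_waveKernel : IsMeasurableFamily fun n => waveKernel n :=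
  isForced_waveKernel.isMeasurableFamily isMeasurableFamily_unitForcing

lemma isMeasurableFamily_waveD (ξ : JumpSpace) : IsMeasurableFamily (waveD ξ) :=
  (isForced_waveD ξ).isMeasurableFamily (isMeasurableFamily_waveKernel.pointForcing ξ)

section

variable {ν : Measure JumpSize} [SigmaFinite ν] {C : ℝ}

lemma kernelEnergy_pointForcing_le (ξ : JumpSpace)
    {f : ∀ n : ℕ, ℝ≥0 → ℝ → (Fin n → JumpSpace) → ℝ} (hf : IsMeasurableFamily f) {n : ℕ} {B : ℝ}
    (hB : kernelEnergy ν f n ξ.1 ξ.2.1 ≤ ENNReal.ofReal B) (t : ℝ≥0) (x : ℝ) :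
    kernelEnergy ν (pointForcing ξ f) n t x ≤ ENNReal.ofReal ((ξ.2.2 : ℝ) ^ 2 * B) := by
  have hm : Measurable fun η => ENNReal.ofReal (f n ξ.1 ξ.2.1 η ^ 2) :=
    ((hf.measurable_right n ξ.1 ξ.2.1).pow_const 2).ennreal_ofReal
  rw [ENNReal.ofReal_mul (by positivity)]
  refine le_trans ?_ (mul_le_mul_right hB _)
  rw [kernelEnergy, kernelEnergy, ← lintegral_const_mul _ hm]
  refine lintegral_mono fun η => ?_
  rw [← ENNReal.ofReal_mul (by positivity)]
  refine ENNReal.ofReal_le_ofReal ?_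
  rw [pointForcing, mul_pow, mul_pow]
  refine mul_le_mul_of_nonneg_right (mul_le_of_le_one_left (by positivity) ?_) (by positivity)
  have h1 := pathG_nonneg t x ξ
  have h2 := pathG_le t x ξ
  nlinarith

lemma kernelEnergy_waveKernel_le (hC : 0 ≤ C) (hν : jumpMoment ν 2 ≤ ENNReal.ofReal (C ^ 2))
    (n : ℕ) (t : ℝ≥0) (x : ℝ) : kernelEnergy ν (fun n => waveKernel n) n t x ≤
      ENNReal.ofReal (2 * ((C * t) ^ (2 * n) / (2 * n)!)) := by
  have h := isForced_waveKernel.kernelEnergy_le (ν := ν) isMeasurableFamily_unitForcing hC le_rfl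
    zero_le_one hν (fun n t x => ?_) n t x
  · simpa using h
  · cases n with
    | zero => simp [kernelEnergy, unitForcing]
    | succ n => simp [kernelEnergy, unitForcing]

/-- The forcing at ξ carries the energy of the wave kernels at time ξ.1, hence R = ξ.1. Each layer
of forcing doubles the constant: 2, then 4 here and 8 for the second derivative. -/
lemma kernelEnergy_waveD_le (hC : 0 ≤ C) (hν : jumpMoment ν 2 ≤ ENNReal.ofReal (C ^ 2))
    (ξ : JumpSpace) (n : ℕ) (t : ℝ≥0) (x : ℝ) : kernelEnergy ν (waveD ξ) n t x ≤
      ENNReal.ofReal (4 * (ξ.2.2 : ℝ) ^ 2 * ((C * (ξ.1 + t)) ^ (2 * n) / (2 * n)!)) := by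
  have h := (isForced_waveD ξ).kernelEnergy_le (ν := ν) (c := 2 * (ξ.2.2 : ℝ) ^ 2) (R := ξ.1)
    (isMeasurableFamily_waveKernel.pointForcing ξ) hC ξ.1.2 (by positivity) hν (fun n t x => ?_) n t x
  · refine h.trans (ENNReal.ofReal_le_ofReal (le_of_eq (by ring)))
  · refine (kernelEnergy_pointForcing_le ξ isMeasurableFamily_waveKernel
      (kernelEnergy_waveKernel_le hC hν n _ _) t x).trans (ENNReal.ofReal_le_ofReal (le_of_eq (by ring)))

lemma kernelEnergy_waveD2_le (hC : 0 ≤ C) (hν : jumpMoment ν 2 ≤ ENNReal.ofReal (C ^ 2))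
    {ζ ξ : JumpSpace} (hζ : ζ.1 ≤ ξ.1) (n : ℕ) (t : ℝ≥0) (x : ℝ) :
    kernelEnergy ν (waveD2 ζ ξ) n t x ≤ ENNReal.ofReal (8 * (ζ.2.2 : ℝ) ^ 2 * (ξ.2.2 : ℝ) ^ 2 *
      ((C * (ζ.1 + ξ.1 + t)) ^ (2 * n) / (2 * n)!)) := by
  have h := (isForced_waveD2 hζ).kernelEnergy_le (ν := ν)
    (c := 4 * (ζ.2.2 : ℝ) ^ 2 * (ξ.2.2 : ℝ) ^ 2) (R := ζ.1 + ξ.1)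
    ((isMeasurableFamily_waveD ζ).pointForcing ξ) hC (add_nonneg ζ.1.2 ξ.1.2) (by positivity) hν
    (fun n t x => ?_) n t x
  · refine h.trans (ENNReal.ofReal_le_ofReal (le_of_eq (by ring)))
  · refine (kernelEnergy_pointForcing_le ξ (isMeasurableFamily_waveD ζ)
      (kernelEnergy_waveD_le hC hν ζ n _ _) t x).trans (ENNReal.ofReal_le_ofReal (le_of_eq (by ring)))

/-- From (n!)² ≤ (2n)!: the decay of the energies leaves a spare n! after the isometry factor n! is
spent. -/
lemma factorial_mul_volterra_le (n : ℕ) (y : ℝ) :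
    (n ! : ℝ) * (y ^ (2 * n) / (2 * n)!) ≤ (y ^ 2) ^ n / n ! := by
  have h1 : n ! * n ! ≤ (2 * n)! := by
    have := Nat.factorial_mul_factorial_dvd_factorial_add n n
    rw [← two_mul] at this
    exact Nat.le_of_dvd (Nat.factorial_pos _) this
  have h1' : (n ! : ℝ) * n ! ≤ (2 * n)! := by exact_mod_cast h1
  have hp : (0 : ℝ) < n ! := by positivity
  rw [← pow_mul, ← mul_div_assoc, div_le_div_iff₀ (by positivity) hp]
  have hy : 0 ≤ y ^ (2 * n) := by rw [pow_mul]; positivity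
  nlinarith

lemma summable_sqrt_factorial_mul_eLpNorm {f : ∀ n : ℕ, ℝ≥0 → ℝ → (Fin n → JumpSpace) → ℝ}
    (hf : IsMeasurableFamily f) {t : ℝ≥0} {x c y : ℝ} (hc : 0 ≤ c)
    (h : ∀ n, kernelEnergy ν f n t x ≤ ENNReal.ofReal (c * (y ^ (2 * n) / (2 * n)!))) :
    Summable fun n => √(n ! : ℝ) * (eLpNorm (symmetrize (f n t x)) 2
      (Measure.pi fun _ : Fin n => intensity ν)).toReal := by
  have hb : ∀ n, √(n ! : ℝ) * (eLpNorm (symmetrize (f n t x)) 2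
      (Measure.pi fun _ : Fin n => intensity ν)).toReal ≤
      c * ((2 * y ^ 2) ^ n / n !) + (1 / 2) ^ n := by
    intro n
    have hL := memLp_two_of_kernelEnergy hf ((h n).trans_lt ENNReal.ofReal_lt_top)
    set q := (eLpNorm (f n t x) 2 (Measure.pi fun _ : Fin n => intensity ν)).toReal with hq
    have hyn : 0 ≤ y ^ (2 * n) := by rw [pow_mul]; positivity
    have h1 : q ^ 2 ≤ c * (y ^ (2 * n) / (2 * n)!) := by
      have := (eLpNorm_sq_eq_kernelEnergy (ν := ν) f n t x).trans_le (h n)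
      have := ENNReal.toReal_mono ENNReal.ofReal_ne_top this
      rwa [ENNReal.toReal_pow, ENNReal.toReal_ofReal (by positivity)] at this
    have h2 : (eLpNorm (symmetrize (f n t x)) 2
        (Measure.pi fun _ : Fin n => intensity ν)).toReal ≤ q :=
      ENNReal.toReal_mono hL.2.ne (eLpNorm_symmetrize_le hL)
    have h3 : (√(n ! : ℝ) * q) ^ 2 ≤ c * ((y ^ 2) ^ n / n !) := by
      rw [mul_pow, Real.sq_sqrt (by positivity)]
      calc (n ! : ℝ) * q ^ 2 ≤ n ! * (c * (y ^ (2 * n) / (2 * n)!)) := by gcongr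
        _ = c * (n ! * (y ^ (2 * n) / (2 * n)!)) := by ring
        _ ≤ _ := by gcongr; exact factorial_mul_volterra_le n y
    -- Weighted arithmetic–geometric mean, to deduce summability of norms from bounds on their
    -- squares; 2^n is harmless against n!.
    have h4 : √(n ! : ℝ) * q ≤ 2 ^ n * (√(n ! : ℝ) * q) ^ 2 + (1 / 2) ^ n := by
      have e : (2 : ℝ) ^ n * (1 / 2) ^ n = 1 := by rw [← mul_pow]; norm_num
      have hp : (0 : ℝ) < (1 / 2) ^ n := by positivity
      have hp2 : (0 : ℝ) < 2 ^ n := by positivity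
      set w := √(n ! : ℝ) * q
      have h5 : 0 ≤ 2 ^ n * (w - (1 / 2) ^ n) ^ 2 := by positivity
      have h6 : 0 ≤ w := by positivity
      have h7 : 2 ^ n * (w - (1 / 2) ^ n) ^ 2 = 2 ^ n * w ^ 2 - 2 * w + (1 / 2) ^ n := by
        have : 2 ^ n * (w - (1 / 2) ^ n) ^ 2 = 2 ^ n * w ^ 2 - 2 * w * (2 ^ n * (1 / 2) ^ n) +
          (1 / 2) ^ n * (2 ^ n * (1 / 2) ^ n) := by ring
        rw [this, e]; ring
      linarith
    calc √(n ! : ℝ) * (eLpNorm (symmetrize (f n t x)) 2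
          (Measure.pi fun _ : Fin n => intensity ν)).toReal ≤ √(n ! : ℝ) * q := by gcongr
      _ ≤ 2 ^ n * (√(n ! : ℝ) * q) ^ 2 + (1 / 2) ^ n := h4
      _ ≤ 2 ^ n * (c * ((y ^ 2) ^ n / n !)) + (1 / 2) ^ n := by gcongr
      _ = c * ((2 * y ^ 2) ^ n / n !) + (1 / 2) ^ n := by rw [mul_pow 2 (y ^ 2) n]; ring
  refine Summable.of_nonneg_of_le (fun n => by positivity) hb ?_
  exact ((Real.summable_pow_div_factorial _).mul_left c).add
    (summable_geometric_of_lt_one (by norm_num) (by norm_num))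

lemma tsum_sq_factorial_mul_eLpNorm_lt_top
    {f : ∀ n : ℕ, ℝ≥0 → ℝ → (Fin n → JumpSpace) → ℝ} (hf : IsMeasurableFamily f) {t : ℝ≥0}
    {x c y : ℝ} (hc : 0 ≤ c)
    (h : ∀ n, kernelEnergy ν f n t x ≤ ENNReal.ofReal (c * (y ^ (2 * n) / (2 * n)!))) :
    ∑' n : ℕ, ((n ^ 2 * n ! : ℕ) : ℝ≥0∞) * eLpNorm (symmetrize (f n t x)) 2
      (Measure.pi fun _ : Fin n => intensity ν) ^ 2 < ∞ := by
  have hb : ∀ n : ℕ, ((n ^ 2 * n ! : ℕ) : ℝ≥0∞) * eLpNorm (symmetrize (f n t x)) 2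
      (Measure.pi fun _ : Fin n => intensity ν) ^ 2 ≤
      ENNReal.ofReal (c * ((4 * y ^ 2) ^ n / n !)) := by
    intro n
    have hL := memLp_two_of_kernelEnergy hf ((h n).trans_lt ENNReal.ofReal_lt_top)
    have h1 : eLpNorm (symmetrize (f n t x)) 2 (Measure.pi fun _ : Fin n => intensity ν) ^ 2 ≤
        ENNReal.ofReal (c * (y ^ (2 * n) / (2 * n)!)) :=
      (pow_le_pow_left' (eLpNorm_symmetrize_le hL) 2).trans
        ((eLpNorm_sq_eq_kernelEnergy (ν := ν) f n t x).trans_le (h n))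
    refine (mul_le_mul_right h1 _).trans ?_
    rw [← ENNReal.ofReal_natCast, ← ENNReal.ofReal_mul (by positivity)]
    refine ENNReal.ofReal_le_ofReal ?_
    have h2 : ((n : ℝ)) ^ 2 ≤ 4 ^ n := by
      have : (n : ℝ) ≤ 2 ^ n := by exact_mod_cast Nat.lt_two_pow_self.le
      calc (n : ℝ) ^ 2 ≤ (2 ^ n) ^ 2 := by gcongr
        _ = 4 ^ n := by rw [← pow_mul, mul_comm n 2, pow_mul]; norm_num
    push_cast
    calc (n : ℝ) ^ 2 * n ! * (c * (y ^ (2 * n) / (2 * n)!)) =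
        (n : ℝ) ^ 2 * (c * (n ! * (y ^ (2 * n) / (2 * n)!))) := by ring
      _ ≤ 4 ^ n * (c * ((y ^ 2) ^ n / n !)) := by
        have := factorial_mul_volterra_le n y
        have hyn : 0 ≤ y ^ (2 * n) := by rw [pow_mul]; positivity
        gcongr
      _ = c * ((4 * y ^ 2) ^ n / n !) := by rw [mul_pow 4 (y ^ 2) n]; ring
  refine (ENNReal.tsum_le_tsum hb).trans_lt ?_
  rw [← ENNReal.ofReal_tsum_of_nonneg (fun n => by positivity)
    ((Real.summable_pow_div_factorial _).mul_left c)]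
  exact ENNReal.ofReal_lt_top

end

end

/-! ### Volterra equations for the pairings of u and v. -/

noncomputable section

/-! ### Pairings of the solutions with exponential functionals -/

section

variable {Ω : Type*} [mΩ : MeasurableSpace Ω] {P : Measure Ω} [IsProbabilityMeasure P]
  {ν : Measure JumpSize} [SigmaFinite ν] {N : Ω → Measure JumpSpace}
  {h : JumpSpace → ℝ≥0} {k : ℕ}

/-- The pairing `E[w(t,x) ε_h]`. -/
def fieldPairing (P : Measure Ω) (N : Ω → Measure JumpSpace) (h : JumpSpace → ℝ≥0)
    (w : ℝ≥0 → ℝ → Ω → ℝ) (t : ℝ≥0) (x : ℝ) : ℝ :=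
  ∫ ω, w t x ω * normExp P N h ω ∂P

/-- The pairing `E[w(t,x) ε_h]` for `t > r`, and zero for `t ≤ r`. -/
def deltaPairing (P : Measure Ω) (N : Ω → Measure JumpSpace) (h : JumpSpace → ℝ≥0) (r : ℝ≥0)
    (w : ℝ≥0 → ℝ → Ω → ℝ) (t : ℝ≥0) (x : ℝ) : ℝ :=
  if r < t then fieldPairing P N h w t x else 0

lemma deltaPairing_of_lt {r : ℝ≥0} {w : ℝ≥0 → ℝ → Ω → ℝ} {t : ℝ≥0} {x : ℝ} (ht : r < t) :
    deltaPairing P N h r w t x = fieldPairing P N h w t x := if_pos ht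

lemma deltaPairing_of_le {r : ℝ≥0} {w : ℝ≥0 → ℝ → Ω → ℝ} {t : ℝ≥0} {x : ℝ} (ht : t ≤ r) :
    deltaPairing P N h r w t x = 0 := if_neg (not_lt.2 ht)

lemma measurable_fieldPairing (hN : IsPoissonRandomMeasure P (intensity ν) N)
    (hh : IsTestFun (intensity ν) h) {w : ℝ≥0 → ℝ → Ω → ℝ} (hw : IsPredictableField P ν N w) :
    Measurable fun q : ℝ≥0 × ℝ => fieldPairing P N h w q.1 q.2 := by
  have h1 : Measurable fun p : (ℝ≥0 × ℝ) × Ω => w p.1.1 p.1.2 p.2 * normExp P N h p.2 :=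
    ((hw.measurable hN).comp (measurable_fst.fst.prodMk
      (measurable_fst.snd.prodMk measurable_snd))).mul
      ((hN.measurable_normExp hh.measurable).comp measurable_snd)
  exact (h1.stronglyMeasurable.integral_prod_right' (ν := P)).measurable

lemma measurable_deltaPairing (hN : IsPoissonRandomMeasure P (intensity ν) N)
    (hh : IsTestFun (intensity ν) h) (r : ℝ≥0) {w : ℝ≥0 → ℝ → Ω → ℝ}
    (hw : IsPredictableField P ν N w) :
    Measurable fun q : ℝ≥0 × ℝ => deltaPairing P N h r w q.1 q.2 :=
  Measurable.ite (measurableSet_lt measurable_const measurable_fst)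
    (measurable_fieldPairing hN hh hw) measurable_const

lemma measurable_weighted_pairing {T : ℝ≥0 → ℝ → ℝ} (hh : IsTestFun (intensity ν) h)
    (hT : Measurable fun q : ℝ≥0 × ℝ => T q.1 q.2) (t : ℝ≥0) (x : ℝ) :
    Measurable fun ξ : JumpSpace => pathG t x ξ * (ξ.2.2 * expGap h ξ * T ξ.1 ξ.2.1) :=
  (measurable_pathG_right t x).mul
    (((measurable_coe_jumpSize.comp measurable_snd.snd).mul (measurable_expGap hh.measurable)).mul
      (hT.comp (measurable_fst.prodMk measurable_snd.fst)))

lemma lintegral_lebTime_sub_lt_top (t : ℝ≥0) :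
    ∫⁻ s, ENNReal.ofReal ((t : ℝ) - s) ∂lebTime < ∞ := by
  have := lintegral_lebTime_sub_mul_pow_le t le_rfl 0
  simp only [Nat.mul_zero, pow_zero, ENNReal.ofReal_one, mul_one] at this
  exact this.trans_lt ENNReal.ofReal_lt_top

lemma integrable_weighted_pairing (hν : jumpMoment ν 2 < ∞) (hh : IsTestFun (intensity ν) h)
    (hk : Function.support h ⊆ jumpBox ν k) {T : ℝ≥0 → ℝ → ℝ}
    (hT : Measurable fun q : ℝ≥0 × ℝ => T q.1 q.2) {t : ℝ≥0} {x c : ℝ}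
    (hTc : ∀ (s : ℝ≥0) y, |x - y| < (t : ℝ) - s → |T s y| ≤ c) :
    Integrable (fun ξ : JumpSpace => pathG t x ξ * (ξ.2.2 * expGap h ξ * T ξ.1 ξ.2.1))
      (intensity ν) := by
  refine ⟨(measurable_weighted_pairing hh hT t x).aestronglyMeasurable, ?_⟩
  obtain ⟨C, -, hC⟩ := exists_lintegral_boxWeight_le hν k
  refine lt_of_le_of_lt (b := ∫⁻ ξ, ENNReal.ofReal (pathG t x ξ) *
    (boxWeight ν k ξ.2.2 * ENNReal.ofReal c) ∂(intensity ν)) ?_ ?_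
  · refine lintegral_mono fun ξ => ?_
    rw [← ofReal_norm, Real.norm_eq_abs, abs_mul, abs_mul, abs_of_nonneg (pathG_nonneg _ _ _),
      ENNReal.ofReal_mul (pathG_nonneg _ _ _), ENNReal.ofReal_mul (abs_nonneg _)]
    by_cases hG : pathG t x ξ = 0
    · simp [hG]
    · exact mul_le_mul_right (mul_le_mul' (ofReal_abs_mul_expGap_le hk ξ)
        (ENNReal.ofReal_le_ofReal (hTc _ _ (waveG_ne_zero_iff.1 hG)))) _
  · rw [lintegral_pathG_mul (measurable_boxWeight k) measurable_const,
      lintegral_mul_const _ (by fun_prop)]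
    exact ENNReal.mul_lt_top (hC.trans_lt ENNReal.ofReal_lt_top)
      (ENNReal.mul_lt_top (lintegral_lebTime_sub_lt_top t) ENNReal.ofReal_lt_top)

lemma IsItoIntegral.integrable_pairing (hN : IsPoissonRandomMeasure P (intensity ν) N)
    {V : JumpSpace × Ω → ℝ} {X : Ω → ℝ} (hX : IsItoIntegral P ν N V X)
    (hh : IsTestFun (intensity ν) h) :
    Integrable (fun ξ => expGap h ξ * ∫ ω, V (ξ, ω) * normExp P N h ω ∂P) (intensity ν) := by
  have hg : MemLp (fun p : JumpSpace × Ω => expGap h p.1 * normExp P N h p.2) 2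
      ((intensity ν).prod P) := by
    have hm : Measurable fun p : JumpSpace × Ω => expGap h p.1 * normExp P N h p.2 :=
      ((measurable_expGap hh.measurable).comp measurable_fst).mul
        ((hN.measurable_normExp hh.measurable).comp measurable_snd)
    rw [memLp_two_iff_integrable_sq hm.aestronglyMeasurable]
    refine (((memLp_two_iff_integrable_sq (memLp_expGap hh).1).1 (memLp_expGap hh)).mul_prod
      ((memLp_two_iff_integrable_sq (hN.memLp_normExp hh.measurable 2).1).1
        (hN.memLp_normExp hh.measurable 2))).congr (Eventually.of_forall fun p => ?_)
    simp only
    ring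
  have h1 := (integrable_mul_of_memLp_two hX.1 hg).integral_prod_left
  refine h1.congr (Eventually.of_forall fun ξ => ?_)
  simp only
  rw [← integral_const_mul]
  congr 1; ext ω
  ring

namespace IsWaveSolution

variable {u : ℝ≥0 → ℝ → Ω → ℝ}

lemma memLp (hu : IsWaveSolution P ν N u) (hN : IsPoissonRandomMeasure P (intensity ν) N)
    (t : ℝ≥0) (x : ℝ) : MemLp (u t x) 2 P := by
  obtain ⟨K, hK⟩ := hu.bounded t
  refine ⟨?_, (hK t le_rfl x).trans_lt ENNReal.coe_lt_top⟩
  exact ((hu.predictable.measurable hN).comp (measurable_const.prodMk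
    (measurable_const.prodMk measurable_id) : Measurable fun ω => (t, x, ω))).aestronglyMeasurable

lemma fieldPairing_eq (hu : IsWaveSolution P ν N u)
    (hN : IsPoissonRandomMeasure P (intensity ν) N) (hh : IsTestFun (intensity ν) h) (t : ℝ≥0)
    (x : ℝ) : fieldPairing P N h u t x = 1 + ∫ ξ, pathG t x ξ *
      (ξ.2.2 * expGap h ξ * fieldPairing P N h u ξ.1 ξ.2.1) ∂(intensity ν) := by
  rcases eq_or_lt_of_le (zero_le (a := t)) with rfl | ht
  · have e : ∀ ξ : JumpSpace, pathG 0 x ξ = 0 := fun ξ => pathG_eq_zero_of_le zero_le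
    simp only [e, zero_mul, integral_zero, add_zero]
    rw [fieldPairing, integral_congr_ae (g := normExp P N h), hN.integral_normExp hh.measurable]
    filter_upwards [hu.initial x] with ω hω
    rw [hω, one_mul]
  · obtain ⟨I, hI, hu1⟩ := hu.mild t ht x
    have hε := hN.memLp_normExp hh.measurable 2
    have e1 : fieldPairing P N h u t x =
        ∫ ω, (normExp P N h ω + I ω * normExp P N h ω) ∂P := by
      refine integral_congr_ae ?_
      filter_upwards [hu1] with ω hω
      rw [hω]; ring
    rw [e1, integral_add (hε.integrable (by norm_num)) (integrable_mul_of_memLp_two hI.2.1 hε),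
      hN.integral_normExp hh.measurable, hI.integral_mul_normExp hN hh]
    congr 2; ext ξ
    rw [fieldPairing, ← integral_const_mul, ← integral_const_mul, ← integral_const_mul]
    congr 1; ext ω
    simp only [pathG]; ring

/-- The pairings of `u` are the sums of the pairings of the wave kernels, with a uniform rate on
backward light cones. -/
lemma exists_abs_fieldPairing_sub_le (hu : IsWaveSolution P ν N u)
    (hN : IsPoissonRandomMeasure P (intensity ν) N) (hν : jumpMoment ν 2 < ∞)
    (hh : IsTestFun (intensity ν) h) (hk : Function.support h ⊆ jumpBox ν k) {C : ℝ} (hC : 0 ≤ C)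
    (hCk : ∫⁻ z, boxWeight ν k z ∂ν ≤ ENNReal.ofReal (C ^ 2)) (t : ℝ≥0) (x : ℝ) :
    ∃ c : ℝ, 0 ≤ c ∧ ∀ M : ℕ, |fieldPairing P N h u t x - ∑ n ∈ Finset.range M,
      kernelPairing ν h (fun n => waveKernel n) n t x| ≤ c * ((C * t) ^ (2 * M) / (2 * M)!) := by
  obtain ⟨K, hK⟩ := hu.bounded t
  have hε := hN.memLp_normExp hh.measurable 2
  -- The first term bounds the pairing by Cauchy–Schwarz; the 1 bounds the forcing when M = 0. For
  -- larger M the forcing is matched exactly by its first kernel, so R = 0 is allowed.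
  let c : ℝ := K * (eLpNorm (normExp P N h) 2 P).toReal + 1
  have hc : 0 ≤ c := by positivity
  have hbd : ∀ s y, (s, y) ∈ pastCone t x → |fieldPairing P N h u s y| ≤ c := by
    intro s y hsy
    have hst : s ≤ t := by
      have : (0 : ℝ) ≤ t - s := (abs_nonneg _).trans hsy
      exact NNReal.coe_le_coe.1 (by linarith)
    refine (abs_integral_mul_le_of_memLp_two (hu.memLp hN s y) hε).trans ?_
    have h1 : (eLpNorm (u s y) 2 P).toReal ≤ K := by
      have := ENNReal.toReal_mono ENNReal.coe_ne_top (hK s hst y)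
      simpa using this
    have := mul_le_mul_of_nonneg_right h1
      (ENNReal.toReal_nonneg (a := eLpNorm (normExp P N h) 2 P))
    linarith
  have hm := measurable_fieldPairing hN hh hu.predictable
  obtain ⟨C₀, hC₀, hC₀ν⟩ : ∃ C₀ : ℝ, 0 ≤ C₀ ∧ jumpMoment ν 2 ≤ ENNReal.ofReal (C₀ ^ 2) :=
    ⟨√(jumpMoment ν 2).toReal, Real.sqrt_nonneg _, by
      rw [Real.sq_sqrt ENNReal.toReal_nonneg, ENNReal.ofReal_toReal hν.ne]⟩
  refine ⟨c, hc, fun M => ?_⟩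
  have hpc := isPastClosed_pastCone t x
  have main := isForced_waveKernel.abs_sub_sum_kernelPairing_le (ν := ν)
    isMeasurableFamily_unitForcing hh hk
    (fun n t x => (kernelEnergy_waveKernel_le hC₀ hC₀ν n t x).trans_lt ENNReal.ofReal_lt_top)
    (fun n t x => ?_) hC le_rfl hc hCk hpc hbd
    (fun s y hsy => integrable_weighted_pairing hν hh hk hm fun s' y' h' =>
      hbd s' y' (hpc s y s' y' hsy h'))
    (A := fun _ _ => 1) (fun s y _ => hu.fieldPairing_eq hN hh s y) (fun M s y _ => ?_) M t x
    (mem_pastCone_self t x)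
  · simpa using main
  · cases n <;> simp [kernelEnergy, unitForcing]
  · have e : ∀ n, kernelPairing ν h unitForcing n s y = if n = 0 then 1 else 0 := by
      intro n
      cases n with
      | zero => simp [kernelPairing, unitForcing, tensorGap, Measure.real]
      | succ n => simp [kernelPairing, unitForcing]
    simp only [e]
    cases M with
    | zero => simp [c]; positivity
    | succ M => simp

end IsWaveSolution

namespace IsDeltaWaveSolution

variable {ξ : JumpSpace} {v : ℝ≥0 → ℝ → Ω → ℝ}

lemma memLp (hv : IsDeltaWaveSolution P ν N ξ v) {t : ℝ≥0} (ht : ξ.1 ≤ t) (x : ℝ) :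
    MemLp (v t x) 2 P := by
  rcases eq_or_lt_of_le ht with rfl | ht
  · exact (memLp_congr_ae (hv.initial x)).2 (memLp_const 0)
  · obtain ⟨I, hI, h1⟩ := hv.mild t ht x
    have h2 : MemLp (fun _ : Ω => waveG ((t : ℝ) - ξ.1) (x - ξ.2.1) * ξ.2.2) 2 P := memLp_const _
    exact (memLp_congr_ae h1).2 (h2.add hI.2.1)

lemma fieldPairing_eq_deltaPairing (hv : IsDeltaWaveSolution P ν N ξ v) {t : ℝ≥0}
    (ht : ξ.1 ≤ t) (x : ℝ) : fieldPairing P N h v t x = deltaPairing P N h ξ.1 v t x := by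
  rcases eq_or_lt_of_le ht with h1 | h1
  · rw [deltaPairing_of_le h1.ge, fieldPairing, integral_congr_ae (g := 0)]
    · simp
    · rw [← h1]
      filter_upwards [hv.initial x] with ω hω
      simp [hω]
  · rw [deltaPairing_of_lt h1]

/-- Declaring the pairing zero up to time r absorbs the restriction of the integral to times after
r. The equation then holds at all times; for t ≤ r both sides vanish. -/
lemma deltaPairing_eq (hv : IsDeltaWaveSolution P ν N ξ v)
    (hN : IsPoissonRandomMeasure P (intensity ν) N) (hh : IsTestFun (intensity ν) h) (t : ℝ≥0)
    (x : ℝ) : deltaPairing P N h ξ.1 v t x = pathG t x ξ * ξ.2.2 + ∫ ζ, pathG t x ζ *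
      (ζ.2.2 * expGap h ζ * deltaPairing P N h ξ.1 v ζ.1 ζ.2.1) ∂(intensity ν) := by
  rcases le_or_gt t ξ.1 with ht | ht
  · have e : ∀ ζ : JumpSpace, pathG t x ζ *
        (ζ.2.2 * expGap h ζ * deltaPairing P N h ξ.1 v ζ.1 ζ.2.1) = 0 := fun ζ => by
      rcases le_total t ζ.1 with h1 | h1
      · rw [pathG_eq_zero_of_le h1, zero_mul]
      · rw [deltaPairing_of_le (h1.trans ht)]; simp
    simp only [e]
    rw [deltaPairing_of_le ht, pathG_eq_zero_of_le ht]
    simp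
  · obtain ⟨I, hI, hv1⟩ := hv.mild t ht x
    have hε := hN.memLp_normExp hh.measurable 2
    have e1 : fieldPairing P N h v t x =
        ∫ ω, (pathG t x ξ * ξ.2.2 * normExp P N h ω + I ω * normExp P N h ω) ∂P := by
      refine integral_congr_ae ?_
      filter_upwards [hv1] with ω hω
      rw [hω, pathG]; ring
    rw [deltaPairing_of_lt ht, e1, integral_add ((hε.integrable (by norm_num)).const_mul _)
      (integrable_mul_of_memLp_two hI.2.1 hε), integral_const_mul,
      hN.integral_normExp hh.measurable, mul_one, hI.integral_mul_normExp hN hh]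
    congr 2; ext ζ
    rcases le_or_gt ζ.1 ξ.1 with h1 | h1
    · have h2 : ζ.1 ∉ Ioi ξ.1 := not_lt.2 h1
      rw [deltaPairing_of_le h1]
      simp [h2]
    · have h2 : ζ.1 ∈ Ioi ξ.1 := h1
      rw [deltaPairing_of_lt h1, fieldPairing, ← integral_const_mul, ← integral_const_mul,
        ← integral_const_mul]
      congr 1; ext ω
      simp only [h2, indicator_of_mem, pathG]; ring

/-- Backward light cones are nested and G is constant on its cone, so what holds at the apex
dominates everything inside. -/
lemma pathG_le_of_mem_pastCone {t s : ℝ≥0} {x y : ℝ} (hsy : (s, y) ∈ pastCone t x)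
    (ζ : JumpSpace) : pathG s y ζ ≤ pathG t x ζ := by
  by_cases hG : pathG s y ζ = 0
  · rw [hG]; exact pathG_nonneg _ _ _
  · have h1 : |y - ζ.2.1| < (s : ℝ) - ζ.1 := waveG_ne_zero_iff.1 hG
    have h2 : |x - y| ≤ (t : ℝ) - s := hsy
    have h3 : |x - ζ.2.1| < (t : ℝ) - ζ.1 := by
      calc |x - ζ.2.1| = |(x - y) + (y - ζ.2.1)| := by ring_nf
        _ ≤ |x - y| + |y - ζ.2.1| := abs_add_le _ _
        _ < _ := by linarith
    simp only [pathG, waveG, h1, h3, if_true, le_refl]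

/-- On a backward light cone the pairings of `v` are bounded and the Volterra integral
converges. -/
lemma exists_bound (hv : IsDeltaWaveSolution P ν N ξ v)
    (hN : IsPoissonRandomMeasure P (intensity ν) N) (hh : IsTestFun (intensity ν) h) (t : ℝ≥0)
    (x : ℝ) : ∃ c : ℝ, 0 ≤ c ∧ ∀ s y, (s, y) ∈ pastCone t x →
      |deltaPairing P N h ξ.1 v s y| ≤ c ∧ Integrable (fun ζ => pathG s y ζ *
        (ζ.2.2 * expGap h ζ * deltaPairing P N h ξ.1 v ζ.1 ζ.2.1)) (intensity ν) := by
  have hm := measurable_deltaPairing hN hh ξ.1 hv.predictable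
  -- No moment bound on v is assumed. Existence of the Itô integral at the apex (t,x) supplies one
  -- integrable majorant, valid at all points of its cone.
  obtain ⟨b, hb, hle⟩ : ∃ b : JumpSpace → ℝ, Integrable b (intensity ν) ∧ ∀ ζ,
      |pathG t x ζ * (ζ.2.2 * expGap h ζ * deltaPairing P N h ξ.1 v ζ.1 ζ.2.1)| ≤ b ζ := by
    rcases le_or_gt t ξ.1 with ht | ht
    · refine ⟨0, integrable_zero _ _ _, fun ζ => ?_⟩
      rcases le_total t ζ.1 with h1 | h1
      · simp [pathG_eq_zero_of_le h1]
      · simp [deltaPairing_of_le (h1.trans ht)]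
    · obtain ⟨I, hI, hv1⟩ := hv.mild t ht x
      refine ⟨_, (hI.integrable_pairing hN hh).norm, fun ζ => ?_⟩
      rcases le_or_gt ζ.1 ξ.1 with h1 | h1
      · simp only [deltaPairing_of_le h1, mul_zero, abs_zero, norm_nonneg]
      · have h2 : ζ.1 ∈ Ioi ξ.1 := h1
        rw [deltaPairing_of_lt h1, fieldPairing, Real.norm_eq_abs, ← integral_const_mul,
          ← integral_const_mul, ← integral_const_mul]
        refine le_of_eq (congrArg _ ?_)
        congr 1; ext ω
        simp only [h2, indicator_of_mem, pathG]; ring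
  have hdom : ∀ s y, (s, y) ∈ pastCone t x → ∀ ζ : JumpSpace, ‖pathG s y ζ *
      (ζ.2.2 * expGap h ζ * deltaPairing P N h ξ.1 v ζ.1 ζ.2.1)‖ ≤ b ζ := by
    intro s y hsy ζ
    refine le_trans ?_ (hle ζ)
    rw [Real.norm_eq_abs, abs_mul, abs_mul (pathG t x ζ), abs_of_nonneg (pathG_nonneg _ _ _),
      abs_of_nonneg (pathG_nonneg _ _ _)]
    exact mul_le_mul_of_nonneg_right (pathG_le_of_mem_pastCone hsy ζ) (abs_nonneg _)
  have hb0 : 0 ≤ ∫ ζ, b ζ ∂(intensity ν) := integral_nonneg fun ζ => (abs_nonneg _).trans (hle ζ)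
  refine ⟨|(ξ.2.2 : ℝ)| + ∫ ζ, b ζ ∂(intensity ν), by positivity, fun s y hsy => ⟨?_, ?_⟩⟩
  · rw [hv.deltaPairing_eq hN hh s y]
    refine (abs_add_le _ _).trans (add_le_add ?_ ?_)
    · rw [abs_mul, abs_of_nonneg (pathG_nonneg _ _ _)]
      exact mul_le_of_le_one_left (abs_nonneg _) ((pathG_le _ _ _).trans (by norm_num))
    · exact norm_integral_le_of_norm_le hb (Eventually.of_forall (hdom s y hsy))
  · exact hb.mono' (measurable_weighted_pairing hh hm s y).aestronglyMeasurable
      (Eventually.of_forall (hdom s y hsy))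

/-- The pairing of `v` only depends on the test function after time `r`. -/
lemma deltaPairing_indicator (hv : IsDeltaWaveSolution P ν N ξ v)
    (hN : IsPoissonRandomMeasure P (intensity ν) N) (hν : jumpMoment ν 2 < ∞)
    (hh : IsTestFun (intensity ν) h)
    (hk : Function.support h ⊆ jumpBox ν k) (t : ℝ≥0) (x : ℝ) :
    deltaPairing P N h ξ.1 v t x = deltaPairing P N ((timeLE ξ.1)ᶜ.indicator h) ξ.1 v t x := by
  have hh' := hh.indicator (measurableSet_timeLE ξ.1).compl
  obtain ⟨c, hc, hcb⟩ := hv.exists_bound hN hh t x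
  obtain ⟨c', hc', hcb'⟩ := hv.exists_bound hN hh' t x
  -- Changing the test function up to time r has no effect in the equation, because the pairing is
  -- zero there.
  have e : ∀ s y (ζ : JumpSpace), pathG s y ζ * (ζ.2.2 *
      expGap ((timeLE ξ.1)ᶜ.indicator h) ζ *
        deltaPairing P N ((timeLE ξ.1)ᶜ.indicator h) ξ.1 v ζ.1 ζ.2.1) =
      pathG s y ζ * (ζ.2.2 * expGap h ζ *
        deltaPairing P N ((timeLE ξ.1)ᶜ.indicator h) ξ.1 v ζ.1 ζ.2.1) := by
    intro s y ζ
    by_cases h1 : ζ.1 ≤ ξ.1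
    · simp [deltaPairing_of_le h1]
    · have : ζ ∈ (timeLE ξ.1)ᶜ := h1
      simp only [expGap, indicator_of_mem this]
  simp only [e] at hcb'
  obtain ⟨C, hC, hCk⟩ := exists_lintegral_boxWeight_le hν k
  have hz : IsForced (fun _ _ _ _ => 0) (fun _ _ _ _ => 0) := ⟨fun _ _ _ => rfl, fun _ _ _ _ => by simp⟩
  -- The difference solves the homogeneous equation, so the iteration applies with zero kernels and
  -- zero forcing and forces T to vanish.
  let T : ℝ≥0 → ℝ → ℝ := fun s y => deltaPairing P N h ξ.1 v s y -
    deltaPairing P N ((timeLE ξ.1)ᶜ.indicator h) ξ.1 v s y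
  have e3 : ∀ s y (ζ : JumpSpace), pathG s y ζ * (ζ.2.2 * expGap h ζ * T ζ.1 ζ.2.1) =
      pathG s y ζ * (ζ.2.2 * expGap h ζ * deltaPairing P N h ξ.1 v ζ.1 ζ.2.1) -
      pathG s y ζ * (ζ.2.2 * expGap h ζ *
        deltaPairing P N ((timeLE ξ.1)ᶜ.indicator h) ξ.1 v ζ.1 ζ.2.1) := fun s y ζ => by
    simp only [T]; ring
  have main : ∀ M : ℕ, |T t x| ≤ (c + c') * ((C * (0 + t)) ^ (2 * M) / (2 * M)!) := by
    intro M
    have := hz.abs_sub_sum_kernelPairing_le (ν := ν) (T := T) (A := fun _ _ => 0)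
      (fun _ => measurable_const) hh hk (fun _ _ _ => by simp [kernelEnergy])
      (fun _ _ _ => by simp [kernelEnergy]) hC le_rfl (add_nonneg hc hc') hCk
      (isPastClosed_pastCone t x) (fun s y hsy => ?_) (fun s y hsy => ?_) (fun s y hsy => ?_)
      (fun M s y _ => ?_) M t x (mem_pastCone_self t x)
    · simpa [kernelPairing] using this
    · exact (abs_sub _ _).trans (add_le_add (hcb s y hsy).1 (hcb' s y hsy).1)
    · simp only [e3]
      exact (hcb s y hsy).2.sub (hcb' s y hsy).2
    · simp only [e3]
      rw [integral_sub (hcb s y hsy).2 (hcb' s y hsy).2]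
      have h1 := hv.deltaPairing_eq hN hh s y
      have h2 := hv.deltaPairing_eq hN hh' s y
      simp only [e] at h2
      simp only [T]
      linarith
    · simp [kernelPairing]; positivity
  have h0 : |T t x| ≤ 0 := ge_of_tendsto (tendsto_volterra_bound (c + c') (C * (0 + t)))
    (Eventually.of_forall main)
  exact sub_eq_zero.1 (abs_nonpos_iff.1 h0)

/-- `v(t,x)` is a functional of the noise in the time interval `(r, t]`. -/
lemma aestronglyMeasurable_restrictSigma (hv : IsDeltaWaveSolution P ν N ξ v)
    (hN : IsPoissonRandomMeasure P (intensity ν) N) (hν : jumpMoment ν 2 < ∞) {t : ℝ≥0}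
    (ht : ξ.1 ≤ t) (x : ℝ) :
    AEStronglyMeasurable[restrictSigma N ((timeLE ξ.1)ᶜ ∩ timeLE t)] (v t x) P := by
  have h1 := hv.predictable.aestronglyMeasurable_restrictSigma t x
  have hS := isExhaustion_jumpBox ν
  refine hN.aestronglyMeasurable_restrictSigma_of_forall hS.measurableSet hS.monotone hS.iUnion
    hS.ne_top ((hv.memLp ht x).integrable (by norm_num))
    (h1.mono (restrictSigma_mono N (measurableSet_timeLE t) (subset_univ _)))
    ((measurableSet_timeLE ξ.1).compl.inter (measurableSet_timeLE t)) ?_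
  rintro h hh ⟨k, hk⟩
  -- The test function is cut twice: after time t by adaptedness of v, and up to time r by
  -- `deltaPairing_indicator`.
  have hh' := hh.indicator (measurableSet_timeLE t)
  rw [hN.integral_mul_normExp_indicator hh (measurableSet_timeLE t) h1]
  have hk' : Function.support ((timeLE t).indicator h) ⊆ jumpBox ν k := fun ζ hζ =>
    hk (by
      rw [Function.mem_support] at hζ ⊢
      exact fun h0 => hζ (by simp [indicator, h0]))
  have h2 := hv.deltaPairing_indicator hN hν hh' hk' t x
  rw [← hv.fieldPairing_eq_deltaPairing ht, ← hv.fieldPairing_eq_deltaPairing ht,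
    indicator_indicator] at h2
  exact h2

/-- The multiplication step: the pairing of a variable with kernels `f(ξ)` times the pairing of
`v` is the sum of the pairings of the kernels forced by `f` at `ξ`. -/
lemma exists_abs_mul_deltaPairing_sub_le (hv : IsDeltaWaveSolution P ν N ξ v)
    (hN : IsPoissonRandomMeasure P (intensity ν) N)
    (hh : IsTestFun (intensity ν) h) (hk : Function.support h ⊆ jumpBox ν k) {C R c₁ : ℝ}
    (hC : 0 ≤ C) (hR : 0 ≤ R) (hc₁ : 0 ≤ c₁)
    (hCk : ∫⁻ z, boxWeight ν k z ∂ν ≤ ENNReal.ofReal (C ^ 2))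
    {f g : ∀ n : ℕ, ℝ≥0 → ℝ → (Fin n → JumpSpace) → ℝ} (hf : IsMeasurableFamily f)
    (hg : IsForced (pointForcing ξ f) g) (hfL : ∀ n t x, kernelEnergy ν f n t x < ∞)
    (hgL : ∀ n t x, kernelEnergy ν g n t x < ∞) {b : ℝ}
    (hb : ∀ M : ℕ, |b - ∑ n ∈ Finset.range M, kernelPairing ν h f n ξ.1 ξ.2.1| ≤
      c₁ * ((C * R) ^ (2 * M) / (2 * M)!)) (t : ℝ≥0) (x : ℝ) :
    ∃ c : ℝ, 0 ≤ c ∧ ∀ M : ℕ, |b * deltaPairing P N h ξ.1 v t x -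
      ∑ n ∈ Finset.range M, kernelPairing ν h g n t x| ≤
        c * ((C * (R + t)) ^ (2 * M) / (2 * M)!) := by
  obtain ⟨c₂, hc₂, hcb⟩ := hv.exists_bound hN hh t x
  -- The first summand controls the error of the forcing, the second bounds the solution b times the
  -- pairing of v.
  let c : ℝ := |(ξ.2.2 : ℝ)| * c₁ + |b| * c₂
  refine ⟨c, by positivity, fun M => ?_⟩
  have e : ∀ s y (ζ : JumpSpace), pathG s y ζ * (ζ.2.2 * expGap h ζ *
      (b * deltaPairing P N h ξ.1 v ζ.1 ζ.2.1)) = b * (pathG s y ζ * (ζ.2.2 * expGap h ζ *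
        deltaPairing P N h ξ.1 v ζ.1 ζ.2.1)) := fun s y ζ => by ring
  refine hg.abs_sub_sum_kernelPairing_le (ν := ν)
    (T := fun s y => b * deltaPairing P N h ξ.1 v s y) (A := fun s y => b * (pathG s y ξ * ξ.2.2))
    (hf.pointForcing ξ) hh hk hgL (fun n s y => ?_) hC hR (by positivity) hCk
    (isPastClosed_pastCone t x) (fun s y hsy => ?_) (fun s y hsy => ?_) (fun s y hsy => ?_)
    (fun M s y _ => ?_) M t x (mem_pastCone_self t x)
  · exact (kernelEnergy_pointForcing_le ξ hf (ENNReal.ofReal_toReal (hfL n ξ.1 ξ.2.1).ne).ge s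
      y).trans_lt ENNReal.ofReal_lt_top
  · rw [abs_mul]
    have := mul_le_mul_of_nonneg_left (hcb s y hsy).1 (abs_nonneg b)
    have h3 : 0 ≤ |(ξ.2.2 : ℝ)| * c₁ := by positivity
    simp only [c]; linarith
  · simp only [e]
    exact (hcb s y hsy).2.const_mul b
  · simp only [e]
    rw [integral_const_mul, hv.deltaPairing_eq hN hh s y]
    ring
  · have e2 : ∀ n, kernelPairing ν h (pointForcing ξ f) n s y =
        pathG s y ξ * ξ.2.2 * kernelPairing ν h f n ξ.1 ξ.2.1 := by
      intro n
      rw [kernelPairing, kernelPairing, ← integral_const_mul]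
      congr 1; ext η
      rw [pointForcing]; ring
    simp only [e2]
    rw [← Finset.mul_sum, mul_comm b, ← mul_sub, abs_mul, abs_mul,
      abs_of_nonneg (pathG_nonneg _ _ _)]
    have hq : 0 ≤ (C * R) ^ (2 * M) / (2 * M)! := by positivity
    calc pathG s y ξ * |(ξ.2.2 : ℝ)| * |b - ∑ n ∈ Finset.range M, kernelPairing ν h f n ξ.1 ξ.2.1|
        ≤ 1 * |(ξ.2.2 : ℝ)| * (c₁ * ((C * R) ^ (2 * M) / (2 * M)!)) := by
          gcongr
          · exact (pathG_le _ _ _).trans (by norm_num)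
          · exact hb M
      _ = |(ξ.2.2 : ℝ)| * c₁ * ((C * R) ^ (2 * M) / (2 * M)!) := by ring
      _ ≤ c * ((C * R) ^ (2 * M) / (2 * M)!) := by
          refine mul_le_mul_of_nonneg_right ?_ hq
          have : 0 ≤ |b| * c₂ := by positivity
          simp only [c]; linarith

end IsDeltaWaveSolution

end

end

/-! ### Identification of the derivatives: parts (i) and (ii). -/

noncomputable section

/-! ### Independence and products -/

section

variable {Ω : Type*} {mΩ : MeasurableSpace Ω} {P : Measure Ω} [IsProbabilityMeasure P]

lemma memLp_two_mul_of_indepFun {X Y : Ω → ℝ} (hXY : IndepFun X Y P) (hX : MemLp X 2 P)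
    (hY : MemLp Y 2 P) : MemLp (fun ω => X ω * Y ω) 2 P := by
  have hm : AEStronglyMeasurable (fun ω => X ω * Y ω) P := hX.1.mul hY.1
  rw [memLp_two_iff_integrable_sq hm]
  have h1 : IndepFun (fun ω => X ω ^ 2) (fun ω => Y ω ^ 2) P :=
    hXY.comp (measurable_id.pow_const 2) (measurable_id.pow_const 2)
  refine (h1.integrable_mul ((memLp_two_iff_integrable_sq hX.1).1 hX)
    ((memLp_two_iff_integrable_sq hY.1).1 hY)).congr (Eventually.of_forall fun ω => ?_)
  simp [mul_pow]

/-- Joint independence from two pairwise statements: the third variable is independent of a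
σ-algebra that contains the first two. -/
lemma iIndepFun_fin_three {m₁ m₂ m₁₂ m₃ : MeasurableSpace Ω} (h₁ : m₁ ≤ m₁₂) (h₂ : m₂ ≤ m₁₂)
    (hi : Indep m₁ m₂ P) (hi' : Indep m₁₂ m₃ P) {X Y Z : Ω → ℝ}
    (hX : AEStronglyMeasurable[m₁] X P) (hY : AEStronglyMeasurable[m₂] Y P)
    (hZ : AEStronglyMeasurable[m₃] Z P) : iIndepFun ![X, Y, Z] P := by
  obtain ⟨X', hX', eX⟩ := hX
  obtain ⟨Y', hY', eY⟩ := hY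
  obtain ⟨Z', hZ', eZ⟩ := hZ
  have main : iIndepFun ![X', Y', Z'] P := by
    rw [iIndepFun_iff_measure_inter_preimage_eq_mul]
    intro S A hA
    -- Filling the missing indices with the whole line reduces every subfamily to the full triple.
    have hA' : ∃ A' : Fin 3 → Set ℝ, (∀ i, MeasurableSet (A' i)) ∧ (∀ i ∈ S, A' i = A i) ∧
        ∀ i ∉ S, A' i = univ := by
      classical
      refine ⟨fun i => if i ∈ S then A i else univ, fun i => ?_, fun i hi => if_pos hi,
        fun i hi => if_neg hi⟩
      by_cases h : i ∈ S
      · simpa [h] using hA i h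
      · simp [h]
    obtain ⟨A', hA'm, hA1, hA2⟩ := hA'
    have e1 : ⋂ i ∈ S, ![X', Y', Z'] i ⁻¹' A i = (X' ⁻¹' A' 0 ∩ Y' ⁻¹' A' 1) ∩ Z' ⁻¹' A' 2 := by
      have : ⋂ i ∈ S, ![X', Y', Z'] i ⁻¹' A i = ⋂ i, ![X', Y', Z'] i ⁻¹' A' i := by
        ext ω
        simp only [mem_iInter, mem_preimage]
        refine ⟨fun h i => ?_, fun h i hi => hA1 i hi ▸ h i⟩
        by_cases hi : i ∈ S
        · rw [hA1 i hi]; exact h i hi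
        · rw [hA2 i hi]; trivial
      rw [this]
      ext ω
      simp [Fin.forall_fin_succ, and_assoc]
    have e2 : ∏ i ∈ S, P (![X', Y', Z'] i ⁻¹' A i) =
        P (X' ⁻¹' A' 0) * P (Y' ⁻¹' A' 1) * P (Z' ⁻¹' A' 2) := by
      have : ∏ i ∈ S, P (![X', Y', Z'] i ⁻¹' A i) = ∏ i, P (![X', Y', Z'] i ⁻¹' A' i) := by
        rw [← Finset.prod_subset (Finset.subset_univ S)]
        · exact Finset.prod_congr rfl fun i hi => by rw [hA1 i hi]
        · intro i _ hi
          rw [hA2 i hi]; simp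
      rw [this, Fin.prod_univ_three]
      rfl
    have mX : MeasurableSet[m₁] (X' ⁻¹' A' 0) := hX'.measurable (hA'm 0)
    have mY : MeasurableSet[m₂] (Y' ⁻¹' A' 1) := hY'.measurable (hA'm 1)
    have mZ : MeasurableSet[m₃] (Z' ⁻¹' A' 2) := hZ'.measurable (hA'm 2)
    rw [e1, e2, (Indep_iff _ _ _).1 hi' _ _
      (@MeasurableSet.inter _ m₁₂ _ _ (h₁ _ mX) (h₂ _ mY)) mZ, (Indep_iff _ _ _).1 hi _ _ mX mY]
  refine main.congr fun i => ?_
  fin_cases i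
  · exact eX.symm
  · exact eY.symm
  · exact eZ.symm

end

/-! ### Chaos expansions of the solutions and of their derivatives -/

section

variable {Ω : Type*} [mΩ : MeasurableSpace Ω] {P : Measure Ω} [IsProbabilityMeasure P]
  {ν : Measure JumpSize} [SigmaFinite ν] {N : Ω → Measure JumpSpace}

/-- The criterion used for u and both derivatives: energies with factorial decay, and pairings
approximated by their partial sums with a rate of the same type. Symmetrization does not change
pairings with tensor powers. -/
lemma isChaosExpansion_of_kernelPairing (hN : IsPoissonRandomMeasure P (intensity ν) N)
    {f : ∀ n : ℕ, ℝ≥0 → ℝ → (Fin n → JumpSpace) → ℝ} (hf : IsMeasurableFamily f) {t : ℝ≥0}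
    {x c y : ℝ} (hc : 0 ≤ c)
    (hE : ∀ n, kernelEnergy ν f n t x ≤ ENNReal.ofReal (c * (y ^ (2 * n) / (2 * n)!)))
    {X : Ω → ℝ} (hX : MemLp X 2 P) (hXm : AEStronglyMeasurable[restrictSigma N univ] X P)
    (hpair : ∀ h, IsTestFun (intensity ν) h → ∀ k, Function.support h ⊆ jumpBox ν k →
      ∃ c y : ℝ, ∀ M : ℕ, |∫ ω, X ω * normExp P N h ω ∂P -
        ∑ n ∈ Finset.range M, kernelPairing ν h f n t x| ≤ c * (y ^ (2 * M) / (2 * M)!)) :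
    IsChaosExpansion P (intensity ν) N (fun n => symmetrize (f n t x)) X := by
  have hL := fun n => memLp_two_of_kernelEnergy hf ((hE n).trans_lt ENNReal.ofReal_lt_top)
  refine IsChaosExpansion.of_tendsto_pairing hN (isExhaustion_jumpBox ν) measurable_timeOf
    (intensity_timeOf_eq ν) (fun n => memLp_symmetrize (hL n))
    (fun n σ => Eventually.of_forall fun ξ => symmetrize_comp_perm _ ξ σ)
    (summable_sqrt_factorial_mul_eLpNorm hf hc hE) hX hXm ?_
  rintro h hh ⟨k, hk⟩
  obtain ⟨c', y', hM⟩ := hpair h hh k hk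
  have e : ∀ n, ∫ ξ, symmetrize (f n t x) ξ * tensorGap h n ξ
      ∂(Measure.pi fun _ : Fin n => intensity ν) = kernelPairing ν h f n t x := fun n =>
    integral_symmetrize_mul_tensorGap (hL n) hh
  simp only [e]
  rw [tendsto_iff_dist_tendsto_zero]
  refine squeeze_zero (fun _ => dist_nonneg) (fun M => ?_) (tendsto_volterra_bound c' y')
  rw [dist_comm]
  exact hM M

lemma exists_sq_jumpMoment_le (hν : jumpMoment ν 2 < ∞) :
    ∃ C : ℝ, 0 ≤ C ∧ jumpMoment ν 2 ≤ ENNReal.ofReal (C ^ 2) :=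
  ⟨√(jumpMoment ν 2).toReal, Real.sqrt_nonneg _, by
    rw [Real.sq_sqrt ENNReal.toReal_nonneg, ENNReal.ofReal_toReal hν.ne]⟩

variable {u : ℝ≥0 → ℝ → Ω → ℝ} {v v₁ v₂ : ℝ≥0 → ℝ → Ω → ℝ} {ξ ξ₁ ξ₂ : JumpSpace}

lemma IsPredictableField.aestronglyMeasurable_univ {w : ℝ≥0 → ℝ → Ω → ℝ}
    (hw : IsPredictableField P ν N w) (t : ℝ≥0) (x : ℝ) :
    AEStronglyMeasurable[restrictSigma N univ] (w t x) P :=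
  (hw.aestronglyMeasurable_restrictSigma t x).mono
    (restrictSigma_mono N (measurableSet_timeLE t) (subset_univ _))

theorem IsWaveSolution.isChaosExpansion (hu : IsWaveSolution P ν N u)
    (hN : IsPoissonRandomMeasure P (intensity ν) N) (hν : jumpMoment ν 2 < ∞) (t : ℝ≥0) (x : ℝ) :
    IsChaosExpansion P (intensity ν) N (waveChaos t x) (u t x) := by
  obtain ⟨C, hC, hCν⟩ := exists_sq_jumpMoment_le hν
  refine isChaosExpansion_of_kernelPairing hN isMeasurableFamily_waveKernel zero_le_two
    (fun n => kernelEnergy_waveKernel_le hC hCν n t x) (hu.memLp hN t x)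
    (hu.predictable.aestronglyMeasurable_univ t x) fun h hh k hk => ?_
  obtain ⟨C', hC', hCk⟩ := exists_lintegral_boxWeight_le hν k
  obtain ⟨c, -, hM⟩ := hu.exists_abs_fieldPairing_sub_le hN hν hh hk hC' hCk t x
  exact ⟨c, _, hM⟩

theorem IsWaveSolution.inDomD2 (hu : IsWaveSolution P ν N u)
    (hN : IsPoissonRandomMeasure P (intensity ν) N) (hν : jumpMoment ν 2 < ∞) (t : ℝ≥0) (x : ℝ) :
    InDomD2 P (intensity ν) N (u t x) := by
  obtain ⟨C, hC, hCν⟩ := exists_sq_jumpMoment_le hν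
  exact ⟨waveChaos t x, hu.isChaosExpansion hN hν t x, tsum_sq_factorial_mul_eLpNorm_lt_top
    isMeasurableFamily_waveKernel zero_le_two fun n => kernelEnergy_waveKernel_le hC hCν n t x⟩

/-- `v(t,x)` is a functional of the noise after time `r`. -/
lemma IsDeltaWaveSolution.aestronglyMeasurable_compl (hv : IsDeltaWaveSolution P ν N ξ v)
    (hN : IsPoissonRandomMeasure P (intensity ν) N) (hν : jumpMoment ν 2 < ∞) {t : ℝ≥0}
    (ht : ξ.1 ≤ t) (x : ℝ) : AEStronglyMeasurable[restrictSigma N (timeLE ξ.1)ᶜ] (v t x) P :=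
  (hv.aestronglyMeasurable_restrictSigma hN hν ht x).mono (restrictSigma_mono N
    ((measurableSet_timeLE ξ.1).compl.inter (measurableSet_timeLE t)) inter_subset_left)

lemma indep_restrictSigma_timeLE (hN : IsPoissonRandomMeasure P (intensity ν) N) (r : ℝ≥0) :
    Indep (restrictSigma N (timeLE r)) (restrictSigma N (timeLE r)ᶜ) P :=
  hN.indep_restrictSigma (measurableSet_timeLE r) (measurableSet_timeLE r).compl
    disjoint_compl_right

/-- A functional of the noise up to time `r` is independent of `v(t,x)`. -/
lemma IsDeltaWaveSolution.indepFun (hv : IsDeltaWaveSolution P ν N ξ v)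
    (hN : IsPoissonRandomMeasure P (intensity ν) N) (hν : jumpMoment ν 2 < ∞) {t : ℝ≥0}
    (ht : ξ.1 ≤ t) (x : ℝ) {X : Ω → ℝ}
    (hX : AEStronglyMeasurable[restrictSigma N (timeLE ξ.1)] X P) : IndepFun X (v t x) P :=
  indepFun_of_indep_of_aestronglyMeasurable (indep_restrictSigma_timeLE hN ξ.1) hX
    (hv.aestronglyMeasurable_compl hN hν ht x)

lemma IsDeltaWaveSolution.integral_mul_mul_normExp (hv : IsDeltaWaveSolution P ν N ξ v)
    (hN : IsPoissonRandomMeasure P (intensity ν) N) (hν : jumpMoment ν 2 < ∞) {t : ℝ≥0}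
    (ht : ξ.1 ≤ t) (x : ℝ) {X : Ω → ℝ}
    (hX : AEStronglyMeasurable[restrictSigma N (timeLE ξ.1)] X P) {h : JumpSpace → ℝ≥0}
    (hh : IsTestFun (intensity ν) h) : ∫ ω, X ω * v t x ω * normExp P N h ω ∂P =
      (∫ ω, X ω * normExp P N h ω ∂P) * deltaPairing P N h ξ.1 v t x := by
  rw [hN.integral_mul_mul_normExp hh (measurableSet_timeLE ξ.1) hX
    (hv.aestronglyMeasurable_compl hN hν ht x), ← hv.fieldPairing_eq_deltaPairing ht]
  rfl

/-- `u(r,y) v(t,x)` is a functional of the noise up to time `t`. -/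
lemma aestronglyMeasurable_mul (hu : IsWaveSolution P ν N u) (hv : IsDeltaWaveSolution P ν N ξ v)
    {t : ℝ≥0} (ht : ξ.1 ≤ t) (x : ℝ) :
    AEStronglyMeasurable[restrictSigma N (timeLE t)] (fun ω => u ξ.1 ξ.2.1 ω * v t x ω) P :=
  AEStronglyMeasurable.mul
    ((hu.predictable.aestronglyMeasurable_restrictSigma ξ.1 ξ.2.1).mono
      (restrictSigma_mono N (measurableSet_timeLE _) (timeLE_mono ht)))
    (hv.predictable.aestronglyMeasurable_restrictSigma t x)

lemma memLp_mul (hu : IsWaveSolution P ν N u) (hv : IsDeltaWaveSolution P ν N ξ v)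
    (hN : IsPoissonRandomMeasure P (intensity ν) N) (hν : jumpMoment ν 2 < ∞) {t : ℝ≥0}
    (ht : ξ.1 ≤ t) (x : ℝ) : MemLp (fun ω => u ξ.1 ξ.2.1 ω * v t x ω) 2 P :=
  memLp_two_mul_of_indepFun (hv.indepFun hN hν ht x
    (hu.predictable.aestronglyMeasurable_restrictSigma _ _)) (hu.memLp hN _ _) (hv.memLp ht x)

lemma exists_abs_integral_mul_sub_le (hu : IsWaveSolution P ν N u)
    (hv : IsDeltaWaveSolution P ν N ξ v)
    (hN : IsPoissonRandomMeasure P (intensity ν) N) (hν : jumpMoment ν 2 < ∞) {t : ℝ≥0}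
    (ht : ξ.1 ≤ t) (x : ℝ) {h : JumpSpace → ℝ≥0} (hh : IsTestFun (intensity ν) h) {k : ℕ}
    (hk : Function.support h ⊆ jumpBox ν k) {C : ℝ} (hC : 0 ≤ C)
    (hCk : ∫⁻ z, boxWeight ν k z ∂ν ≤ ENNReal.ofReal (C ^ 2)) :
    ∃ c : ℝ, 0 ≤ c ∧ ∀ M : ℕ, |∫ ω, u ξ.1 ξ.2.1 ω * v t x ω * normExp P N h ω ∂P -
      ∑ n ∈ Finset.range M, kernelPairing ν h (waveD ξ) n t x| ≤
        c * ((C * (ξ.1 + t)) ^ (2 * M) / (2 * M)!) := by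
  obtain ⟨C₀, hC₀, hCν⟩ := exists_sq_jumpMoment_le hν
  obtain ⟨c, hc, hM⟩ := hu.exists_abs_fieldPairing_sub_le hN hν hh hk hC hCk ξ.1 ξ.2.1
  have := hv.exists_abs_mul_deltaPairing_sub_le hN hh hk hC ξ.1.coe_nonneg hc hCk
    isMeasurableFamily_waveKernel (isForced_waveD ξ)
    (fun n t x => (kernelEnergy_waveKernel_le hC₀ hCν n t x).trans_lt ENNReal.ofReal_lt_top)
    (fun n t x => (kernelEnergy_waveD_le hC₀ hCν ξ n t x).trans_lt ENNReal.ofReal_lt_top) hM t x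
  rwa [fieldPairing, ← hv.integral_mul_mul_normExp hN hν ht x
    (hu.predictable.aestronglyMeasurable_restrictSigma _ _) hh] at this

/-- No equation is differentiated: the product is square integrable by independence, and its
pairings are those of the inserted kernels. -/
theorem isWaveD_mul (hu : IsWaveSolution P ν N u) (hv : IsDeltaWaveSolution P ν N ξ v)
    (hN : IsPoissonRandomMeasure P (intensity ν) N) (hν : jumpMoment ν 2 < ∞) {t : ℝ≥0}
    (ht : ξ.1 ≤ t) (x : ℝ) : IsWaveD P ν N t x ξ (fun ω => u ξ.1 ξ.2.1 ω * v t x ω) := by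
  obtain ⟨C, hC, hCν⟩ := exists_sq_jumpMoment_le hν
  rw [IsWaveD, derivKernel_waveChaos]
  refine isChaosExpansion_of_kernelPairing hN (isMeasurableFamily_waveD ξ)
    (by positivity : 0 ≤ 4 * (ξ.2.2 : ℝ) ^ 2)
    (fun n => kernelEnergy_waveD_le hC hCν ξ n t x) (memLp_mul hu hv hN hν ht x)
    ((aestronglyMeasurable_mul hu hv ht x).mono
      (restrictSigma_mono N (measurableSet_timeLE t) (subset_univ _))) fun h hh k hk => ?_
  obtain ⟨C', hC', hCk⟩ := exists_lintegral_boxWeight_le hν k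
  obtain ⟨c, -, hM⟩ := exists_abs_integral_mul_sub_le hu hv hN hν ht x hh hk hC' hCk
  exact ⟨c, _, hM⟩

/-- The multiplication step is applied once more, at ξ₂, with u v₁ in the role of u. This product
depends on the noise up to the time of ξ₂, and its pairings are already known from the first
derivative. -/
theorem isWaveD2_mul (hu : IsWaveSolution P ν N u) (hv₁ : IsDeltaWaveSolution P ν N ξ₁ v₁)
    (hv₂ : IsDeltaWaveSolution P ν N ξ₂ v₂)
    (hN : IsPoissonRandomMeasure P (intensity ν) N) (hν : jumpMoment ν 2 < ∞) {t : ℝ≥0}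
    (h₁₂ : ξ₁.1 ≤ ξ₂.1) (ht : ξ₂.1 ≤ t) (x : ℝ) : IsWaveD2 P ν N t x ξ₁ ξ₂
      (fun ω => u ξ₁.1 ξ₁.2.1 ω * v₁ ξ₂.1 ξ₂.2.1 ω * v₂ t x ω) := by
  obtain ⟨C, hC, hCν⟩ := exists_sq_jumpMoment_le hν
  have hX := aestronglyMeasurable_mul hu hv₁ h₁₂ ξ₂.2.1
  rw [IsWaveD2, derivKernel_derivKernel_waveChaos]
  refine isChaosExpansion_of_kernelPairing hN
    ((isForced_waveD2 h₁₂).isMeasurableFamily ((isMeasurableFamily_waveD ξ₁).pointForcing ξ₂))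
    (by positivity : 0 ≤ 8 * (ξ₁.2.2 : ℝ) ^ 2 * (ξ₂.2.2 : ℝ) ^ 2)
    (fun n => kernelEnergy_waveD2_le hC hCν h₁₂ n t x)
    (memLp_two_mul_of_indepFun (hv₂.indepFun hN hν ht x hX) (memLp_mul hu hv₁ hN hν h₁₂ _)
      (hv₂.memLp ht x)) ?_ fun h hh k hk => ?_
  · exact AEStronglyMeasurable.mul (hX.mono
      (restrictSigma_mono N (measurableSet_timeLE _) (subset_univ _)))
      (hv₂.predictable.aestronglyMeasurable_univ t x)
  · obtain ⟨C', hC', hCk⟩ := exists_lintegral_boxWeight_le hν k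
    obtain ⟨c, hc, hM⟩ :=
      exists_abs_integral_mul_sub_le hu hv₁ hN hν h₁₂ ξ₂.2.1 hh hk hC' hCk
    obtain ⟨c', -, hM'⟩ := hv₂.exists_abs_mul_deltaPairing_sub_le hN hh hk hC'
      (add_nonneg ξ₁.1.coe_nonneg ξ₂.1.coe_nonneg) hc hCk
      (isMeasurableFamily_waveD ξ₁) (isForced_waveD2 h₁₂)
      (fun n t x => (kernelEnergy_waveD_le hC hCν ξ₁ n t x).trans_lt ENNReal.ofReal_lt_top)
      (fun n t x => (kernelEnergy_waveD2_le hC hCν h₁₂ n t x).trans_lt ENNReal.ofReal_lt_top) hM t x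
    rw [← hv₂.integral_mul_mul_normExp hN hν ht x hX hh] at hM'
    exact ⟨c', _, hM'⟩

theorem iIndepFun_factors (hu : IsWaveSolution P ν N u) (hv₁ : IsDeltaWaveSolution P ν N ξ₁ v₁)
    (hv₂ : IsDeltaWaveSolution P ν N ξ₂ v₂)
    (hN : IsPoissonRandomMeasure P (intensity ν) N) (hν : jumpMoment ν 2 < ∞) {t : ℝ≥0}
    (h₁₂ : ξ₁.1 ≤ ξ₂.1) (ht : ξ₂.1 ≤ t) (x : ℝ) :
    iIndepFun ![u ξ₁.1 ξ₁.2.1, v₁ ξ₂.1 ξ₂.2.1, v₂ t x] P := by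
  have hB : MeasurableSet ((timeLE ξ₁.1)ᶜ ∩ timeLE ξ₂.1) :=
    (measurableSet_timeLE _).compl.inter (measurableSet_timeLE _)
  exact iIndepFun_fin_three (m₁₂ := restrictSigma N (timeLE ξ₂.1))
    (restrictSigma_mono N (measurableSet_timeLE _) (timeLE_mono h₁₂))
    (restrictSigma_mono N hB inter_subset_right)
    (hN.indep_restrictSigma (measurableSet_timeLE _) hB
      (disjoint_compl_right.mono_right inter_subset_left))
    (indep_restrictSigma_timeLE hN ξ₂.1)
    (hu.predictable.aestronglyMeasurable_restrictSigma _ _)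
    (hv₁.aestronglyMeasurable_restrictSigma hN hν h₁₂ _)
    (hv₂.aestronglyMeasurable_compl hN hν ht x)

end

/-! ### Versions of the derivatives -/

section

variable {Ω E : Type*} [MeasurableSpace Ω] [MeasurableSpace E] {P : Measure Ω}
  {m : Measure E} [SigmaFinite m] {N : Ω → Measure E}

lemma IsMultipleIntegral.congr_kernel {n : ℕ} {f f' : (Fin n → E) → ℝ} {X : Ω → ℝ}
    (hX : IsMultipleIntegral P m N n f X) (h : f =ᵐ[Measure.pi fun _ : Fin n => m] f') :
    IsMultipleIntegral P m N n f' X := by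
  obtain ⟨hf, hX2, s, hs, hsX⟩ := hX
  refine ⟨(memLp_congr_ae h).1 hf, hX2, s, ?_, hsX⟩
  convert hs using 2 with l
  refine eLpNorm_congr_ae ?_
  filter_upwards [h] with ξ hξ
  simp [hξ]

lemma IsChaosExpansion.congr_kernel {f f' : ∀ n : ℕ, (Fin n → E) → ℝ} {F : Ω → ℝ}
    (hF : IsChaosExpansion P m N f F) (h : ∀ n, f n =ᵐ[Measure.pi fun _ : Fin n => m] f' n) :
    IsChaosExpansion P m N f' F := by
  obtain ⟨hF2, hs, X, hX, hlim⟩ := hF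
  refine ⟨hF2, fun n σ => ?_, X, fun n => (hX n).congr_kernel (h n), hlim⟩
  have h1 := (measurePreserving_comp_perm m σ).quasiMeasurePreserving.ae (h n)
  filter_upwards [h1, hs n σ, h n] with ξ e1 e2 e3
  rw [← e1, e2, e3]

lemma measurePreserving_cons (n : ℕ) :
    MeasurePreserving (fun q : E × (Fin n → E) => (Fin.cons q.1 q.2 : Fin (n + 1) → E))
      (m.prod (Measure.pi fun _ => m)) (Measure.pi fun _ => m) := by
  have h := (measurePreserving_piFinSuccAbove (fun _ : Fin (n + 1) => m) 0).symm
  convert h using 1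
  funext q
  exact (Fin.insertNth_zero (α := fun _ : Fin (n + 1) => E) q.1 q.2).symm

lemma ae_derivKernel_ae_eq {f f' : ∀ n : ℕ, (Fin n → E) → ℝ}
    (h : ∀ n, f n =ᵐ[Measure.pi fun _ : Fin n => m] f' n) :
    ∀ᵐ ξ ∂m, ∀ n, derivKernel f ξ n =ᵐ[Measure.pi fun _ : Fin n => m] derivKernel f' ξ n := by
  rw [ae_all_iff]
  intro n
  have h1 := (measurePreserving_cons (m := m) n).quasiMeasurePreserving.ae (h (n + 1))
  filter_upwards [Measure.ae_ae_of_ae_prod h1] with ξ hξ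
  filter_upwards [hξ] with η hη
  simp only [derivKernel]
  rw [hη]

/-- Fubini, after a measure preserving rearrangement: the pair is listed as (ζ, ξ), whereas the
kernel takes ξ first. -/
lemma ae_derivKernel_derivKernel_ae_eq {f f' : ∀ n : ℕ, (Fin n → E) → ℝ}
    (h : ∀ n, f n =ᵐ[Measure.pi fun _ : Fin n => m] f' n) :
    ∀ᵐ q ∂(m.prod m), ∀ n, derivKernel (derivKernel f q.2) q.1 n =ᵐ[Measure.pi fun _ : Fin n => m]
      derivKernel (derivKernel f' q.2) q.1 n := by
  rw [ae_all_iff]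
  intro n
  have hc := measurePreserving_cons (m := m) n
  have hc' := measurePreserving_cons (m := m) (n + 1)
  have h1 : MeasurePreserving (fun q : (E × E) × (Fin n → E) => (q.1.swap, q.2))
      ((m.prod m).prod (Measure.pi fun _ => m)) ((m.prod m).prod (Measure.pi fun _ => m)) :=
    Measure.measurePreserving_swap.prod (MeasurePreserving.id _)
  have h2 := measurePreserving_prodAssoc m m (Measure.pi fun _ : Fin n => m)
  have h3 := (MeasurePreserving.id m).prod hc
  have h4 := (hc'.comp (h3.comp (h2.comp h1))).quasiMeasurePreserving.ae (h (n + 2))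
  filter_upwards [Measure.ae_ae_of_ae_prod h4] with q hq
  filter_upwards [hq] with η hη
  simp only [derivKernel]
  have hη' : f (n + 2) (Fin.cons q.2 (Fin.cons q.1 η : Fin (n + 1) → E)) =
      f' (n + 2) (Fin.cons q.2 (Fin.cons q.1 η : Fin (n + 1) → E)) := hη
  rw [hη']

end

section

variable {Ω : Type*} [mΩ : MeasurableSpace Ω] {P : Measure Ω} [IsProbabilityMeasure P]
  {ν : Measure JumpSize} [SigmaFinite ν] {N : Ω → Measure JumpSpace}
  {u : ℝ≥0 → ℝ → Ω → ℝ} {v : JumpSpace → ℝ≥0 → ℝ → Ω → ℝ}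

/-- Kernels are unique almost everywhere, so by Fubini any other choice has the same derivative
kernels for almost every ξ, and kernels determine the variable. -/
theorem IsMalliavinDeriv.ae_eq_mul (hu : IsWaveSolution P ν N u)
    (hv : ∀ ξ, IsDeltaWaveSolution P ν N ξ (v ξ)) (hN : IsPoissonRandomMeasure P (intensity ν) N)
    (hν : jumpMoment ν 2 < ∞) {t : ℝ≥0} {x : ℝ} {D : JumpSpace → Ω → ℝ}
    (hD : IsMalliavinDeriv P (intensity ν) N (u t x) D) :
    ∀ᵐ ξ ∂(intensity ν), ξ.1 ≤ t → D ξ =ᵐ[P] fun ω => u ξ.1 ξ.2.1 ω * v ξ t x ω := by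
  obtain ⟨f, hf, -, hfD⟩ := hD
  have h1 := ae_derivKernel_ae_eq (IsChaosExpansion.kernel_ae_eq hN measurable_timeOf
    (intensity_timeOf_eq ν) hf (hu.isChaosExpansion hN hν t x))
  filter_upwards [hfD, h1] with ξ hξ h1ξ ht
  exact IsChaosExpansion.ae_eq hN (isExhaustion_jumpBox ν) (hξ.congr_kernel h1ξ)
    (isWaveD_mul hu (hv ξ) hN hν ht x)

theorem IsMalliavinDeriv2.ae_eq_mul (hu : IsWaveSolution P ν N u)
    (hv : ∀ ξ, IsDeltaWaveSolution P ν N ξ (v ξ)) (hN : IsPoissonRandomMeasure P (intensity ν) N)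
    (hν : jumpMoment ν 2 < ∞) {t : ℝ≥0} {x : ℝ} {D2 : JumpSpace → JumpSpace → Ω → ℝ}
    (hD : IsMalliavinDeriv2 P (intensity ν) N (u t x) D2) :
    ∀ᵐ q ∂((intensity ν).prod (intensity ν)), q.1.1 < q.2.1 → q.2.1 ≤ t → D2 q.1 q.2 =ᵐ[P]
      fun ω => u q.1.1 q.1.2.1 ω * v q.1 q.2.1 q.2.2.1 ω * v q.2 t x ω := by
  obtain ⟨f, hf, -, hfD⟩ := hD
  have h1 := ae_derivKernel_derivKernel_ae_eq (IsChaosExpansion.kernel_ae_eq hN measurable_timeOf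
    (intensity_timeOf_eq ν) hf (hu.isChaosExpansion hN hν t x))
  filter_upwards [hfD, h1] with q hq h1q hlt ht
  exact IsChaosExpansion.ae_eq hN (isExhaustion_jumpBox ν) (hq.congr_kernel h1q)
    (isWaveD2_mul hu (hv q.1) (hv q.2) hN hν hlt.le ht x)

end

end

/-! ### Moment estimates with truncated powers. -/

noncomputable section

/-! ### Truncated powers -/

/-- The function `|x|^p`, continued quadratically beyond `K`. -/
def truncPow (p K x : ℝ) : ℝ := min (|x| ^ p) (K ^ (p - 2) * x ^ 2)

/-- The weight with `truncPow p K x = x ^ 2 * truncWeight p K x`. -/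
def truncWeight (p K x : ℝ) : ℝ := min |x| K ^ (p - 2)

section

variable {p K : ℝ}

lemma rpow_eq_sq_mul (hp : 2 ≤ p) (x : ℝ) : |x| ^ p = x ^ 2 * |x| ^ (p - 2) := by
  rcases eq_or_ne x 0 with rfl | hx
  · simp [Real.zero_rpow (by linarith : p ≠ 0)]
  · have h : 0 < |x| := abs_pos.2 hx
    rw [← sq_abs x, ← Real.rpow_natCast, ← Real.rpow_add h]
    congr 1; push_cast; ring

lemma truncWeight_nonneg (hK : 0 < K) (x : ℝ) : 0 ≤ truncWeight p K x :=
  Real.rpow_nonneg (le_min (abs_nonneg _) hK.le) _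

lemma truncWeight_le (hp : 2 ≤ p) (hK : 0 < K) (x : ℝ) : truncWeight p K x ≤ K ^ (p - 2) :=
  Real.rpow_le_rpow (le_min (abs_nonneg _) hK.le) (min_le_right _ _) (by linarith)

lemma truncWeight_mono (hp : 2 ≤ p) (hK : 0 < K) {x y : ℝ} (h : |x| ≤ |y|) :
    truncWeight p K x ≤ truncWeight p K y :=
  Real.rpow_le_rpow (le_min (abs_nonneg _) hK.le) (min_le_min_right _ h) (by linarith)

lemma truncPow_eq (hp : 2 ≤ p) (hK : 0 < K) (x : ℝ) :
    truncPow p K x = x ^ 2 * truncWeight p K x := by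
  unfold truncPow truncWeight
  rw [rpow_eq_sq_mul hp]
  rcases le_total |x| K with h | h
  · have h1 : |x| ^ (p - 2) ≤ K ^ (p - 2) := Real.rpow_le_rpow (abs_nonneg _) h (by linarith)
    rw [min_eq_left h, min_eq_left]
    nlinarith [sq_nonneg x]
  · have h1 : K ^ (p - 2) ≤ |x| ^ (p - 2) := Real.rpow_le_rpow hK.le h (by linarith)
    rw [min_eq_right h, min_eq_right]
    · ring
    · nlinarith [sq_nonneg x]

lemma truncPow_nonneg (hK : 0 < K) (x : ℝ) : 0 ≤ truncPow p K x :=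
  le_min (by positivity) (by positivity)

lemma truncPow_zero (hp : 2 ≤ p) : truncPow p K 0 = 0 := by
  simp [truncPow, Real.zero_rpow (by linarith : p ≠ 0)]

lemma truncPow_le_sq (x : ℝ) : truncPow p K x ≤ K ^ (p - 2) * x ^ 2 := min_le_right _ _

lemma truncPow_le_rpow (x : ℝ) : truncPow p K x ≤ |x| ^ p := min_le_left _ _

lemma truncPow_mono (hp : 2 ≤ p) (hK : 0 < K) {x y : ℝ} (h : |x| ≤ |y|) :
    truncPow p K x ≤ truncPow p K y :=
  min_le_min (Real.rpow_le_rpow (abs_nonneg _) h (by linarith))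
    (mul_le_mul_of_nonneg_left (sq_le_sq.2 h) (by positivity))

lemma continuous_truncPow (hp : 2 ≤ p) : Continuous (truncPow p K) := by
  unfold truncPow
  exact (continuous_abs.rpow_const fun _ => Or.inr (by linarith)).min (by fun_prop)

lemma truncPow_mul_le (hK : 0 < K) (a b : ℝ) :
    truncPow p K (a * b) ≤ max (a ^ 2) (|a| ^ p) * truncPow p K b := by
  have hm : 0 ≤ max (a ^ 2) (|a| ^ p) := le_max_of_le_left (sq_nonneg a)
  rw [truncPow, truncPow, abs_mul, Real.mul_rpow (abs_nonneg _) (abs_nonneg _), mul_pow]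
  rcases min_choice (|b| ^ p) (K ^ (p - 2) * b ^ 2) with h | h <;> rw [h]
  · exact (min_le_left _ _).trans (mul_le_mul_of_nonneg_right (le_max_right _ _) (by positivity))
  · refine (min_le_right _ _).trans ?_
    calc K ^ (p - 2) * (a ^ 2 * b ^ 2) = a ^ 2 * (K ^ (p - 2) * b ^ 2) := by ring
      _ ≤ _ := mul_le_mul_of_nonneg_right (le_max_left _ _) (by positivity)

lemma truncPow_two_mul_le (hp : 2 ≤ p) (hK : 0 < K) (x : ℝ) :
    truncPow p K (2 * x) ≤ 2 ^ p * truncPow p K x := by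
  refine (truncPow_mul_le hK 2 x).trans (mul_le_mul_of_nonneg_right ?_ (truncPow_nonneg hK x))
  refine max_le ?_ (by simp)
  rw [← Real.rpow_natCast]
  exact Real.rpow_le_rpow_of_exponent_le (by norm_num) (by simpa using hp)

lemma truncPow_add_le (hp : 2 ≤ p) (hK : 0 < K) (a b : ℝ) :
    truncPow p K (a + b) ≤ 2 ^ p * (truncPow p K a + truncPow p K b) := by
  have h2 : (0 : ℝ) < 2 ^ p := by positivity
  have ha := truncPow_nonneg (p := p) hK a
  have hb := truncPow_nonneg (p := p) hK b
  rcases le_total |a| |b| with h | h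
  · have h1 : |a + b| ≤ |2 * b| := by
      rw [abs_mul, abs_two]; exact (abs_add_le a b).trans (by linarith)
    refine (truncPow_mono hp hK h1).trans ((truncPow_two_mul_le hp hK b).trans ?_)
    nlinarith
  · have h1 : |a + b| ≤ |2 * a| := by
      rw [abs_mul, abs_two]; exact (abs_add_le a b).trans (by linarith)
    refine (truncPow_mono hp hK h1).trans ((truncPow_two_mul_le hp hK a).trans ?_)
    nlinarith

/-- The constant in the second order Taylor bound of `|x|^p`. -/
def taylorConst (p : ℝ) : ℝ := 3 ^ p + p * 2 ^ p + (Real.exp p + 1) * p ^ 2 + 4 + p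

/-- Applied with x = pq, where (1+q)^p ≤ e^{pq}, to get a second order expansion for real exponents
without derivatives of |x|^p. -/
lemma exp_le_one_add_add_sq {p x : ℝ} (hx : x ≤ p) :
    Real.exp x ≤ 1 + x + (Real.exp p + 1) * x ^ 2 := by
  rcases le_or_gt |x| 1 with h | h
  · have h1 := (abs_le.1 (Real.abs_exp_sub_one_sub_id_le h)).2
    have h2 : 0 ≤ Real.exp p * x ^ 2 := by positivity
    linarith
  · have h1 : Real.exp x ≤ Real.exp p := Real.exp_le_exp.2 hx
    have h2 : 1 ≤ x ^ 2 := by rw [← sq_abs]; nlinarith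
    have h3 : 0 < Real.exp p := Real.exp_pos p
    rcases le_or_gt 0 x with h4 | h4
    · nlinarith
    · rw [abs_of_neg h4] at h
      have h5 : -x ≤ x ^ 2 := by nlinarith
      nlinarith

/-- Second order Taylor bound for `|x|^p`. -/
lemma abs_add_rpow_le (hp : 2 ≤ p) (s d : ℝ) :
    |s + d| ^ p ≤ |s| ^ p + p * |s| ^ (p - 2) * s * d +
      taylorConst p * d ^ 2 * (|s| ^ (p - 2) + |d| ^ (p - 2)) := by
  have hp0 : 0 ≤ p := by linarith
  have hs2 : 0 ≤ |s| ^ (p - 2) := by positivity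
  have hd2 : 0 ≤ |d| ^ (p - 2) := by positivity
  have h2p : (0 : ℝ) < 2 ^ p := by positivity
  have h3p : (0 : ℝ) < 3 ^ p := by positivity
  -- If |s| ≤ 2|d| every term is comparable with |d|^p. Otherwise q = d/s satisfies |q| < 1/2 and
  -- the expansion of (1+q)^p is used.
  rcases le_or_gt |s| (2 * |d|) with h | h
  · have h1 : |s + d| ^ p ≤ 3 ^ p * (d ^ 2 * |d| ^ (p - 2)) := by
      rw [← rpow_eq_sq_mul hp, ← Real.mul_rpow (by norm_num) (abs_nonneg _)]
      exact Real.rpow_le_rpow (abs_nonneg _) ((abs_add_le s d).trans (by linarith)) hp0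
    have h2 : |s| ^ (p - 2) * |s| ≤ 2 ^ p * (|d| ^ (p - 2) * |d|) := by
      have a1 : |s| ^ (p - 2) ≤ (2 * |d|) ^ (p - 2) :=
        Real.rpow_le_rpow (abs_nonneg _) h (by linarith)
      rw [Real.mul_rpow (by norm_num) (abs_nonneg _)] at a1
      have a2 : (2 : ℝ) ^ p = 2 ^ (p - 2) * 4 := by
        rw [show (4 : ℝ) = 2 ^ (2 : ℝ) by norm_num, ← Real.rpow_add (by norm_num)]; congr 1; ring
      have a3 : (0 : ℝ) < 2 ^ (p - 2) := by positivity
      calc |s| ^ (p - 2) * |s| ≤ 2 ^ (p - 2) * |d| ^ (p - 2) * (2 * |d|) :=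
            mul_le_mul a1 h (abs_nonneg _) (by positivity)
        _ = 2 * (2 ^ (p - 2) * (|d| ^ (p - 2) * |d|)) := by ring
        _ ≤ 2 ^ p * (|d| ^ (p - 2) * |d|) := by
            rw [a2]
            have : 0 ≤ 2 ^ (p - 2) * (|d| ^ (p - 2) * |d|) := by positivity
            linarith
    have h3 : -(p * |s| ^ (p - 2) * s * d) ≤ p * 2 ^ p * (d ^ 2 * |d| ^ (p - 2)) := by
      calc -(p * |s| ^ (p - 2) * s * d) ≤ |p * |s| ^ (p - 2) * s * d| := neg_le_abs _
        _ = p * (|s| ^ (p - 2) * |s|) * |d| := by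
            rw [abs_mul, abs_mul, abs_mul, abs_of_nonneg hp0, abs_of_nonneg hs2]; ring
        _ ≤ p * (2 ^ p * (|d| ^ (p - 2) * |d|)) * |d| := by gcongr
        _ = p * 2 ^ p * (d ^ 2 * |d| ^ (p - 2)) := by rw [← sq_abs d]; ring
    have h4 : 0 ≤ |s| ^ p := by positivity
    have h5 : (3 ^ p + p * 2 ^ p) * (d ^ 2 * |d| ^ (p - 2)) ≤
        taylorConst p * d ^ 2 * (|s| ^ (p - 2) + |d| ^ (p - 2)) := by
      have c1 : 3 ^ p + p * 2 ^ p ≤ taylorConst p := by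
        have := Real.exp_pos p
        unfold taylorConst
        nlinarith [sq_nonneg p]
      have c0 : 0 ≤ taylorConst p := le_trans (by positivity) c1
      calc (3 ^ p + p * 2 ^ p) * (d ^ 2 * |d| ^ (p - 2)) ≤
            taylorConst p * (d ^ 2 * |d| ^ (p - 2)) := by gcongr
        _ ≤ taylorConst p * d ^ 2 * (|s| ^ (p - 2) + |d| ^ (p - 2)) := by
            have : 0 ≤ taylorConst p * d ^ 2 * |s| ^ (p - 2) := by positivity
            linarith
    nlinarith
  · have hs : s ≠ 0 := by
      rintro rfl
      simp at h
      linarith [abs_nonneg d]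
    have hsa : 0 < |s| := abs_pos.2 hs
    set q := d / s with hq
    have hqa : |q| < 1 / 2 := by
      rw [hq, abs_div, div_lt_iff₀ hsa]; linarith
    have h1 : 0 < 1 + q := by linarith [(abs_lt.1 hqa).1]
    have e1 : s + d = s * (1 + q) := by rw [hq]; field_simp
    have h2 : (1 + q) ^ p ≤ 1 + p * q + (Real.exp p + 1) * (p * q) ^ 2 := by
      have a1 : 1 + q ≤ Real.exp q := by linarith [Real.add_one_le_exp q]
      calc (1 + q) ^ p ≤ Real.exp q ^ p := Real.rpow_le_rpow h1.le a1 hp0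
        _ = Real.exp (p * q) := by rw [← Real.exp_mul, mul_comm]
        _ ≤ _ := exp_le_one_add_add_sq (by nlinarith [(abs_lt.1 hqa).2])
    have e2 : |s| ^ p * (p * q) = p * |s| ^ (p - 2) * s * d := by
      rw [rpow_eq_sq_mul hp, hq]; field_simp
    have e3 : |s| ^ p * (p * q) ^ 2 = p ^ 2 * d ^ 2 * |s| ^ (p - 2) := by
      rw [rpow_eq_sq_mul hp, hq]; field_simp
    rw [e1, abs_mul, abs_of_pos h1, Real.mul_rpow (abs_nonneg _) h1.le]
    have h3 : |s| ^ p * (1 + q) ^ p ≤ |s| ^ p + p * |s| ^ (p - 2) * s * d +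
        (Real.exp p + 1) * (p ^ 2 * d ^ 2 * |s| ^ (p - 2)) := by
      calc |s| ^ p * (1 + q) ^ p ≤ |s| ^ p * (1 + p * q + (Real.exp p + 1) * (p * q) ^ 2) := by
            gcongr
        _ = |s| ^ p + |s| ^ p * (p * q) + (Real.exp p + 1) * (|s| ^ p * (p * q) ^ 2) := by ring
        _ = _ := by rw [e2, e3]
    refine h3.trans (add_le_add le_rfl ?_)
    have c1 : (Real.exp p + 1) * p ^ 2 ≤ taylorConst p := by
      unfold taylorConst
      nlinarith
    have c0 : 0 ≤ taylorConst p := le_trans (by positivity) c1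
    calc (Real.exp p + 1) * (p ^ 2 * d ^ 2 * |s| ^ (p - 2)) =
          (Real.exp p + 1) * p ^ 2 * (d ^ 2 * |s| ^ (p - 2)) := by ring
      _ ≤ taylorConst p * (d ^ 2 * |s| ^ (p - 2)) := by gcongr
      _ ≤ taylorConst p * d ^ 2 * (|s| ^ (p - 2) + |d| ^ (p - 2)) := by
          have : 0 ≤ taylorConst p * d ^ 2 * |d| ^ (p - 2) := by positivity
          linarith

lemma taylorConst_pos (hp : 2 ≤ p) : 0 < taylorConst p := by
  have := Real.exp_pos p
  unfold taylorConst
  positivity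

/-- Second order Taylor bound for the truncated power. -/
lemma exists_truncPow_add_le (hp : 2 ≤ p) (hK : 0 < K) (s : ℝ) : ∃ l : ℝ, ∀ d,
    truncPow p K (s + d) ≤ truncPow p K s + l * d +
      taylorConst p * (d ^ 2 * truncWeight p K s + truncPow p K d) := by
  have hC := taylorConst_pos hp
  have hC4 : 4 + p ≤ taylorConst p := by
    have := Real.exp_pos p
    unfold taylorConst
    have h1 : (0 : ℝ) < 3 ^ p := by positivity
    have h2 : 0 ≤ p * 2 ^ p := by positivity
    nlinarith [sq_nonneg p]
  -- The slope l is the derivative at s of the branch that is active there: of |x|^p inside [-K,K],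
  -- of K^{p-2} x² outside.
  rcases le_or_gt |s| K with hs | hs
  · have ws : truncWeight p K s = |s| ^ (p - 2) := by rw [truncWeight, min_eq_left hs]
    have ts : truncPow p K s = |s| ^ p := by rw [truncPow_eq hp hK, ws, rpow_eq_sq_mul hp]
    refine ⟨p * |s| ^ (p - 2) * s, fun d => ?_⟩
    rcases le_or_gt |d| K with hd | hd
    · have td : truncPow p K d = d ^ 2 * |d| ^ (p - 2) := by
        rw [truncPow_eq hp hK, truncWeight, min_eq_left hd]
      refine (truncPow_le_rpow _).trans ((abs_add_rpow_le hp s d).trans (le_of_eq ?_))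
      rw [ts, ws, td]; ring
    -- Here |s| ≤ K < |d|, so d² K^{p-2} absorbs everything: 4 from the quadratic growth of the left
    -- side, p from the linear term.
    · have td : truncPow p K d = d ^ 2 * K ^ (p - 2) := by
        rw [truncPow_eq hp hK, truncWeight, min_eq_right hd.le]
      have hsd : |s| ≤ |d| := hs.trans hd.le
      have hKp : 0 < K ^ (p - 2) := by positivity
      have h1 : truncPow p K (s + d) ≤ 4 * (d ^ 2 * K ^ (p - 2)) := by
        refine (truncPow_le_sq _).trans ?_
        have : (s + d) ^ 2 ≤ 4 * d ^ 2 := by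
          have := abs_add_le s d
          rw [← sq_abs (s + d), ← sq_abs d]
          nlinarith [abs_nonneg (s + d), abs_nonneg d]
        nlinarith
      have h2 : -(p * |s| ^ (p - 2) * s * d) ≤ p * (d ^ 2 * K ^ (p - 2)) := by
        have a1 : |s| ^ (p - 2) ≤ K ^ (p - 2) :=
          Real.rpow_le_rpow (abs_nonneg _) hs (by linarith)
        calc -(p * |s| ^ (p - 2) * s * d) ≤ |p * |s| ^ (p - 2) * s * d| := neg_le_abs _
          _ = p * |s| ^ (p - 2) * |s| * |d| := by
              rw [abs_mul, abs_mul, abs_mul, abs_of_nonneg (by linarith : 0 ≤ p),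
                abs_of_nonneg (by positivity : 0 ≤ |s| ^ (p - 2))]
          _ ≤ p * K ^ (p - 2) * |d| * |d| := by
              gcongr
          _ = p * (d ^ 2 * K ^ (p - 2)) := by rw [← sq_abs d]; ring
      have h3 : (4 + p) * (d ^ 2 * K ^ (p - 2)) ≤ taylorConst p *
          (d ^ 2 * truncWeight p K s + truncPow p K d) := by
        rw [td]
        have a1 : 0 ≤ d ^ 2 * truncWeight p K s :=
          mul_nonneg (sq_nonneg d) (truncWeight_nonneg hK s)
        have a2 : 0 ≤ d ^ 2 * K ^ (p - 2) := by positivity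
        nlinarith
      have h4 := truncPow_nonneg (p := p) hK s
      nlinarith
  · have ws : truncWeight p K s = K ^ (p - 2) := by rw [truncWeight, min_eq_right hs.le]
    have ts : truncPow p K s = s ^ 2 * K ^ (p - 2) := by rw [truncPow_eq hp hK, ws]
    refine ⟨2 * K ^ (p - 2) * s, fun d => ?_⟩
    refine (truncPow_le_sq _).trans ?_
    rw [ts, ws]
    have h1 := truncPow_nonneg (p := p) hK d
    have h2 : 0 ≤ d ^ 2 * K ^ (p - 2) := by positivity
    have h3 : 1 ≤ taylorConst p := by linarith
    nlinarith [mul_nonneg hC.le h1]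

end

end

noncomputable section

/-! ### Truncated moments of compensated Poisson variables -/

/-- Bounds for the moments of Poisson laws with parameter at most one. -/
def poissonPowConst : ℕ → ℝ
  | 0 => 1
  | j + 1 => 2 ^ (j - 1) * (poissonPowConst j + 1)

lemma poissonPowConst_pos (j : ℕ) : 0 < poissonPowConst j := by
  induction j with
  | zero => simp [poissonPowConst]
  | succ j ih => simp only [poissonPowConst]; positivity

lemma integrable_natCast_pow_poissonMeasure (r : ℝ≥0) (j : ℕ) :
    Integrable (fun n : ℕ => (n : ℝ) ^ j) (poissonMeasure r) := by
  induction j with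
  | zero => simp
  | succ j ih =>
    have h : Integrable (fun n : ℕ => ((n + 1 : ℕ) : ℝ) ^ j) (poissonMeasure r) := by
      refine ((ih.add (integrable_const (1 : ℝ))).const_mul (2 ^ (j - 1))).mono'
        (by fun_prop) (ae_of_all _ fun n => ?_)
      rw [Real.norm_of_nonneg (by positivity)]
      have := add_pow_le (n.cast_nonneg : (0 : ℝ) ≤ n) zero_le_one j
      simpa using this
    refine (integrable_natCast_mul_poissonMeasure (f := fun n => (n : ℝ) ^ j) h).congr
      (ae_of_all _ fun n => ?_)
    simp only []
    ring

/-- The factor r is the point: the Chen–Stein identity extracts it once, and the remaining moment is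
bounded since r ≤ 1. -/
lemma integral_natCast_pow_succ_le {r : ℝ≥0} (hr : r ≤ 1) (j : ℕ) :
    ∫ n : ℕ, (n : ℝ) ^ (j + 1) ∂(poissonMeasure r) ≤ r * poissonPowConst (j + 1) := by
  have key : ∀ j, ∫ n : ℕ, (n : ℝ) ^ j ∂(poissonMeasure r) ≤ poissonPowConst j →
      ∫ n : ℕ, (n : ℝ) ^ (j + 1) ∂(poissonMeasure r) ≤ r * poissonPowConst (j + 1) := by
    intro j ih
    have hi := integrable_natCast_pow_poissonMeasure r j
    have hp : ∀ n : ℕ, ((n + 1 : ℕ) : ℝ) ^ j ≤ 2 ^ (j - 1) * ((n : ℝ) ^ j + 1) := fun n => by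
      have := add_pow_le (n.cast_nonneg : (0 : ℝ) ≤ n) zero_le_one j
      simpa using this
    have hd : Integrable (fun n : ℕ => 2 ^ (j - 1) * ((n : ℝ) ^ j + 1)) (poissonMeasure r) :=
      (hi.add (integrable_const (1 : ℝ))).const_mul _
    have h : Integrable (fun n : ℕ => ((n + 1 : ℕ) : ℝ) ^ j) (poissonMeasure r) := by
      refine hd.mono' (by fun_prop) (ae_of_all _ fun n => ?_)
      rw [Real.norm_of_nonneg (by positivity)]
      exact hp n
    have e := integral_natCast_mul_poissonMeasure r (fun n => (n : ℝ) ^ j) h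
    have e' : ∀ n : ℕ, (n : ℝ) ^ (j + 1) = n * (n : ℝ) ^ j := fun n => by ring
    simp only [e']
    rw [e]
    refine mul_le_mul_of_nonneg_left ?_ r.2
    calc ∫ n : ℕ, ((n + 1 : ℕ) : ℝ) ^ j ∂(poissonMeasure r)
        ≤ ∫ n : ℕ, 2 ^ (j - 1) * ((n : ℝ) ^ j + 1) ∂(poissonMeasure r) :=
          integral_mono h hd hp
      _ = 2 ^ (j - 1) * (∫ n : ℕ, (n : ℝ) ^ j ∂(poissonMeasure r) + 1) := by
          rw [integral_const_mul, integral_add hi (integrable_const _)]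
          simp
      _ ≤ poissonPowConst (j + 1) := by
          simp only [poissonPowConst]
          gcongr
  have all : ∀ j, ∫ n : ℕ, (n : ℝ) ^ j ∂(poissonMeasure r) ≤ poissonPowConst j := by
    intro j
    induction j with
    | zero => simp [poissonPowConst]
    | succ j ih =>
      refine (key j ih).trans ?_
      have := poissonPowConst_pos (j + 1)
      have hr' : (r : ℝ) ≤ 1 := hr
      nlinarith
  exact key j (all j)

section

variable {p K : ℝ}

/-- At n = 0 only d contributes; for n ≥ 1 both powers are at most n^⌈p⌉. The exponent is written as
a successor to match the moment bound that carries the factor r. -/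
lemma max_sq_rpow_le (hp : 2 ≤ p) {d : ℝ} (hd0 : 0 ≤ d) (hd : d ≤ 1) (n : ℕ) :
    max (((n : ℝ) - d) ^ 2) (|(n : ℝ) - d| ^ p) ≤ d + (n : ℝ) ^ (⌈p⌉₊ - 1 + 1) := by
  have hq : (2 : ℝ) ≤ ⌈p⌉₊ := hp.trans (Nat.le_ceil p)
  have hq2 : 2 ≤ ⌈p⌉₊ := by exact_mod_cast hq
  rw [Nat.sub_add_cancel (by omega)]
  rcases Nat.eq_zero_or_pos n with rfl | hn
  · have h0 : ((0 : ℕ) : ℝ) ^ ⌈p⌉₊ = 0 := by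
      rw [Nat.cast_zero, zero_pow (by omega)]
    rw [h0, add_zero, Nat.cast_zero, zero_sub, abs_neg, abs_of_nonneg hd0]
    refine max_le (by nlinarith) ?_
    calc d ^ p ≤ d ^ (1 : ℝ) := by
          rcases eq_or_lt_of_le hd0 with h | h
          · rw [← h, Real.zero_rpow (by linarith), Real.zero_rpow one_ne_zero]
          · exact Real.rpow_le_rpow_of_exponent_ge h hd (by linarith)
      _ = d := Real.rpow_one d
  · have h1 : (1 : ℝ) ≤ n := by exact_mod_cast hn
    have h2 : |(n : ℝ) - d| ≤ n := by rw [abs_of_nonneg (by linarith)]; linarith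
    refine le_trans ?_ (le_add_of_nonneg_left hd0)
    refine max_le ?_ ?_
    · rw [← sq_abs]
      exact (pow_le_pow_left₀ (abs_nonneg _) h2 2).trans (pow_le_pow_right₀ h1 hq2)
    · calc |(n : ℝ) - d| ^ p ≤ (n : ℝ) ^ p := Real.rpow_le_rpow (abs_nonneg _) h2 (by linarith)
        _ ≤ (n : ℝ) ^ (⌈p⌉₊ : ℝ) := Real.rpow_le_rpow_of_exponent_le h1 (Nat.le_ceil p)
        _ = _ := Real.rpow_natCast _ _

/-- The constant in the moment inequality. -/
def stepConst (p : ℝ) : ℝ := taylorConst p * (1 + (1 + poissonPowConst (⌈p⌉₊ - 1 + 1)))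

lemma stepConst_pos (hp : 2 ≤ p) : 0 < stepConst p := by
  have := taylorConst_pos hp
  have := poissonPowConst_pos (⌈p⌉₊ - 1 + 1)
  unfold stepConst
  positivity

lemma integrable_truncPow_poissonMeasure (hK : 0 < K) (r : ℝ≥0) (s y d : ℝ) :
    Integrable (fun n : ℕ => truncPow p K (s + y * ((n : ℝ) - d))) (poissonMeasure r) := by
  have h : Integrable (fun n : ℕ => K ^ (p - 2) * (s + y * ((n : ℝ) - d)) ^ 2)
      (poissonMeasure r) := by
    have h0 := ((integrable_natCast_pow_poissonMeasure r 2).const_mul (y ^ 2)).add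
      (((integrable_natCast_pow_poissonMeasure r 1).const_mul (2 * y * (s - y * d))).add
        (integrable_const ((s - y * d) ^ 2)))
    refine (h0.const_mul (K ^ (p - 2))).congr (ae_of_all _ fun n => ?_)
    simp only [Pi.add_apply]
    ring
  refine h.mono' Measurable.of_discrete.aestronglyMeasurable (ae_of_all _ fun n => ?_)
  rw [Real.norm_of_nonneg (truncPow_nonneg hK _)]
  exact truncPow_le_sq _

/-- The linear Taylor term has mean zero by compensation, the variance is r, and the remaining
moments are of order r. The constant does not depend on K. -/
lemma integral_truncPow_step_le (hp : 2 ≤ p) (hK : 0 < K) {r : ℝ≥0} (hr : r ≤ 1) (s y : ℝ) :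
    ∫ n : ℕ, truncPow p K (s + y * ((n : ℝ) - r)) ∂(poissonMeasure r) ≤
      truncPow p K s +
        stepConst p * r * (y ^ 2 * truncWeight p K s + truncPow p K y) := by
  obtain ⟨l, hl⟩ := exists_truncPow_add_le hp hK s
  have hr' : (r : ℝ) ≤ 1 := hr
  set c := taylorConst p
  have hc : 0 < c := taylorConst_pos hp
  have hΦ := truncPow_nonneg (p := p) hK y
  have hw := truncWeight_nonneg (p := p) hK s
  have i1 := integrable_natCast_poissonMeasure r
  have i2 := integrable_natCast_sq_poissonMeasure r
  set q := ⌈p⌉₊ - 1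
  have iq := integrable_natCast_pow_poissonMeasure r (q + 1)
  have hb : ∀ n : ℕ, truncPow p K (s + y * ((n : ℝ) - r)) ≤
      (truncPow p K s - l * y * r + c * y ^ 2 * truncWeight p K s * r ^ 2
        + c * r * truncPow p K y) +
      ((l * y - 2 * r * (c * y ^ 2 * truncWeight p K s)) * n +
      (c * y ^ 2 * truncWeight p K s * ((n : ℝ) * n) +
      c * truncPow p K y * (n : ℝ) ^ (q + 1))) := by
    intro n
    have h1 : truncPow p K (y * ((n : ℝ) - r)) ≤ (r + (n : ℝ) ^ (q + 1)) * truncPow p K y := by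
      rw [mul_comm y]
      exact (truncPow_mul_le hK _ _).trans
        (mul_le_mul_of_nonneg_right (max_sq_rpow_le hp r.2 hr' n) hΦ)
    have h2 := mul_le_mul_of_nonneg_left h1 hc.le
    have h3 := hl (y * ((n : ℝ) - r))
    nlinarith
  have j2 := i2.const_mul (c * y ^ 2 * truncWeight p K s)
  have j1 := i1.const_mul (l * y - 2 * r * (c * y ^ 2 * truncWeight p K s))
  have jq := iq.const_mul (c * truncPow p K y)
  have j3 := j2.add jq
  have j4 := j1.add j3
  have j0 := integrable_const (μ := poissonMeasure r)
    (truncPow p K s - l * y * r + c * y ^ 2 * truncWeight p K s * r ^ 2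
        + c * r * truncPow p K y)
  have h := integral_mono (integrable_truncPow_poissonMeasure hK r s y r) (j0.add j4) hb
  refine h.trans ?_
  have e1 := integral_add j0 j4
  have e2 := integral_add j1 j3
  have e3 := integral_add j2 jq
  simp only [Pi.add_apply] at e1 e2 e3 ⊢
  rw [e1, e2, e3, integral_const_mul, integral_const_mul, integral_const_mul,
    integral_natCast_poissonMeasure, integral_natCast_sq_poissonMeasure]
  simp only [integral_const, probReal_univ, one_smul]
  have h4 := mul_le_mul_of_nonneg_left (integral_natCast_pow_succ_le hr q)
    (mul_nonneg hc.le hΦ)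
  have hq := poissonPowConst_pos (q + 1)
  have h5 : 0 ≤ c * (1 + poissonPowConst (q + 1)) * r * (y ^ 2 * truncWeight p K s) := by
    have := r.2
    positivity
  have h6 : 0 ≤ c * r * truncPow p K y := by
    have := r.2
    positivity
  have e : stepConst p = c * (1 + (1 + poissonPowConst (q + 1))) := rfl
  rw [e]
  nlinarith

/-- A Poisson variable of parameter jε is a sum of j independent ones of parameter ε. The hypothesis
is demanded at every s, so the one-step bound can be applied from the random position reached
before. -/
lemma lintegral_truncPow_poisson_le_pow (hp : 2 ≤ p) (hK : 0 < K) {ε : ℝ≥0} (hε : ε ≤ 1)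
    {y a b : ℝ} (ha : 0 ≤ a) (hb : 0 ≤ b)
    (h : ∀ s, stepConst p * ε * (y ^ 2 * truncWeight p K s + truncPow p K y) ≤
      a * truncPow p K s + b) (j : ℕ) (s : ℝ) :
    ∫⁻ n : ℕ, ENNReal.ofReal (truncPow p K (s + y * ((n : ℝ) - (j * ε : ℝ≥0))))
      ∂(poissonMeasure (j * ε)) ≤
    ENNReal.ofReal ((1 + a) ^ j * (truncPow p K s + j * b)) := by
  have step : ∀ s, ∫⁻ n : ℕ, ENNReal.ofReal (truncPow p K (s + y * ((n : ℝ) - ε)))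
      ∂(poissonMeasure ε) ≤ ENNReal.ofReal ((1 + a) * truncPow p K s + b) := by
    intro s
    rw [← ofReal_integral_eq_lintegral_ofReal
      (integrable_truncPow_poissonMeasure hK ε s y ε)
      (ae_of_all _ fun n => truncPow_nonneg hK _)]
    refine ENNReal.ofReal_le_ofReal ((integral_truncPow_step_le hp hK hε s y).trans ?_)
    linarith [h s]
  induction j with
  | zero =>
    have hz : ((0 : ℕ) : ℝ≥0) * ε = 0 := by simp
    -- The Poisson law of parameter zero is the unit mass at 0.
    rw [hz, poissonMeasure, lintegral_sum_measure, tsum_eq_single 0 fun n hn => by simp [hn]]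
    simp
  | succ j ih =>
    have e : (((j + 1 : ℕ) : ℝ≥0) * ε) = j * ε + ε := by push_cast; ring
    rw [e, ← poissonMeasure_conv_poissonMeasure, Measure.lintegral_conv Measurable.of_discrete]
    have hΦ := truncPow_nonneg (p := p) hK s
    have hpow : 1 ≤ (1 + a) ^ (j + 1) := one_le_pow₀ (by linarith)
    calc ∫⁻ n : ℕ, ∫⁻ n' : ℕ, ENNReal.ofReal
          (truncPow p K (s + y * (((n + n' : ℕ) : ℝ) - (j * ε + ε : ℝ≥0))))
          ∂(poissonMeasure ε) ∂(poissonMeasure (j * ε))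
        ≤ ∫⁻ n : ℕ, (ENNReal.ofReal (1 + a) * ENNReal.ofReal
            (truncPow p K (s + y * ((n : ℝ) - (j * ε : ℝ≥0)))) + ENNReal.ofReal b)
            ∂(poissonMeasure (j * ε)) := by
          refine lintegral_mono fun n => ?_
          rw [← ENNReal.ofReal_mul (by linarith), ← ENNReal.ofReal_add
            (mul_nonneg (by linarith) (truncPow_nonneg hK _)) hb]
          refine le_trans (le_of_eq ?_) (step _)
          refine lintegral_congr fun n' => ?_
          congr 2
          push_cast
          ring
      _ = ENNReal.ofReal (1 + a) * ∫⁻ n : ℕ, ENNReal.ofReal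
            (truncPow p K (s + y * ((n : ℝ) - (j * ε : ℝ≥0)))) ∂(poissonMeasure (j * ε)) +
            ENNReal.ofReal b := by
          rw [lintegral_add_right _ measurable_const, lintegral_const_mul _ Measurable.of_discrete]
          simp
      _ ≤ ENNReal.ofReal (1 + a) *
            ENNReal.ofReal ((1 + a) ^ j * (truncPow p K s + j * b)) + ENNReal.ofReal b := by
          gcongr
      _ ≤ _ := by
          rw [← ENNReal.ofReal_mul (by linarith), ← ENNReal.ofReal_add (by positivity) hb]
          refine ENNReal.ofReal_le_ofReal ?_
          push_cast
          have : b ≤ (1 + a) ^ (j + 1) * b := le_mul_of_one_le_left hb hpow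
          calc (1 + a) * ((1 + a) ^ j * (truncPow p K s + j * b)) + b
              = (1 + a) ^ (j + 1) * (truncPow p K s + j * b) + b := by ring
            _ ≤ (1 + a) ^ (j + 1) * (truncPow p K s + j * b) + (1 + a) ^ (j + 1) * b := by
                linarith
            _ = _ := by ring

/-- Growth of truncated moments along a compensated Poisson variable. -/
lemma lintegral_truncPow_poisson_le (hp : 2 ≤ p) (hK : 0 < K) {δ : ℝ≥0}
    {y a b : ℝ} (ha : 0 ≤ a) (hb : 0 ≤ b)
    (h : ∀ s, stepConst p * δ * (y ^ 2 * truncWeight p K s + truncPow p K y) ≤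
      a * truncPow p K s + b) (s : ℝ) :
    ∫⁻ n : ℕ, ENNReal.ofReal (truncPow p K (s + y * ((n : ℝ) - δ))) ∂(poissonMeasure δ) ≤
    ENNReal.ofReal (Real.exp a * (truncPow p K s + b)) := by
  -- Cut into k steps of parameter at most one; (1 + a/k)^k ≤ e^a makes the result independent of k.
  obtain ⟨k, hk⟩ := exists_nat_gt δ
  have hk0 : 0 < k := by
    rcases Nat.eq_zero_or_pos k with rfl | h
    · simp at hk
    · exact h
  have hkr : (0 : ℝ) < k := by exact_mod_cast hk0
  have hkn : (0 : ℝ≥0) < k := by exact_mod_cast hk0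
  have hε : δ / k ≤ 1 := by
    rw [div_le_one hkn]; exact hk.le
  have h' : ∀ s, stepConst p * (δ / k : ℝ≥0) * (y ^ 2 * truncWeight p K s + truncPow p K y) ≤
      a / k * truncPow p K s + b / k := by
    intro s
    have := div_le_div_of_nonneg_right (h s) hkr.le
    push_cast
    calc stepConst p * (δ / k) * (y ^ 2 * truncWeight p K s + truncPow p K y) =
          stepConst p * δ * (y ^ 2 * truncWeight p K s + truncPow p K y) / k := by ring
      _ ≤ (a * truncPow p K s + b) / k := this
      _ = _ := by ring
  have key := lintegral_truncPow_poisson_le_pow hp hK hε (div_nonneg ha hkr.le)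
    (div_nonneg hb hkr.le) h' k s
  have e : (k : ℝ≥0) * (δ / k) = δ := by field_simp
  rw [e] at key
  refine key.trans (ENNReal.ofReal_le_ofReal ?_)
  have e2 : (k : ℝ) * (b / k) = b := by field_simp
  rw [e2]
  refine mul_le_mul_of_nonneg_right ?_ (add_nonneg (truncPow_nonneg hK s) hb)
  calc (1 + a / k) ^ k ≤ Real.exp (a / k) ^ k := by
        refine pow_le_pow_left₀ (by positivity) ?_ k
        linarith [Real.add_one_le_exp (a / k)]
    _ = Real.exp a := by
        rw [← Real.exp_nat_mul]; congr 1; field_simp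

/-- The remainder in the bound of `y ^ 2 * truncWeight p K s` by `ζ ^ 2 * truncPow p K s`, plus
`truncPow p K y`. -/
def momentRem (p K ζ y : ℝ) : ℝ :=
  (if ζ = 0 then K ^ (p - 2) * y ^ 2 else ζ ^ 2 * truncPow p K (y / ζ)) + truncPow p K y

lemma momentRem_nonneg (hK : 0 < K) (ζ y : ℝ) : 0 ≤ momentRem p K ζ y := by
  unfold momentRem
  refine add_nonneg ?_ (truncPow_nonneg hK y)
  split_ifs
  · positivity
  · exact mul_nonneg (sq_nonneg _) (truncPow_nonneg hK _)

/-- A Young inequality with free parameter ζ: the larger of |s| and |y/ζ| absorbs the mixed term.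
For ζ = 0 only the bound K^{p-2} on the weight is available. -/
lemma sq_mul_truncWeight_add_le (hp : 2 ≤ p) (hK : 0 < K) (ζ y s : ℝ) :
    y ^ 2 * truncWeight p K s + truncPow p K y ≤ ζ ^ 2 * truncPow p K s + momentRem p K ζ y := by
  have hs := truncPow_nonneg (p := p) hK s
  unfold momentRem
  split_ifs with h
  · have := mul_le_mul_of_nonneg_left (truncWeight_le hp hK s) (sq_nonneg y)
    rw [h]
    linarith
  · have hy := truncPow_nonneg (p := p) hK (y / ζ)
    have hζ : 0 < ζ ^ 2 := by positivity
    have e : y ^ 2 = ζ ^ 2 * (y / ζ) ^ 2 := by field_simp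
    rcases le_total |s| |y / ζ| with h1 | h1
    · have h2 := truncWeight_mono hp hK h1
      have h3 : y ^ 2 * truncWeight p K s ≤ ζ ^ 2 * truncPow p K (y / ζ) := by
        rw [truncPow_eq hp hK, ← mul_assoc, ← e]
        exact mul_le_mul_of_nonneg_left h2 (sq_nonneg y)
      have := mul_nonneg hζ.le hs
      linarith
    · have h3 : y ^ 2 * truncWeight p K s ≤ ζ ^ 2 * truncPow p K s := by
        rw [truncPow_eq hp hK, ← mul_assoc, e]
        exact mul_le_mul_of_nonneg_right
          (mul_le_mul_of_nonneg_left (sq_le_sq.2 h1) hζ.le) (truncWeight_nonneg hK s)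
      have := mul_nonneg hζ.le hy
      linarith

lemma momentRem_le (hK : 0 < K) (ζ y : ℝ) : momentRem p K ζ y ≤ 2 * K ^ (p - 2) * y ^ 2 := by
  have h1 := truncPow_le_sq (p := p) (K := K) y
  unfold momentRem
  split_ifs with h
  · linarith
  · have h2 : ζ ^ 2 * truncPow p K (y / ζ) ≤ K ^ (p - 2) * y ^ 2 := by
      calc ζ ^ 2 * truncPow p K (y / ζ) ≤ ζ ^ 2 * (K ^ (p - 2) * (y / ζ) ^ 2) :=
            mul_le_mul_of_nonneg_left (truncPow_le_sq _) (sq_nonneg ζ)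
        _ = _ := by field_simp
    linarith

lemma momentRem_add_le (hp : 2 ≤ p) (hK : 0 < K) (ζ a b : ℝ) :
    momentRem p K ζ (a + b) ≤ 2 ^ p * (momentRem p K ζ a + momentRem p K ζ b) := by
  have h1 := truncPow_add_le hp hK a b
  have h4 : (4 : ℝ) ≤ 2 ^ p := by
    calc (4 : ℝ) = 2 ^ (2 : ℝ) := by norm_num
      _ ≤ 2 ^ p := Real.rpow_le_rpow_of_exponent_le (by norm_num) hp
  unfold momentRem
  split_ifs with h
  · have : K ^ (p - 2) * (a + b) ^ 2 ≤
        2 ^ p * (K ^ (p - 2) * a ^ 2 + K ^ (p - 2) * b ^ 2) := by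
      have hk : 0 < K ^ (p - 2) := by positivity
      have : (a + b) ^ 2 ≤ 2 ^ p * (a ^ 2 + b ^ 2) := by nlinarith [sq_nonneg (a - b)]
      nlinarith
    nlinarith
  · have h2 := truncPow_add_le hp hK (a / ζ) (b / ζ)
    rw [← add_div] at h2
    have h3 := mul_le_mul_of_nonneg_left h2 (sq_nonneg ζ)
    nlinarith

/-- This explains the role of ζ: for an integrand ζU with deterministic ζ, as in the mild equation
with ζ = G z, the remainder is again a truncated power of U, with a constant free of K. -/
lemma momentRem_mul_le (hp : 2 ≤ p) (hK : 0 < K) (ζ U : ℝ) :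
    momentRem p K ζ (ζ * U) ≤ (2 * ζ ^ 2 + |ζ| ^ p) * truncPow p K U := by
  have hU := truncPow_nonneg (p := p) hK U
  have h1 : truncPow p K (ζ * U) ≤ (ζ ^ 2 + |ζ| ^ p) * truncPow p K U :=
    (truncPow_mul_le hK ζ U).trans (mul_le_mul_of_nonneg_right
      (max_le_add_of_nonneg (by positivity) (by positivity)) hU)
  unfold momentRem
  split_ifs with h
  · subst h
    simp only [zero_mul, truncPow_zero hp]
    have : 0 ≤ |(0 : ℝ)| ^ p := by positivity
    simpa using mul_nonneg this hU
  · rw [mul_div_cancel_left₀ _ h]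
    linarith

lemma measurable_momentRem (hp : 2 ≤ p) :
    Measurable fun q : ℝ × ℝ => momentRem p K q.1 q.2 := by
  have h := (continuous_truncPow (p := p) (K := K) hp).measurable
  unfold momentRem
  refine Measurable.add (Measurable.ite (measurable_fst (measurableSet_singleton 0)) ?_ ?_) ?_
  · fun_prop
  · exact (measurable_fst.pow_const 2).mul (h.comp (measurable_snd.div measurable_fst))
  · exact h.comp measurable_snd

end

end

noncomputable section

/-! ### The moment inequality for elementary processes -/

section

variable {Ω E : Type*} [mΩ : MeasurableSpace Ω] [MeasurableSpace E] {P : Measure Ω}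
  {m : Measure E} {N : Ω → Measure E} {p K : ℝ}

/-- Integrating the Young inequality over B replaces m(B) by integrals of ζ² and of the remainder,
so ζ may vary within the cell although the integrand y does not. -/
lemma lintegral_truncPow_poisson_le_setLIntegral (hp : 2 ≤ p) (hK : 0 < K) {B : Set E}
    (hm : m B ≠ ∞) {ζ : E → ℝ} (hζ : Measurable ζ)
    (hB : ∫⁻ ξ in B, ENNReal.ofReal (ζ ξ ^ 2) ∂m ≠ ∞) (s y : ℝ) :
    ∫⁻ n : ℕ, ENNReal.ofReal (truncPow p K (s + y * ((n : ℝ) - (m B).toReal)))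
        ∂(poissonMeasure (m B).toNNReal) ≤
      ENNReal.ofReal (Real.exp (stepConst p * (∫⁻ ξ in B, ENNReal.ofReal (ζ ξ ^ 2) ∂m).toReal)) *
        (ENNReal.ofReal (truncPow p K s) + ENNReal.ofReal (stepConst p) *
          ∫⁻ ξ in B, ENNReal.ofReal (momentRem p K (ζ ξ) y) ∂m) := by
  have hC := stepConst_pos hp
  have hR : ∫⁻ ξ in B, ENNReal.ofReal (momentRem p K (ζ ξ) y) ∂m ≠ ∞ := by
    refine ne_top_of_le_ne_top (b := ENNReal.ofReal (2 * K ^ (p - 2) * y ^ 2) * m B)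
      (ENNReal.mul_ne_top ENNReal.ofReal_ne_top hm) ?_
    rw [← setLIntegral_const]
    exact lintegral_mono fun ξ => ENNReal.ofReal_le_ofReal (momentRem_le hK _ _)
  have key : ∀ s, stepConst p * ((m B).toNNReal : ℝ) *
      (y ^ 2 * truncWeight p K s + truncPow p K y) ≤
      stepConst p * (∫⁻ ξ in B, ENNReal.ofReal (ζ ξ ^ 2) ∂m).toReal * truncPow p K s +
      stepConst p * (∫⁻ ξ in B, ENNReal.ofReal (momentRem p K (ζ ξ) y) ∂m).toReal := by
    intro s
    have hΦ := truncPow_nonneg (p := p) hK s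
    have hl : 0 ≤ y ^ 2 * truncWeight p K s + truncPow p K y :=
      add_nonneg (mul_nonneg (sq_nonneg y) (truncWeight_nonneg hK s)) (truncPow_nonneg hK y)
    have h1 : ENNReal.ofReal (y ^ 2 * truncWeight p K s + truncPow p K y) * m B ≤
        (∫⁻ ξ in B, ENNReal.ofReal (ζ ξ ^ 2) ∂m) * ENNReal.ofReal (truncPow p K s) +
        ∫⁻ ξ in B, ENNReal.ofReal (momentRem p K (ζ ξ) y) ∂m := by
      rw [← setLIntegral_const, ← lintegral_mul_const _ (by fun_prop),
        ← lintegral_add_left (by fun_prop)]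
      refine lintegral_mono fun ξ => ?_
      simp only []
      rw [← ENNReal.ofReal_mul (sq_nonneg _),
        ← ENNReal.ofReal_add (mul_nonneg (sq_nonneg _) hΦ) (momentRem_nonneg hK _ _)]
      exact ENNReal.ofReal_le_ofReal (sq_mul_truncWeight_add_le hp hK _ _ _)
    have h2 := ENNReal.toReal_mono
      (ENNReal.add_ne_top.2 ⟨ENNReal.mul_ne_top hB ENNReal.ofReal_ne_top, hR⟩) h1
    rw [ENNReal.toReal_add (ENNReal.mul_ne_top hB ENNReal.ofReal_ne_top) hR, ENNReal.toReal_mul,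
      ENNReal.toReal_mul, ENNReal.toReal_ofReal hl, ENNReal.toReal_ofReal hΦ] at h2
    have h3 := mul_le_mul_of_nonneg_left h2 hC.le
    have e : ((m B).toNNReal : ℝ) = (m B).toReal := rfl
    rw [e]
    linarith
  have h := lintegral_truncPow_poisson_le hp hK (δ := (m B).toNNReal)
    (mul_nonneg hC.le ENNReal.toReal_nonneg) (mul_nonneg hC.le ENNReal.toReal_nonneg) key s
  refine h.trans (le_of_eq ?_)
  rw [ENNReal.ofReal_mul (Real.exp_nonneg _), ENNReal.ofReal_add (truncPow_nonneg hK s)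
    (mul_nonneg hC.le ENNReal.toReal_nonneg), ENNReal.ofReal_mul hC.le, ENNReal.ofReal_toReal hR]

variable [IsProbabilityMeasure P]

/-- Integration over the number of points in a set that is independent of the remaining
variables. -/
lemma IsPoissonRandomMeasure.lintegral_freeze (hN : IsPoissonRandomMeasure P m N) {B : Set E}
    (hB : MeasurableSet B) (hm : m B ≠ ∞) {S Y : Ω → ℝ}
    (hS : AEStronglyMeasurable[restrictSigma N Bᶜ] S P)
    (hY : AEStronglyMeasurable[restrictSigma N Bᶜ] Y P) {f : ℝ × ℝ → ℝ → ℝ≥0∞}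
    (hf : Measurable (Function.uncurry f)) :
    ∫⁻ ω, f (S ω, Y ω) (N ω B).toReal ∂P =
      ∫⁻ ω, ∫⁻ n : ℕ, f (S ω, Y ω) n ∂(poissonMeasure (m B).toNNReal) ∂P := by
  have hle := hN.restrictSigma_le hB.compl
  set Z : Ω → ℝ × ℝ := fun ω => (hS.mk S ω, hY.mk Y ω) with hZ
  have hZm : Measurable[restrictSigma N Bᶜ] Z :=
    hS.stronglyMeasurable_mk.measurable.prodMk hY.stronglyMeasurable_mk.measurable
  have hZm' : Measurable Z := hZm.mono hle le_rfl
  have hBm : Measurable[restrictSigma N B] fun ω => (N ω B).toReal :=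
    @Measurable.ennreal_toReal _ (restrictSigma N B) _ (measurable_restrictSigma_apply N hB le_rfl)
  have hBm' : Measurable fun ω => (N ω B).toReal := (hN.measurable_apply hB).ennreal_toReal
  have hind : IndepFun Z (fun ω => (N ω B).toReal) P :=
    indep_of_indep_of_le_right (indep_of_indep_of_le_left
      (hN.indep_restrictSigma hB.compl hB disjoint_compl_left) hZm.comap_le) hBm.comap_le
  have hmap := (indepFun_iff_map_prod_eq_prod_map_map hZm'.aemeasurable
    hBm'.aemeasurable).1 hind
  have hae : ∀ᵐ ω ∂P, (S ω, Y ω) = Z ω := by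
    filter_upwards [hS.ae_eq_mk, hY.ae_eq_mk] with ω h1 h2
    simp [hZ, ← h1, ← h2]
  have e1 : ∫⁻ ω, f (S ω, Y ω) (N ω B).toReal ∂P = ∫⁻ ω, f (Z ω) (N ω B).toReal ∂P :=
    lintegral_congr_ae (hae.mono fun ω h => by simp only [h])
  have e2 : ∫⁻ ω, ∫⁻ n : ℕ, f (S ω, Y ω) n ∂(poissonMeasure (m B).toNNReal) ∂P =
      ∫⁻ ω, ∫⁻ n : ℕ, f (Z ω) n ∂(poissonMeasure (m B).toNNReal) ∂P :=
    lintegral_congr_ae (hae.mono fun ω h => by simp only [h])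
  rw [e1, e2]
  have h1 := lintegral_map (μ := P) hf (hZm'.prodMk hBm')
  rw [hmap, lintegral_prod _ hf.aemeasurable, lintegral_map _ hZm'] at h1
  rotate_left
  · exact hf.lintegral_prod_right'
  refine Eq.trans h1.symm ?_
  refine lintegral_congr fun ω => ?_
  refine (lintegral_map (f := f (Z ω)) (hf.comp measurable_prodMk_left) hBm').trans ?_
  exact hN.lintegral_comp hB hm (f := f (Z ω)) (hf.comp measurable_prodMk_left)

/-- The truncated moment inequality for the integral `S`, over the set `W`, of the process `V`. -/
def HasMomentBound (P : Measure Ω) (m : Measure E) (p K : ℝ) (ζ : E → ℝ) (V : E × Ω → ℝ) (c : ℝ)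
    (W : Set E) (S : Ω → ℝ) : Prop :=
  ∫⁻ ω, ENNReal.ofReal (truncPow p K (S ω)) ∂P ≤
    ENNReal.ofReal (Real.exp (stepConst p * (∫⁻ ξ in W, ENNReal.ofReal (ζ ξ ^ 2) ∂m).toReal)) *
      (ENNReal.ofReal (truncPow p K c) + ENNReal.ofReal (stepConst p) *
        ∫⁻ ω, ∫⁻ ξ in W, ENNReal.ofReal (momentRem p K (ζ ξ) (V (ξ, ω))) ∂m ∂P)

variable {ζ : E → ℝ} {V : E × Ω → ℝ} {c : ℝ}

lemma HasMomentBound.mono (hp : 2 ≤ p) (hζi : ∫⁻ ξ, ENNReal.ofReal (ζ ξ ^ 2) ∂m ≠ ∞)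
    {W W' : Set E} {S : Ω → ℝ} (h : HasMomentBound P m p K ζ V c W S) (hW : W ⊆ W') :
    HasMomentBound P m p K ζ V c W' S := by
  have hC := stepConst_pos hp
  refine le_trans h (mul_le_mul' ?_ (add_le_add le_rfl (mul_le_mul' le_rfl ?_)))
  · refine ENNReal.ofReal_le_ofReal (Real.exp_le_exp.2 (mul_le_mul_of_nonneg_left ?_ hC.le))
    exact ENNReal.toReal_mono (ne_top_of_le_ne_top hζi (setLIntegral_le_lintegral _ _))
      (lintegral_mono_set hW)
  · exact lintegral_mono fun ω => lintegral_mono_set hW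

lemma HasMomentBound.congr {W : Set E} {S S' : Ω → ℝ} (h : HasMomentBound P m p K ζ V c W S)
    (hS : S =ᵐ[P] S') : HasMomentBound P m p K ζ V c W S' := by
  have e : ∫⁻ ω, ENNReal.ofReal (truncPow p K (S ω)) ∂P =
      ∫⁻ ω, ENNReal.ofReal (truncPow p K (S' ω)) ∂P :=
    lintegral_congr_ae (hS.mono fun ω h => by simp only [h])
  unfold HasMomentBound at *
  rwa [← e]

/-- With S and Y frozen, the count of B is an independent Poisson variable. The exponential factors
multiply because ∫ζ² is additive, and the new remainder may be inflated by the old factor, which is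
at least one. -/
lemma HasMomentBound.union [SFinite m] (hN : IsPoissonRandomMeasure P m N) (hp : 2 ≤ p) (hK : 0 < K)
    (hζ : Measurable ζ) (hζi : ∫⁻ ξ, ENNReal.ofReal (ζ ξ ^ 2) ∂m ≠ ∞) (hV : Measurable V)
    {W B : Set E} {S Y : Ω → ℝ} (h : HasMomentBound P m p K ζ V c W S)
    (hB : MeasurableSet B) (hm : m B ≠ ∞) (hWB : Disjoint W B)
    (hS : AEStronglyMeasurable[restrictSigma N Bᶜ] S P)
    (hY : AEStronglyMeasurable[restrictSigma N Bᶜ] Y P)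
    (hVY : ∀ ξ ∈ B, ∀ ω, V (ξ, ω) = Y ω) :
    HasMomentBound P m p K ζ V c (W ∪ B) (fun ω => S ω + Y ω * compensated m N B ω) := by
  have hle := hN.restrictSigma_le hB.compl
  have hC := stepConst_pos hp
  have hfin : ∀ A : Set E, ∫⁻ ξ in A, ENNReal.ofReal (ζ ξ ^ 2) ∂m ≠ ∞ := fun A =>
    ne_top_of_le_ne_top hζi (setLIntegral_le_lintegral _ _)
  have hΦ := (continuous_truncPow (p := p) (K := K) hp).measurable
  have hRm : Measurable fun q : E × Ω => ENNReal.ofReal (momentRem p K (ζ q.1) (V q)) :=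
    ((measurable_momentRem hp).comp ((hζ.comp measurable_fst).prodMk hV)).ennreal_ofReal
  have hfm : Measurable (Function.uncurry fun (q : ℝ × ℝ) (k : ℝ) =>
      ENNReal.ofReal (truncPow p K (q.1 + q.2 * (k - (m B).toReal)))) :=
    (hΦ.comp (by fun_prop)).ennreal_ofReal
  have e := hN.lintegral_freeze hB hm hS hY hfm
  unfold HasMomentBound at *
  simp only [compensated]
  rw [e]
  have hu : ∀ f : E → ℝ≥0∞, ∫⁻ ξ in W ∪ B, f ξ ∂m = ∫⁻ ξ in W, f ξ ∂m + ∫⁻ ξ in B, f ξ ∂m :=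
    fun f => lintegral_union hB hWB
  simp only [hu]
  rw [ENNReal.toReal_add (hfin W) (hfin B), mul_add (stepConst p), Real.exp_add,
    ENNReal.ofReal_mul (Real.exp_nonneg _), lintegral_add_right _
      (Measurable.lintegral_prod_left' hRm)]
  set aW := ENNReal.ofReal
    (Real.exp (stepConst p * (∫⁻ ξ in W, ENNReal.ofReal (ζ ξ ^ 2) ∂m).toReal))
  set aB := ENNReal.ofReal
    (Real.exp (stepConst p * (∫⁻ ξ in B, ENNReal.ofReal (ζ ξ ^ 2) ∂m).toReal))
  have haW : 1 ≤ aW := by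
    rw [← ENNReal.ofReal_one]
    exact ENNReal.ofReal_le_ofReal (Real.one_le_exp (mul_nonneg hC.le ENNReal.toReal_nonneg))
  set RW := ∫⁻ ω, ∫⁻ ξ in W, ENNReal.ofReal (momentRem p K (ζ ξ) (V (ξ, ω))) ∂m ∂P
  set RB := ∫⁻ ω, ∫⁻ ξ in B, ENNReal.ofReal (momentRem p K (ζ ξ) (V (ξ, ω))) ∂m ∂P with hRB
  have hSm : AEMeasurable (fun ω => ENNReal.ofReal (truncPow p K (S ω))) P :=
    (hΦ.comp_aemeasurable (hS.mono hle).aemeasurable).ennreal_ofReal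
  calc ∫⁻ ω, ∫⁻ n : ℕ, ENNReal.ofReal (truncPow p K (S ω + Y ω * ((n : ℝ) - (m B).toReal)))
        ∂(poissonMeasure (m B).toNNReal) ∂P
      ≤ ∫⁻ ω, aB * (ENNReal.ofReal (truncPow p K (S ω)) + ENNReal.ofReal (stepConst p) *
          ∫⁻ ξ in B, ENNReal.ofReal (momentRem p K (ζ ξ) (V (ξ, ω))) ∂m) ∂P := by
        refine lintegral_mono fun ω => ?_
        refine (lintegral_truncPow_poisson_le_setLIntegral hp hK hm hζ (hfin B) _ _).trans
          (le_of_eq ?_)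
        congr 3
        exact setLIntegral_congr_fun hB fun ξ hξ => by simp only [hVY ξ hξ ω]
    _ = aB * (∫⁻ ω, ENNReal.ofReal (truncPow p K (S ω)) ∂P + ENNReal.ofReal (stepConst p) * RB) := by
        rw [lintegral_const_mul' _ _ ENNReal.ofReal_ne_top, lintegral_add_left' hSm,
          lintegral_const_mul' _ _ ENNReal.ofReal_ne_top]
    _ ≤ aB * (aW * (ENNReal.ofReal (truncPow p K c) + ENNReal.ofReal (stepConst p) * RW) +
          aW * (ENNReal.ofReal (stepConst p) * RB)) := by
        exact mul_le_mul' le_rfl (add_le_add h (le_mul_of_one_le_left' haW))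
    _ = _ := by ring

end

end

/-! ### Elementary processes cut into time slabs and atoms. -/

noncomputable section

section

variable {Ω : Type*} [mΩ : MeasurableSpace Ω] {P : Measure Ω} {ν : Measure JumpSize}
  {N : Ω → Measure JumpSpace} {p K : ℝ}

lemma aestronglyMeasurable_finsetSum {m₁ : MeasurableSpace Ω} {κ : Type*}
    (s : Finset κ) {f : κ → Ω → ℝ} (h : ∀ j ∈ s, AEStronglyMeasurable[m₁] (f j) P) :
    AEStronglyMeasurable[m₁] (fun ω => ∑ j ∈ s, f j ω) P := by
  classical
  induction s using Finset.induction_on with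
  | empty => simpa using (@stronglyMeasurable_const _ _ m₁ _ (0 : ℝ)).aestronglyMeasurable
  | insert a s ha ih =>
    simp only [Finset.sum_insert ha]
    exact (h a (Finset.mem_insert_self _ _)).add
      (ih fun j hj => h j (Finset.mem_insert_of_mem hj))

namespace ElementaryProcess

open IsPoissonRandomMeasure (atomOf atomOf_disjoint measurableSet_atomOf
  measure_inter_eq_sum_atomOf)

variable (V : ElementaryProcess P ν N)

lemma measurable_toFun (hN : IsPoissonRandomMeasure P (intensity ν) N) : Measurable V.toFun := by
  unfold toFun
  refine Finset.measurable_sum _ fun j _ => ?_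
  exact ((V.measurable_coeff hN j).comp measurable_snd).mul
    ((measurable_const.indicator (V.measurableSet_cell j)).comp measurable_fst)

/-- The integral of an elementary process up to time `θ`, plus a constant. -/
def integralUpTo (c : ℝ) (θ : ℝ≥0) (ω : Ω) : ℝ :=
  c + ∑ j, V.Y j ω * compensated (intensity ν) N (V.cell j ∩ timeLE θ) ω

/-- The value of the process on the atom `b` of a time slab that starts at `θ`. -/
def atomCoeff (θ : ℝ≥0) (b : Fin V.size → Bool) (ω : Ω) : ℝ :=
  ∑ j with V.a j ≤ θ ∧ b j = true, V.Y j ω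

lemma atomCoeff_aestronglyMeasurable (θ : ℝ≥0) (b : Fin V.size → Bool) :
    AEStronglyMeasurable[restrictSigma N (timeLE θ)] (V.atomCoeff θ b) P := by
  refine aestronglyMeasurable_finsetSum _ fun j hj => ?_
  exact (aestronglyMeasurable_of_measurable_noiseSigma (V.measurable_Y j)).mono
    (restrictSigma_mono N (measurableSet_timeLE _) (timeLE_mono (Finset.mem_filter.1 hj).2.1))

lemma integralUpTo_aestronglyMeasurable (c : ℝ) (θ : ℝ≥0) :
    AEStronglyMeasurable[restrictSigma N (timeLE θ)] (V.integralUpTo c θ) P := by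
  unfold integralUpTo
  refine (@stronglyMeasurable_const _ _ (restrictSigma N (timeLE θ)) _ c).aestronglyMeasurable.add
    (aestronglyMeasurable_finsetSum _ fun j _ => ?_)
  rcases le_or_gt (V.a j) θ with h | h
  · refine ((aestronglyMeasurable_of_measurable_noiseSigma (V.measurable_Y j)).mono
      (restrictSigma_mono N (measurableSet_timeLE _) (timeLE_mono h))).mul ?_
    exact (measurable_restrictSigma_compensated N
      ((V.measurableSet_cell j).inter (measurableSet_timeLE θ))
      inter_subset_right).aestronglyMeasurable
  · have e : V.cell j ∩ timeLE θ = ∅ := by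
      ext ξ
      simp only [mem_inter_iff, mem_empty_iff_false, iff_false, not_and]
      intro h1 h2
      exact absurd (V.cell_subset_compl j h1) (not_not.2 (le_trans (α := ℝ≥0) h2 h.le))
    simp only [e, compensated, measure_empty, ENNReal.toReal_zero, sub_zero, mul_zero]
    exact (@stronglyMeasurable_const _ _ (restrictSigma N (timeLE θ)) _ (0 : ℝ)).aestronglyMeasurable

/-- The gap condition says that no summand starts strictly inside the slab. The process is therefore
constant on each atom, with a value known at the start of the slab. -/
lemma toFun_eq_atomCoeff {θ₀ θ : ℝ≥0} (hgap : ∀ j, V.a j ≤ θ₀ ∨ θ ≤ V.a j)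
    (b : Fin V.size → Bool) {ξ : JumpSpace}
    (hξ : ξ ∈ atomOf (timeLE θ \ timeLE θ₀) V.cell b) (ω : Ω) :
    V.toFun (ξ, ω) = V.atomCoeff θ₀ b ω := by
  unfold toFun atomCoeff
  rw [Finset.sum_filter]
  refine Finset.sum_congr rfl fun j _ => ?_
  have h1 := hξ.2 j
  change V.Y j ω * (V.cell j).indicator (fun _ => (1 : ℝ)) ξ = _
  by_cases hb : b j = true
  · have hc := h1.2 hb
    have ha : V.a j ≤ θ₀ := by
      rcases hgap j with h | h
      · exact h
      · exact absurd (V.cell_subset_compl j hc) (not_not.2 (le_trans (α := ℝ≥0) hξ.1.1 h))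
    rw [indicator_of_mem hc, if_pos ⟨ha, hb⟩, mul_one]
  · rw [indicator_of_notMem (fun h => hb (h1.1 h)), if_neg (fun h => hb h.2), mul_zero]

variable [SigmaFinite ν]

lemma intensity_atomOf_ne_top (B : Set JumpSpace) {b : Fin V.size → Bool} (hb : ∃ j, b j = true) :
    intensity ν (atomOf B V.cell b) ≠ ∞ := by
  obtain ⟨j, hj⟩ := hb
  exact ne_top_of_le_ne_top (V.intensity_cell_ne_top j)
    (measure_mono fun ξ hξ => (hξ.2 j).2 hj)

lemma compensated_cell_inter (hN : IsPoissonRandomMeasure P (intensity ν) N)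
    {θ₀ θ : ℝ≥0} (h : θ₀ ≤ θ) (j : Fin V.size) :
    ∀ᵐ ω ∂P, compensated (intensity ν) N (V.cell j ∩ timeLE θ) ω =
      compensated (intensity ν) N (V.cell j ∩ timeLE θ₀) ω +
      ∑ b : Fin V.size → Bool with b j = true,
        compensated (intensity ν) N (atomOf (timeLE θ \ timeLE θ₀) V.cell b) ω := by
  have hB : MeasurableSet (timeLE θ \ timeLE θ₀) :=
    (measurableSet_timeLE θ).diff (measurableSet_timeLE θ₀)
  have key : ∀ χ : Measure JumpSpace, χ (V.cell j) ≠ ∞ →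
      (χ (V.cell j ∩ timeLE θ)).toReal = (χ (V.cell j ∩ timeLE θ₀)).toReal +
      ∑ b : Fin V.size → Bool with b j = true,
        (χ (atomOf (timeLE θ \ timeLE θ₀) V.cell b)).toReal := by
    intro χ hχ
    have e : V.cell j ∩ timeLE θ =
        (V.cell j ∩ timeLE θ₀) ∪ (V.cell j ∩ (timeLE θ \ timeLE θ₀)) := by
      rw [← inter_union_distrib_left, union_sdiff_cancel (timeLE_mono h)]
    have hd : Disjoint (V.cell j ∩ timeLE θ₀) (V.cell j ∩ (timeLE θ \ timeLE θ₀)) :=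
      (disjoint_sdiff_right).mono inter_subset_right inter_subset_right
    have hfin : ∀ A ⊆ V.cell j, χ A ≠ ∞ := fun A hA =>
      ne_top_of_le_ne_top hχ (measure_mono hA)
    rw [e, measure_union hd ((V.measurableSet_cell j).inter hB),
      ENNReal.toReal_add (hfin _ inter_subset_left) (hfin _ inter_subset_left),
      measure_inter_eq_sum_atomOf χ hB V.measurableSet_cell j, ENNReal.toReal_sum]
    intro b hb
    exact hfin _ fun ξ hξ => (hξ.2 j).2 (Finset.mem_filter.1 hb).2
  have h2 := key (intensity ν) (V.intensity_cell_ne_top j)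
  filter_upwards [hN.ae_lt_top (V.measurableSet_cell j) (V.intensity_cell_ne_top j)] with ω hω
  have h1 := key (N ω) hω.ne
  simp only [compensated, Finset.sum_sub_distrib]
  rw [h1, h2]
  ring

/-- Only atoms inside at least one cell are summed: the remaining one may have infinite intensity,
and its coefficient is an empty sum. -/
lemma integralUpTo_eq_add_sum (hN : IsPoissonRandomMeasure P (intensity ν) N) (c : ℝ)
    {θ₀ θ : ℝ≥0} (h : θ₀ ≤ θ) (hgap : ∀ j, V.a j ≤ θ₀ ∨ θ ≤ V.a j) :
    (fun ω => V.integralUpTo c θ₀ ω + ∑ b : Fin V.size → Bool with ∃ j, b j = true,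
      V.atomCoeff θ₀ b ω *
        compensated (intensity ν) N (atomOf (timeLE θ \ timeLE θ₀) V.cell b) ω) =ᵐ[P]
      V.integralUpTo c θ := by
  filter_upwards [ae_all_iff.2 fun j => V.compensated_cell_inter hN h j] with ω hω
  unfold integralUpTo
  simp only [hω, mul_add, Finset.sum_add_distrib, add_assoc]
  congr 2
  simp only [Finset.mul_sum, Finset.sum_filter, atomCoeff, Finset.sum_mul]
  rw [Finset.sum_comm]
  refine Finset.sum_congr rfl fun b _ => ?_
  have hz : ∀ j, b j = true → ¬ V.a j ≤ θ₀ →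
      compensated (intensity ν) N (atomOf (timeLE θ \ timeLE θ₀) V.cell b) ω = 0 := by
    intro j hb ha
    have e : atomOf (timeLE θ \ timeLE θ₀) V.cell b = ∅ := by
      ext ξ
      simp only [mem_empty_iff_false, iff_false]
      intro hξ
      exact absurd (V.cell_subset_compl j ((hξ.2 j).2 hb))
        (not_not.2 (le_trans (α := ℝ≥0) hξ.1.1 ((hgap j).resolve_left ha)))
    simp [e, compensated]
  by_cases hb : ∃ j, b j = true
  · rw [if_pos hb]
    refine Finset.sum_congr rfl fun j _ => ?_
    by_cases hj : b j = true
    · by_cases ha : V.a j ≤ θ₀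
      · simp [hj, ha]
      · simp [hj, ha, hz j hj ha]
    · simp [hj]
  · rw [if_neg hb]
    refine (Finset.sum_eq_zero fun j _ => ?_).symm
    rw [if_neg fun h => hb ⟨j, h⟩, mul_zero]

variable [IsProbabilityMeasure P] {ζ : JumpSpace → ℝ} {c : ℝ}

/-- All coefficients in the slab are known at θ₀ and the atoms are disjoint, so each atom is
independent of what was added before; the atoms are added one at a time. -/
lemma hasMomentBound_slab (hN : IsPoissonRandomMeasure P (intensity ν) N) (hp : 2 ≤ p)
    (hK : 0 < K) (hζ : Measurable ζ)
    (hζi : ∫⁻ ξ, ENNReal.ofReal (ζ ξ ^ 2) ∂(intensity ν) ≠ ∞) {θ₀ θ : ℝ≥0} (h : θ₀ ≤ θ)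
    (hgap : ∀ j, V.a j ≤ θ₀ ∨ θ ≤ V.a j)
    (h₀ : HasMomentBound P (intensity ν) p K ζ V.toFun c (timeLE θ₀) (V.integralUpTo c θ₀)) :
    HasMomentBound P (intensity ν) p K ζ V.toFun c (timeLE θ) (V.integralUpTo c θ) := by
  classical
  set B := timeLE θ \ timeLE θ₀ with hBdef
  have hB : MeasurableSet B := (measurableSet_timeLE θ).diff (measurableSet_timeLE θ₀)
  have hat : ∀ b, MeasurableSet (atomOf B V.cell b) := fun b =>
    measurableSet_atomOf hB V.measurableSet_cell b
  have hsub : ∀ b, timeLE θ₀ ⊆ (atomOf B V.cell b)ᶜ := fun b ξ hξ hξ' => hξ'.1.2 hξ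
  have hY : ∀ b b', AEStronglyMeasurable[restrictSigma N (atomOf B V.cell b')ᶜ]
      (V.atomCoeff θ₀ b) P := fun b b' => (V.atomCoeff_aestronglyMeasurable θ₀ b).mono
    (restrictSigma_mono N (measurableSet_timeLE _) (hsub b'))
  have key : ∀ s : Finset (Fin V.size → Bool), (∀ b ∈ s, ∃ j, b j = true) →
      HasMomentBound P (intensity ν) p K ζ V.toFun c (timeLE θ₀ ∪ ⋃ b ∈ s, atomOf B V.cell b)
        (fun ω => V.integralUpTo c θ₀ ω + ∑ b ∈ s, V.atomCoeff θ₀ b ω *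
          compensated (intensity ν) N (atomOf B V.cell b) ω) := by
    intro s
    induction s using Finset.induction_on with
    | empty => intro _; simpa using h₀
    | insert b s hb ih =>
      intro hs
      have ih' := ih fun b' hb' => hs b' (Finset.mem_insert_of_mem hb')
      have hdis : Disjoint (timeLE θ₀ ∪ ⋃ b' ∈ s, atomOf B V.cell b') (atomOf B V.cell b) := by
        refine Disjoint.union_left (disjoint_left.2 fun ξ h1 h2 => h2.1.2 h1) ?_
        simp only [disjoint_iUnion_left]
        intro b' hb'
        exact atomOf_disjoint B V.cell fun e => hb (e ▸ hb')
      have hS : AEStronglyMeasurable[restrictSigma N (atomOf B V.cell b)ᶜ]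
          (fun ω => V.integralUpTo c θ₀ ω + ∑ b ∈ s, V.atomCoeff θ₀ b ω *
            compensated (intensity ν) N (atomOf B V.cell b) ω) P := by
        refine ((V.integralUpTo_aestronglyMeasurable c θ₀).mono
          (restrictSigma_mono N (measurableSet_timeLE _) (hsub b))).add
          (aestronglyMeasurable_finsetSum s fun b' hb' => (hY b' b).mul ?_)
        refine (measurable_restrictSigma_compensated N (hat b') ?_).aestronglyMeasurable
        rw [subset_compl_iff_disjoint_right]
        exact atomOf_disjoint B V.cell fun e => hb (e ▸ hb')
      have := ih'.union hN hp hK hζ hζi (V.measurable_toFun hN) (hat b)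
        (V.intensity_atomOf_ne_top B (hs b (Finset.mem_insert_self _ _))) hdis hS (hY b b)
        (fun ξ hξ ω => V.toFun_eq_atomCoeff hgap b hξ ω)
      convert this using 1
      · rw [Finset.set_biUnion_insert, union_comm (atomOf B V.cell b), union_assoc]
      · ext ω
        rw [Finset.sum_insert hb]
        ring
  have h1 := key (Finset.univ.filter fun b => ∃ j, b j = true)
    (fun b hb => (Finset.mem_filter.1 hb).2)
  refine (h1.congr (V.integralUpTo_eq_add_sum hN c h hgap)).mono hp hζi ?_
  refine union_subset (timeLE_mono h) (iUnion₂_subset fun b _ ξ hξ => hξ.1.1)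

/-- Induction on the number of start times before θ: the last slab begins at the latest of them, so
the gap condition holds. -/
lemma hasMomentBound_integralUpTo (hN : IsPoissonRandomMeasure P (intensity ν) N) (hp : 2 ≤ p)
    (hK : 0 < K) (hζ : Measurable ζ)
    (hζi : ∫⁻ ξ, ENNReal.ofReal (ζ ξ ^ 2) ∂(intensity ν) ≠ ∞) (θ : ℝ≥0) :
    HasMomentBound P (intensity ν) p K ζ V.toFun c (timeLE θ) (V.integralUpTo c θ) := by
  induction hn : (Finset.univ.filter fun j => V.a j < θ).card using Nat.strong_induction_on
    generalizing θ with
  | _ n ih =>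
  rcases (Finset.univ.filter fun j => V.a j < θ).eq_empty_or_nonempty with h | h
  · refine V.hasMomentBound_slab hN hp hK hζ hζi (zero_le (a := θ)) (fun j => ?_) ?_
    · right
      by_contra hj
      have : j ∈ Finset.univ.filter fun j => V.a j < θ := by simpa using hj
      simp [h] at this
    · have e : V.integralUpTo c 0 = fun _ => c := by
        ext ω
        unfold integralUpTo
        rw [Finset.sum_eq_zero, add_zero]
        intro j _
        have e : V.cell j ∩ timeLE 0 = ∅ := by
          ext ξ
          simp only [mem_inter_iff, mem_empty_iff_false, iff_false, not_and]
          intro h1 h2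
          exact absurd (V.cell_subset_compl j h1) (not_not.2 (le_trans (α := ℝ≥0) h2 zero_le))
        simp [e, compensated]
      have hC := stepConst_pos hp
      unfold HasMomentBound
      rw [e]
      simp only [lintegral_const, measure_univ, mul_one]
      refine le_trans le_self_add (le_mul_of_one_le_left' ?_)
      rw [← ENNReal.ofReal_one]
      exact ENNReal.ofReal_le_ofReal (Real.one_le_exp (mul_nonneg hC.le ENNReal.toReal_nonneg))
  · obtain ⟨j₀, hj₀, hmax⟩ := Finset.exists_max_image _ V.a h
    have hlt : V.a j₀ < θ := (Finset.mem_filter.1 hj₀).2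
    refine V.hasMomentBound_slab hN hp hK hζ hζi hlt.le (fun j => ?_) (ih _ ?_ _ rfl)
    · by_cases hj : V.a j < θ
      · exact Or.inl (hmax j (by simpa using hj))
      · exact Or.inr (not_lt.1 hj)
    · rw [← hn]
      refine Finset.card_lt_card (Finset.ssubset_iff_of_subset ?_ |>.2 ⟨j₀, hj₀, by simp⟩)
      intro j hj
      simp only [Finset.mem_filter, Finset.mem_univ, true_and] at hj ⊢
      exact hj.trans hlt

/-- The truncated moment inequality for elementary processes. -/
theorem hasMomentBound (hN : IsPoissonRandomMeasure P (intensity ν) N) (hp : 2 ≤ p)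
    (hK : 0 < K) (hζ : Measurable ζ)
    (hζi : ∫⁻ ξ, ENNReal.ofReal (ζ ξ ^ 2) ∂(intensity ν) ≠ ∞) (c : ℝ) :
    HasMomentBound P (intensity ν) p K ζ V.toFun c univ (fun ω => c + V.integral ω) := by
  obtain ⟨θ, hθ⟩ : ∃ θ : ℝ≥0, ∀ j, V.b j ≤ θ :=
    ⟨∑ j, V.b j, fun j => Finset.single_le_sum (f := V.b) (fun _ _ => zero_le) (Finset.mem_univ j)⟩
  have h := V.hasMomentBound_integralUpTo (c := c) hN hp hK hζ hζi θ
  refine (h.mono hp hζi (subset_univ _)).congr (ae_of_all _ fun ω => ?_)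
  unfold integralUpTo integral
  congr 1
  refine Finset.sum_congr rfl fun j _ => ?_
  rw [inter_eq_left.2]
  · rfl
  · exact fun ξ hξ => le_trans (α := ℝ≥0) hξ.1.2 (hθ j)

end ElementaryProcess

end

end

noncomputable section

/-! ### The moment inequality for Itô integrals -/

lemma lintegral_ofReal_sq_eq_eLpNorm {α : Type*} [MeasurableSpace α] (μ : Measure α) (f : α → ℝ) :
    ∫⁻ a, ENNReal.ofReal (f a ^ 2) ∂μ = eLpNorm f 2 μ ^ 2 := by
  rw [eLpNorm_eq_lintegral_rpow_enorm_toReal (by norm_num) (by norm_num), ← ENNReal.rpow_natCast,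
    ← ENNReal.rpow_mul]
  norm_num
  refine lintegral_congr fun a => ?_
  rw [← sq_abs, ENNReal.ofReal_pow (abs_nonneg _), Real.enorm_eq_ofReal_abs]

section

variable {Ω : Type*} [mΩ : MeasurableSpace Ω] {P : Measure Ω} [IsProbabilityMeasure P]
  {ν : Measure JumpSize} [SigmaFinite ν] {N : Ω → Measure JumpSpace} {p K : ℝ}

/-- The truncated moment inequality for Itô integrals. -/
theorem IsItoIntegral.lintegral_truncPow_le (hN : IsPoissonRandomMeasure P (intensity ν) N)
    {V : JumpSpace × Ω → ℝ} {X : Ω → ℝ} (hX : IsItoIntegral P ν N V X) (hp : 2 ≤ p) (hK : 0 < K)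
    {ζ : JumpSpace → ℝ} (hζ : Measurable ζ)
    (hζi : ∫⁻ ξ, ENNReal.ofReal (ζ ξ ^ 2) ∂(intensity ν) ≠ ∞) (c : ℝ) :
    ∫⁻ ω, ENNReal.ofReal (truncPow p K (c + X ω)) ∂P ≤
      ENNReal.ofReal
        (Real.exp (stepConst p * (∫⁻ ξ, ENNReal.ofReal (ζ ξ ^ 2) ∂(intensity ν)).toReal)) *
      (ENNReal.ofReal (truncPow p K c) + ENNReal.ofReal (stepConst p * 2 ^ p) *
        ∫⁻ q, ENNReal.ofReal (momentRem p K (ζ q.1) (V q)) ∂((intensity ν).prod P)) := by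
  obtain ⟨hV, hX2, s, hs, hsX⟩ := hX
  have hC := stepConst_pos hp
  have hΦ := continuous_truncPow (p := p) (K := K) hp
  have hRm := measurable_momentRem (p := p) (K := K) hp
  have hRV : ∀ f : JumpSpace × Ω → ℝ, AEMeasurable f ((intensity ν).prod P) → AEMeasurable
      (fun q => ENNReal.ofReal (momentRem p K (ζ q.1) (f q))) ((intensity ν).prod P) := fun f hf =>
    (hRm.comp_aemeasurable ((hζ.comp measurable_fst).aemeasurable.prodMk hf)).ennreal_ofReal
  set A := ENNReal.ofReal
    (Real.exp (stepConst p * (∫⁻ ξ, ENNReal.ofReal (ζ ξ ^ 2) ∂(intensity ν)).toReal))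
  set J := ∫⁻ q, ENNReal.ofReal (momentRem p K (ζ q.1) (V q)) ∂((intensity ν).prod P)
  -- Passing from the approximating process to V costs the factor 2^p and an error that is quadratic
  -- for fixed K, hence controlled by the L² approximation.
  have hbound : ∀ l, ∫⁻ ω, ENNReal.ofReal (truncPow p K (c + (s l).integral ω)) ∂P ≤
      A * (ENNReal.ofReal (truncPow p K c) + ENNReal.ofReal (stepConst p * 2 ^ p) *
        (J + ENNReal.ofReal (2 * K ^ (p - 2)) *
          eLpNorm ((s l).toFun - V) 2 ((intensity ν).prod P) ^ 2)) := by
    intro l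
    have h := (s l).hasMomentBound hN hp hK hζ hζi c
    unfold HasMomentBound at h
    simp only [Measure.restrict_univ] at h
    refine h.trans (mul_le_mul' le_rfl (add_le_add le_rfl ?_))
    have hm := (s l).measurable_toFun hN
    rw [← lintegral_prod_symm (f := fun q : JumpSpace × Ω =>
        ENNReal.ofReal (momentRem p K (ζ q.1) ((s l).toFun q))) (hRV _ hm.aemeasurable),
      ENNReal.ofReal_mul hC.le, mul_assoc]
    refine mul_le_mul' le_rfl ?_
    have hsub : AEMeasurable ((s l).toFun - V) ((intensity ν).prod P) :=
      hm.aemeasurable.sub hV.1.aemeasurable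
    calc ∫⁻ q, ENNReal.ofReal (momentRem p K (ζ q.1) ((s l).toFun q)) ∂((intensity ν).prod P)
        ≤ ∫⁻ q, ENNReal.ofReal (2 ^ p) * (ENNReal.ofReal (momentRem p K (ζ q.1) (V q)) +
            ENNReal.ofReal (2 * K ^ (p - 2)) *
              ENNReal.ofReal (((s l).toFun - V) q ^ 2)) ∂((intensity ν).prod P) := by
          refine lintegral_mono fun q => ?_
          rw [← ENNReal.ofReal_mul (by positivity),
            ← ENNReal.ofReal_add (momentRem_nonneg hK _ _) (by positivity),
            ← ENNReal.ofReal_mul (by positivity)]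
          refine ENNReal.ofReal_le_ofReal ?_
          have h1 := momentRem_add_le hp hK (ζ q.1) (V q) (((s l).toFun - V) q)
          have h2 : V q + ((s l).toFun - V) q = (s l).toFun q := by simp
          rw [h2] at h1
          refine h1.trans (mul_le_mul_of_nonneg_left ?_ (by positivity))
          exact add_le_add le_rfl (momentRem_le hK _ _)
      _ = _ := by
          rw [lintegral_const_mul' _ _ ENNReal.ofReal_ne_top,
            lintegral_add_left' (hRV V hV.1.aemeasurable),
            lintegral_const_mul' _ _ ENNReal.ofReal_ne_top, lintegral_ofReal_sq_eq_eLpNorm]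
  have hlim : Tendsto (fun l => A * (ENNReal.ofReal (truncPow p K c) +
      ENNReal.ofReal (stepConst p * 2 ^ p) * (J + ENNReal.ofReal (2 * K ^ (p - 2)) *
          eLpNorm ((s l).toFun - V) 2 ((intensity ν).prod P) ^ 2))) atTop
      (𝓝 (A * (ENNReal.ofReal (truncPow p K c) + ENNReal.ofReal (stepConst p * 2 ^ p) * J))) := by
    have h0 : Tendsto (fun l => eLpNorm ((s l).toFun - V) 2 ((intensity ν).prod P) ^ 2) atTop
        (𝓝 0) := by
      simpa using ENNReal.Tendsto.pow (n := 2) hs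
    have h1 := ENNReal.Tendsto.const_mul (a := ENNReal.ofReal (2 * K ^ (p - 2))) h0
      (Or.inr ENNReal.ofReal_ne_top)
    rw [mul_zero] at h1
    have h2 := (tendsto_const_nhds (x := J)).add h1
    rw [add_zero] at h2
    exact ENNReal.Tendsto.const_mul (tendsto_const_nhds.add
      (ENNReal.Tendsto.const_mul h2 (Or.inr ENNReal.ofReal_ne_top))) (Or.inr ENNReal.ofReal_ne_top)
  have hmeas : ∀ l, AEStronglyMeasurable (s l).integral P := fun l => ((s l).memLp_integral hN).1
  -- An almost surely convergent subsequence and Fatou's lemma suffice; no uniform integrability is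
  -- needed for an upper bound.
  obtain ⟨φ', hmono, hae⟩ := (tendstoInMeasure_of_tendsto_eLpNorm two_ne_zero hmeas hX2.1
    hsX).exists_seq_tendsto_ae
  calc ∫⁻ ω, ENNReal.ofReal (truncPow p K (c + X ω)) ∂P
      = ∫⁻ ω, liminf (fun l => ENNReal.ofReal (truncPow p K (c + (s (φ' l)).integral ω))) atTop
          ∂P := by
        refine lintegral_congr_ae ?_
        filter_upwards [hae] with ω hω
        refine (Tendsto.liminf_eq ?_).symm
        exact (ENNReal.continuous_ofReal.tendsto _).comp
          ((hΦ.tendsto _).comp (tendsto_const_nhds.add hω))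
    _ ≤ liminf (fun l => ∫⁻ ω, ENNReal.ofReal (truncPow p K (c + (s (φ' l)).integral ω)) ∂P)
          atTop :=
        lintegral_liminf_le' fun l => (hΦ.measurable.comp_aemeasurable
          ((hmeas _).aemeasurable.const_add c)).ennreal_ofReal
    _ ≤ liminf (fun l => A * (ENNReal.ofReal (truncPow p K c) +
          ENNReal.ofReal (stepConst p * 2 ^ p) * (J + ENNReal.ofReal (2 * K ^ (p - 2)) *
          eLpNorm ((s (φ' l)).toFun - V) 2 ((intensity ν).prod P) ^ 2))) atTop :=
        liminf_le_liminf (Eventually.of_forall fun l => hbound (φ' l))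
    _ = _ := (hlim.comp hmono.tendsto_atTop).liminf_eq

end

/-! ### A Gronwall inequality on light cones -/

lemma lintegral_lebTime_sub_mul_exp_le (t : ℝ≥0) {l : ℝ} (hl : 0 < l) :
    ∫⁻ s, ENNReal.ofReal ((t : ℝ) - s) * ENNReal.ofReal (Real.exp (l * s)) ∂lebTime ≤
      ENNReal.ofReal (Real.exp (l * t) / l ^ 2) := by
  rw [lintegral_lebTime fun s => ENNReal.ofReal ((t : ℝ) - s) * ENNReal.ofReal (Real.exp (l * s))]
  have h1 : ∫⁻ s in Ici (0 : ℝ), ENNReal.ofReal ((t : ℝ) - s) * ENNReal.ofReal (Real.exp (l * s)) ≤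
      ∫⁻ s in Ioc (0 : ℝ) t, ENNReal.ofReal (((t : ℝ) - s) * Real.exp (l * s)) := by
    rw [setLIntegral_congr Ioi_ae_eq_Ici.symm, ← lintegral_indicator measurableSet_Ioi,
      ← lintegral_indicator measurableSet_Ioc]
    refine lintegral_mono fun s => ?_
    by_cases hs : 0 < s
    · have b : s ∈ Ioi (0 : ℝ) := hs
      rw [indicator_of_mem b]
      by_cases hst : s ≤ t
      · have a : s ∈ Ioc (0 : ℝ) t := ⟨hs, hst⟩
        rw [indicator_of_mem a, ENNReal.ofReal_mul (by linarith)]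
      · rw [ENNReal.ofReal_of_nonpos (by linarith), zero_mul]
        exact zero_le
    · have b : s ∉ Ioi (0 : ℝ) := hs
      rw [indicator_of_notMem b]
      exact zero_le
  refine h1.trans ?_
  rw [← ofReal_integral_eq_lintegral_ofReal]
  · refine ENNReal.ofReal_le_ofReal ?_
    rw [← intervalIntegral.integral_of_le t.coe_nonneg]
    have hd : ∀ s ∈ uIcc (0 : ℝ) t, HasDerivAt
        (fun s => (((t : ℝ) - s) / l + 1 / l ^ 2) * Real.exp (l * s))
        (((t : ℝ) - s) * Real.exp (l * s)) s := by
      intro s _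
      have a1 : HasDerivAt (fun s : ℝ => ((t : ℝ) - s) / l + 1 / l ^ 2) (-1 / l) s :=
        (((hasDerivAt_id s).const_sub (t : ℝ)).div_const l).add_const _
      have a2 : HasDerivAt (fun s : ℝ => Real.exp (l * s)) (Real.exp (l * s) * l) s := by
        have := ((hasDerivAt_id s).const_mul l).exp
        simpa using this
      refine (a1.mul a2).congr_deriv ?_
      field_simp
      ring
    rw [intervalIntegral.integral_eq_sub_of_hasDerivAt hd (by
      apply Continuous.intervalIntegrable; fun_prop)]
    have : 0 ≤ ((t : ℝ) - 0) / l + 1 / l ^ 2 := by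
      have := t.2
      simp only [sub_zero]
      positivity
    have h2 : 0 ≤ (((t : ℝ) - 0) / l + 1 / l ^ 2) * Real.exp (l * 0) :=
      mul_nonneg this (Real.exp_nonneg _)
    have h3 : (((t : ℝ) - t) / l + 1 / l ^ 2) * Real.exp (l * t) = Real.exp (l * t) / l ^ 2 := by
      rw [sub_self, zero_div, zero_add]; ring
    linarith
  · exact (by fun_prop : Continuous fun s : ℝ =>
      ((t : ℝ) - s) * Real.exp (l * s)).integrableOn_Ioc
  · refine (ae_restrict_iff' measurableSet_Ioc).2 (Eventually.of_forall fun s hs => ?_)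
    exact mul_nonneg (by linarith [hs.2]) (Real.exp_nonneg _)

/-- In the norm weighted by e^{lt} the Volterra operator has norm at most k₀/l² ≤ 1/2 for l = 2k₀+1.
The a priori bound M is halved at each iteration and does not enter the conclusion. -/
theorem gronwall_pastClosed {ν : Measure JumpSize} [SigmaFinite ν] {k₀ c M : ℝ} (hk₀ : 0 ≤ k₀)
    (hc : 0 ≤ c) (hM : 0 ≤ M) {κ : JumpSize → ℝ≥0∞} (hκm : Measurable κ)
    (hκ : ∫⁻ z, κ z ∂ν ≤ ENNReal.ofReal k₀) {D : Set (ℝ≥0 × ℝ)} (hD : IsPastClosed D)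
    {F : ℝ≥0 → ℝ → ℝ≥0∞} (hF : ∀ t x, (t, x) ∈ D → F t x ≤ ENNReal.ofReal M)
    (h : ∀ t x, (t, x) ∈ D → F t x ≤ ENNReal.ofReal c +
      ∫⁻ ξ, ENNReal.ofReal (pathG t x ξ) * (κ ξ.2.2 * F ξ.1 ξ.2.1) ∂(intensity ν)) :
    ∀ t x, (t, x) ∈ D → F t x ≤ ENNReal.ofReal (2 * c * Real.exp ((2 * k₀ + 1) * t)) := by
  set l := 2 * k₀ + 1 with hl
  have hl0 : 0 < l := by positivity
  have key : ∀ n : ℕ, ∀ t x, (t, x) ∈ D →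
      F t x ≤ ENNReal.ofReal ((2 * c + M * (1 / 2) ^ n) * Real.exp (l * t)) := by
    intro n
    induction n with
    | zero =>
      intro t x hx
      refine (hF t x hx).trans (ENNReal.ofReal_le_ofReal ?_)
      have : 1 ≤ Real.exp (l * t) := Real.one_le_exp (mul_nonneg hl0.le t.2)
      rw [pow_zero, mul_one]
      nlinarith
    | succ n ih =>
      intro t x hx
      refine (h t x hx).trans ?_
      set a := 2 * c + M * (1 / 2) ^ n with ha
      have ha0 : 0 ≤ a := by positivity
      have h1 : ∫⁻ ξ, ENNReal.ofReal (pathG t x ξ) * (κ ξ.2.2 * F ξ.1 ξ.2.1) ∂(intensity ν) ≤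
          ∫⁻ ξ, ENNReal.ofReal (pathG t x ξ) * (κ ξ.2.2 *
            (ENNReal.ofReal a * ENNReal.ofReal (Real.exp (l * ξ.1)))) ∂(intensity ν) := by
        refine lintegral_mono fun ξ => ?_
        by_cases hG : pathG t x ξ = 0
        · simp [hG]
        · refine mul_le_mul' le_rfl (mul_le_mul' le_rfl ?_)
          rw [← ENNReal.ofReal_mul ha0]
          exact ih ξ.1 ξ.2.1 (hD t x _ _ hx (waveG_ne_zero_iff.1 hG))
      rw [lintegral_pathG_mul hκm
        (q := fun s => ENNReal.ofReal a * ENNReal.ofReal (Real.exp (l * s))) (by fun_prop)] at h1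
      have h2 : ∫⁻ s, ENNReal.ofReal ((t : ℝ) - s) *
          (ENNReal.ofReal a * ENNReal.ofReal (Real.exp (l * s))) ∂lebTime ≤
          ENNReal.ofReal a * ENNReal.ofReal (Real.exp (l * t) / l ^ 2) := by
        refine le_trans (le_of_eq ?_)
          (mul_le_mul' le_rfl (lintegral_lebTime_sub_mul_exp_le t hl0))
        rw [← lintegral_const_mul _ (by fun_prop)]
        refine lintegral_congr fun s => ?_
        ring
      refine (add_le_add le_rfl (h1.trans (mul_le_mul' hκ h2))).trans ?_
      rw [← ENNReal.ofReal_mul ha0, ← ENNReal.ofReal_mul hk₀,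
        ← ENNReal.ofReal_add hc (by positivity)]
      refine ENNReal.ofReal_le_ofReal ?_
      have e1 : 1 ≤ Real.exp (l * t) := Real.one_le_exp (mul_nonneg hl0.le t.2)
      have e2 : k₀ * (a * (Real.exp (l * t) / l ^ 2)) ≤ 1 / 2 * a * Real.exp (l * t) := by
        have : k₀ / l ^ 2 ≤ 1 / 2 := by
          rw [div_le_iff₀ (by positivity), hl]
          nlinarith [sq_nonneg k₀]
        calc k₀ * (a * (Real.exp (l * t) / l ^ 2)) = k₀ / l ^ 2 * (a * Real.exp (l * t)) := by ring
          _ ≤ 1 / 2 * (a * Real.exp (l * t)) :=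
              mul_le_mul_of_nonneg_right this (by positivity)
          _ = _ := by ring
      have e3 : c ≤ c * Real.exp (l * t) := le_mul_of_one_le_right hc e1
      calc c + k₀ * (a * (Real.exp (l * t) / l ^ 2)) ≤
            c * Real.exp (l * t) + 1 / 2 * a * Real.exp (l * t) := add_le_add e3 e2
        _ = _ := by rw [ha, pow_succ]; ring
  intro t x hx
  have hlim : Tendsto (fun n : ℕ => ENNReal.ofReal
      ((2 * c + M * (1 / 2) ^ n) * Real.exp (l * t))) atTop
      (𝓝 (ENNReal.ofReal ((2 * c + M * 0) * Real.exp (l * t)))) :=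
    ENNReal.tendsto_ofReal (((tendsto_pow_atTop_nhds_zero_of_lt_one (by norm_num)
      (by norm_num)).const_mul M |>.const_add (2 * c)).mul_const _)
  rw [mul_zero, add_zero] at hlim
  exact ge_of_tendsto hlim (Eventually.of_forall fun n => key n t x hx)

end

noncomputable section

/-! ### Moments of the solutions -/

/-- The factor in the moment inequality that comes from the weight `∫ ζ²`. -/
def growthFactor (p T m₂ : ℝ) : ℝ := Real.exp (stepConst p * (m₂ * T ^ 2))

/-- The rate in the Volterra inequality for the truncated moments. -/
def growthRate (p T m₂ mₚ : ℝ) : ℝ :=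
  growthFactor p T m₂ * (stepConst p * 2 ^ p) * (m₂ + mₚ)

/-- The constant in the moment bounds of the solutions. -/
def momentConst (p T m₂ mₚ : ℝ) : ℝ :=
  (2 * growthFactor p T m₂ * Real.exp ((2 * growthRate p T m₂ mₚ + 1) * T)) ^ (1 / p)

lemma growthFactor_nonneg (p T m₂ : ℝ) : 0 ≤ growthFactor p T m₂ := Real.exp_nonneg _

lemma momentConst_nonneg (p T m₂ mₚ : ℝ) : 0 ≤ momentConst p T m₂ mₚ := by
  have := Real.exp_pos (stepConst p * (m₂ * T ^ 2))
  unfold momentConst growthFactor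
  positivity

/-- The jump weight in the Volterra inequality for the truncated moments. -/
def jumpWeight (ν : Measure JumpSize) (p T : ℝ) (z : JumpSize) : ℝ≥0∞ :=
  ENNReal.ofReal (growthFactor p T (jumpMoment ν 2).toReal * (stepConst p * 2 ^ p)) *
    (ENNReal.ofReal ((z : ℝ) ^ 2) + ENNReal.ofReal (|(z : ℝ)| ^ p))

section

variable {ν : Measure JumpSize} {p T : ℝ}

lemma growthRate_nonneg (hp : 2 ≤ p) :
    0 ≤ growthRate p T (jumpMoment ν 2).toReal (jumpMoment ν p).toReal := by
  have := stepConst_pos hp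
  unfold growthRate growthFactor
  positivity

lemma measurable_jumpWeight : Measurable (jumpWeight ν p T) := by
  unfold jumpWeight
  have := measurable_coe_jumpSize
  fun_prop

lemma lintegral_jumpWeight_le (hp : 2 ≤ p) (hν : jumpMoment ν 2 < ∞) (hνp : jumpMoment ν p < ∞) :
    ∫⁻ z, jumpWeight ν p T z ∂ν ≤
      ENNReal.ofReal (growthRate p T (jumpMoment ν 2).toReal (jumpMoment ν p).toReal) := by
  have hC := stepConst_pos hp
  have hz := measurable_coe_jumpSize
  unfold jumpWeight growthRate
  rw [lintegral_const_mul' _ _ ENNReal.ofReal_ne_top, lintegral_add_left (by fun_prop),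
    ← jumpMoment_two_eq, ENNReal.ofReal_mul (mul_nonneg (growthFactor_nonneg _ _ _) (by positivity)),
    ENNReal.ofReal_add ENNReal.toReal_nonneg ENNReal.toReal_nonneg, ENNReal.ofReal_toReal hν.ne,
    ENNReal.ofReal_toReal hνp.ne]
  rfl

lemma pathG_rpow_le (hp : 2 ≤ p) (t : ℝ≥0) (x : ℝ) (ξ : JumpSpace) :
    pathG t x ξ ^ p ≤ pathG t x ξ := by
  have h := Real.rpow_le_rpow_of_exponent_ge' (pathG_nonneg t x ξ)
    ((pathG_le t x ξ).trans (by norm_num)) zero_le_one (by linarith : (1 : ℝ) ≤ p)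
  simpa using h

/-- Since 2G² = G and G^p ≤ G, a single factor G survives, and the truncated moments obey an
inequality with the same Volterra kernel as before. -/
lemma momentRem_pathG_le {K : ℝ} (hp : 2 ≤ p) (hK : 0 < K) (t : ℝ≥0) (x : ℝ) (ξ : JumpSpace)
    (U : ℝ) : momentRem p K (pathG t x ξ * ξ.2.2) (pathG t x ξ * U * ξ.2.2) ≤
      pathG t x ξ * (((ξ.2.2 : ℝ) ^ 2 + |(ξ.2.2 : ℝ)| ^ p) * truncPow p K U) := by
  have h1 := momentRem_mul_le hp hK (pathG t x ξ * ξ.2.2) U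
  have e : pathG t x ξ * ξ.2.2 * U = pathG t x ξ * U * ξ.2.2 := by ring
  rw [e] at h1
  refine h1.trans ?_
  rw [← mul_assoc]
  refine mul_le_mul_of_nonneg_right ?_ (truncPow_nonneg hK U)
  have hG := pathG_nonneg t x ξ
  have e2 : pathG t x ξ * pathG t x ξ = pathG t x ξ / 2 := waveG_mul_self _ _
  have e3 : 2 * (pathG t x ξ * (ξ.2.2 : ℝ)) ^ 2 = pathG t x ξ * (ξ.2.2 : ℝ) ^ 2 := by
    rw [mul_pow, sq (pathG t x ξ), e2]; ring
  rw [e3, abs_mul, abs_of_nonneg hG, Real.mul_rpow hG (abs_nonneg _), mul_add]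
  exact add_le_add le_rfl (mul_le_mul_of_nonneg_right (pathG_rpow_le hp t x ξ) (by positivity))

variable [SigmaFinite ν]

lemma lintegral_sq_pathG_mul_le (t : ℝ≥0) (x : ℝ) :
    ∫⁻ ξ, ENNReal.ofReal ((pathG t x ξ * ξ.2.2) ^ 2) ∂(intensity ν) ≤
      jumpMoment ν 2 * ENNReal.ofReal ((t : ℝ) ^ 2) := by
  have hz := measurable_coe_jumpSize
  have h1 : ∀ ξ : JumpSpace, ENNReal.ofReal ((pathG t x ξ * ξ.2.2) ^ 2) ≤
      ENNReal.ofReal (pathG t x ξ) * (ENNReal.ofReal ((ξ.2.2 : ℝ) ^ 2) * 1) := by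
    intro ξ
    rw [mul_one, ← ENNReal.ofReal_mul (pathG_nonneg _ _ _)]
    refine ENNReal.ofReal_le_ofReal ?_
    have e2 : pathG t x ξ * pathG t x ξ = pathG t x ξ / 2 := waveG_mul_self _ _
    rw [mul_pow, sq (pathG t x ξ), e2]
    have := mul_nonneg (pathG_nonneg t x ξ) (sq_nonneg (ξ.2.2 : ℝ))
    linarith
  refine (lintegral_mono h1).trans ?_
  rw [lintegral_pathG_mul (κ := fun z : JumpSize => ENNReal.ofReal ((z : ℝ) ^ 2))
    (q := fun _ => 1) (by fun_prop) measurable_const, ← jumpMoment_two_eq]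
  refine mul_le_mul' le_rfl ?_
  have := lintegral_lebTime_sub_mul_pow_le t le_rfl 0
  simp only [Nat.mul_zero, pow_zero, ENNReal.ofReal_one] at this
  refine this.trans (ENNReal.ofReal_le_ofReal ?_)
  norm_num

end

section

variable {Ω : Type*} [mΩ : MeasurableSpace Ω] {P : Measure Ω} [IsProbabilityMeasure P]
  {ν : Measure JumpSize} [SigmaFinite ν] {N : Ω → Measure JumpSpace} {p K : ℝ}

/-- The truncated moments of a random field. -/
def fieldMoment (P : Measure Ω) (p K : ℝ) (w : ℝ≥0 → ℝ → Ω → ℝ) (t : ℝ≥0) (x : ℝ) : ℝ≥0∞ :=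
  ∫⁻ ω, ENNReal.ofReal (truncPow p K (w t x ω)) ∂P

/-- The Volterra inequality for the truncated moments of a mild solution. -/
lemma IsItoIntegral.lintegral_truncPow_wave_le (hN : IsPoissonRandomMeasure P (intensity ν) N)
    (hp : 2 ≤ p) (hK : 0 < K) (hν : jumpMoment ν 2 < ∞) {t T : ℝ≥0} (ht : t ≤ T) {x : ℝ}
    {w : ℝ≥0 → ℝ → Ω → ℝ} (hw : Measurable fun q : ℝ≥0 × ℝ × Ω => w q.1 q.2.1 q.2.2) {X : Ω → ℝ}
    (hX : IsItoIntegral P ν N (fun q => pathG t x q.1 * w q.1.1 q.1.2.1 q.2 * q.1.2.2) X) (c : ℝ) :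
    ∫⁻ ω, ENNReal.ofReal (truncPow p K (c + X ω)) ∂P ≤
      ENNReal.ofReal (growthFactor p T (jumpMoment ν 2).toReal * truncPow p K c) +
      ∫⁻ ξ, ENNReal.ofReal (pathG t x ξ) * (jumpWeight ν p T ξ.2.2 *
        fieldMoment P p K w ξ.1 ξ.2.1) ∂(intensity ν) := by
  have hC := stepConst_pos hp
  have hz := measurable_coe_jumpSize
  have hG := measurable_pathG_right t x
  have hΦ := (continuous_truncPow (p := p) (K := K) hp).measurable
  have hζ : Measurable fun ξ : JumpSpace => pathG t x ξ * ξ.2.2 := hG.mul (by fun_prop)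
  have hsq := lintegral_sq_pathG_mul_le (ν := ν) t x
  have hfin : jumpMoment ν 2 * ENNReal.ofReal ((t : ℝ) ^ 2) ≠ ∞ :=
    ENNReal.mul_ne_top hν.ne ENNReal.ofReal_ne_top
  have hζi := ne_top_of_le_ne_top hfin hsq
  have h := hX.lintegral_truncPow_le hN hp hK hζ hζi c
  have hA : ENNReal.ofReal (Real.exp (stepConst p *
      (∫⁻ ξ, ENNReal.ofReal ((pathG t x ξ * ξ.2.2) ^ 2) ∂(intensity ν)).toReal)) ≤
      ENNReal.ofReal (growthFactor p T (jumpMoment ν 2).toReal) := by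
    refine ENNReal.ofReal_le_ofReal (Real.exp_le_exp.2 (mul_le_mul_of_nonneg_left ?_ hC.le))
    refine (ENNReal.toReal_mono hfin hsq).trans ?_
    rw [ENNReal.toReal_mul, ENNReal.toReal_ofReal (sq_nonneg _)]
    have : (t : ℝ) ≤ T := ht
    gcongr
  have hJ : ∫⁻ q, ENNReal.ofReal (momentRem p K (pathG t x q.1 * q.1.2.2)
      (pathG t x q.1 * w q.1.1 q.1.2.1 q.2 * q.1.2.2)) ∂((intensity ν).prod P) ≤
      ∫⁻ ξ, ENNReal.ofReal (pathG t x ξ) * ((ENNReal.ofReal ((ξ.2.2 : ℝ) ^ 2) +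
        ENNReal.ofReal (|(ξ.2.2 : ℝ)| ^ p)) * fieldMoment P p K w ξ.1 ξ.2.1) ∂(intensity ν) := by
    have hm : Measurable fun q : JumpSpace × Ω => ENNReal.ofReal (pathG t x q.1) *
        ((ENNReal.ofReal ((q.1.2.2 : ℝ) ^ 2) + ENNReal.ofReal (|(q.1.2.2 : ℝ)| ^ p)) *
          ENNReal.ofReal (truncPow p K (w q.1.1 q.1.2.1 q.2))) := by
      have hw' : Measurable fun q : JumpSpace × Ω => truncPow p K (w q.1.1 q.1.2.1 q.2) :=
        hΦ.comp (hw.comp (measurable_fst.fst.prodMk (measurable_fst.snd.fst.prodMk measurable_snd)))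
      exact (hG.comp measurable_fst).ennreal_ofReal.mul
        (Measurable.mul (by fun_prop) hw'.ennreal_ofReal)
    calc _ ≤ ∫⁻ q : JumpSpace × Ω, ENNReal.ofReal (pathG t x q.1) *
        ((ENNReal.ofReal ((q.1.2.2 : ℝ) ^ 2) + ENNReal.ofReal (|(q.1.2.2 : ℝ)| ^ p)) *
          ENNReal.ofReal (truncPow p K (w q.1.1 q.1.2.1 q.2))) ∂((intensity ν).prod P) := by
          refine lintegral_mono fun q => ?_
          rw [← ENNReal.ofReal_add (by positivity) (by positivity),
            ← ENNReal.ofReal_mul (by positivity), ← ENNReal.ofReal_mul (pathG_nonneg _ _ _)]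
          exact ENNReal.ofReal_le_ofReal (momentRem_pathG_le hp hK t x q.1 _)
      _ = _ := by
          rw [lintegral_prod _ hm.aemeasurable]
          refine lintegral_congr fun ξ => ?_
          have hw'' : Measurable fun ω => ENNReal.ofReal (truncPow p K (w ξ.1 ξ.2.1 ω)) :=
            (hΦ.comp (hw.comp (measurable_const.prodMk
              (measurable_const.prodMk measurable_id)))).ennreal_ofReal
          simp only []
          rw [lintegral_const_mul' _ _ ENNReal.ofReal_ne_top, lintegral_const_mul _ hw'']
          rfl
  refine h.trans ((mul_le_mul' hA (add_le_add le_rfl (mul_le_mul' le_rfl hJ))).trans (le_of_eq ?_))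
  rw [mul_add, ← ENNReal.ofReal_mul (growthFactor_nonneg _ _ _), ← mul_assoc,
    ← ENNReal.ofReal_mul (growthFactor_nonneg _ _ _), ← lintegral_const_mul' _ _ ENNReal.ofReal_ne_top]
  congr 1
  refine lintegral_congr fun ξ => ?_
  rw [jumpWeight]
  ring

lemma truncPow_eq_rpow (hp : 2 ≤ p) {x : ℝ} (h : |x| ≤ K) : truncPow p K x = |x| ^ p := by
  rw [truncPow, min_eq_left, rpow_eq_sq_mul hp, mul_comm]
  rw [rpow_eq_sq_mul hp, mul_comm]
  exact mul_le_mul_of_nonneg_right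
    (Real.rpow_le_rpow (abs_nonneg _) h (by linarith)) (sq_nonneg x)

/-- Removal of the truncation. -/
lemma eLpNorm_le_of_truncPow_le (hp : 2 ≤ p) {X : Ω → ℝ} (hX : AEStronglyMeasurable X P) {b c : ℝ}
    (hb : 0 ≤ b)
    (h : ∀ K : ℝ, 0 < K → ∫⁻ ω, ENNReal.ofReal (truncPow p K (X ω)) ∂P ≤
      ENNReal.ofReal (b * truncPow p K c)) :
    eLpNorm X (ENNReal.ofReal p) P ≤ ENNReal.ofReal (b ^ (1 / p) * |c|) := by
  have hp0 : 0 < p := by linarith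
  have h1 : ∫⁻ ω, ENNReal.ofReal (|X ω| ^ p) ∂P ≤ ENNReal.ofReal (b * |c| ^ p) := by
    calc ∫⁻ ω, ENNReal.ofReal (|X ω| ^ p) ∂P =
          ∫⁻ ω, liminf (fun n : ℕ => ENNReal.ofReal (truncPow p ((n : ℝ) + 1) (X ω))) atTop ∂P := by
          refine lintegral_congr fun ω => (Tendsto.liminf_eq ?_).symm
          refine tendsto_const_nhds.congr' ?_
          obtain ⟨n₀, hn₀⟩ := exists_nat_gt |X ω|
          filter_upwards [eventually_ge_atTop n₀] with n hn
          have : (n₀ : ℝ) ≤ n := by exact_mod_cast hn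
          rw [truncPow_eq_rpow hp (by linarith)]
      _ ≤ liminf (fun n : ℕ => ∫⁻ ω, ENNReal.ofReal (truncPow p ((n : ℝ) + 1) (X ω)) ∂P) atTop :=
          lintegral_liminf_le' fun n => ((continuous_truncPow hp).measurable.comp_aemeasurable
            hX.aemeasurable).ennreal_ofReal
      _ ≤ liminf (fun _ : ℕ => ENNReal.ofReal (b * |c| ^ p)) atTop := by
          refine liminf_le_liminf (Eventually.of_forall fun n => ?_)
          refine (h _ (by positivity)).trans (ENNReal.ofReal_le_ofReal ?_)
          exact mul_le_mul_of_nonneg_left (truncPow_le_rpow c) hb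
      _ = _ := liminf_const _
  have hpe : (ENNReal.ofReal p).toReal = p := ENNReal.toReal_ofReal hp0.le
  rw [eLpNorm_eq_lintegral_rpow_enorm_toReal (by simpa using hp0) ENNReal.ofReal_ne_top, hpe]
  have e : ∀ ω, ‖X ω‖ₑ ^ p = ENNReal.ofReal (|X ω| ^ p) := fun ω => by
    rw [Real.enorm_eq_ofReal_abs, ENNReal.ofReal_rpow_of_nonneg (abs_nonneg _) hp0.le]
  simp only [e]
  refine (ENNReal.rpow_le_rpow h1 (by positivity)).trans (le_of_eq ?_)
  rw [ENNReal.ofReal_rpow_of_nonneg (by positivity) (by positivity),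
    Real.mul_rpow hb (by positivity), ← Real.rpow_mul (abs_nonneg _), mul_one_div_cancel hp0.ne',
    Real.rpow_one]

/-- Moments of the solution with constant initial condition. -/
theorem IsWaveSolution.eLpNorm_le {u : ℝ≥0 → ℝ → Ω → ℝ} (hu : IsWaveSolution P ν N u)
    (hN : IsPoissonRandomMeasure P (intensity ν) N) (hν : jumpMoment ν 2 < ∞) (hp : 2 ≤ p)
    (hνp : jumpMoment ν p < ∞) {t T : ℝ≥0} (ht : t ≤ T) (x : ℝ) :
    eLpNorm (u t x) (ENNReal.ofReal p) P ≤
      ENNReal.ofReal (momentConst p T (jumpMoment ν 2).toReal (jumpMoment ν p).toReal) := by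
  have hw := hu.predictable.measurable hN
  obtain ⟨B, hB⟩ := hu.bounded T
  set A := growthFactor p T (jumpMoment ν 2).toReal with hA
  have hA1 : 1 ≤ A := Real.one_le_exp
    (mul_nonneg (stepConst_pos hp).le (mul_nonneg ENNReal.toReal_nonneg (sq_nonneg _)))
  have h := eLpNorm_le_of_truncPow_le hp (hu.memLp hN t x).1 (c := 1)
    (b := 2 * A * Real.exp ((2 * growthRate p T (jumpMoment ν 2).toReal
      (jumpMoment ν p).toReal + 1) * T)) (by positivity) fun K hK => ?_
  · simpa [momentConst] using h
  -- The second moments of u are bounded uniformly on this set, which makes its truncated moments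
  -- bounded for each K.
  have hD : IsPastClosed {q : ℝ≥0 × ℝ | q.1 ≤ T} := by
    intro t x s y h1 h2
    have h3 : (0 : ℝ) < t - s := (abs_nonneg _).trans_lt h2
    have h4 : (s : ℝ) ≤ t := by linarith
    exact le_trans (α := ℝ≥0) (NNReal.coe_le_coe.1 h4) h1
  have hΦ1 := truncPow_nonneg (p := p) hK 1
  have key := gronwall_pastClosed (ν := ν) (growthRate_nonneg hp)
    (mul_nonneg (zero_le_one.trans hA1) hΦ1) (M := K ^ (p - 2) * B ^ 2) (by positivity)
    (measurable_jumpWeight (ν := ν) (p := p) (T := T)) (lintegral_jumpWeight_le hp hν hνp) hD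
    (F := fieldMoment P p K u) ?_ ?_ t x ht
  · refine key.trans (ENNReal.ofReal_le_ofReal ?_)
    have hg := growthRate_nonneg (ν := ν) (T := T) hp
    have ht' : (t : ℝ) ≤ T := ht
    calc 2 * (A * truncPow p K 1) * Real.exp ((2 * growthRate p T (jumpMoment ν 2).toReal
          (jumpMoment ν p).toReal + 1) * t) ≤
          2 * (A * truncPow p K 1) * Real.exp ((2 * growthRate p T (jumpMoment ν 2).toReal
          (jumpMoment ν p).toReal + 1) * T) := by gcongr
      _ = _ := by ring
  · intro s y hs
    calc fieldMoment P p K u s y ≤ ∫⁻ ω, ENNReal.ofReal (K ^ (p - 2)) *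
          ENNReal.ofReal (u s y ω ^ 2) ∂P := by
          refine lintegral_mono fun ω => ?_
          rw [← ENNReal.ofReal_mul (by positivity)]
          exact ENNReal.ofReal_le_ofReal (truncPow_le_sq _)
      _ = ENNReal.ofReal (K ^ (p - 2)) * eLpNorm (u s y) 2 P ^ 2 := by
          rw [lintegral_const_mul' _ _ ENNReal.ofReal_ne_top, lintegral_ofReal_sq_eq_eLpNorm]
      _ ≤ ENNReal.ofReal (K ^ (p - 2)) * (B : ℝ≥0∞) ^ 2 := by
          gcongr
          exact hB s hs y
      _ = _ := by
          rw [ENNReal.ofReal_mul (by positivity), ENNReal.ofReal_pow B.coe_nonneg,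
            ENNReal.ofReal_coe_nnreal]
  · intro s y hs
    rcases eq_or_lt_of_le (zero_le (a := s)) with rfl | hs0
    · refine le_trans (le_trans (le_of_eq ?_) (ENNReal.ofReal_le_ofReal
        (le_mul_of_one_le_left hΦ1 hA1))) le_self_add
      rw [fieldMoment, lintegral_congr_ae (g := fun _ => ENNReal.ofReal (truncPow p K 1))]
      · simp
      · filter_upwards [hu.initial y] with ω hω
        rw [hω]
    · obtain ⟨I, hI, hae⟩ := hu.mild s hs0 y
      refine le_trans (le_of_eq ?_) (hI.lintegral_truncPow_wave_le hN hp hK hν hs hw 1)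
      refine lintegral_congr_ae ?_
      filter_upwards [hae] with ω hω
      rw [hω]

/-- Moments of the solution that starts from a point mass. -/
theorem IsDeltaWaveSolution.eLpNorm_le {ξ : JumpSpace} {v : ℝ≥0 → ℝ → Ω → ℝ}
    (hv : IsDeltaWaveSolution P ν N ξ v)
    (hN : IsPoissonRandomMeasure P (intensity ν) N) (hν : jumpMoment ν 2 < ∞) (hp : 2 ≤ p)
    (hνp : jumpMoment ν p < ∞) {t T : ℝ≥0} (hξ : ξ.1 ≤ t) (ht : t ≤ T) (x : ℝ) :
    eLpNorm (v t x) (ENNReal.ofReal p) P ≤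
      ENNReal.ofReal (momentConst p T (jumpMoment ν 2).toReal (jumpMoment ν p).toReal *
        |pathG t x ξ * ξ.2.2|) := by
  rcases eq_or_lt_of_le hξ with hξ | hξ
  · rw [eLpNorm_congr_ae (g := fun _ => 0) (by rw [← hξ]; exact hv.initial x)]
    simp
  have hvm := hv.predictable.measurable hN
  have hC := stepConst_pos hp
  set A := growthFactor p T (jumpMoment ν 2).toReal with hA
  have hA1 : 1 ≤ A := Real.one_le_exp
    (mul_nonneg (stepConst_pos hp).le (mul_nonneg ENNReal.toReal_nonneg (sq_nonneg _)))
  refine eLpNorm_le_of_truncPow_le hp (hv.memLp hξ.le x).1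
    (b := 2 * A * Real.exp ((2 * growthRate p T (jumpMoment ν 2).toReal
      (jumpMoment ν p).toReal + 1) * T)) (by positivity) fun K hK => ?_
  -- Cutting v off up to time r absorbs the indicator in the mild equation, which then has the form
  -- required by the moment inequality.
  let w : ℝ≥0 → ℝ → Ω → ℝ := fun s y ω => (Ioi ξ.1).indicator (fun _ => (1 : ℝ)) s * v s y ω
  have hw : Measurable fun q : ℝ≥0 × ℝ × Ω => w q.1 q.2.1 q.2.2 :=
    ((measurable_const.indicator measurableSet_Ioi).comp measurable_fst).mul hvm
  have hwv : ∀ s y, ξ.1 < s → w s y = v s y := fun s y hs => by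
    ext ω
    simp only [w]
    rw [indicator_of_mem (show s ∈ Ioi ξ.1 from hs), one_mul]
  have hw0 : ∀ s y, s ≤ ξ.1 → fieldMoment P p K w s y = 0 := fun s y hs => by
    have : ∀ ω, w s y ω = 0 := fun ω => by
      simp only [w]
      rw [indicator_of_notMem (show s ∉ Ioi ξ.1 from not_lt.2 hs), zero_mul]
    simp [fieldMoment, this, truncPow_zero hp]
  have hmild : ∀ s, ξ.1 < s → ∀ y, ∃ I : Ω → ℝ, IsItoIntegral P ν N
      (fun q => pathG s y q.1 * w q.1.1 q.1.2.1 q.2 * q.1.2.2) I ∧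
      fieldMoment P p K w s y =
        ∫⁻ ω, ENNReal.ofReal (truncPow p K (pathG s y ξ * ξ.2.2 + I ω)) ∂P := by
    intro s hs y
    obtain ⟨I, hI, hae⟩ := hv.mild s hs y
    refine ⟨I, ?_, ?_⟩
    · convert hI using 2 with q
      simp only [w, pathG]
      ring
    · rw [fieldMoment, hwv s y hs]
      refine lintegral_congr_ae ?_
      filter_upwards [hae] with ω hω
      rw [hω]
      rfl
  have hc : ∀ s y, (s, y) ∈ pastCone t x →
      truncPow p K (pathG s y ξ * ξ.2.2) ≤ truncPow p K (pathG t x ξ * ξ.2.2) := by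
    intro s y hs
    refine truncPow_mono hp hK ?_
    rw [abs_mul, abs_mul, abs_of_nonneg (pathG_nonneg _ _ _), abs_of_nonneg (pathG_nonneg _ _ _)]
    exact mul_le_mul_of_nonneg_right (pathG_le_of_mem_pastCone hs ξ) (abs_nonneg _)
  have hΦ := truncPow_nonneg (p := p) hK (pathG t x ξ * ξ.2.2)
  obtain ⟨I₀, hI₀, -⟩ := hmild t hξ x
  -- The L² norm of the integrand at the apex dominates those at all points of its cone, since G
  -- only decreases there.
  set B := eLpNorm (fun q : JumpSpace × Ω => pathG t x q.1 * w q.1.1 q.1.2.1 q.2 * q.1.2.2) 2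
    ((intensity ν).prod P) with hBdef
  have hB : B ≠ ∞ := hI₀.1.2.ne
  have hbound : ∀ s y, (s, y) ∈ pastCone t x → fieldMoment P p K w s y ≤
      ENNReal.ofReal (truncPow p K (pathG t x ξ * ξ.2.2) +
        stepConst p * 2 ^ p * (2 * K ^ (p - 2) * B.toReal ^ 2)) := by
    intro s y hsy
    rcases le_or_gt s ξ.1 with hs | hs
    · rw [hw0 s y hs]
      exact zero_le
    obtain ⟨I, hI, e⟩ := hmild s hs y
    rw [e]
    -- With ζ = 0 the inequality is crude and depends on K, but it only has to provide the finite a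
    -- priori bound for the Gronwall argument.
    have h1 := hI.lintegral_truncPow_le hN hp hK (ζ := fun _ => 0) measurable_const (by simp)
      (pathG s y ξ * ξ.2.2)
    simp only [ne_eq, OfNat.ofNat_ne_zero, not_false_eq_true, zero_pow, ENNReal.ofReal_zero,
      lintegral_zero, ENNReal.toReal_zero, mul_zero, Real.exp_zero, ENNReal.ofReal_one,
      one_mul] at h1
    refine h1.trans ?_
    rw [ENNReal.ofReal_add hΦ (by positivity),
      ENNReal.ofReal_mul (p := stepConst p * 2 ^ p) (by positivity)]
    refine add_le_add (ENNReal.ofReal_le_ofReal (hc s y hsy)) (mul_le_mul' le_rfl ?_)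
    rw [ENNReal.ofReal_mul (by positivity), ENNReal.ofReal_pow ENNReal.toReal_nonneg,
      ENNReal.ofReal_toReal hB, hBdef, ← lintegral_ofReal_sq_eq_eLpNorm,
      ← lintegral_const_mul' _ _ ENNReal.ofReal_ne_top]
    refine lintegral_mono fun q => ?_
    rw [← ENNReal.ofReal_mul (by positivity)]
    refine ENNReal.ofReal_le_ofReal ((momentRem_le hK _ _).trans ?_)
    refine mul_le_mul_of_nonneg_left ?_ (by positivity)
    refine sq_le_sq.2 ?_
    rw [mul_assoc (pathG s y q.1), mul_assoc (pathG t x q.1), abs_mul (pathG s y q.1),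
      abs_mul (pathG t x q.1), abs_of_nonneg (pathG_nonneg _ _ _),
      abs_of_nonneg (pathG_nonneg _ _ _)]
    exact mul_le_mul_of_nonneg_right (pathG_le_of_mem_pastCone hsy q.1) (abs_nonneg _)
  have key := gronwall_pastClosed (ν := ν) (growthRate_nonneg hp)
    (mul_nonneg (zero_le_one.trans hA1) hΦ) (M := truncPow p K (pathG t x ξ * ξ.2.2) +
        stepConst p * 2 ^ p * (2 * K ^ (p - 2) * B.toReal ^ 2)) (by positivity)
    (measurable_jumpWeight (ν := ν) (p := p) (T := T)) (lintegral_jumpWeight_le hp hν hνp)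
    (isPastClosed_pastCone t x) (F := fieldMoment P p K w) hbound ?_ t x (mem_pastCone_self t x)
  · rw [fieldMoment, hwv t x hξ] at key
    refine key.trans (ENNReal.ofReal_le_ofReal ?_)
    have hg := growthRate_nonneg (ν := ν) (T := T) hp
    have ht' : (t : ℝ) ≤ T := ht
    calc 2 * (A * truncPow p K (pathG t x ξ * ξ.2.2)) *
          Real.exp ((2 * growthRate p T (jumpMoment ν 2).toReal
          (jumpMoment ν p).toReal + 1) * t) ≤
          2 * (A * truncPow p K (pathG t x ξ * ξ.2.2)) *
          Real.exp ((2 * growthRate p T (jumpMoment ν 2).toReal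
          (jumpMoment ν p).toReal + 1) * T) := by gcongr
      _ = _ := by ring
  · intro s y hsy
    rcases le_or_gt s ξ.1 with hs | hs
    · rw [hw0 s y hs]
      exact zero_le
    obtain ⟨I, hI, e⟩ := hmild s hs y
    have hst : s ≤ T := by
      have h1 : |x - y| ≤ (t : ℝ) - s := hsy
      have h2 : (s : ℝ) ≤ t := by linarith [abs_nonneg (x - y)]
      exact le_trans (NNReal.coe_le_coe.1 h2) ht
    rw [e]
    refine (hI.lintegral_truncPow_wave_le hN hp hK hν hst hw _).trans (add_le_add ?_ le_rfl)
    exact ENNReal.ofReal_le_ofReal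
      (mul_le_mul_of_nonneg_left (hc s y hsy) (zero_le_one.trans hA1))

end

end

noncomputable section

/-! ### Moments of the Malliavin derivatives -/

section

variable {Ω E : Type*} [MeasurableSpace Ω] [MeasurableSpace E] {P : Measure Ω}
  {m : Measure E} {N : Ω → Measure E}

lemma eLpNorm_mul_of_indepFun {p : ℝ} (hp : 0 < p) {X Y : Ω → ℝ} (h : IndepFun X Y P)
    (hX : AEStronglyMeasurable X P) (hY : AEStronglyMeasurable Y P) :
    eLpNorm (fun ω => X ω * Y ω) (ENNReal.ofReal p) P =
      eLpNorm X (ENNReal.ofReal p) P * eLpNorm Y (ENNReal.ofReal p) P := by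
  have hp' : ENNReal.ofReal p ≠ 0 := by simpa using hp
  simp only [eLpNorm_eq_lintegral_rpow_enorm_toReal hp' ENNReal.ofReal_ne_top,
    ENNReal.toReal_ofReal hp.le, enorm_mul, ENNReal.mul_rpow_of_nonneg _ _ hp.le]
  have hm : Measurable fun a : ℝ => ‖a‖ₑ ^ p := measurable_enorm.pow_const p
  have h1 : IndepFun (fun ω => ‖X ω‖ₑ ^ p) (fun ω => ‖Y ω‖ₑ ^ p) P := h.comp hm hm
  rw [lintegral_mul_eq_lintegral_mul_lintegral_of_indepFun'' (f := fun ω => ‖X ω‖ₑ ^ p)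
    (g := fun ω => ‖Y ω‖ₑ ^ p) (hm.comp_aemeasurable hX.aemeasurable)
    (hm.comp_aemeasurable hY.aemeasurable) h1, ENNReal.mul_rpow_of_nonneg _ _ (by positivity)]

lemma isMultipleIntegral_zero (P : Measure Ω) (m : Measure E) (N : Ω → Measure E) (k : ℕ) :
    IsMultipleIntegral P m N k (fun _ => 0) (fun _ => 0) := by
  let s : SimpleKernel m k :=
    { size := 0
      F := fun i => i.elim0
      coeff := fun _ => 0
      measurable := fun i => i.elim0
      finite := fun i => i.elim0
      disjoint := fun i => i.elim0
      diagonal := fun _ _ => rfl }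
  have h1 : s.toFun - (fun _ => 0) = 0 := by
    ext ξ
    simp [SimpleKernel.toFun, s]
  have h2 : s.integral N - (fun _ => 0) = 0 := by
    ext ω
    simp [SimpleKernel.integral, s]
  refine ⟨MemLp.zero', MemLp.zero', fun _ => s, ?_, ?_⟩
  · simp only [h1, eLpNorm_zero]
    exact tendsto_const_nhds
  · simp only [h2, eLpNorm_zero]
    exact tendsto_const_nhds

lemma isChaosExpansion_zero (P : Measure Ω) (m : Measure E) (N : Ω → Measure E) :
    IsChaosExpansion P m N (fun _ _ => 0) (fun _ => 0) := by
  refine ⟨MemLp.zero', fun n σ => Filter.EventuallyEq.rfl, fun _ _ => 0,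
    fun n => isMultipleIntegral_zero P m N n, ?_⟩
  have e : ∀ M : ℕ, (∑ n ∈ Finset.range M, fun _ : Ω => (0 : ℝ)) - (fun _ => 0) = 0 := by
    intro M
    ext ω
    simp
  simp only [e, eLpNorm_zero]
  exact tendsto_const_nhds

end

lemma derivKernel_derivKernel_waveChaos_comm (t : ℝ≥0) (x : ℝ) (ζ ξ : JumpSpace) :
    derivKernel (derivKernel (waveChaos t x) ξ) ζ =
      derivKernel (derivKernel (waveChaos t x) ζ) ξ := by
  funext n η
  simp only [derivKernel]
  congr 2
  have e : (Fin.cons ξ (Fin.cons ζ η : Fin (n + 1) → JumpSpace) : Fin (n + 2) → JumpSpace) =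
      (Fin.cons ζ (Fin.cons ξ η : Fin (n + 1) → JumpSpace) : Fin (n + 2) → JumpSpace) ∘
        (Equiv.swap 0 1) := by
    funext i
    refine Fin.cases ?_ (fun i => ?_) i
    · rw [Function.comp_apply, Equiv.swap_apply_left, ← Fin.succ_zero_eq_one, Fin.cons_succ]
      rfl
    · refine Fin.cases ?_ (fun i => ?_) i
      · simp
      · have h0 : (i.succ.succ : Fin (n + 2)) ≠ 0 := Fin.succ_ne_zero _
        have h1 : (i.succ.succ : Fin (n + 2)) ≠ 1 := by
          rw [← Fin.succ_zero_eq_one]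
          exact fun h => Fin.succ_ne_zero i (Fin.succ_injective _ h)
        rw [Function.comp_apply, Equiv.swap_apply_of_ne_of_ne h0 h1]
        simp
  rw [e]
  exact symmetrize_comp_perm _ _ _

section

variable {Ω : Type*} [mΩ : MeasurableSpace Ω] {P : Measure Ω} [IsProbabilityMeasure P]
  {ν : Measure JumpSize} [SigmaFinite ν] {N : Ω → Measure JumpSpace} {p : ℝ}
  {u : ℝ≥0 → ℝ → Ω → ℝ} {v : JumpSpace → ℝ≥0 → ℝ → Ω → ℝ} {ξ ξ₁ ξ₂ : JumpSpace}

lemma isWaveD2_comm {t : ℝ≥0} {x : ℝ} {X : Ω → ℝ} :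
    IsWaveD2 P ν N t x ξ₁ ξ₂ X ↔ IsWaveD2 P ν N t x ξ₂ ξ₁ X := by
  rw [IsWaveD2, IsWaveD2, derivKernel_derivKernel_waveChaos_comm]

lemma isWaveD2_zero {t : ℝ≥0} (ht : t ≤ ξ₂.1) (x : ℝ) :
    IsWaveD2 P ν N t x ξ₁ ξ₂ (fun _ => 0) := by
  have e : derivKernel (derivKernel (waveChaos t x) ξ₂) ξ₁ = fun _ _ => 0 := by
    rw [derivKernel_waveChaos]
    funext n η
    simp [derivKernel, symmetrize, waveD_eq_zero_of_le _ x _ ht]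
  rw [IsWaveD2, e]
  exact isChaosExpansion_zero _ _ _

/-- Moments of the first Malliavin derivative. -/
lemma eLpNorm_mul_le (hu : IsWaveSolution P ν N u) (hv : ∀ ξ, IsDeltaWaveSolution P ν N ξ (v ξ))
    (hN : IsPoissonRandomMeasure P (intensity ν) N) (hν : jumpMoment ν 2 < ∞) (hp : 2 ≤ p)
    (hνp : jumpMoment ν p < ∞) {t T : ℝ≥0} (hξ : ξ.1 ≤ t) (ht : t ≤ T) (x : ℝ) :
    eLpNorm (fun ω => u ξ.1 ξ.2.1 ω * v ξ t x ω) (ENNReal.ofReal p) P ≤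
      ENNReal.ofReal (momentConst p T (jumpMoment ν 2).toReal (jumpMoment ν p).toReal ^ 2 *
        pathG t x ξ * |(ξ.2.2 : ℝ)|) := by
  have hM := momentConst_nonneg p T (jumpMoment ν 2).toReal (jumpMoment ν p).toReal
  rw [eLpNorm_mul_of_indepFun (by linarith) ((hv ξ).indepFun hN hν hξ x
    (hu.predictable.aestronglyMeasurable_restrictSigma _ _)) (hu.memLp hN _ _).1
    ((hv ξ).memLp hξ x).1]
  refine (mul_le_mul' (hu.eLpNorm_le hN hν hp hνp (hξ.trans ht) _)
    ((hv ξ).eLpNorm_le hN hν hp hνp hξ ht x)).trans (le_of_eq ?_)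
  rw [← ENNReal.ofReal_mul hM, abs_mul, abs_of_nonneg (pathG_nonneg _ _ _)]
  congr 1
  ring

/-- Moments of the second Malliavin derivative. -/
lemma eLpNorm_mul_mul_le (hu : IsWaveSolution P ν N u)
    (hv : ∀ ξ, IsDeltaWaveSolution P ν N ξ (v ξ))
    (hN : IsPoissonRandomMeasure P (intensity ν) N) (hν : jumpMoment ν 2 < ∞) (hp : 2 ≤ p)
    (hνp : jumpMoment ν p < ∞) {t T : ℝ≥0} (h₁₂ : ξ₁.1 ≤ ξ₂.1) (hξ : ξ₂.1 ≤ t) (ht : t ≤ T)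
    (x : ℝ) :
    eLpNorm (fun ω => u ξ₁.1 ξ₁.2.1 ω * v ξ₁ ξ₂.1 ξ₂.2.1 ω * v ξ₂ t x ω) (ENNReal.ofReal p) P ≤
      ENNReal.ofReal (momentConst p T (jumpMoment ν 2).toReal (jumpMoment ν p).toReal ^ 3 *
        |(ξ₁.2.2 : ℝ) * (ξ₂.2.2 : ℝ)| * (pathG t x ξ₂ * pathG ξ₂.1 ξ₂.2.1 ξ₁)) := by
  have hM := momentConst_nonneg p T (jumpMoment ν 2).toReal (jumpMoment ν p).toReal
  have hG := pathG_nonneg ξ₂.1 ξ₂.2.1 ξ₁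
  rw [eLpNorm_mul_of_indepFun (by linarith) ((hv ξ₂).indepFun hN hν hξ x
    (aestronglyMeasurable_mul hu (hv ξ₁) h₁₂ ξ₂.2.1)) (memLp_mul hu (hv ξ₁) hN hν h₁₂ _).1
    ((hv ξ₂).memLp hξ x).1]
  refine (mul_le_mul' (eLpNorm_mul_le hu hv hN hν hp hνp h₁₂ (hξ.trans ht) _)
    ((hv ξ₂).eLpNorm_le hN hν hp hνp hξ ht x)).trans (le_of_eq ?_)
  rw [← ENNReal.ofReal_mul (by positivity), abs_mul, abs_mul, abs_of_nonneg (pathG_nonneg _ _ _)]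
  congr 1
  ring

lemma exists_isWaveD2_of_lt (hu : IsWaveSolution P ν N u)
    (hv : ∀ ξ, IsDeltaWaveSolution P ν N ξ (v ξ))
    (hN : IsPoissonRandomMeasure P (intensity ν) N) (hν : jumpMoment ν 2 < ∞) (hp : 2 ≤ p)
    (hνp : jumpMoment ν p < ∞) {t T : ℝ≥0} (h₁₂ : ξ₁.1 < ξ₂.1) (ht : t ≤ T) (x : ℝ) :
    (∃ X, IsWaveD2 P ν N t x ξ₁ ξ₂ X) ∧ ∀ X, IsWaveD2 P ν N t x ξ₁ ξ₂ X →
      eLpNorm X (ENNReal.ofReal p) P ≤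
      ENNReal.ofReal (momentConst p T (jumpMoment ν 2).toReal (jumpMoment ν p).toReal ^ 3 *
        |(ξ₁.2.2 : ℝ) * (ξ₂.2.2 : ℝ)| * (pathG t x ξ₂ * pathG ξ₂.1 ξ₂.2.1 ξ₁)) := by
  rcases le_or_gt ξ₂.1 t with h | h
  · have hX := isWaveD2_mul hu (hv ξ₁) (hv ξ₂) hN hν h₁₂.le h x
    refine ⟨⟨_, hX⟩, fun X hX' => ?_⟩
    rw [eLpNorm_congr_ae (IsChaosExpansion.ae_eq hN (isExhaustion_jumpBox ν) hX' hX)]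
    exact eLpNorm_mul_mul_le hu hv hN hν hp hνp h₁₂.le h ht x
  · have hX : IsWaveD2 P ν N t x ξ₁ ξ₂ (fun _ => 0) := isWaveD2_zero h.le x
    refine ⟨⟨_, hX⟩, fun X hX' => ?_⟩
    rw [eLpNorm_congr_ae (IsChaosExpansion.ae_eq hN (isExhaustion_jumpBox ν) hX' hX)]
    simp

end

end

theorem proposition3p2 :
    -- the constants depend only on `p`, `T`, `m₂`, `m_p`
    ∃ C' C'' : ℝ → ℝ → ℝ → ℝ → ℝ,
    ∀ (Ω : Type*) [MeasurableSpace Ω] (P : Measure Ω) [IsProbabilityMeasure P]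
      (ν : Measure JumpSize) [SigmaFinite ν] (N : Ω → Measure JumpSpace)
      (u : ℝ≥0 → ℝ → Ω → ℝ) (v : JumpSpace → ℝ≥0 → ℝ → Ω → ℝ),
      jumpMoment ν 2 < ∞ →
      IsPoissonRandomMeasure P (intensity ν) N →
      IsWaveSolution P ν N u →
      (∀ ξ, IsDeltaWaveSolution P ν N ξ (v ξ)) →
      ∀ (t : ℝ≥0) (x : ℝ),
        -- `u(t,x)` is twice Malliavin differentiable; `waveChaos t x` are its chaos kernels
        InDomD2 P (intensity ν) N (u t x) ∧
        IsChaosExpansion P (intensity ν) N (waveChaos t x) (u t x) ∧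
        -- (i), at every point, and for every version of the derivative at almost every point
        (∀ (r : ℝ≥0) (y : ℝ) (z : JumpSize), 0 < r → r ≤ t →
          IsWaveD P ν N t x (r, y, z) (fun ω => u r y ω * v (r, y, z) t x ω)) ∧
        (∀ D, IsMalliavinDeriv P (intensity ν) N (u t x) D →
          ∀ᵐ ξ ∂(intensity ν), ξ.1 ≤ t →
            D ξ =ᵐ[P] fun ω => u ξ.1 ξ.2.1 ω * v ξ t x ω) ∧
        -- (ii), likewise; the three factors are independent
        (∀ (r₁ r₂ : ℝ≥0) (y₁ y₂ : ℝ) (z₁ z₂ : JumpSize), r₁ < r₂ → r₂ ≤ t →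
          IsWaveD2 P ν N t x (r₁, y₁, z₁) (r₂, y₂, z₂)
            (fun ω => u r₁ y₁ ω * v (r₁, y₁, z₁) r₂ y₂ ω * v (r₂, y₂, z₂) t x ω) ∧
          iIndepFun ![u r₁ y₁, v (r₁, y₁, z₁) r₂ y₂, v (r₂, y₂, z₂) t x] P) ∧
        (∀ D2, IsMalliavinDeriv2 P (intensity ν) N (u t x) D2 →
          ∀ᵐ q ∂((intensity ν).prod (intensity ν)), q.1.1 < q.2.1 → q.2.1 ≤ t →
            D2 q.1 q.2 =ᵐ[P]
              fun ω => u q.1.1 q.1.2.1 ω * v q.1 q.2.1 q.2.2.1 ω * v q.2 t x ω) ∧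
        -- (iii)
        (∀ p : ℝ, 2 ≤ p → jumpMoment ν p < ∞ → ∀ T : ℝ≥0, 0 < T → t ≤ T →
          (∀ (r : ℝ≥0) (y : ℝ) (z : JumpSize), 0 < r → r < t →
            (∃ X, IsWaveD P ν N t x (r, y, z) X) ∧
            ∀ X, IsWaveD P ν N t x (r, y, z) X →
              eLpNorm X (ENNReal.ofReal p) P ≤ ENNReal.ofReal
                (C' p T (jumpMoment ν 2).toReal (jumpMoment ν p).toReal *
                  waveG ((t : ℝ) - r) (x - y) * |(z : ℝ)|)) ∧
          (∀ (r₁ r₂ : ℝ≥0) (y₁ y₂ : ℝ) (z₁ z₂ : JumpSize), r₁ ≠ r₂ →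
            (∃ X, IsWaveD2 P ν N t x (r₁, y₁, z₁) (r₂, y₂, z₂) X) ∧
            ∀ X, IsWaveD2 P ν N t x (r₁, y₁, z₁) (r₂, y₂, z₂) X →
              eLpNorm X (ENNReal.ofReal p) P ≤ ENNReal.ofReal
                (C'' p T (jumpMoment ν 2).toReal (jumpMoment ν p).toReal *
                  |(z₁ : ℝ) * (z₂ : ℝ)| *
                  if r₁ < r₂ then
                    waveG ((t : ℝ) - r₂) (x - y₂) * waveG ((r₂ : ℝ) - r₁) (y₂ - y₁)
                  else
                    waveG ((t : ℝ) - r₁) (x - y₁) * waveG ((r₁ : ℝ) - r₂) (y₁ - y₂)))) := by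
  -- One power of the moment constant for each independent factor: two in the first derivative,
  -- three in the second.
  refine ⟨fun p T m₂ mₚ => momentConst p T m₂ mₚ ^ 2, fun p T m₂ mₚ => momentConst p T m₂ mₚ ^ 3, ?_⟩
  intro Ω _ P _ ν _ N u v hν hN hu hv t x
  refine ⟨hu.inDomD2 hN hν t x, hu.isChaosExpansion hN hν t x,
    fun r y z _ hrt => isWaveD_mul hu (hv (r, y, z)) hN hν hrt x,
    fun D hD => hD.ae_eq_mul hu hv hN hν,
    fun r₁ r₂ y₁ y₂ z₁ z₂ h₁₂ h₂ =>
      ⟨isWaveD2_mul hu (hv (r₁, y₁, z₁)) (hv (r₂, y₂, z₂)) hN hν h₁₂.le h₂ x,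
        iIndepFun_factors hu (hv (r₁, y₁, z₁)) (hv (r₂, y₂, z₂)) hN hν h₁₂.le h₂ x⟩,
    fun D2 hD2 => hD2.ae_eq_mul hu hv hN hν, ?_⟩
  intro p hp hνp T _ htT
  refine ⟨fun r y z _ hrt => ?_, fun r₁ r₂ y₁ y₂ z₁ z₂ hne => ?_⟩
  · have hX := isWaveD_mul hu (hv (r, y, z)) hN hν hrt.le x
    refine ⟨⟨_, hX⟩, fun X hX' => ?_⟩
    rw [eLpNorm_congr_ae (IsChaosExpansion.ae_eq hN (isExhaustion_jumpBox ν) hX' hX)]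
    exact eLpNorm_mul_le hu hv hN hν hp hνp (ξ := (r, y, z)) hrt.le htT x
  · rcases lt_or_gt_of_ne hne with h | h
    · rw [if_pos h]
      exact exists_isWaveD2_of_lt hu hv hN hν hp hνp (ξ₁ := (r₁, y₁, z₁)) (ξ₂ := (r₂, y₂, z₂))
        h htT x
    -- The opposite time order reduces to the previous one, because the symmetrized kernels make the
    -- second derivative symmetric in its two points.
    · rw [if_neg h.not_gt, mul_comm (z₁ : ℝ)]
      have key := exists_isWaveD2_of_lt hu hv hN hν hp hνp (ξ₁ := (r₂, y₂, z₂))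
        (ξ₂ := (r₁, y₁, z₁)) h htT x
      exact ⟨key.1.imp fun X => isWaveD2_comm.1, fun X hX => key.2 X (isWaveD2_comm.1 hX)⟩
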